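/- **Setup.** Let $k$ be a field of characteristic $0$, let $\mathbf{GL}=\bigcup_{n\ge 1}\mathbf{GL}_n(k)$, regarded as a discrete group, and let $\mathbf{V}=\bigcup_{n\ge1}k^n$ be its standard representation. A representation of $\mathbf{GL}$ over $k$ is *polynomial* if it is a subquotient of a (possibly infinite) direct sum of tensor powers $\mathbf{V}^{\otimes n}$. A polynomial representation $M$ is the value at $\mathbf{V}$ of a polynomial functor, and $M\{V\}$ denotes the value of this functor at a $k$-vector space $V$ (explicitly, $M\{V\}=\bigoplus_{n\ge0}V^{\otimes n}\otimes_{k[S_n]}\operatorname{Hom}_{\mathbf{GL}}(\mathbf{V}^{\otimes n},M)$). Let $R$ be an integral domain that is a $k$-algebra with an action of $\mathbf{GL}$ by $k$-algebra automorphisms, such that $R$ is a polynomial representation and is generated as a $k$-algebra by the $\mathbf{GL}$-orbits of finitely many elements. Let $K=\operatorname{Frac}(R)$, with the induced action of $\mathbf{GL}$, and assume that $K^{\mathbf{GL}}=k$. Let $X=\operatorname{Spec}(R)$. For a $k$-vector space $V$, $R\{V\}$ is a $k$-algebra, and $X\{V\}=\operatorname{Spec}(R\{V\})$. The closed $\mathbf{GL}$-subvarieties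 of $X$ are the $Z=\operatorname{Spec}(R/I)$ for $\mathbf{GL}$-stable radical ideals $I$, and $Z\{V\}\subseteq X\{V\}$ is the zero locus of $I\{V\}\subseteq R\{V\}$. A $k$-point $x$ of $X\{V\}$ is *$\mathbf{GL}$-generic* if there is no proper closed $\mathbf{GL}$-subvariety $Z$ of $X$ with $x\in Z\{V\}$. A *$K$-module* is a $K$-vector space with a semilinear action of $\mathbf{GL}$ that is spanned over $K$ by a polynomial subrepresentation. With equivariant $K$-linear maps and $\otimes_K$ these form a $k$-linear symmetric monoidal category $\mathrm{Mod}_K$. For a $K$-module $N$, let $N^{\mathrm{pol}}$ be its maximal polynomial subrepresentation, which is an $R$-module. A *fiber functor* on $\mathrm{Mod}_K$ is a symmetric monoidal functor $\mathrm{Mod}_K\to\mathrm{Vec}_k$ that is exact, faithful, cocontinuous, and $k$-linear; isomorphisms of fiber functors are isomorphisms of symmetric monoidal functors. A *pair* $(V,x)$ consists of an infinite dimensional $k$-vector space $V$ (of arbitrary infinite dimension) and a $\mathbf{GL}$-generic $k$-point $x$ of $X\{V\}$, with maximal ideal $\mathfrak{m}\subset R\{V\}$. An *isomorphism* $(V,x)\to(V',x')$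 is a linear isomorphism $V\to V'$ such that the induced map $X\{V'\}\to X\{V\}$ carries $x'$ to $x$. For a pair $(V,x)$ define $$\Phi_{V,x}\colon \mathrm{Mod}_K\to\mathrm{Vec}_k,\qquad \Phi_{V,x}(N)=M\{V\}/\mathfrak{m}M\{V\},\quad M=N^{\mathrm{pol}},$$ with the symmetric monoidal structure induced by the maps $N^{\mathrm{pol}}\times N'^{\,\mathrm{pol}}\to(N\otimes_KN')^{\mathrm{pol}}$ and by $1\in K^{\mathrm{pol}}$. An isomorphism $f\colon(V,x)\to(V',x')$ induces, through the maps $M\{V\}\to M\{V'\}$, an isomorphism $\Phi_f\colon\Phi_{V,x}\to\Phi_{V',x'}$. **Theorem.** Each $\Phi_{V,x}$ is a fiber functor on $\mathrm{Mod}_K$, and: (a) Any fiber functor on $\mathrm{Mod}_K$ is isomorphic to $\Phi_{V,x}$ for some pair $(V,x)$. (b) For any two pairs $(V,x)$ and $(V',x')$, the map $f\mapsto\Phi_f$ is a bijection $$\operatorname{Isom}((V,x),(V',x'))\longrightarrow\operatorname{Isom}(\Phi_{V,x},\Phi_{V',x'}),$$ and these bijections are compatible with composition: $\Phi_{g\circ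 f}=\Phi_g\circ\Phi_f$. -/

import Mathlib

open CategoryTheory TensorProduct DirectSum

universe u

namespace SemilinearGL

noncomputable section

/-! ### The infinite general linear group and polynomial representations -/

/-- The standard representation `𝐕 = ⋃ kⁿ`, with basis indexed by `ℕ`. -/
abbrev StdRep (k : Type u) [Field k] : Type u := ℕ →₀ k

/-- The group `GL = ⋃ GL_n(k)`, as a discrete group of automorphisms of `𝐕`: the automorphisms
that are block diagonal of the form `(A, 1)` with `A` of some finite size `n`. -/
def glSubgroup (k : Type u) [Field k] : Subgroup (StdRep k ≃ₗ[k] StdRep k) where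
  carrier := {g | ∃ n : ℕ, ∀ i, n ≤ i →
    g (Finsupp.single i 1) = Finsupp.single i 1 ∧ ∀ v : StdRep k, g v i = v i}
  one_mem' := ⟨0, fun _ _ => ⟨rfl, fun _ => rfl⟩⟩
  mul_mem' := by
    rintro a b ⟨n, hn⟩ ⟨m, hm⟩
    refine ⟨max n m, fun i hi => ⟨?_, fun v => ?_⟩⟩
    · rw [LinearEquiv.mul_apply, (hm i (le_trans (le_max_right _ _) hi)).1,
        (hn i (le_trans (le_max_left _ _) hi)).1]
    · rw [LinearEquiv.mul_apply, (hn i (le_trans (le_max_left _ _) hi)).2,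
        (hm i (le_trans (le_max_right _ _) hi)).2]
  inv_mem' := by
    rintro a ⟨n, hn⟩
    refine ⟨n, fun i hi => ⟨?_, fun v => ?_⟩⟩
    · conv_lhs => rw [← (hn i hi).1]
      exact a.symm_apply_apply _
    · conv_rhs => rw [← a.apply_symm_apply v]
      exact ((hn i hi).2 _).symm

/-- The group `GL = ⋃ GL_n(k)` as a type. -/
def GLinf (k : Type u) [Field k] : Type u := glSubgroup k

instance (k : Type u) [Field k] : Group (GLinf k) := inferInstanceAs (Group (glSubgroup k))

/-- The automorphism of `𝐕` given by an element of `GL`. -/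
def GLinf.toEquiv {k : Type u} [Field k] (g : GLinf k) : StdRep k ≃ₗ[k] StdRep k :=
  Subtype.val (p := fun g => g ∈ glSubgroup k) g

section Polynomial

variable (k : Type u) [Field k]

/-- The direct sum `⨁ i, 𝐕^{⊗ n i}` of tensor powers of the standard representation. -/
abbrev TensorSum {ι : Type u} (n : ι → ℕ) : Type u := ⨁ i, ⨂[k]^(n i) (StdRep k)

variable {k}

/-- The action of `GL` on a direct sum of tensor powers of `𝐕`. -/
def tensorAct {ι : Type u} (n : ι → ℕ) (g : GLinf k) : TensorSum k n →ₗ[k] TensorSum k n :=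
  DirectSum.lmap fun _ => PiTensorProduct.map fun _ => g.toEquiv.toLinearMap

/-- The subspace `P` of the representation `M` is a polynomial subrepresentation: it is the image
of an equivariant map from a subrepresentation of a direct sum of tensor powers of `𝐕`
(in other words: `P`, with its action of `GL`, is a subquotient of such a direct sum). -/
def IsPolynomialSub {M : Type u} [AddCommGroup M] [Module k M] [DistribMulAction (GLinf k) M]
    (P : Submodule k M) : Prop :=
  ∃ (ι : Type u) (n : ι → ℕ) (S : Submodule k (TensorSum k n))
    (hS : ∀ g : GLinf k, ∀ s ∈ S, tensorAct n g s ∈ S) (q : S →ₗ[k] M),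
    (∀ (g : GLinf k) (s : S), q ⟨tensorAct n g s, hS g s s.2⟩ = g • q s) ∧ LinearMap.range q = P

/-- Polynomial representations of `GL`: the subquotients of direct sums of tensor powers of the
standard representation. -/
class IsPolynomialRep (k M : Type u) [Field k] [AddCommGroup M] [Module k M]
    [DistribMulAction (GLinf k) M] : Prop where
  polynomial : IsPolynomialSub (⊤ : Submodule k M)

variable (k) in
/-- The maximal polynomial subrepresentation `M^pol` of a representation `M`. -/
def pol (M : Type u) [AddCommGroup M] [Module k M] [DistribMulAction (GLinf k) M] :
    Submodule k M :=
  sSup {P | IsPolynomialSub P}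

variable {A B C M N : Type u}
  [AddCommGroup A] [Module k A] [DistribMulAction (GLinf k) A]
  [AddCommGroup B] [Module k B] [DistribMulAction (GLinf k) B]
  [AddCommGroup C] [Module k C] [DistribMulAction (GLinf k) C]
  [AddCommGroup M] [Module k M] [DistribMulAction (GLinf k) M]
  [AddCommGroup N] [Module k N] [DistribMulAction (GLinf k) N]

lemma IsPolynomialSub.smul_mem {P : Submodule k M} (hP : IsPolynomialSub P) (g : GLinf k) {x : M}
    (hx : x ∈ P) : g • x ∈ P := by
  obtain ⟨ι, n, S, hS, q, hq, rfl⟩ := hP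
  obtain ⟨s, rfl⟩ := hx
  exact ⟨_, hq g s⟩

lemma IsPolynomialSub.map {P : Submodule k M} (hP : IsPolynomialSub P) (f : M →ₗ[k] N)
    (hf : ∀ (g : GLinf k) (m : M), f (g • m) = g • f m) : IsPolynomialSub (P.map f) := by
  obtain ⟨ι, n, S, hS, q, hq, rfl⟩ := hP
  refine ⟨ι, n, S, hS, f ∘ₗ q, fun g s => ?_, LinearMap.range_comp _ _⟩
  rw [LinearMap.comp_apply, hq, hf, LinearMap.comp_apply]

lemma smul_mem_pol [SMulCommClass (GLinf k) k M] (g : GLinf k) {x : M} (hx : x ∈ pol k M) :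
    g • x ∈ pol k M := by
  have : pol k M ≤ (pol k M).comap (DistribSMul.toLinearMap k M g) :=
    sSup_le fun P hP x hx => (le_sSup hP : P ≤ pol k M) (hP.smul_mem g hx)
  exact this hx

lemma map_mem_pol (f : M →ₗ[k] N) (hf : ∀ (g : GLinf k) (m : M), f (g • m) = g • f m)
    {x : M} (hx : x ∈ pol k M) : f x ∈ pol k N := by
  have : pol k M ≤ (pol k N).comap f :=
    sSup_le fun P hP x hx => (le_sSup (hP.map f hf) : P.map f ≤ pol k N) ⟨x, hx, rfl⟩
  exact this hx

lemma pol_eq_top [IsPolynomialRep k M] : pol k M = ⊤ :=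
  top_le_iff.1 (le_sSup IsPolynomialRep.polynomial)

lemma tensorAct_lof {ι : Type u} [DecidableEq ι] (n : ι → ℕ) (g : GLinf k) (i : ι)
    (t : ⨂[k]^(n i) (StdRep k)) :
    tensorAct n g (DirectSum.lof k ι (fun i => ⨂[k]^(n i) (StdRep k)) i t) =
      DirectSum.lof k ι (fun i => ⨂[k]^(n i) (StdRep k)) i
        (PiTensorProduct.map (fun _ => g.toEquiv.toLinearMap) t) := by
  simp [tensorAct]

open Classical in
/-- The identification `(⨁ 𝐕^{⊗ n i}) ⊗ (⨁ 𝐕^{⊗ m j}) = ⨁ 𝐕^{⊗ (n i + m j)}`. -/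
def tensorSumMul {ι κ : Type u} (n : ι → ℕ) (m : κ → ℕ) :
    TensorSum k n ⊗[k] TensorSum k m ≃ₗ[k] TensorSum k (fun p : ι × κ => n p.1 + m p.2) :=
  (TensorProduct.directSum k k (fun i => ⨂[k]^(n i) (StdRep k))
    (fun j => ⨂[k]^(m j) (StdRep k))).trans
    (DFinsupp.mapRange.linearEquiv fun _ => TensorPower.mulEquiv)

open Classical in
lemma tensorSumMul_lof {ι κ : Type u} (n : ι → ℕ) (m : κ → ℕ) (i : ι) (j : κ)
    (a : Fin (n i) → StdRep k) (b : Fin (m j) → StdRep k) :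
    tensorSumMul n m
      (DirectSum.lof k ι (fun i => ⨂[k]^(n i) (StdRep k)) i (PiTensorProduct.tprod k a) ⊗ₜ
        DirectSum.lof k κ (fun j => ⨂[k]^(m j) (StdRep k)) j (PiTensorProduct.tprod k b)) =
      DirectSum.lof k (ι × κ) (fun p => ⨂[k]^(n p.1 + m p.2) (StdRep k)) (i, j)
        (PiTensorProduct.tprod k (Fin.append a b)) := by
  rw [tensorSumMul, LinearEquiv.trans_apply, TensorProduct.directSum_lof_tmul_lof,
    DFinsupp.mapRange.linearEquiv_apply, DirectSum.lof_eq_of, DirectSum.lof_eq_of]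
  refine (DFinsupp.mapRange_single (hf := fun _ => map_zero _)).trans ?_
  congr 1
  exact TensorPower.tprod_mul_tprod k a b

lemma tensorSumMul_act {ι κ : Type u} (n : ι → ℕ) (m : κ → ℕ) (g : GLinf k)
    (s : TensorSum k n) (t : TensorSum k m) :
    tensorSumMul n m (tensorAct n g s ⊗ₜ tensorAct m g t) =
      tensorAct _ g (tensorSumMul n m (s ⊗ₜ t)) := by
  classical
  have : (tensorSumMul n m).toLinearMap ∘ₗ TensorProduct.map (tensorAct n g) (tensorAct m g) =
      tensorAct _ g ∘ₗ (tensorSumMul n m).toLinearMap := by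
    apply TensorProduct.ext
    refine DirectSum.linearMap_ext _ fun i => PiTensorProduct.ext (MultilinearMap.ext fun a => ?_)
    refine DirectSum.linearMap_ext _ fun j => PiTensorProduct.ext (MultilinearMap.ext fun b => ?_)
    change tensorSumMul n m (tensorAct n g (DirectSum.lof k ι _ i _) ⊗ₜ
      tensorAct m g (DirectSum.lof k κ _ j _)) = tensorAct _ g (tensorSumMul n m
        (DirectSum.lof k ι _ i _ ⊗ₜ DirectSum.lof k κ _ j _))
    rw [tensorAct_lof, tensorAct_lof, tensorSumMul_lof, tensorAct_lof, PiTensorProduct.map_tprod,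
      PiTensorProduct.map_tprod, PiTensorProduct.map_tprod, tensorSumMul_lof]
    congr 2
    funext l
    refine Fin.addCases (fun l => ?_) (fun l => ?_) l <;> simp
  exact congrArg (fun f => f (s ⊗ₜ t)) this

lemma tensorMap_injective {A B C D : Type u} [AddCommMonoid A] [AddCommMonoid B] [AddCommMonoid C]
    [AddCommMonoid D] [Module k A] [Module k B] [Module k C] [Module k D] (f : A →ₗ[k] B)
    (g : C →ₗ[k] D) (hf : Function.Injective f) (hg : Function.Injective g) :
    Function.Injective (TensorProduct.map f g) := by
  let _ := Module.addCommMonoidToAddCommGroup k (M := A)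
  let _ := Module.addCommMonoidToAddCommGroup k (M := B)
  let _ := Module.addCommMonoidToAddCommGroup k (M := C)
  let _ := Module.addCommMonoidToAddCommGroup k (M := D)
  exact TensorProduct.map_injective_of_flat_flat _ _ hf hg

/-- An equivariant bilinear map sends pairs of polynomial elements to polynomial elements. -/
lemma bilin_mem_pol (b : A →ₗ[k] B →ₗ[k] C)
    (hb : ∀ (g : GLinf k) (x : A) (y : B), b (g • x) (g • y) = g • b x y)
    {x : A} {y : B} (hx : x ∈ pol k A) (hy : y ∈ pol k B) : b x y ∈ pol k C := by
  have key : ∀ P : Submodule k A, IsPolynomialSub P → ∀ Q : Submodule k B, IsPolynomialSub Q →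
      ∀ x ∈ P, ∀ y ∈ Q, b x y ∈ pol k C := by
    rintro P ⟨ι, n, S, hS, q, hq, rfl⟩ Q ⟨κ, m, T, hT, r, hr, rfl⟩ _ ⟨s, rfl⟩ _ ⟨t, rfl⟩
    let j : S ⊗[k] T →ₗ[k] TensorSum k (fun p : ι × κ => n p.1 + m p.2) :=
      (tensorSumMul n m).toLinearMap ∘ₗ TensorProduct.map S.subtype T.subtype
    have hj : Function.Injective j := by
      refine (tensorSumMul n m).injective.comp ?_
      exact tensorMap_injective _ _ S.injective_subtype T.injective_subtype
    have hjg : ∀ (g : GLinf k) (z : S ⊗[k] T), ∃ z', j z' = tensorAct _ g (j z) ∧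
        TensorProduct.lift (b.compl₁₂ q r) z' = g • TensorProduct.lift (b.compl₁₂ q r) z := by
      intro g z
      induction z with
      | zero => exact ⟨0, by simp, by simp⟩
      | tmul s t =>
        refine ⟨⟨_, hS g s s.2⟩ ⊗ₜ ⟨_, hT g t t.2⟩, ?_, ?_⟩
        · simp only [j, LinearMap.comp_apply, TensorProduct.map_tmul, LinearEquiv.coe_coe,
            Submodule.subtype_apply]
          exact tensorSumMul_act n m g s t
        · simp only [TensorProduct.lift.tmul, LinearMap.compl₁₂_apply, hq, hr, hb]
      | add z w hz hw =>
        obtain ⟨z', h1, h2⟩ := hz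
        obtain ⟨w', h3, h4⟩ := hw
        exact ⟨z' + w', by simp [h1, h3], by simp [h2, h4]⟩
    let e := LinearEquiv.ofInjective j hj
    have hpoly : IsPolynomialSub (LinearMap.range (TensorProduct.lift (b.compl₁₂ q r))) := by
      refine ⟨ι × κ, _, LinearMap.range j, ?_,
        TensorProduct.lift (b.compl₁₂ q r) ∘ₗ e.symm.toLinearMap, ?_, ?_⟩
      · rintro g _ ⟨z, rfl⟩
        obtain ⟨z', h, -⟩ := hjg g z
        exact ⟨z', h⟩
      · rintro g ⟨_, z, rfl⟩
        obtain ⟨z', h, h'⟩ := hjg g z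
        have e1 : e.symm ⟨j z, z, rfl⟩ = z := (LinearEquiv.symm_apply_eq e).2 rfl
        have e2 : ∀ h0, e.symm ⟨tensorAct _ g (j z), h0⟩ = z' :=
          fun h0 => (LinearEquiv.symm_apply_eq e).2 (Subtype.ext h.symm)
        simp only [LinearMap.comp_apply, LinearEquiv.coe_coe]
        rw [e1, e2, h']
      · rw [LinearMap.range_comp, LinearEquiv.range, Submodule.map_top]
    exact (le_sSup hpoly : _ ≤ pol k C) ⟨s ⊗ₜ t, by simp⟩
  have h1 : ∀ P : Submodule k A, IsPolynomialSub P → ∀ x ∈ P, ∀ y ∈ pol k B, b x y ∈ pol k C := by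
    intro P hP x hx y hy
    have : pol k B ≤ (pol k C).comap (b x) := sSup_le fun Q hQ y hy => key P hP Q hQ x hx y hy
    exact this hy
  have : pol k A ≤ (pol k C).comap (b.flip y) := sSup_le fun P hP x hx => h1 P hP x hx y hy
  exact this hx

/-- The identification `𝐕^{⊗ 0} = k`. -/
def tensorZero : TensorSum k (fun _ : PUnit.{u+1} => 0) →ₗ[k] k :=
  DirectSum.toModule k PUnit.{u+1} k fun _ =>
    (PiTensorProduct.isEmptyEquiv (s := fun _ : Fin 0 => StdRep k) (Fin 0)).toLinearMap

lemma tensorZero_lof (i : PUnit.{u+1}) (a : Fin 0 → StdRep k) :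
    tensorZero (DirectSum.lof k PUnit.{u+1} (fun _ => ⨂[k]^0 (StdRep k)) i
      (PiTensorProduct.tprod k a)) = 1 := by
  rw [tensorZero]
  erw [DirectSum.toModule_lof]
  simp

lemma tensorZero_act (g : GLinf k) (s : TensorSum k (fun _ : PUnit.{u+1} => 0)) :
    tensorZero (tensorAct _ g s) = tensorZero s := by
  have h : tensorZero ∘ₗ tensorAct _ g = tensorZero (k := k) := by
    refine DirectSum.linearMap_ext _ fun i => PiTensorProduct.ext (MultilinearMap.ext fun a => ?_)
    change tensorZero (tensorAct _ g (DirectSum.lof k PUnit.{u+1} _ i _)) =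
      tensorZero (DirectSum.lof k PUnit.{u+1} _ i _)
    rw [tensorAct_lof, PiTensorProduct.map_tprod, tensorZero_lof]
    exact (tensorZero_lof i a).symm
  exact congrArg (fun f => f s) h

/-- Invariant vectors are polynomial. -/
lemma mem_pol_of_invariant [SMulCommClass (GLinf k) k M] (x : M) (hx : ∀ g : GLinf k, g • x = x) :
    x ∈ pol k M := by
  have : IsPolynomialSub (k ∙ x) := by
    refine ⟨PUnit, fun _ => 0, ⊤, fun _ _ _ => trivial,
      LinearMap.toSpanSingleton k M x ∘ₗ tensorZero ∘ₗ Submodule.subtype _, fun g s => ?_, ?_⟩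
    · simp only [LinearMap.comp_apply, Submodule.subtype_apply, LinearMap.toSpanSingleton_apply]
      rw [tensorZero_act, smul_comm, hx]
    · refine le_antisymm ?_ ?_
      · rw [LinearMap.range_comp]
        rintro _ ⟨c, -, rfl⟩
        exact Submodule.smul_mem _ _ (Submodule.mem_span_singleton_self x)
      · rw [Submodule.span_singleton_le_iff_mem]
        refine ⟨⟨DirectSum.lof k PUnit.{u+1} (fun _ => ⨂[k]^0 (StdRep k)) PUnit.unit
          (PiTensorProduct.tprod k fun _ => 0), trivial⟩, ?_⟩
        simp only [LinearMap.comp_apply, Submodule.subtype_apply,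
          LinearMap.toSpanSingleton_apply]
        rw [tensorZero_lof, one_smul]
  exact (le_sSup this : _ ≤ pol k M) (Submodule.mem_span_singleton_self x)

/-! ### Evaluating polynomial representations on vector spaces -/

/-- Equivariant multilinear maps `𝐕ⁿ → M`, i.e. equivariant linear maps `𝐕^{⊗ n} → M`. -/
def GLEquivariant {n : ℕ} (f : MultilinearMap k (fun _ : Fin n => StdRep k) M) : Prop :=
  ∀ (g : GLinf k) (v : Fin n → StdRep k),
    f (fun i => g.toEquiv (v i)) = g • f v

variable (U U' U'' : Type u) [AddCommGroup U] [Module k U] [AddCommGroup U'] [Module k U']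
  [AddCommGroup U''] [Module k U'']

variable {U} in
/-- The function `Hom(U, 𝐕) → M`, `φ ↦ f (φ u₁, …, φ uₙ)`. -/
def genFun {n : ℕ} (f : MultilinearMap k (fun _ : Fin n => StdRep k) M) (u : Fin n → U) :
    (U →ₗ[k] StdRep k) → M :=
  fun φ => f fun i => φ (u i)

variable (k M) in
/-- The evaluation `M{U}` on the vector space `U` of the polynomial representation `M`, regarded
as a polynomial functor.

Write `F` for the polynomial functor with `F(𝐕) = M`. An element `t ∈ F(U)` is determined by its
images `F(φ)(t) ∈ F(𝐕) = M` under all linear maps `φ : U → 𝐕` (as `t` comes from `F(U₀)` for a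
finite dimensional subspace `U₀` of `U`, which is a retract of `U` and embeds in `𝐕` as a direct
summand), so `F(U)` embeds in the space of functions `Hom(U, 𝐕) → M`. By Schur–Weyl duality `F(U)`
is the sum of the images of `U^{⊗ n}` under the natural transformations from the `n`-th tensor
power functor to `F`, and these correspond to the equivariant maps `f : 𝐕^{⊗ n} → M`. The
image of `u₁ ⊗ ⋯ ⊗ uₙ` under such a transformation is the function `φ ↦ f (φ u₁ ⊗ ⋯ ⊗ φ uₙ)`. -/
def polEval : Submodule k ((U →ₗ[k] StdRep k) → M) :=
  Submodule.span k {h | ∃ (n : ℕ) (f : MultilinearMap k (fun _ : Fin n => StdRep k) M)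
    (u : Fin n → U), GLEquivariant f ∧ h = genFun f u}

variable {U U' U''}

lemma genFun_mem {n : ℕ} {f : MultilinearMap k (fun _ : Fin n => StdRep k) M}
    (hf : GLEquivariant f) (u : Fin n → U) : genFun f u ∈ polEval k M U :=
  Submodule.subset_span ⟨n, f, u, hf, rfl⟩

/-- Constant functions with invariant value, the elements of `M{U}` of degree zero. -/
lemma const_mem_polEval (x : M) (hx : ∀ g : GLinf k, g • x = x) :
    (fun _ => x) ∈ polEval k M U :=
  genFun_mem (f := MultilinearMap.constOfIsEmpty k (fun _ : Fin 0 => StdRep k) x)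
    (fun g _ => (hx g).symm) (fun i => i.elim0)

/-- Functoriality of `M{U}` in the representation `M`. -/
lemma comp_mem_polEval (f : M →ₗ[k] N) (hf : ∀ (g : GLinf k) (m : M), f (g • m) = g • f m)
    {h : (U →ₗ[k] StdRep k) → M} (hh : h ∈ polEval k M U) :
    (fun φ => f (h φ)) ∈ polEval k N U := by
  have : polEval k M U ≤ (polEval k N U).comap (f.compLeft (U →ₗ[k] StdRep k)) := by
    refine Submodule.span_le.2 ?_
    rintro _ ⟨n, F, u, hF, rfl⟩
    refine genFun_mem (f := f.compMultilinearMap F) (fun g v => ?_) u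
    rw [LinearMap.compMultilinearMap_apply, hF g v, hf, LinearMap.compMultilinearMap_apply]
  exact this hh

/-- Functoriality of `M{U}` in the vector space `U`. -/
lemma precomp_mem_polEval (e : U →ₗ[k] U') {h : (U →ₗ[k] StdRep k) → M}
    (hh : h ∈ polEval k M U) : (fun φ : U' →ₗ[k] StdRep k => h (φ ∘ₗ e)) ∈ polEval k M U' := by
  have : polEval k M U ≤ (polEval k M U').comap
      (LinearMap.funLeft k M fun φ : U' →ₗ[k] StdRep k => φ ∘ₗ e) := by
    refine Submodule.span_le.2 ?_
    rintro _ ⟨n, F, u, hF, rfl⟩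
    exact genFun_mem hF fun i => e (u i)
  exact this hh

/-- Equivariant bilinear maps `A × B → C` induce bilinear maps `A{U} × B{U} → C{U}`. -/
lemma bilin_mem_polEval (b : A →ₗ[k] B →ₗ[k] C)
    (hb : ∀ (g : GLinf k) (x : A) (y : B), b (g • x) (g • y) = g • b x y)
    {h : (U →ₗ[k] StdRep k) → A} {h' : (U →ₗ[k] StdRep k) → B}
    (hh : h ∈ polEval k A U) (hh' : h' ∈ polEval k B U) :
    (fun φ => b (h φ) (h' φ)) ∈ polEval k C U := by
  induction hh, hh' using Submodule.span_induction₂ with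
  | mem_mem x y hx hy =>
    obtain ⟨n, F, u, hF, rfl⟩ := hx
    obtain ⟨m, F', u', hF', rfl⟩ := hy
    have hG : GLEquivariant (((TensorProduct.lift b).compMultilinearMap
        (F.domCoprod F')).domDomCongr finSumFinEquiv) := by
      intro g v
      have h1 := hF g fun i => v (finSumFinEquiv (Sum.inl i))
      have h2 := hF' g fun i => v (finSumFinEquiv (Sum.inr i))
      simp only [MultilinearMap.domDomCongr_apply, LinearMap.compMultilinearMap_apply,
        MultilinearMap.domCoprod_apply, TensorProduct.lift.tmul]
      rw [h1, h2, hb]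
    have hE : (fun φ => b (genFun F u φ) (genFun F' u' φ)) = genFun
        (((TensorProduct.lift b).compMultilinearMap
          (F.domCoprod F')).domDomCongr finSumFinEquiv) (Fin.append u u') := by
      funext φ
      simp [genFun, MultilinearMap.domCoprod, MultilinearMap.domCoprodDep]
    rw [hE]
    exact genFun_mem hG (Fin.append u u')
  | zero_left y hy =>
    convert Submodule.zero_mem (polEval k C U) using 1
    exact funext fun φ => by simp
  | zero_right x hx =>
    convert Submodule.zero_mem (polEval k C U) using 1
    exact funext fun φ => by simp
  | add_left x y z hx hy hz h1 h2 =>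
    convert Submodule.add_mem _ h1 h2 using 1
    exact funext fun φ => by simp
  | add_right x y z hx hy hz h1 h2 =>
    convert Submodule.add_mem _ h1 h2 using 1
    exact funext fun φ => by simp
  | smul_left r x y hx hy h1 =>
    convert Submodule.smul_mem _ r h1 using 1
    exact funext fun φ => by simp
  | smul_right r x y hx hy h1 =>
    convert Submodule.smul_mem _ r h1 using 1
    exact funext fun φ => by simp

variable (k M U) in
/-- The space `M{U}` of `polEval`, as a type. -/
def PolEval : Type u := polEval k M U

instance : AddCommGroup (PolEval k M U) := inferInstanceAs (AddCommGroup (polEval k M U))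

instance : Module k (PolEval k M U) := inferInstanceAs (Module k (polEval k M U))

/-- The function `Hom(U, 𝐕) → M` underlying an element of `M{U}`. -/
def PolEval.fn (h : PolEval k M U) : (U →ₗ[k] StdRep k) → M :=
  Subtype.val (p := fun h => h ∈ polEval k M U) h

/-- The element of `M{U}` with given underlying function. -/
def PolEval.mk (h : (U →ₗ[k] StdRep k) → M) (hh : h ∈ polEval k M U) : PolEval k M U :=
  Subtype.mk (p := fun h => h ∈ polEval k M U) h hh

lemma PolEval.fn_mem (h : PolEval k M U) : h.fn ∈ polEval k M U :=
  Subtype.property (p := fun h => h ∈ polEval k M U) h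

lemma PolEval.ext {h h' : PolEval k M U} (H : ∀ φ, h.fn φ = h'.fn φ) : h = h' :=
  Subtype.ext (funext H)

@[simp] lemma PolEval.fn_mk (h : (U →ₗ[k] StdRep k) → M) (hh : h ∈ polEval k M U) :
    (PolEval.mk h hh).fn = h := rfl

@[simp] lemma PolEval.fn_add (h h' : PolEval k M U) (φ : U →ₗ[k] StdRep k) :
    (h + h').fn φ = h.fn φ + h'.fn φ := rfl

@[simp] lemma PolEval.fn_zero (φ : U →ₗ[k] StdRep k) : (0 : PolEval k M U).fn φ = 0 := rfl

@[simp] lemma PolEval.fn_smul (c : k) (h : PolEval k M U) (φ : U →ₗ[k] StdRep k) :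
    (c • h).fn φ = c • h.fn φ := rfl

/-- The map `A{U} → B{U}` induced by an equivariant linear map `A → B`. -/
def evalMap (U : Type u) [AddCommGroup U] [Module k U] (f : A →ₗ[k] B)
    (hf : ∀ (g : GLinf k) (a : A), f (g • a) = g • f a) : PolEval k A U →ₗ[k] PolEval k B U where
  toFun h := PolEval.mk (fun φ => f (h.fn φ)) (comp_mem_polEval f hf h.fn_mem)
  map_add' h h' := PolEval.ext fun φ => map_add f (h.fn φ) (h'.fn φ)
  map_smul' c h := PolEval.ext fun φ => map_smul f c (h.fn φ)

/-- The map `M{U} → M{U'}` induced by a linear map `U → U'`. -/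
def evalTransport (M : Type u) [AddCommGroup M] [Module k M] [DistribMulAction (GLinf k) M]
    (e : U →ₗ[k] U') : PolEval k M U →ₗ[k] PolEval k M U' where
  toFun h := PolEval.mk (fun φ => h.fn (φ ∘ₗ e)) (precomp_mem_polEval e h.fn_mem)
  map_add' _ _ := rfl
  map_smul' _ _ := rfl

/-- The map `A{U} × B{U} → C{U}` induced by an equivariant bilinear map `A × B → C`. -/
def evalMap₂ (U : Type u) [AddCommGroup U] [Module k U] (b : A →ₗ[k] B →ₗ[k] C)
    (hb : ∀ (g : GLinf k) (a : A) (a' : B), b (g • a) (g • a') = g • b a a') :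
    PolEval k A U →ₗ[k] PolEval k B U →ₗ[k] PolEval k C U :=
  LinearMap.mk₂ k
    (fun h h' => PolEval.mk (fun φ => b (h.fn φ) (h'.fn φ))
      (bilin_mem_polEval b hb h.fn_mem h'.fn_mem))
    (fun h₁ h₂ h' => PolEval.ext fun φ => LinearMap.map_add₂ b (h₁.fn φ) (h₂.fn φ) (h'.fn φ))
    (fun c h h' => PolEval.ext fun φ => LinearMap.map_smul₂ b c (h.fn φ) (h'.fn φ))
    (fun h h₁ h₂ => PolEval.ext fun φ => map_add (b (h.fn φ)) (h₁.fn φ) (h₂.fn φ))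
    (fun c h h' => PolEval.ext fun φ => map_smul (b (h.fn φ)) c (h'.fn φ))

end Polynomial

section Algebra

variable (k R : Type u) [Field k] [CommRing R] [Algebra k R] [MulSemiringAction (GLinf k) R]
  (U U' : Type u) [AddCommGroup U] [Module k U] [AddCommGroup U'] [Module k U']

/-- The `k`-algebra `R{U}`, for a `GL`-algebra `R`: the space `polEval k R U` with the pointwise
multiplication of functions. -/
def algEval : Subalgebra k ((U →ₗ[k] StdRep k) → R) where
  carrier := polEval k R U
  add_mem' := Submodule.add_mem _
  mul_mem' := bilin_mem_polEval (LinearMap.mul k R) fun g x y => (smul_mul' g x y).symm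
  algebraMap_mem' c := by
    have h : (fun _ => 1) ∈ polEval k R U := const_mem_polEval (1 : R) fun g => smul_one g
    have := Submodule.smul_mem _ c h
    rw [Algebra.algebraMap_eq_smul_one]
    exact this

/-- The `k`-algebra `R{U}`, as a type. -/
def AlgEval : Type u := algEval k R U

instance : CommRing (AlgEval k R U) := inferInstanceAs (CommRing (algEval k R U))

instance : Algebra k (AlgEval k R U) := inferInstanceAs (Algebra k (algEval k R U))

variable {k R U U'}

/-- The function `Hom(U, 𝐕) → R` underlying an element of `R{U}`. -/
def AlgEval.fn (a : AlgEval k R U) : (U →ₗ[k] StdRep k) → R :=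
  Subtype.val (p := fun h => h ∈ algEval k R U) a

/-- The element of `R{U}` with given underlying function. -/
def AlgEval.mk (h : (U →ₗ[k] StdRep k) → R) (hh : h ∈ polEval k R U) : AlgEval k R U :=
  Subtype.mk (p := fun h => h ∈ algEval k R U) h hh

lemma AlgEval.fn_mem (a : AlgEval k R U) : a.fn ∈ polEval k R U :=
  Subtype.property (p := fun h => h ∈ algEval k R U) a

lemma AlgEval.ext {a b : AlgEval k R U} (H : ∀ φ, a.fn φ = b.fn φ) : a = b :=
  Subtype.ext (funext H)

@[simp] lemma AlgEval.fn_mul (a b : AlgEval k R U) (φ : U →ₗ[k] StdRep k) :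
    (a * b).fn φ = a.fn φ * b.fn φ := rfl

@[simp] lemma AlgEval.fn_add (a b : AlgEval k R U) (φ : U →ₗ[k] StdRep k) :
    (a + b).fn φ = a.fn φ + b.fn φ := rfl

@[simp] lemma AlgEval.fn_smul (c : k) (a : AlgEval k R U) (φ : U →ₗ[k] StdRep k) :
    (c • a).fn φ = c • a.fn φ := rfl

/-- The algebra homomorphism `R{U} → R{U'}` induced by a linear map `U → U'`. -/
def AlgEval.map (e : U →ₗ[k] U') : AlgEval k R U →ₐ[k] AlgEval k R U' where
  toFun a := AlgEval.mk (fun φ => a.fn (φ ∘ₗ e)) (precomp_mem_polEval e a.fn_mem)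
  map_one' := rfl
  map_mul' _ _ := rfl
  map_zero' := rfl
  map_add' _ _ := rfl
  commutes' _ := rfl

/-- The `k`-point `x` of `X{U} = Spec R{U}` (where `X = Spec R`) is `GL`-generic: the only
closed `GL`-subvariety `Z` of `X` such that `x` lies on `Z{U}` is `X` itself. Here
`Z = Spec (R / I)` for a `GL`-stable radical ideal `I`, and `Z{U}` is the zero locus in `X{U}` of
`I{U} ⊆ R{U}`. -/
def IsGLGeneric (x : AlgEval k R U →ₐ[k] k) : Prop :=
  ∀ I : Ideal R, I.IsRadical → (∀ (g : GLinf k), ∀ r ∈ I, g • r ∈ I) →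
    (∀ (n : ℕ) (f : MultilinearMap k (fun _ : Fin n => StdRep k) R) (u : Fin n → U)
      (hf : GLEquivariant f), (∀ v, f v ∈ I) →
        x (AlgEval.mk (genFun f u) (genFun_mem hf u)) = 0) → I = ⊥

variable {A B C M : Type u}
  [AddCommGroup A] [Module k A] [Module R A] [IsScalarTower k R A]
  [DistribMulAction (GLinf k) A] [SMulDistribClass (GLinf k) R A]
  [AddCommGroup B] [Module k B] [Module R B] [IsScalarTower k R B]
  [DistribMulAction (GLinf k) B] [SMulDistribClass (GLinf k) R B]
  [AddCommGroup C] [Module k C] [Module R C] [IsScalarTower k R C]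
  [DistribMulAction (GLinf k) C] [SMulDistribClass (GLinf k) R C]
  [AddCommGroup M] [Module k M] [Module R M] [IsScalarTower k R M]
  [DistribMulAction (GLinf k) M] [SMulDistribClass (GLinf k) R M]

/-- For an `R`-module `M`, the space `M{U}` is an `R{U}`-module, by pointwise scalar
multiplication. -/
instance : Module (AlgEval k R U) (PolEval k M U) where
  smul a m := PolEval.mk (fun φ => a.fn φ • m.fn φ) <|
    bilin_mem_polEval (Algebra.lsmul k k M : R →ₐ[k] Module.End k M).toLinearMap
      (fun g x y => (smul_distrib_smul g x y).symm) a.fn_mem m.fn_mem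
  one_smul m := PolEval.ext fun φ => one_smul R (m.fn φ)
  mul_smul a b m := PolEval.ext fun φ => mul_smul (a.fn φ) (b.fn φ) (m.fn φ)
  smul_zero a := PolEval.ext fun φ => smul_zero (a.fn φ)
  smul_add a m n := PolEval.ext fun φ => smul_add (a.fn φ) (m.fn φ) (n.fn φ)
  add_smul a b m := PolEval.ext fun φ => add_smul (a.fn φ) (b.fn φ) (m.fn φ)
  zero_smul m := PolEval.ext fun φ => zero_smul R (m.fn φ)

@[simp] lemma fn_alg_smul (a : AlgEval k R U) (m : PolEval k M U) (φ : U →ₗ[k] StdRep k) :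
    (a • m).fn φ = a.fn φ • m.fn φ := rfl

instance : IsScalarTower k (AlgEval k R U) (PolEval k M U) :=
  ⟨fun c a m => PolEval.ext fun φ => smul_assoc c (a.fn φ) (m.fn φ)⟩

variable (M) in
/-- The subspace `𝔪 M{U}` of `M{U}`, where `𝔪` is the maximal ideal of the `k`-point `x` of
`Spec R{U}`. -/
def maxSub (x : AlgEval k R U →ₐ[k] k) : Submodule k (PolEval k M U) :=
  (RingHom.ker x • (⊤ : Submodule (AlgEval k R U) (PolEval k M U))).restrictScalars k

variable (M) in
/-- The fiber `M{U} / 𝔪 M{U}` of an `R`-module `M` at a `k`-point `x` of `Spec R{U}`. -/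
abbrev Fiber (x : AlgEval k R U →ₐ[k] k) : Type u := PolEval k M U ⧸ maxSub M x

lemma smul_mem_maxSub {x : AlgEval k R U →ₐ[k] k} {a : AlgEval k R U} (ha : x a = 0)
    (m : PolEval k M U) : a • m ∈ maxSub M x := by
  have h : a ∈ RingHom.ker x := ha
  have := Submodule.smul_mem_smul h (Submodule.mem_top (R := AlgEval k R U) (x := m))
  rw [maxSub, Submodule.restrictScalars_mem]
  exact this

lemma maxSub_le {x : AlgEval k R U →ₐ[k] k} {S : Submodule k (PolEval k M U)}
    (h : ∀ a : AlgEval k R U, x a = 0 → ∀ m : PolEval k M U, a • m ∈ S) : maxSub M x ≤ S := by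
  intro y hy
  rw [maxSub, Submodule.restrictScalars_mem] at hy
  induction hy using Submodule.smul_induction_on' with
  | smul a ha m hm => exact h a ha m
  | add y hy z hz h1 h2 => exact S.add_mem h1 h2

/-- The map on fibers induced by a map of `R`-modules. -/
def fiberMap (x : AlgEval k R U →ₐ[k] k) (f : A →ₗ[k] B)
    (hf : ∀ (g : GLinf k) (a : A), f (g • a) = g • f a)
    (hR : ∀ (r : R) (a : A), f (r • a) = r • f a) : Fiber A x →ₗ[k] Fiber B x :=
  (maxSub A x).mapQ (maxSub B x) (evalMap U f hf) <| maxSub_le fun a ha m => by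
    have : evalMap U f hf (a • m) = a • evalMap U f hf m :=
      PolEval.ext fun φ => hR (a.fn φ) (m.fn φ)
    rw [Submodule.mem_comap, this]
    exact smul_mem_maxSub ha _

/-- The bilinear map on fibers induced by an equivariant `R`-bilinear map. -/
def fiberMap₂ (x : AlgEval k R U →ₐ[k] k) (b : A →ₗ[k] B →ₗ[k] C)
    (hb : ∀ (g : GLinf k) (a : A) (a' : B), b (g • a) (g • a') = g • b a a')
    (hl : ∀ (r : R) (a : A) (a' : B), b (r • a) a' = r • b a a')
    (hr : ∀ (r : R) (a : A) (a' : B), b a (r • a') = r • b a a') :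
    Fiber A x →ₗ[k] Fiber B x →ₗ[k] Fiber C x :=
  (maxSub A x).liftQ
    (LinearMap.flip <| (maxSub B x).liftQ
      (LinearMap.flip <| (evalMap₂ U b hb).compr₂ (maxSub C x).mkQ) <|
      maxSub_le fun a ha m => by
        rw [LinearMap.mem_ker]
        refine LinearMap.ext fun h => (Submodule.Quotient.mk_eq_zero _).2 ?_
        have : evalMap₂ U b hb h (a • m) = a • evalMap₂ U b hb h m :=
          PolEval.ext fun φ => hr (a.fn φ) (h.fn φ) (m.fn φ)
        rw [this]
        exact smul_mem_maxSub ha _) <|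
    maxSub_le fun a ha m => by
      rw [LinearMap.mem_ker]
      refine LinearMap.ext fun h => ?_
      obtain ⟨h, rfl⟩ := Submodule.mkQ_surjective _ h
      refine (Submodule.Quotient.mk_eq_zero _).2 ?_
      have : evalMap₂ U b hb (a • m) h = a • evalMap₂ U b hb m h :=
        PolEval.ext fun φ => hl (a.fn φ) (m.fn φ) (h.fn φ)
      rw [this]
      exact smul_mem_maxSub ha _

@[simp] lemma fiberMap_mk (x : AlgEval k R U →ₐ[k] k) (f : A →ₗ[k] B)
    (hf : ∀ (g : GLinf k) (a : A), f (g • a) = g • f a)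
    (hR : ∀ (r : R) (a : A), f (r • a) = r • f a) (h : PolEval k A U) :
    fiberMap x f hf hR ((maxSub A x).mkQ h) = (maxSub B x).mkQ (evalMap U f hf h) := rfl

@[simp] lemma fiberMap₂_mk (x : AlgEval k R U →ₐ[k] k) (b : A →ₗ[k] B →ₗ[k] C)
    (hb : ∀ (g : GLinf k) (a : A) (a' : B), b (g • a) (g • a') = g • b a a')
    (hl : ∀ (r : R) (a : A) (a' : B), b (r • a) a' = r • b a a')
    (hr : ∀ (r : R) (a : A) (a' : B), b a (r • a') = r • b a a')
    (h : PolEval k A U) (h' : PolEval k B U) :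
    fiberMap₂ x b hb hl hr ((maxSub A x).mkQ h) ((maxSub B x).mkQ h') =
      (maxSub C x).mkQ (evalMap₂ U b hb h h') := rfl

/-- A linear map `e : U → U'` such that the induced map `X{U'} → X{U}` takes `x'` to `x` induces
a map between the fibers at `x` and at `x'`. -/
def fiberTransport (M : Type u) [AddCommGroup M] [Module k M] [Module R M] [IsScalarTower k R M]
    [DistribMulAction (GLinf k) M] [SMulDistribClass (GLinf k) R M]
    {x : AlgEval k R U →ₐ[k] k} {x' : AlgEval k R U' →ₐ[k] k} (e : U →ₗ[k] U')
    (he : ∀ a, x' (AlgEval.map e a) = x a) : Fiber M x →ₗ[k] Fiber M x' :=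
  (maxSub M x).mapQ (maxSub M x') (evalTransport M e) <| maxSub_le fun a ha m => by
    have : evalTransport M e (a • m) = AlgEval.map e a • evalTransport M e m := rfl
    rw [Submodule.mem_comap, this]
    exact smul_mem_maxSub (by rw [he, ha]) _

@[simp] lemma fiberTransport_mk {x : AlgEval k R U →ₐ[k] k} {x' : AlgEval k R U' →ₐ[k] k}
    (e : U →ₗ[k] U') (he : ∀ a, x' (AlgEval.map e a) = x a) (h : PolEval k M U) :
    fiberTransport M e he ((maxSub M x).mkQ h) = (maxSub M x').mkQ (evalTransport M e h) := rfl

end Algebra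

/-! ### Semilinear representations -/

section KMod

variable (k K : Type u) [Field k] [Field K] [Algebra k K] [MulSemiringAction (GLinf k) K]
  [SMulCommClass (GLinf k) k K]

/-- The `K`-modules for a `GL`-field `K`: semilinear representations of `GL` over `K` that are
generated by a polynomial subrepresentation (equivalently, by the maximal one). -/
structure KMod where
  /-- the underlying vector space -/
  carrier : Type u
  [addCommGroup : AddCommGroup carrier]
  [module : Module K carrier]
  [moduleBase : Module k carrier]
  [isScalarTower : IsScalarTower k K carrier]
  [action : DistribMulAction (GLinf k) carrier]
  [semilinear : SMulDistribClass (GLinf k) K carrier]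
  span_pol : Submodule.span K (pol k carrier : Set carrier) = ⊤

attribute [instance] KMod.addCommGroup KMod.module KMod.moduleBase KMod.isScalarTower
  KMod.action KMod.semilinear

variable {k K}

/-- The action of `GL` on a semilinear representation is `k`-linear. -/
lemma smulCommClass_of_semilinear (M : Type u) [AddCommGroup M] [Module K M] [Module k M]
    [IsScalarTower k K M] [DistribMulAction (GLinf k) M] [SMulDistribClass (GLinf k) K M] :
    SMulCommClass (GLinf k) k M :=
  ⟨fun g c m => by
    have h : g • algebraMap k K c = algebraMap k K c := by
      rw [Algebra.algebraMap_eq_smul_one, smul_comm, smul_one]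
    rw [← algebraMap_smul K c m, smul_distrib_smul, h, algebraMap_smul]⟩

namespace KMod

instance (M : KMod k K) : SMulCommClass (GLinf k) k M.carrier :=
  smulCommClass_of_semilinear (K := K) M.carrier

/-- The space of morphisms of `K`-modules: equivariant `K`-linear maps. -/
def homSub (M N : KMod k K) : Submodule k (M.carrier →ₗ[K] N.carrier) where
  carrier := {f | ∀ (g : GLinf k) (m : M.carrier), f (g • m) = g • f m}
  add_mem' {f f'} hf hf' g m := by
    rw [LinearMap.add_apply, hf g m, hf' g m, ← smul_add, LinearMap.add_apply]
  zero_mem' g m := by simp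
  smul_mem' c f hf g m := by
    rw [LinearMap.smul_apply, hf g m, ← smul_comm g c, LinearMap.smul_apply]

/-- Morphisms of `K`-modules. -/
def Hom (M N : KMod k K) : Type u := homSub M N

instance (M N : KMod k K) : AddCommGroup (Hom M N) := inferInstanceAs (AddCommGroup (homSub M N))

instance (M N : KMod k K) : Module k (Hom M N) := inferInstanceAs (Module k (homSub M N))

/-- Constructor for morphisms of `K`-modules. -/
def Hom.mk {M N : KMod k K} (f : M.carrier →ₗ[K] N.carrier)
    (hf : ∀ (g : GLinf k) (m : M.carrier), f (g • m) = g • f m) : Hom M N :=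
  Subtype.mk (p := fun f => f ∈ homSub M N) f hf

/-- The `K`-linear map underlying a morphism of `K`-modules. -/
def Hom.lin {M N : KMod k K} (f : Hom M N) : M.carrier →ₗ[K] N.carrier :=
  Subtype.val (p := fun f => f ∈ homSub M N) f

lemma Hom.equivariant {M N : KMod k K} (f : Hom M N) (g : GLinf k) (m : M.carrier) :
    f.lin (g • m) = g • f.lin m :=
  Subtype.property (p := fun f => f ∈ homSub M N) f g m

instance : Category (KMod k K) where
  Hom := Hom
  id M := Hom.mk LinearMap.id fun _ _ => rfl
  comp f g := Hom.mk (g.lin ∘ₗ f.lin) fun γ m => by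
    rw [LinearMap.comp_apply, f.equivariant, g.equivariant, LinearMap.comp_apply]

/-- The linear map underlying a morphism in the category of `K`-modules. -/
def lin {M N : KMod k K} (f : M ⟶ N) : M.carrier →ₗ[K] N.carrier := Hom.lin f

/-- Constructor for morphisms in the category of `K`-modules. -/
def homMk {M N : KMod k K} (f : M.carrier →ₗ[K] N.carrier)
    (hf : ∀ (g : GLinf k) (m : M.carrier), f (g • m) = g • f m) : M ⟶ N := Hom.mk f hf

lemma lin_smul {M N : KMod k K} (f : M ⟶ N) (g : GLinf k) (m : M.carrier) :
    lin f (g • m) = g • lin f m := Hom.equivariant f g m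

@[simp] lemma lin_homMk {M N : KMod k K} (f : M.carrier →ₗ[K] N.carrier)
    (hf : ∀ (g : GLinf k) (m : M.carrier), f (g • m) = g • f m) : lin (homMk f hf) = f := rfl

@[simp] lemma lin_id (M : KMod k K) : lin (𝟙 M) = LinearMap.id := rfl

@[simp] lemma lin_comp {M N P : KMod k K} (f : M ⟶ N) (g : N ⟶ P) :
    lin (f ≫ g) = lin g ∘ₗ lin f := rfl

@[ext] lemma hom_ext {M N : KMod k K} {f g : M ⟶ N} (h : lin f = lin g) : f = g :=
  Subtype.ext h

instance : Preadditive (KMod k K) where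
  homGroup M N := inferInstanceAs (AddCommGroup (Hom M N))
  add_comp _ _ _ f f' g := hom_ext (LinearMap.comp_add (lin f) (lin f') (lin g))
  comp_add _ _ _ f g g' := hom_ext (LinearMap.add_comp (lin f) (lin g') (lin g))

@[simp] lemma lin_add {M N : KMod k K} (f g : M ⟶ N) : lin (f + g) = lin f + lin g := rfl

instance : Linear k (KMod k K) where
  homModule M N := inferInstanceAs (Module k (Hom M N))
  smul_comp _ _ _ c f g := hom_ext <| LinearMap.ext fun m => by
    change lin g (c • lin f m) = c • lin g (lin f m)
    rw [← algebraMap_smul K c, map_smul, algebraMap_smul]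
  comp_smul _ _ _ f c g := hom_ext rfl

/-- The isomorphism of `K`-modules given by an equivariant linear equivalence. -/
def isoMk {M N : KMod k K} (e : M.carrier ≃ₗ[K] N.carrier)
    (he : ∀ (g : GLinf k) (m : M.carrier), e (g • m) = g • e m) : M ≅ N where
  hom := homMk e.toLinearMap he
  inv := homMk e.symm.toLinearMap fun g m => e.injective (by
    change e (e.symm (g • m)) = e (g • e.symm m)
    rw [he, e.apply_symm_apply, e.apply_symm_apply])
  hom_inv_id := hom_ext (LinearMap.ext e.symm_apply_apply)
  inv_hom_id := hom_ext (LinearMap.ext e.apply_symm_apply)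

/-- The action of a group element on a semilinear representation, as a semilinear map. -/
def actSemilinear (g : GLinf k) (M : KMod k K) :
    M.carrier →ₛₗ[MulSemiringAction.toRingHom (GLinf k) K g] M.carrier where
  toFun m := g • m
  map_add' := smul_add g
  map_smul' := smul_distrib_smul g

/-- The diagonal action of a group element on a tensor product, as a semilinear map. -/
def diag (g : GLinf k) (M N : KMod k K) : M.carrier ⊗[K] N.carrier
    →ₛₗ[MulSemiringAction.toRingHom (GLinf k) K g] M.carrier ⊗[K] N.carrier :=
  TensorProduct.map (actSemilinear g M) (actSemilinear g N)

lemma diag_tmul (g : GLinf k) {M N : KMod k K} (x : M.carrier) (y : N.carrier) :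
    diag g M N (x ⊗ₜ y) = (g • x) ⊗ₜ (g • y) := rfl

/-- The diagonal action on the tensor product of semilinear representations. -/
@[reducible] def tensorAction (M N : KMod k K) :
    DistribMulAction (GLinf k) (M.carrier ⊗[K] N.carrier) where
  smul g t := diag g M N t
  one_smul t := by
    change diag 1 M N t = t
    induction t with
    | zero => exact map_zero _
    | add x y hx hy => rw [map_add, hx, hy]
    | tmul x y => rw [diag_tmul, one_smul, one_smul]
  mul_smul g h t := by
    change diag (g * h) M N t = diag g M N (diag h M N t)
    induction t with
    | zero => simp only [map_zero]
    | add x y hx hy => rw [map_add, map_add, map_add, hx, hy]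
    | tmul x y => rw [diag_tmul, diag_tmul, diag_tmul, mul_smul, mul_smul]
  smul_zero g := map_zero (diag g M N)
  smul_add g := map_add (diag g M N)

/-- The tensor product over `K` of two `K`-modules, with the diagonal action. -/
def tensorObj (M N : KMod k K) : KMod k K :=
  letI := tensorAction M N
  have hsl : SMulDistribClass (GLinf k) K (M.carrier ⊗[K] N.carrier) :=
    ⟨fun g a t => LinearMap.map_smulₛₗ (diag g M N) a t⟩
  { carrier := M.carrier ⊗[K] N.carrier
    span_pol := by
      have := smulCommClass_of_semilinear (k := k) (K := K) (M.carrier ⊗[K] N.carrier)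
      have key : ∀ x ∈ pol k M.carrier, ∀ y ∈ pol k N.carrier,
          x ⊗ₜ[K] y ∈ pol k (M.carrier ⊗[K] N.carrier) := fun x hx y hy =>
        bilin_mem_pol (LinearMap.mk₂ k (fun x y => x ⊗ₜ[K] y) TensorProduct.add_tmul
          (fun c x y => rfl) TensorProduct.tmul_add (fun c x y => by simp))
          (fun g x y => rfl) hx hy
      refine eq_top_iff.2 ?_
      rw [← TensorProduct.span_tmul_eq_top]
      refine Submodule.span_le.2 ?_
      rintro _ ⟨x, y, rfl⟩
      have hx : x ∈ Submodule.span K (pol k M.carrier : Set M.carrier) := by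
        rw [M.span_pol]; trivial
      have hy : y ∈ Submodule.span K (pol k N.carrier : Set N.carrier) := by
        rw [N.span_pol]; trivial
      induction hx, hy using Submodule.span_induction₂ with
      | mem_mem x y hx hy => exact Submodule.subset_span (key x hx y hy)
      | zero_left y hy => rw [TensorProduct.zero_tmul]; exact Submodule.zero_mem _
      | zero_right x hx => rw [TensorProduct.tmul_zero]; exact Submodule.zero_mem _
      | add_left x y z hx hy hz h1 h2 =>
        rw [TensorProduct.add_tmul]; exact Submodule.add_mem _ h1 h2
      | add_right x y z hx hy hz h1 h2 =>
        rw [TensorProduct.tmul_add]; exact Submodule.add_mem _ h1 h2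
      | smul_left r x y hx hy h1 =>
        rw [← TensorProduct.smul_tmul']; exact Submodule.smul_mem _ r h1
      | smul_right r x y hx hy h1 =>
        rw [TensorProduct.tmul_smul]; exact Submodule.smul_mem _ r h1 }

/-- The unit object: `K` itself. -/
def unit : KMod k K :=
  { carrier := K
    semilinear := ⟨fun g a b => smul_mul' g a b⟩
    span_pol := by
      have h : (1 : K) ∈ Submodule.span K (pol k K : Set K) :=
        Submodule.subset_span (mem_pol_of_invariant (1 : K) fun g => smul_one g)
      exact (Ideal.eq_top_iff_one _).2 h }

lemma smul_tensorObj (M N : KMod k K) (g : GLinf k) (t : (tensorObj M N).carrier) :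
    g • t = diag g M N t := rfl

/-- Equivariance for maps out of a tensor product can be checked on pure tensors. -/
lemma equivariant_of_tmul {M N P : KMod k K} (f : M.carrier ⊗[K] N.carrier →ₗ[K] P.carrier)
    (h : ∀ (g : GLinf k) (x : M.carrier) (y : N.carrier),
      f ((g • x) ⊗ₜ (g • y)) = g • f (x ⊗ₜ y)) (g : GLinf k) (t : M.carrier ⊗[K] N.carrier) :
    f (diag g M N t) = g • f t := by
  induction t with
  | zero => rw [map_zero, map_zero, smul_zero]
  | tmul x y => rw [diag_tmul, h]
  | add x y hx hy => rw [map_add, map_add, map_add, smul_add, hx, hy]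

/-- The tensor product of morphisms. -/
def tensorHom {M M' N N' : KMod k K} (f : M ⟶ M') (f' : N ⟶ N') :
    tensorObj M N ⟶ tensorObj M' N' :=
  homMk (M := tensorObj M N) (N := tensorObj M' N') (TensorProduct.map (lin f) (lin f')) <|
    equivariant_of_tmul (P := tensorObj M' N') (TensorProduct.map (lin f) (lin f'))
      fun g x y => congrArg₂ (fun a b => a ⊗ₜ[K] b) (lin_smul f g x) (lin_smul f' g y)

/-- The associator. -/
def associator (M N P : KMod k K) :
    tensorObj (tensorObj M N) P ≅ tensorObj M (tensorObj N P) :=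
  isoMk (M := tensorObj (tensorObj M N) P) (N := tensorObj M (tensorObj N P))
    (TensorProduct.assoc K M.carrier N.carrier P.carrier) <|
    equivariant_of_tmul (M := tensorObj M N) (N := P) (P := tensorObj M (tensorObj N P))
      (TensorProduct.assoc K M.carrier N.carrier P.carrier).toLinearMap fun g t z => by
        change TensorProduct.assoc K M.carrier N.carrier P.carrier (diag g M N t ⊗ₜ (g • z)) =
          diag g M (tensorObj N P) (TensorProduct.assoc K M.carrier N.carrier P.carrier (t ⊗ₜ z))
        induction t using TensorProduct.induction_on with
        | zero =>
          simp only [map_zero, TensorProduct.zero_tmul]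
          exact (map_zero (diag g M (tensorObj N P))).symm
        | tmul x y => rfl
        | add x y hx hy =>
          simp only [map_add, TensorProduct.add_tmul, hx, hy]
          exact (map_add (diag g M (tensorObj N P)) _ _).symm

/-- The left unitor. -/
def leftUnitor (M : KMod k K) : tensorObj unit M ≅ M :=
  isoMk (M := tensorObj unit M) (N := M) (TensorProduct.lid K M.carrier) <|
    equivariant_of_tmul (M := unit) (P := M) (TensorProduct.lid K M.carrier).toLinearMap
      fun g (x : K) y => (smul_distrib_smul g x y).symm

/-- The right unitor. -/
def rightUnitor (M : KMod k K) : tensorObj M unit ≅ M :=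
  isoMk (M := tensorObj M unit) (N := M) (TensorProduct.rid K M.carrier) <|
    equivariant_of_tmul (N := unit) (P := M) (TensorProduct.rid K M.carrier).toLinearMap
      fun g x (y : K) => (smul_distrib_smul g y x).symm

/-- The symmetry. -/
def braiding (M N : KMod k K) : tensorObj M N ≅ tensorObj N M :=
  isoMk (M := tensorObj M N) (N := tensorObj N M) (TensorProduct.comm K M.carrier N.carrier) <|
    equivariant_of_tmul (P := tensorObj N M) (TensorProduct.comm K M.carrier N.carrier).toLinearMap
      fun _ _ _ => rfl

instance : MonoidalCategoryStruct (KMod k K) where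
  tensorObj := tensorObj
  whiskerLeft M _ _ f := tensorHom (𝟙 M) f
  whiskerRight f M := tensorHom f (𝟙 M)
  tensorHom := tensorHom
  tensorUnit := unit
  associator := associator
  leftUnitor := leftUnitor
  rightUnitor := rightUnitor

instance : MonoidalCategory (KMod k K) := MonoidalCategory.ofTensorHom
  (id_tensorHom_id := fun M N => hom_ext (TensorProduct.ext' fun _ _ => rfl))
  (tensorHom_comp_tensorHom := fun _ _ _ _ => hom_ext (TensorProduct.ext' fun _ _ => rfl))
  (associator_naturality := fun _ _ _ => hom_ext (TensorProduct.ext_threefold fun _ _ _ => rfl))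
  (leftUnitor_naturality := fun f => hom_ext (TensorProduct.ext' fun (a : K) m =>
    ((lin f).map_smul a m).symm))
  (rightUnitor_naturality := fun f => hom_ext (TensorProduct.ext' fun m (a : K) =>
    ((lin f).map_smul a m).symm))
  (pentagon := fun _ _ _ _ => hom_ext (TensorProduct.ext_fourfold fun _ _ _ _ => rfl))
  (triangle := fun M N => hom_ext (TensorProduct.ext_threefold fun x (a : K) y =>
    (TensorProduct.smul_tmul a x y).symm))

instance : BraidedCategory (KMod k K) where
  braiding := braiding
  braiding_naturality_right _ _ _ _ := hom_ext (TensorProduct.ext' fun _ _ => rfl)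
  braiding_naturality_left _ _ := hom_ext (TensorProduct.ext' fun _ _ => rfl)
  hexagon_forward _ _ _ := hom_ext (TensorProduct.ext_threefold fun _ _ _ => rfl)
  hexagon_reverse M N P := by
    rw [← cancel_epi (associator M N P).hom]
    exact hom_ext (TensorProduct.ext_threefold fun _ _ _ => rfl)

instance : SymmetricCategory (KMod k K) where
  symmetry _ _ := hom_ext (TensorProduct.ext' fun _ _ => rfl)

end KMod

end KMod

/-! ### The fiber functors attached to generic points -/

section FiberFunctor

variable (k R K : Type u) [Field k] [CommRing R] [Algebra k R] [MulSemiringAction (GLinf k) R]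
  [Field K] [Algebra k K] [Algebra R K] [IsScalarTower k R K]
  [MulSemiringAction (GLinf k) K] [SMulCommClass (GLinf k) k K]
  [SMulDistribClass (GLinf k) R K]

/-- Pairs `(V, x)` of an infinite dimensional vector space `V` and a `GL`-generic `k`-point `x` of
`X{V} = Spec R{V}`. -/
structure GenericPair where
  /-- the vector space -/
  V : Type u
  [addCommGroup : AddCommGroup V]
  [module : Module k V]
  infinite : ¬ FiniteDimensional k V
  /-- the point -/
  x : AlgEval k R V →ₐ[k] k
  generic : IsGLGeneric x

attribute [instance] GenericPair.addCommGroup GenericPair.module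

variable {k R}

/-- An isomorphism `(V, x) → (V', x')` is a linear isomorphism `V → V'` such that the induced map
`X{V'} → X{V}` carries `x'` to `x`. -/
@[ext] structure GenericPair.Iso (P Q : GenericPair k R) where
  /-- the linear isomorphism -/
  e : P.V ≃ₗ[k] Q.V
  comp_eq : Q.x.comp (AlgEval.map e.toLinearMap) = P.x

/-- Composition of isomorphisms of pairs. -/
def GenericPair.Iso.trans {P Q T : GenericPair k R} (f : P.Iso Q) (g : Q.Iso T) : P.Iso T where
  e := f.e.trans g.e
  comp_eq := by
    rw [← f.comp_eq, ← g.comp_eq]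
    rfl

/-- The inverse of an isomorphism of pairs. -/
def GenericPair.Iso.symm {P Q : GenericPair k R} (f : P.Iso Q) : Q.Iso P where
  e := f.e.symm
  comp_eq := by
    rw [← f.comp_eq]
    refine AlgHom.ext fun a => ?_
    change Q.x (AlgEval.map f.e.toLinearMap (AlgEval.map f.e.symm.toLinearMap a)) = Q.x a
    congr 1
    refine AlgEval.ext fun φ => ?_
    change a.fn ((φ ∘ₗ f.e.toLinearMap) ∘ₗ f.e.symm.toLinearMap) = a.fn φ
    congr 1
    exact LinearMap.ext fun v => congrArg φ (f.e.apply_symm_apply v)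

lemma GenericPair.Iso.map_eq {P Q : GenericPair k R} (f : P.Iso Q) (a : AlgEval k R P.V) :
    Q.x (AlgEval.map f.e.toLinearMap a) = P.x a :=
  congrArg (fun F => F a) f.comp_eq

variable {K}
variable [IsPolynomialRep k R]

lemma smul_mem_pol_of_polynomial (N : KMod k K) (r : R) {n : N.carrier}
    (hn : n ∈ pol k N.carrier) : algebraMap R K r • n ∈ pol k N.carrier := by
  have hr : r ∈ pol k R := by rw [pol_eq_top]; trivial
  have := bilin_mem_pol (k := k)
    (((Algebra.lsmul k k N.carrier : K →ₐ[k] Module.End k N.carrier).toLinearMap) ∘ₗ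
      (IsScalarTower.toAlgHom k R K).toLinearMap)
    (fun g x y => ?_) hr hn
  · exact this
  · change algebraMap R K (g • x) • g • y = g • algebraMap R K x • y
    rw [smul_distrib_smul g (algebraMap R K x) y, Algebra.algebraMap_eq_smul_one,
      Algebra.algebraMap_eq_smul_one, smul_distrib_smul g x (1 : K), smul_one]

/-- The functor `S : Mod_K → Mod_R`, `S(N) = N^pol`, on objects. -/
def polMod (N : KMod k K) : Type u := pol k N.carrier

namespace polMod

variable (N : KMod k K)

instance : AddCommGroup (polMod N) := inferInstanceAs (AddCommGroup (pol k N.carrier))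

instance : Module k (polMod N) := inferInstanceAs (Module k (pol k N.carrier))

variable {N}

/-- The inclusion of `N^pol` in `N`. -/
def val (n : polMod N) : N.carrier := Subtype.val (p := fun n => n ∈ pol k N.carrier) n

/-- The element of `N^pol` given by a polynomial element of `N`. -/
def mk (n : N.carrier) (hn : n ∈ pol k N.carrier) : polMod N :=
  Subtype.mk (p := fun n => n ∈ pol k N.carrier) n hn

lemma val_mem (n : polMod N) : n.val ∈ pol k N.carrier :=
  Subtype.property (p := fun n => n ∈ pol k N.carrier) n

lemma ext {n n' : polMod N} (h : n.val = n'.val) : n = n' := Subtype.ext h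

instance : DistribMulAction (GLinf k) (polMod N) where
  smul g n := mk (g • n.val) (smul_mem_pol g n.val_mem)
  one_smul n := ext (one_smul _ n.val)
  mul_smul g h n := ext (mul_smul g h n.val)
  smul_zero g := ext (smul_zero g)
  smul_add g n n' := ext (smul_add g n.val n'.val)

instance : Module R (polMod N) where
  smul r n := mk (algebraMap R K r • n.val) (smul_mem_pol_of_polynomial N r n.val_mem)
  one_smul n := ext <| by
    change algebraMap R K 1 • n.val = n.val
    rw [map_one, one_smul]
  mul_smul r s n := ext <| by
    change algebraMap R K (r * s) • n.val = algebraMap R K r • algebraMap R K s • n.val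
    rw [map_mul, mul_smul]
  smul_zero r := ext (smul_zero (algebraMap R K r))
  smul_add r n n' := ext (smul_add (algebraMap R K r) n.val n'.val)
  add_smul r s n := ext <| by
    change algebraMap R K (r + s) • n.val = algebraMap R K r • n.val + algebraMap R K s • n.val
    rw [map_add, add_smul]
  zero_smul n := ext <| by
    change algebraMap R K 0 • n.val = 0
    rw [map_zero, zero_smul]

lemma val_smul_alg (r : R) (n : polMod N) : (r • n).val = algebraMap R K r • n.val := rfl

lemma val_smul_group (g : GLinf k) (n : polMod N) : (g • n).val = g • n.val := rfl

instance : IsScalarTower k R (polMod N) := ⟨fun c r n => ext <| by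
  change algebraMap R K (c • r) • n.val = c • algebraMap R K r • n.val
  rw [← smul_assoc]
  congr 1
  rw [Algebra.algebraMap_eq_smul_one, Algebra.algebraMap_eq_smul_one, smul_assoc]⟩

instance : SMulDistribClass (GLinf k) R (polMod N) := ⟨fun g r n => ext <| by
  change g • algebraMap R K r • n.val = algebraMap R K (g • r) • g • n.val
  rw [smul_distrib_smul g (algebraMap R K r) n.val, Algebra.algebraMap_eq_smul_one,
    Algebra.algebraMap_eq_smul_one, smul_distrib_smul g r (1 : K), smul_one]⟩

/-- The functor `S` on morphisms. -/
def map {M N : KMod k K} (f : M ⟶ N) : polMod M →ₗ[k] polMod N where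
  toFun m := mk (KMod.lin f m.val)
    (map_mem_pol ((KMod.lin f).restrictScalars k) (KMod.lin_smul f) m.val_mem)
  map_add' m m' := ext (map_add (KMod.lin f) m.val m'.val)
  map_smul' c m := ext (map_smul ((KMod.lin f).restrictScalars k) c m.val)

lemma map_smul_group {M N : KMod k K} (f : M ⟶ N) (g : GLinf k) (m : polMod M) :
    map f (g • m) = g • map f m := ext (KMod.lin_smul f g m.val)

lemma map_smul_alg {M N : KMod k K} (f : M ⟶ N) (r : R) (m : polMod M) :
    map f (r • m) = r • map f m := ext (map_smul (KMod.lin f) (algebraMap R K r) m.val)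

/-- The `R`-bilinear map `M^pol × N^pol → (M ⊗ N)^pol`. -/
def tmul (M N : KMod k K) : polMod M →ₗ[k] polMod N →ₗ[k] polMod (KMod.tensorObj M N) :=
  LinearMap.mk₂ k
    (fun m n => mk (m.val ⊗ₜ[K] n.val : M.carrier ⊗[K] N.carrier) <|
      bilin_mem_pol (C := (KMod.tensorObj M N).carrier)
        (LinearMap.mk₂ k (fun x y => (x ⊗ₜ[K] y : M.carrier ⊗[K] N.carrier))
          TensorProduct.add_tmul (fun c x y => rfl) TensorProduct.tmul_add
          (fun c x y => TensorProduct.tmul_smul c x y))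
        (fun g x y => rfl) m.val_mem n.val_mem)
    (fun m m' n => ext (TensorProduct.add_tmul m.val m'.val n.val))
    (fun c m n => ext rfl)
    (fun m n n' => ext (TensorProduct.tmul_add m.val n.val n'.val))
    (fun c m n => ext (TensorProduct.tmul_smul c m.val n.val))

lemma tmul_smul_group (M N : KMod k K) (g : GLinf k) (m : polMod M) (n : polMod N) :
    tmul M N (g • m) (g • n) = g • tmul M N m n := ext rfl

lemma tmul_smul_left (M N : KMod k K) (r : R) (m : polMod M) (n : polMod N) :
    tmul M N (r • m) n = r • tmul M N m n := ext rfl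

lemma tmul_smul_right (M N : KMod k K) (r : R) (m : polMod M) (n : polMod N) :
    tmul M N m (r • n) = r • tmul M N m n :=
  ext (TensorProduct.tmul_smul (algebraMap R K r) m.val n.val)

end polMod

lemma one_mem_pol : (1 : K) ∈ pol k K := mem_pol_of_invariant (1 : K) fun g => smul_one g

/-- The element of `Φ_{V,x}(K) = K^pol{V} / 𝔪 K^pol{V}` given by `1 ∈ K^pol`. -/
def unitFn (V : Type u) [AddCommGroup V] [Module k V] :
    PolEval k (polMod (KMod.unit : KMod k K)) V :=
  PolEval.mk (fun _ => polMod.mk (N := KMod.unit) (1 : K) (one_mem_pol (K := K))) <|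
    const_mem_polEval _ fun g => polMod.ext (smul_one g : g • (1 : K) = 1)

/-- The bilinear map `N^pol{V} / 𝔪 × N'^pol{V} / 𝔪 → (N ⊗ N')^pol{V} / 𝔪`. -/
def fiberTmul (P : GenericPair k R) (M N : KMod k K) :
    Fiber (polMod M) P.x →ₗ[k] Fiber (polMod N) P.x →ₗ[k] Fiber (polMod (KMod.tensorObj M N)) P.x :=
  fiberMap₂ P.x (polMod.tmul M N) (polMod.tmul_smul_group M N) (polMod.tmul_smul_left M N)
    (polMod.tmul_smul_right M N)

open MonoidalCategory

variable (K)

/-- The functor `Φ_{V,x} : Mod_K → Vec_k`, `N ↦ M{V} / 𝔪 M{V}` for `M = N^pol`. -/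
def phiFunctor (P : GenericPair k R) : KMod k K ⥤ ModuleCat.{u} k where
  obj N := ModuleCat.of k (Fiber (polMod N) P.x)
  map f := ModuleCat.ofHom
    (fiberMap P.x (polMod.map f) (polMod.map_smul_group f) (polMod.map_smul_alg f))
  map_id N := by
    ext t
    rfl
  map_comp f g := by
    ext t
    rfl

instance (P : GenericPair k R) : (phiFunctor K P).LaxMonoidal where
  ε := ModuleCat.ofHom (LinearMap.toSpanSingleton k (Fiber (polMod (KMod.unit : KMod k K)) P.x)
    ((maxSub _ P.x).mkQ (unitFn P.V)))
  μ M N := ModuleCat.ofHom (TensorProduct.lift (fiberTmul P M N))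
  μ_natural_left f N := by
    refine ModuleCat.MonoidalCategory.tensor_ext fun m n => ?_
    obtain ⟨m, rfl⟩ := Submodule.mkQ_surjective _ m
    obtain ⟨n, rfl⟩ := Submodule.mkQ_surjective _ n
    rfl
  μ_natural_right M f := by
    refine ModuleCat.MonoidalCategory.tensor_ext fun m n => ?_
    obtain ⟨m, rfl⟩ := Submodule.mkQ_surjective _ m
    obtain ⟨n, rfl⟩ := Submodule.mkQ_surjective _ n
    rfl
  associativity X Y Z := by
    refine ModuleCat.MonoidalCategory.tensor_ext₃' fun x y z => ?_
    obtain ⟨x, rfl⟩ := Submodule.mkQ_surjective _ x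
    obtain ⟨y, rfl⟩ := Submodule.mkQ_surjective _ y
    obtain ⟨z, rfl⟩ := Submodule.mkQ_surjective _ z
    rfl
  left_unitality X := by
    refine ModuleCat.MonoidalCategory.tensor_ext fun (c : k) x => ?_
    obtain ⟨x, rfl⟩ := Submodule.mkQ_surjective _ x
    refine congrArg (maxSub _ P.x).mkQ (a₁ := c • x) (PolEval.ext fun φ => polMod.ext ?_)
    change c • (x.fn φ).val = (c • (1 : K)) • (x.fn φ).val
    rw [smul_assoc, one_smul]
  right_unitality X := by
    refine ModuleCat.MonoidalCategory.tensor_ext fun x (c : k) => ?_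
    obtain ⟨x, rfl⟩ := Submodule.mkQ_surjective _ x
    refine congrArg (maxSub _ P.x).mkQ (a₁ := c • x) (PolEval.ext fun φ => polMod.ext ?_)
    change c • (x.fn φ).val = (c • (1 : K)) • (x.fn φ).val
    rw [smul_assoc, one_smul]

instance (P : GenericPair k R) : (phiFunctor K P).LaxBraided where
  braided M N := by
    refine ModuleCat.MonoidalCategory.tensor_ext fun m n => ?_
    obtain ⟨m, rfl⟩ := Submodule.mkQ_surjective _ m
    obtain ⟨n, rfl⟩ := Submodule.mkQ_surjective _ n
    rfl

/-- The functor `Φ_{V,x}`, with its natural symmetric monoidal structure. -/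
def phi (P : GenericPair k R) : LaxBraidedFunctor (KMod k K) (ModuleCat.{u} k) :=
  LaxBraidedFunctor.of (phiFunctor K P)

/-- The isomorphism `Φ_{V,x}(N) → Φ_{V',x'}(N)` induced by an isomorphism `(V,x) → (V',x')`. -/
def fiberEquiv {P Q : GenericPair k R} (f : P.Iso Q) (N : KMod k K) :
    Fiber (polMod N) P.x ≃ₗ[k] Fiber (polMod N) Q.x :=
  LinearEquiv.ofLinearMap
    (fiberTransport (polMod N) f.e.toLinearMap f.map_eq)
    (fiberTransport (polMod N) f.symm.e.toLinearMap f.symm.map_eq)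
    (by
      refine LinearMap.ext fun t => ?_
      obtain ⟨h, rfl⟩ := Submodule.mkQ_surjective _ t
      refine congrArg (maxSub _ Q.x).mkQ (PolEval.ext fun φ => congrArg h.fn ?_)
      exact LinearMap.ext fun v => congrArg φ (f.e.apply_symm_apply v))
    (by
      refine LinearMap.ext fun t => ?_
      obtain ⟨h, rfl⟩ := Submodule.mkQ_surjective _ t
      refine congrArg (maxSub _ P.x).mkQ (PolEval.ext fun φ => congrArg h.fn ?_)
      exact LinearMap.ext fun v => congrArg φ (f.e.symm_apply_apply v))

/-- The isomorphism `Φ_{V,x} ≅ Φ_{V',x'}` induced by an isomorphism `(V,x) → (V',x')`: it is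
induced by the maps `M{V} → M{V'}` for `M = N^pol`. -/
def phiIso {P Q : GenericPair k R} (f : P.Iso Q) : phi K P ≅ phi K Q :=
  LaxBraidedFunctor.isoOfComponents (F := phi K P) (G := phi K Q)
    (fun N => (fiberEquiv K f N).toModuleIso)
    (fun g => by
      refine ModuleCat.hom_ext (LinearMap.ext fun t => ?_)
      obtain ⟨h, rfl⟩ := Submodule.mkQ_surjective _ t
      rfl)
    (by
      refine ModuleCat.hom_ext (LinearMap.ext fun t => ?_)
      rfl)
    (fun M N => by
      refine ModuleCat.MonoidalCategory.tensor_ext fun m n => ?_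
      obtain ⟨m, rfl⟩ := Submodule.mkQ_surjective _ m
      obtain ⟨n, rfl⟩ := Submodule.mkQ_surjective _ n
      rfl)

variable {K}

/-- A fiber functor for `K` is a symmetric monoidal functor `Mod_K → Vec_k` (i.e., a lax symmetric
monoidal functor whose structure maps are isomorphisms) that is `k`-linear, exact, faithful and
cocontinuous. -/
structure IsFiberFunctor (Φ : LaxBraidedFunctor (KMod k K) (ModuleCat.{u} k)) : Prop where
  isIso_ε : IsIso (Functor.LaxMonoidal.ε Φ.toFunctor)
  isIso_μ : ∀ M N : KMod k K, IsIso (Functor.LaxMonoidal.μ Φ.toFunctor M N)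
  additive : Φ.toFunctor.Additive
  linear : Φ.toFunctor.Linear k
  leftExact : Limits.PreservesFiniteLimits Φ.toFunctor
  rightExact : Limits.PreservesFiniteColimits Φ.toFunctor
  faithful : Φ.toFunctor.Faithful
  cocontinuous : Limits.PreservesColimitsOfSize.{u, u} Φ.toFunctor

variable (k R) in
/-- A `GL`-algebra `R` is finitely generated if it is generated, as a `k`-algebra, by the
`GL`-orbits of finitely many elements. -/
def IsFinitelyGLGenerated : Prop :=
  ∃ s : Finset R, Algebra.adjoin k {y : R | ∃ g : GLinf k, ∃ x ∈ s, y = g • x} = ⊤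

end FiberFunctor

end

end SemilinearGL

set_option linter.unusedSectionVars false
set_option linter.unusedVariables false

namespace SemilinearGL

noncomputable section

/-! ### Polynomial curves in vector spaces -/

section PolynomialCurves

variable {k : Type*} [Field k] {M : Type*} [AddCommGroup M] [Module k M]

/-! Call an equivariant multilinear map `𝐕ⁿ → M` a form. In characteristic zero `GL` is dense in the
monoid of endomorphisms of `𝐕` as far as polynomial expressions can tell (`exists_gl_agree`,
`sum_form_endo_mem`). So relations between values of forms can be transported along arbitrary
endomorphisms, differentiated and polarized. Consequently a `GL`-stable subspace of a polynomial
representation is spanned by values of forms (`mem_formSpan_of_mem`), and elements of `M` can be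
pushed to `M{U}` along any `ψ : 𝐕 → U`. Conversely `h ∈ M{U}` is the push of its value `h φ` once `ψ
∘ φ` fixes a finite dimensional subspace supporting `h`. A generic point `x` of `X{U}` yields in
this way ordinary points `pointAt x ψ` of `Spec R`, and a nonzero element of `R` is nonzero at some
of them, hence at almost all points of suitable lines.

Exactness and faithfulness are statements of generic flatness and of Nakayama type. The relations
with coefficients in `R` between the values of a form at basis vectors form a submodule of the free
module on multi-indices. Differentiation shows that it is stable under raising indices
(`raiseStable_comap`), so leading coefficients seen at one place recur at all large indices and are
governed by finitely many patterns. Inverting one nonzero element of `R` brings these leading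
coefficients into echelon form, and induction on the number of large entries gives
`RaiseStable.exists_flat` and `RaiseStable.exists_nakayama`. Pulled back through sections to `Spec
R`, they prove that stable submodules are pure at `x` (`mem_smul_evalSub`), whence `fiberMap_exact`,
and that nonzero forms into torsion free modules survive on the fiber when `U` is infinite
dimensional (`form_eq_zero_of_fiber`). The functor `N ↦ N^pol` is exact up to denominators, which is
enough.

For the tensor structure, contraction with linear forms on `V` identifies the fiber of `K ⊗ 𝐕` with
`V` and makes the structure maps at `K ⊗ 𝐕` invertible. Associativity gives the tensor powers, and
the diagram chase `app_injective_of_tpow` gives all `K`-modules, since these are quotients of sums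
of tensor powers.

Conversely let `F` be a fiber functor and `V = F(K ⊗ 𝐕)`. A form into `N` is a morphism from a
tensor power of `K ⊗ 𝐕`, so `F` turns it into a multilinear map `Vⁿ → F(N)`. These assemble to
`theta : N^pol{V} → F(N)`. For `N = K` this defines a point `x` of `X{V}`. Faithfulness makes `x`
generic, and makes `V` infinite dimensional because antisymmetrizers are nonzero. The induced
monoidal transformation `Φ_{V,x} → F` is invertible on `K ⊗ 𝐕`, hence on tensor powers, hence
everywhere. Finally a monoidal isomorphism is determined by its component on `K ⊗ 𝐕`, a linear
isomorphism `V ≅ V'`, and its compatibility with the unit says that this matches the points. -/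

lemma mem_of_forall_dual (S : Submodule k M) (x : M)
    (h : ∀ l : M →ₗ[k] k, (∀ s ∈ S, l s = 0) → l x = 0) : x ∈ S := by
  by_contra hx
  obtain ⟨l, hl, hS⟩ := Submodule.exists_le_ker_of_notMem hx
  exact hl (h l fun s hs => hS hs)

/-- If a polynomial curve takes values in a subspace infinitely often, then its coefficients lie
in the subspace. -/
lemma coeff_mem_of_infinite (S : Submodule k M) {ι : Type*} (s : Finset ι) (e : ι → ℕ) (c : ι → M)
    {T : Set k} (hT : T.Infinite) (h : ∀ t ∈ T, ∑ i ∈ s, t ^ e i • c i ∈ S) (m : ℕ) :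
    ∑ i ∈ s with e i = m, c i ∈ S := by
  refine mem_of_forall_dual S _ fun l hl => ?_
  -- A functional killing `S` turns the curve into a scalar polynomial with infinitely many roots.
  let p : Polynomial k := ∑ i ∈ s, Polynomial.monomial (e i) (l (c i))
  have hp : p = 0 := by
    refine Polynomial.eq_zero_of_infinite_isRoot p (hT.mono fun t ht => ?_)
    have := hl _ (h t ht)
    simp only [map_sum, map_smul, smul_eq_mul] at this
    simp only [Set.mem_ofPred_eq, Polynomial.IsRoot, p, Polynomial.eval_finsetSum,
      Polynomial.eval_monomial]
    rw [← this]
    exact Finset.sum_congr rfl fun i _ => mul_comm _ _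
  have := congrArg (fun q => Polynomial.coeff q m) hp
  rw [map_sum, Finset.sum_filter]
  simpa [p, Polynomial.finsetSum_coeff, Polynomial.coeff_monomial] using this

/-- The version of `coeff_mem_of_infinite` for several parameters. -/
lemma coeff_mem_of_forall [Infinite k] (S : Submodule k M) {ι σ : Type*} [Fintype σ] [DecidableEq σ]
    (s : Finset ι) (e : ι → σ →₀ ℕ) (c : ι → M) (h : ∀ t : σ → k, ∑ i ∈ s, (∏ a, t a ^ e i a) • c i ∈ S)
    (m : σ →₀ ℕ) :
    ∑ i ∈ s with e i = m, c i ∈ S := by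
  refine mem_of_forall_dual S _ fun l hl => ?_
  let p : MvPolynomial σ k := ∑ i ∈ s, MvPolynomial.monomial (e i) (l (c i))
  have hp : p = 0 := by
    refine MvPolynomial.funext fun t => ?_
    have := hl _ (h t)
    simp only [map_sum, map_smul, smul_eq_mul] at this
    simp only [p, map_sum, map_zero, MvPolynomial.eval_monomial]
    rw [← this]
    refine Finset.sum_congr rfl fun i _ => ?_
    rw [mul_comm, Finsupp.prod_fintype _ _ fun a => pow_zero _]
  have := congrArg (fun q => MvPolynomial.coeff m q) hp
  rw [map_sum, Finset.sum_filter]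
  convert this using 1
  · simp [p, MvPolynomial.coeff_sum, MvPolynomial.coeff_monomial]
  · exact (MvPolynomial.coeff_zero m).symm

variable {A : Type*} [AddCommGroup A] [Module k A]

/-- The expansion of a multilinear map along a line. -/
lemma multilinear_line {n : ℕ} (H : MultilinearMap k (fun _ : Fin n => A) M) (v w : Fin n → A)
    (t : k) : H (fun i => v i + t • w i) =
      ∑ s : Finset (Fin n), t ^ s.card • H (s.piecewise w v) := by
  classical
  have h1 : (fun i => v i + t • w i) = (fun i => t • w i) + v := by
    funext i
    simp [add_comm]
  rw [h1, MultilinearMap.map_add_univ]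
  refine Finset.sum_congr rfl fun s _ => ?_
  have h2 : s.piecewise (fun i => t • w i) v =
      s.piecewise (fun i => t • s.piecewise w v i) (s.piecewise w v) := by
    funext i
    by_cases hi : i ∈ s <;> simp [hi]
  rw [h2, MultilinearMap.map_piecewise_smul (c := fun _ => t)]
  simp

/-- A finite sum of values of multilinear maps, on `A`, along a line: constant coefficient. -/
lemma multilinear_const_mem (S : Submodule k M) {ι : Type*} (q : Finset ι) {n : ι → ℕ}
    (H : ∀ i, MultilinearMap k (fun _ : Fin (n i) => A) M) (v w : ∀ i, Fin (n i) → A)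
    {T : Set k} (hT : T.Infinite)
    (h : ∀ t ∈ T, ∑ i ∈ q, H i (fun a => v i a + t • w i a) ∈ S) :
    ∑ i ∈ q, H i (v i) ∈ S := by
  classical
  have h1 := coeff_mem_of_infinite S (q.sigma fun i => (Finset.univ : Finset (Finset (Fin (n i)))))
    (fun x => x.2.card) (fun x => H x.1 (x.2.piecewise (w x.1) (v x.1))) hT (fun t ht => ?_) 0
  · rw [Finset.sum_filter, Finset.sum_sigma] at h1
    convert h1 using 2 with i hi
    rw [Finset.sum_eq_single ∅]
    · simp
    · intro s _ hs
      simp [hs]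
    · simp
  · have := h t ht
    simp only [multilinear_line] at this
    rwa [Finset.sum_sigma]

/-- The coefficient of `t`, i.e. the derivative along the line, collects the subsets of size one,
where a single argument is replaced. This is how relations get differentiated along endomorphisms of
`𝐕`. -/
lemma multilinear_linear_mem (S : Submodule k M) {ι : Type*} (q : Finset ι) {n : ι → ℕ}
    (H : ∀ i, MultilinearMap k (fun _ : Fin (n i) => A) M) (v w : ∀ i, Fin (n i) → A)
    {T : Set k} (hT : T.Infinite)
    (h : ∀ t ∈ T, ∑ i ∈ q, H i (fun a => v i a + t • w i a) ∈ S) :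
    ∑ i ∈ q, ∑ a, H i (Function.update (v i) a (w i a)) ∈ S := by
  classical
  have h1 := coeff_mem_of_infinite S (q.sigma fun i => (Finset.univ : Finset (Finset (Fin (n i)))))
    (fun x => x.2.card) (fun x => H x.1 (x.2.piecewise (w x.1) (v x.1))) hT (fun t ht => ?_) 1
  · rw [Finset.sum_filter, Finset.sum_sigma] at h1
    convert h1 using 2 with i hi
    rw [← Finset.sum_filter]
    have : (Finset.univ.filter fun s : Finset (Fin (n i)) => s.card = 1) =
        Finset.univ.map ⟨fun a : Fin (n i) => ({a} : Finset (Fin (n i))),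
          Finset.singleton_injective⟩ := by
      ext s
      simp [Finset.card_eq_one, eq_comm]
    rw [this, Finset.sum_map]
    refine Finset.sum_congr rfl fun a _ => ?_
    simp [Finset.piecewise_singleton]
  · have := h t ht
    simp only [multilinear_line] at this
    rwa [Finset.sum_sigma]

/-- The coefficient of `t ^ n` belongs to the full subset and is the value at the direction `w`
itself. A good base point thus gives access to an arbitrary `w`, even a bad one. -/
lemma multilinear_top_mem (S : Submodule k M) {n : ℕ}
    (H : MultilinearMap k (fun _ : Fin n => A) M) (v w : Fin n → A)
    {T : Set k} (hT : T.Infinite) (h : ∀ t ∈ T, H (fun a => v a + t • w a) ∈ S) : H w ∈ S := by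
  classical
  have h1 := coeff_mem_of_infinite S (Finset.univ : Finset (Finset (Fin n)))
    (fun s => s.card) (fun s => H (s.piecewise w v)) hT (fun t ht => ?_) n
  · rw [Finset.sum_filter, Finset.sum_eq_single Finset.univ] at h1
    · simpa using h1
    · intro s _ hs
      rw [if_neg]
      intro hc
      exact hs ((Finset.card_eq_iff_eq_univ s).1 (by rw [hc, Fintype.card_fin]))
    · simp
  · have := h t ht
    rwa [multilinear_line] at this

/-- Polarization: the coefficient of `t₁ ⋯ t_N` in a sum of multilinear maps. -/
lemma multilinear_polarize_mem [Infinite k] (S : Submodule k M) {ι : Type*} (q : Finset ι)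
    {n : ι → ℕ} (H : ∀ i, MultilinearMap k (fun _ : Fin (n i) => A) M) {N : ℕ}
    (w : ∀ i, Fin (n i) → Fin N → A)
    (h : ∀ t : Fin N → k, ∑ i ∈ q, H i (fun a => ∑ s, t s • w i a s) ∈ S) :
    ∑ i ∈ q, ∑ σ : Fin (n i) ≃ Fin N, H i (fun a => w i a (σ a)) ∈ S := by
  classical
  -- A choice `r` of one summand for each argument contributes the monomial with exponent `ex`; it
  -- equals `t₁ ⋯ t_N` exactly when `r` is bijective.
  let ex : (Σ i, Fin (n i) → Fin N) → (Fin N →₀ ℕ) := fun x =>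
    ∑ a, Finsupp.single (x.2 a) 1
  have h1 := coeff_mem_of_forall S
    (q.sigma fun i => (Finset.univ : Finset (Fin (n i) → Fin N))) ex
    (fun x => H x.1 (fun a => w x.1 a (x.2 a))) (fun t => ?_) (∑ s, Finsupp.single s 1)
  · rw [Finset.sum_filter, Finset.sum_sigma] at h1
    convert h1 using 2 with i hi
    refine Eq.trans ?_ (Finset.sum_filter _ _)
    have key : ∀ r : Fin (n i) → Fin N,
        ex ⟨i, r⟩ = ∑ s, Finsupp.single s 1 ↔ Function.Bijective r := by
      intro r
      have e1 : ∀ b, ex ⟨i, r⟩ b = (Finset.univ.filter fun a => r a = b).card := by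
        intro b
        simp [ex, Finsupp.finsetSum_apply, Finsupp.single_apply]
      have e2 : ∀ b, (∑ s : Fin N, Finsupp.single s 1 : Fin N →₀ ℕ) b = 1 := by
        intro b
        simp [Finsupp.finsetSum_apply, Finsupp.single_apply]
      constructor
      · intro hr
        rw [Function.bijective_iff_existsUnique]
        intro b
        have h3 := e1 b
        rw [hr, e2] at h3
        obtain ⟨a, ha⟩ := Finset.card_eq_one.1 h3.symm
        have h4 : ∀ a', r a' = b ↔ a' = a := fun a' => by
          have := Finset.ext_iff.1 ha a'
          simpa using this
        exact ⟨a, (h4 a).2 rfl, fun a' h => (h4 a').1 h⟩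
      · intro hr
        ext b
        rw [e1, e2, Finset.card_eq_one]
        obtain ⟨a, ha, ha'⟩ := (Function.bijective_iff_existsUnique r).1 hr b
        exact ⟨a, by ext a'; simpa using ⟨ha' a', fun h => h ▸ ha⟩⟩
    refine Finset.sum_bij' (fun σ _ => (σ : Fin (n i) → Fin N))
      (fun r hr => Equiv.ofBijective r ((key r).1 (Finset.mem_filter.1 hr).2)) ?_ ?_ ?_ ?_ ?_
    · intro σ _
      exact Finset.mem_filter.2 ⟨Finset.mem_univ _, (key _).2 σ.bijective⟩
    · simp
    · intro σ _
      ext; rfl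
    · intro r _
      rfl
    · intro σ _
      rfl
  · have := h t
    simp only [MultilinearMap.map_sum, MultilinearMap.map_smul_univ] at this
    rw [Finset.sum_sigma]
    convert this using 4 with i hi r hr
    simp only [ex, Finsupp.finsetSum_apply]
    rw [← Finset.prod_fiberwise (s := Finset.univ) (g := r)]
    refine Finset.prod_congr rfl fun s _ => ?_
    rw [Finset.prod_congr rfl (g := fun _ => t s) (by simp +contextual), Finset.prod_const]
    congr 1
    simp [Finsupp.single_apply]

end PolynomialCurves

/-! ### Density of `GL` in the monoid of endomorphisms -/

section Density

variable {k : Type u} [Field k]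

/-- The element of `GL` given by an automorphism of `𝐕` that is block diagonal on the basis. -/
def GLinf.ofBasis (g : StdRep k ≃ₗ[k] StdRep k) (n : ℕ)
    (h1 : ∀ i, n ≤ i → g (Finsupp.single i 1) = Finsupp.single i 1)
    (h2 : ∀ i, n ≤ i → ∀ j, g (Finsupp.single j 1) i = (Finsupp.single j 1 : StdRep k) i) :
    GLinf k :=
  Subtype.mk (p := fun g => g ∈ glSubgroup k) g ⟨n, fun i hi => ⟨h1 i hi, fun v => by
    have : Finsupp.lapply i ∘ₗ g.toLinearMap = Finsupp.lapply (R := k) i := by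
      refine Finsupp.lhom_ext' fun j => LinearMap.ext_ring ?_
      simpa using h2 i hi j
    exact congrArg (fun f => f v) this⟩⟩

@[simp] lemma GLinf.mul_toEquiv (g h : GLinf k) (v : StdRep k) :
    (g * h).toEquiv v = g.toEquiv (h.toEquiv v) := rfl

@[simp] lemma GLinf.one_toEquiv (v : StdRep k) : (1 : GLinf k).toEquiv v = v := rfl

/-- The linear automorphism `1 + N` for `N ^ 2 = 0`. -/
def shear (N : StdRep k →ₗ[k] StdRep k) (hN : ∀ v, N (N v) = 0) : StdRep k ≃ₗ[k] StdRep k :=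
  LinearEquiv.ofLinearMap (LinearMap.id + N) (LinearMap.id - N)
    (LinearMap.ext fun v => by simp [hN]) (LinearMap.ext fun v => by simp [hN])

/-- Exchanges `i` and `L + i` for `i < l`. -/
def blockSwap (l L i : ℕ) : ℕ := if i < l then L + i else if L ≤ i ∧ i < L + l then i - L else i

lemma blockSwap_involutive {l L : ℕ} (h : l ≤ L) : Function.Involutive (blockSwap l L) := by
  intro i
  simp only [blockSwap]
  split_ifs <;> omega

/-- However degenerate `θ` is, the perturbation `e_i ↦ θ e_i + t e_{L+i}` of its first `l` columns
is injective for `t ≠ 0`, because `η` moves these vectors to a block that the `θ e_i` do not reach.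
It extends to a block permutation followed by a shear. -/
lemma exists_gl_agree (θ : StdRep k →ₗ[k] StdRep k) (l : ℕ) :
    ∃ η : StdRep k →ₗ[k] StdRep k, ∀ t : k, t ≠ 0 → ∃ g : GLinf k, ∀ w : StdRep k,
      (∀ j, l ≤ j → w j = 0) → g.toEquiv w = θ w + t • η w := by
  -- `L` bounds the coordinates of all `θ e_i` with `i < l`, and `l ≤ L` keeps the blocks `[0, l)`
  -- and `[L, L + l)` disjoint.
  obtain ⟨L, hlL, hL⟩ : ∃ L, l ≤ L ∧ ∀ i < l, ∀ j, L ≤ j → θ (Finsupp.single i 1) j = 0 := by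
    refine ⟨l + ∑ i ∈ Finset.range l, ((θ (Finsupp.single i 1)).support.sup id + 1),
      Nat.le_add_right _ _, fun i hi j hj => ?_⟩
    by_contra hne
    have h1 : j ≤ (θ (Finsupp.single i 1)).support.sup id :=
      Finset.le_sup (f := id) (Finsupp.mem_support_iff.2 hne)
    have h2 := Finset.single_le_sum (f := fun i => (θ (Finsupp.single i 1)).support.sup id + 1)
      (fun _ _ => Nat.zero_le _) (Finset.mem_range.2 hi)
    omega
  let b : Module.Basis ℕ k (StdRep k) := Finsupp.basisSingleOne
  let η : StdRep k →ₗ[k] StdRep k := Finsupp.lmapDomain k k (fun i => L + i)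
  refine ⟨η, fun t ht => ?_⟩
  -- Only the target block is scaled: `p e_i = t e_{L+i}` and `p e_{L+i} = e_i` for `i < l`.
  let c : ℕ → kˣ := fun i => if L ≤ i ∧ i < L + l then Units.mk0 t ht else 1
  let p : StdRep k ≃ₗ[k] StdRep k := b.equiv (b.unitsSMul c) (blockSwap_involutive hlL).toPerm
  have hp : ∀ i, p (Finsupp.single i 1) =
      (c (blockSwap l L i) : k) • Finsupp.single (blockSwap l L i) 1 := by
    intro i
    have : p (b i) = b.unitsSMul c (blockSwap l L i) := by
      simp only [p, Module.Basis.equiv_apply]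
      rfl
    rw [Module.Basis.unitsSMul_apply] at this
    simpa [b, Units.smul_def] using this
  -- The factor `t⁻¹` cancels the one from `p`. The image of `N` lies in the coordinates below `L`,
  -- where `N` vanishes, so `N² = 0`.
  let N : StdRep k →ₗ[k] StdRep k := Finsupp.linearCombination k fun i =>
    if L ≤ i ∧ i < L + l then t⁻¹ • θ (Finsupp.single (i - L) 1) else 0
  have hN1 : ∀ i, N (Finsupp.single i 1) =
      if L ≤ i ∧ i < L + l then t⁻¹ • θ (Finsupp.single (i - L) 1) else 0 := by
    intro i
    simp [N]
  have hN2 : ∀ v j, L ≤ j → N v j = 0 := by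
    intro v j hj
    have : Finsupp.lapply j ∘ₗ N = 0 := by
      refine Finsupp.lhom_ext' fun i => LinearMap.ext_ring ?_
      simp only [LinearMap.comp_apply, Finsupp.lsingle_apply, hN1]
      split_ifs with h
      · simp [hL (i - L) (by omega) j hj]
      · simp
    exact congrArg (fun f => f v) this
  have hN3 : ∀ v : StdRep k, (∀ j, L ≤ j → v j = 0) → N v = 0 := by
    intro v hv
    rw [show N v = v.sum fun i a => a • _ from Finsupp.linearCombination_apply k v]
    refine Finset.sum_eq_zero fun i hi => ?_
    have : ¬ L ≤ i := fun h => Finsupp.mem_support_iff.1 hi (hv i h)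
    simp [this]
  let h := shear N fun v => hN3 _ (hN2 v)
  have hh : ∀ v, h v = v + N v := fun v => rfl
  let g1 : GLinf k := GLinf.ofBasis h (L + l)
    (fun i hi => by rw [hh, hN1, if_neg (by omega), add_zero])
    (fun i hi j => by rw [hh, Finsupp.add_apply, hN2 _ _ (by omega), add_zero])
  have hb1 : ∀ i, L + l ≤ i → blockSwap l L i = i := fun i hi => by
    simp only [blockSwap]; split_ifs <;> omega
  have hb2 : ∀ i, ∀ j, i ≠ j → L + l ≤ i → blockSwap l L j ≠ i := fun i j hij hi => by
    simp only [blockSwap]; split_ifs <;> omega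
  let g2 : GLinf k := GLinf.ofBasis p (L + l)
    (fun i hi => by
      rw [hp, hb1 i hi]
      simp only [c]
      rw [if_neg (by omega), Units.val_one, one_smul])
    (fun i hi j => by
      rcases eq_or_ne i j with rfl | hij
      · rw [hp, hb1 i hi]
        simp only [c]
        rw [if_neg (by omega), Units.val_one, one_smul]
      · rw [hp, Finsupp.smul_apply, Finsupp.single_eq_of_ne (hb2 i j hij hi).symm,
          Finsupp.single_eq_of_ne hij, smul_zero])
  refine ⟨g1 * g2, fun w hw => ?_⟩
  have key : ∀ i < l, h (p (Finsupp.single i 1)) =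
      θ (Finsupp.single i 1) + t • η (Finsupp.single i 1) := by
    intro i hi
    have e1 : blockSwap l L i = L + i := if_pos hi
    have e2 : (c (L + i) : k) = t := by
      simp only [c]
      rw [if_pos (by omega), Units.val_mk0]
    rw [hp, e1, e2, map_smul, hh, hN1, if_pos (by omega), Nat.add_sub_cancel_left, smul_add,
      smul_smul, mul_inv_cancel₀ ht, one_smul, add_comm]
    congr 2
    simp [η, Finsupp.mapDomain_single]
  change h (p w) = _
  rw [← Finsupp.sum_single w, Finsupp.sum]
  simp only [map_sum, Finset.smul_sum, ← Finset.sum_add_distrib]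
  refine Finset.sum_congr rfl fun i hi => ?_
  have hil : i < l := by
    by_contra hc
    exact Finsupp.mem_support_iff.1 hi (hw i (by omega))
  rw [show Finsupp.single i (w i) = w i • Finsupp.single i (1 : k) by simp]
  simp only [map_smul]
  rw [key i hil, smul_add, smul_comm t]

/-- Finitely many vectors of `𝐕` lie in the span of finitely many basis vectors. -/
lemma exists_bound {ι : Type*} (q : Finset ι) {n : ι → ℕ} (v : ∀ i, Fin (n i) → StdRep k) :
    ∃ l : ℕ, ∀ i ∈ q, ∀ a, ∀ j, l ≤ j → v i a j = 0 := by
  refine ⟨(q.sup fun i => Finset.univ.sup fun a => (v i a).support.sup id) + 1,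
    fun i hi a j hj => ?_⟩
  by_contra hne
  have h1 : j ≤ (v i a).support.sup id :=
    Finset.le_sup (f := id) (Finsupp.mem_support_iff.2 hne)
  have h2 : (v i a).support.sup id ≤ Finset.univ.sup fun a => (v i a).support.sup id :=
    Finset.le_sup (f := fun a => (v i a).support.sup id) (Finset.mem_univ a)
  have h3 := Finset.le_sup (f := fun i => Finset.univ.sup fun a => (v i a).support.sup id) hi
  omega

variable {M : Type u} [AddCommGroup M] [Module k M] [DistribMulAction (GLinf k) M]

lemma infinite_ne_zero [CharZero k] : {t : k | t ≠ 0}.Infinite :=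
  (Set.finite_singleton (0 : k)).infinite_compl

/-- A relation between values of equivariant multilinear maps is preserved by endomorphisms
of `𝐕`. -/
lemma sum_form_endo_mem [CharZero k] (Y : Submodule k M) (hY : ∀ (g : GLinf k), ∀ y ∈ Y, g • y ∈ Y)
    {ι : Type*} (q : Finset ι) {n : ι → ℕ}
    (f : ∀ i, MultilinearMap k (fun _ : Fin (n i) => StdRep k) M)
    (hf : ∀ i, GLEquivariant (f i)) (v : ∀ i, Fin (n i) → StdRep k)
    (h : ∑ i ∈ q, f i (v i) ∈ Y) (θ : StdRep k →ₗ[k] StdRep k) :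
    ∑ i ∈ q, f i (fun a => θ (v i a)) ∈ Y := by
  obtain ⟨l, hl⟩ := exists_bound q v
  obtain ⟨η, hη⟩ := exists_gl_agree θ l
  -- For `t ≠ 0` the map `θ + t η` acts on the given vectors as a group element, so the sum lies in
  -- `Y`; the value at `θ` is the constant coefficient in `t`.
  refine multilinear_const_mem Y q f _ (fun i a => η (v i a)) infinite_ne_zero fun t ht => ?_
  obtain ⟨g, hg⟩ := hη t ht
  have := hY g _ h
  rw [Finset.smul_sum] at this
  convert this using 2 with i hi
  rw [← hf i]
  congr 1
  funext a
  exact (hg _ (hl i hi a)).symm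

end Density

/-! ### Spans of values of equivariant multilinear maps -/

section FormSpan

variable {k : Type u} [Field k]
variable {M N : Type u} [AddCommGroup M] [Module k M] [DistribMulAction (GLinf k) M]
  [AddCommGroup N] [Module k N] [DistribMulAction (GLinf k) N]

/-- The span of the values of those equivariant multilinear maps that take values in `Y`. -/
def formSpan (Y : Submodule k M) : Submodule k M :=
  Submodule.span k {x | ∃ (n : ℕ) (f : MultilinearMap k (fun _ : Fin n => StdRep k) M)
    (v : Fin n → StdRep k), GLEquivariant f ∧ (∀ w, f w ∈ Y) ∧ x = f v}

lemma form_mem_formSpan {Y : Submodule k M} {n : ℕ}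
    {f : MultilinearMap k (fun _ : Fin n => StdRep k) M} (hf : GLEquivariant f)
    (hY : ∀ w, f w ∈ Y) (v : Fin n → StdRep k) : f v ∈ formSpan Y :=
  Submodule.subset_span ⟨n, f, v, hf, hY, rfl⟩

lemma GLEquivariant.smul [SMulCommClass (GLinf k) k M] {n : ℕ}
    {f : MultilinearMap k (fun _ : Fin n => StdRep k) M} (hf : GLEquivariant f) (c : k) :
    GLEquivariant (c • f) := fun g v => by
  rw [_root_.smul_apply, hf g v, _root_.smul_apply, smul_comm g c]

lemma GLEquivariant.sum {n : ℕ} {ι : Type*} (s : Finset ι)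
    {f : ι → MultilinearMap k (fun _ : Fin n => StdRep k) M} (hf : ∀ i ∈ s, GLEquivariant (f i)) :
    GLEquivariant (∑ i ∈ s, f i) := fun g v => by
  simp only [_root_.sum_apply, Finset.smul_sum]
  exact Finset.sum_congr rfl fun i hi => hf i hi g v

lemma GLEquivariant.domDomCongr {n m : ℕ}
    {f : MultilinearMap k (fun _ : Fin n => StdRep k) M} (hf : GLEquivariant f)
    (σ : Fin n ≃ Fin m) : GLEquivariant (f.domDomCongr σ) := fun g v => by
  simp only [MultilinearMap.domDomCongr_apply]
  exact hf g fun i => v (σ i)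

lemma GLEquivariant.comp {n : ℕ} {f : MultilinearMap k (fun _ : Fin n => StdRep k) M}
    (hf : GLEquivariant f) (L : M →ₗ[k] N) (hL : ∀ (g : GLinf k) (m : M), L (g • m) = g • L m) :
    GLEquivariant (L.compMultilinearMap f) := fun g v => by
  rw [LinearMap.compMultilinearMap_apply, hf g v, hL, LinearMap.compMultilinearMap_apply]

lemma exists_sum_of_mem_formSpan [SMulCommClass (GLinf k) k M] {Y : Submodule k M} {x : M}
    (hx : x ∈ formSpan Y) :
    ∃ (m : ℕ) (n : Fin m → ℕ) (f : ∀ i, MultilinearMap k (fun _ : Fin (n i) => StdRep k) M)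
      (v : ∀ i, Fin (n i) → StdRep k), (∀ i, GLEquivariant (f i)) ∧ (∀ i w, f i w ∈ Y) ∧
        x = ∑ i, f i (v i) := by
  obtain ⟨m, c, g, rfl⟩ := Submodule.mem_span_set'.1 hx
  choose n f v hf hY hv using fun i => (g i).2
  refine ⟨m, n, fun i => c i • f i, v, fun i => (hf i).smul _, fun i w => ?_, ?_⟩
  · exact Y.smul_mem _ (hY i w)
  · exact Finset.sum_congr rfl fun i _ => by rw [_root_.smul_apply, ← hv]

/-- The polarization of the sum `∑ f i (v i)`, along basis vectors `j`. -/
def polarForm {m : ℕ} {n : Fin m → ℕ}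
    (f : ∀ i, MultilinearMap k (fun _ : Fin (n i) => StdRep k) M)
    (v : ∀ i, Fin (n i) → StdRep k) (N : ℕ) (j : Fin N → ℕ) :
    MultilinearMap k (fun _ : Fin N => StdRep k) M :=
  ∑ i, ∑ σ : Fin (n i) ≃ Fin N, (∏ a, v i a (j (σ a))) • (f i).domDomCongr σ

section Polar

variable {m : ℕ} {n : Fin m → ℕ} (f : ∀ i, MultilinearMap k (fun _ : Fin (n i) => StdRep k) M)
  (v : ∀ i, Fin (n i) → StdRep k)

lemma polarForm_apply (N : ℕ) (j : Fin N → ℕ) (w : Fin N → StdRep k) :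
    polarForm f v N j w =
      ∑ i, ∑ σ : Fin (n i) ≃ Fin N, (∏ a, v i a (j (σ a))) • f i (fun a => w (σ a)) := by
  simp only [polarForm, _root_.sum_apply, _root_.smul_apply, MultilinearMap.domDomCongr_apply]

lemma polarForm_equivariant [SMulCommClass (GLinf k) k M] (hf : ∀ i, GLEquivariant (f i)) (N : ℕ)
    (j : Fin N → ℕ) : GLEquivariant (polarForm f v N j) :=
  GLEquivariant.sum _ fun i _ => GLEquivariant.sum _ fun σ _ => ((hf i).domDomCongr σ).smul _

/-- The value is the coefficient of `t₁ ⋯ t_N` in `∑ f i (θ_t v i)`, where the endomorphism `θ_t`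
sends `v` to `∑ t_s v(j s) w_s`; all these sums lie in `Y`. -/
lemma polarForm_mem [CharZero k] {Y : Submodule k M}
    (hθ : ∀ θ : StdRep k →ₗ[k] StdRep k, ∑ i, f i (fun a => θ (v i a)) ∈ Y) (N : ℕ)
    (j : Fin N → ℕ) (w : Fin N → StdRep k) : polarForm f v N j w ∈ Y := by
  rw [polarForm_apply]
  have := multilinear_polarize_mem (N := N) Y Finset.univ f (fun i a s => v i a (j s) • w s)
    (fun t => ?_)
  · simpa only [MultilinearMap.map_smul_univ] using this
  · convert hθ (∑ s, t s • (LinearMap.toSpanSingleton k _ (w s)).comp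
      (Finsupp.lapply (j s))) using 4 with i hi
    simp

lemma sum_single_of_bound {l : ℕ} {w : StdRep k} (hl : ∀ j, l ≤ j → w j = 0) :
    w = ∑ s : Fin l, w s • Finsupp.single (s : ℕ) (1 : k) := by
  ext j
  simp only [Finsupp.finsetSum_apply, Finsupp.smul_apply, Finsupp.single_apply, smul_eq_mul,
    mul_ite, mul_one, mul_zero]
  by_cases hj : j < l
  · rw [Finset.sum_eq_single ⟨j, hj⟩]
    · simp
    · intro b _ hb
      rw [if_neg]
      exact fun h => hb (Fin.ext h)
    · simp
  · rw [hl j (by omega), Finset.sum_eq_zero]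
    intro b _
    rw [if_neg]
    have := b.2
    omega

lemma multilinear_sum_basis {l p N : ℕ} (H : MultilinearMap k (fun _ : Fin p => StdRep k) M)
    (w : Fin p → StdRep k) (hl : ∀ a, ∀ j, l ≤ j → w a j = 0) (σ : Fin p ≃ Fin N) :
    ∑ j : Fin N → Fin l,
      (∏ a, w a (j (σ a))) • H (fun a => Finsupp.single (j (σ a) : ℕ) 1) = H w := by
  conv_rhs => rw [show w = fun a => ∑ s : Fin l, w a s • Finsupp.single (s : ℕ) (1 : k)
    from funext fun a => sum_single_of_bound (hl a), MultilinearMap.map_sum]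
  refine Fintype.sum_equiv (σ.symm.arrowCongr (Equiv.refl _)) _ _ fun j => ?_
  rw [MultilinearMap.map_smul_univ]
  rfl

/-- Setting `w = e_j` and summing over `j` reassembles each `v i` from its coordinates, once for
every bijection `Fin (n i) ≃ Fin N`. There are `N!` of these if `n i = N` and none otherwise. -/
lemma sum_polarForm {l : ℕ} (hl : ∀ i a, ∀ j, l ≤ j → v i a j = 0) (N : ℕ) :
    ∑ j : Fin N → Fin l, polarForm f v N (fun a => j a) (fun a => Finsupp.single (j a : ℕ) 1) =
      (N.factorial : k) • ∑ i with n i = N, f i (v i) := by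
  classical
  simp only [polarForm_apply]
  rw [Finset.sum_comm, Finset.smul_sum, Finset.sum_filter]
  refine Finset.sum_congr rfl fun i _ => ?_
  rw [Finset.sum_comm]
  rw [Finset.sum_congr rfl fun σ _ => multilinear_sum_basis (f i) (v i) (hl i) σ]
  rw [Finset.sum_const]
  split_ifs with h
  · rw [Finset.card_univ, Fintype.card_equiv (finCongr h), Fintype.card_fin, Nat.cast_smul_eq_nsmul,
      ← h]
  · rw [Finset.card_eq_zero.2, zero_smul]
    rw [Finset.univ_eq_empty_iff]
    exact ⟨fun σ => h (by simpa using Fintype.card_congr σ)⟩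

end Polar

/-- A `GL`-stable subspace of a polynomial representation is spanned by the values of equivariant
multilinear maps into it. -/
theorem mem_formSpan_of_mem [CharZero k] [SMulCommClass (GLinf k) k M] {Y : Submodule k M}
    (hY : ∀ (g : GLinf k), ∀ y ∈ Y, g • y ∈ Y) {x : M} (hx : x ∈ formSpan (⊤ : Submodule k M))
    (hxY : x ∈ Y) : x ∈ formSpan Y := by
  classical
  obtain ⟨m, n, f, v, hf, -, rfl⟩ := exists_sum_of_mem_formSpan hx
  have hθ := sum_form_endo_mem Y hY Finset.univ f hf v hxY
  obtain ⟨l, hl⟩ := exists_bound Finset.univ v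
  -- The degree `N` part is recovered from the polarizations by dividing by `N!`. The polarized
  -- forms take values in `Y` even when the `f i` do not.
  have : ∑ i, f i (v i) = ∑ N ∈ Finset.univ.image n, (N.factorial : k)⁻¹ •
      ∑ j : Fin N → Fin l,
        polarForm f v N (fun a => j a) (fun a => Finsupp.single (j a : ℕ) 1) := by
    rw [← Finset.sum_fiberwise_of_maps_to (t := Finset.univ.image n) (g := n)
      (fun i hi => Finset.mem_image_of_mem _ hi)]
    refine Finset.sum_congr rfl fun N _ => ?_
    rw [sum_polarForm f v (fun i a => hl i (Finset.mem_univ i) a), smul_smul,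
      inv_mul_cancel₀ (Nat.cast_ne_zero.2 N.factorial_ne_zero), one_smul]
  rw [this]
  exact Submodule.sum_mem _ fun N _ => Submodule.smul_mem _ _ <| Submodule.sum_mem _ fun j _ =>
    form_mem_formSpan (polarForm_equivariant f v hf N _) (polarForm_mem f v hθ N _) _

/-- The representation of `GL` on a direct sum of tensor powers. -/
@[reducible] def tensorRep {ι : Type u} (n : ι → ℕ) :
    DistribMulAction (GLinf k) (TensorSum k n) where
  smul g s := tensorAct n g s
  one_smul s := by
    classical
    have : tensorAct n (1 : GLinf k) = LinearMap.id := by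
      refine DirectSum.linearMap_ext _ fun i => PiTensorProduct.ext (MultilinearMap.ext fun a => ?_)
      change tensorAct n 1 (DirectSum.lof k ι _ i _) = DirectSum.lof k ι _ i _
      rw [tensorAct_lof, PiTensorProduct.map_tprod]
      rfl
    exact congrArg (fun f => f s) this
  mul_smul g h s := by
    classical
    have : tensorAct n (g * h) = tensorAct n g ∘ₗ tensorAct n h := by
      refine DirectSum.linearMap_ext _ fun i => PiTensorProduct.ext (MultilinearMap.ext fun a => ?_)
      change tensorAct n (g * h) (DirectSum.lof k ι _ i _) =
        tensorAct n g (tensorAct n h (DirectSum.lof k ι _ i _))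
      rw [tensorAct_lof, tensorAct_lof, tensorAct_lof, PiTensorProduct.map_tprod,
        PiTensorProduct.map_tprod, PiTensorProduct.map_tprod]
      rfl
    exact congrArg (fun f => f s) this
  smul_zero g := map_zero (tensorAct n g)
  smul_add g := map_add (tensorAct n g)

/-- A sum of tensor powers is spanned by the universal forms `v ↦ v₁ ⊗ ⋯ ⊗ vₙ`;
`mem_formSpan_of_mem` passes this property to the stable subspace `S`, and `q` passes it to the
image. -/
lemma IsPolynomialSub.le_formSpan [CharZero k] [SMulCommClass (GLinf k) k M] {P : Submodule k M}
    (hP : IsPolynomialSub P) : P ≤ formSpan P := by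
  classical
  obtain ⟨ι, n, S, hS, q, hq, rfl⟩ := hP
  let _ : AddCommGroup (TensorSum k n) := Module.addCommMonoidToAddCommGroup k
  let _ : DistribMulAction (GLinf k) (TensorSum k n) := tensorRep (k := k) n
  have : SMulCommClass (GLinf k) k (TensorSum k n) :=
    ⟨fun g c s => map_smul (tensorAct n g) c s⟩
  have htop : formSpan (⊤ : Submodule k (TensorSum k n)) = ⊤ := by
    refine eq_top_iff.2 ?_
    rintro s -
    induction s using DirectSum.induction_on with
    | zero => exact Submodule.zero_mem _
    | add x y hx hy => exact Submodule.add_mem _ hx hy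
    | of i t =>
      induction t using PiTensorProduct.induction_on with
      | smul_tprod r w =>
        have h1 := form_mem_formSpan (k := k) (Y := (⊤ : Submodule k (TensorSum k n)))
          (f := (DirectSum.lof k ι (fun i => ⨂[k]^(n i) (StdRep k)) i).compMultilinearMap
            (PiTensorProduct.tprod k)) (fun g v => by
              simp only [LinearMap.compMultilinearMap_apply]
              change _ = tensorAct n g _
              rw [tensorAct_lof, PiTensorProduct.map_tprod]
              rfl) (fun _ => trivial) w
        have h2 := Submodule.smul_mem _ r h1
        rw [LinearMap.compMultilinearMap_apply, ← map_smul] at h2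
        exact h2
      | add x y hx hy =>
        rw [map_add]
        exact Submodule.add_mem _ hx hy
  rintro _ ⟨⟨s, hs⟩, rfl⟩
  have h1 : s ∈ formSpan S := mem_formSpan_of_mem hS (by rw [htop]; trivial) hs
  obtain ⟨m, n', f, v, hf, hfS, hsum⟩ := exists_sum_of_mem_formSpan h1
  have h2 : q ⟨s, hs⟩ = ∑ i, (q.compMultilinearMap ((f i).codRestrict S (hfS i))) (v i) := by
    simp only [LinearMap.compMultilinearMap_apply]
    rw [← map_sum]
    refine congrArg q (Subtype.ext ?_)
    rw [Submodule.coe_sum]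
    exact hsum
  rw [h2]
  refine Submodule.sum_mem _ fun i _ => form_mem_formSpan (fun g w => ?_)
    (fun w => LinearMap.mem_range_self q _) _
  simp only [LinearMap.compMultilinearMap_apply]
  rw [← hq]
  refine congrArg q ?_
  exact Subtype.ext (hf i g w)

lemma formSpan_mono {Y Y' : Submodule k M} (h : Y ≤ Y') : formSpan Y ≤ formSpan Y' := by
  refine Submodule.span_mono ?_
  rintro _ ⟨n, f, v, hf, hY, rfl⟩
  exact ⟨n, f, v, hf, fun w => h (hY w), rfl⟩

/-- The values of an equivariant multilinear map are polynomial. -/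
lemma form_mem_pol [SMulCommClass (GLinf k) k M] {n : ℕ} {f : MultilinearMap k (fun _ : Fin n => StdRep k) M}
    (hf : GLEquivariant f) (v : Fin n → StdRep k) : f v ∈ pol k M := by
  classical
  let L : TensorSum k (fun _ : PUnit.{u+1} => n) →ₗ[k] M :=
    DirectSum.toModule k _ _ fun _ => PiTensorProduct.lift f
  have hL : ∀ w, L (DirectSum.lof k PUnit.{u+1} (fun _ => ⨂[k]^n (StdRep k)) PUnit.unit
      (PiTensorProduct.tprod k w)) = f w := by
    intro w
    simp only [L]
    erw [DirectSum.toModule_lof]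
    simp
  have hact : ∀ (g : GLinf k) s, L (tensorAct _ g s) = g • L s := by
    intro g s
    induction s using DirectSum.induction_on with
    | zero => simp
    | add x y hx hy => rw [map_add, map_add, map_add, smul_add, hx, hy]
    | of i t =>
      induction t using PiTensorProduct.induction_on with
      | smul_tprod r w =>
        have h : ∀ w, L (DirectSum.of (fun _ : PUnit.{u+1} => ⨂[k]^n (StdRep k)) i
            (PiTensorProduct.tprod k w)) = f w := fun w => hL w
        have h' : ∀ w, tensorAct (fun _ : PUnit.{u+1} => n) g
            (DirectSum.of (fun _ : PUnit.{u+1} => ⨂[k]^n (StdRep k)) i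
              (PiTensorProduct.tprod k w)) = DirectSum.of (fun _ : PUnit.{u+1} =>
                ⨂[k]^n (StdRep k)) i (PiTensorProduct.tprod k fun a => g.toEquiv (w a)) :=
          fun w => (tensorAct_lof _ g i _).trans (by rw [PiTensorProduct.map_tprod]; rfl)
        rw [← DirectSum.lof_eq_of k, map_smul, map_smul, map_smul, map_smul, smul_comm g r,
          DirectSum.lof_eq_of, h, h', h, hf g w]
      | add x y hx hy =>
        rw [map_add, map_add, map_add, map_add, smul_add, hx, hy]
  have : IsPolynomialSub (LinearMap.range L) :=
    ⟨PUnit, fun _ => n, ⊤, fun _ _ _ => trivial, L ∘ₗ Submodule.subtype _, fun g s => hact g s,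
      by rw [LinearMap.range_comp, Submodule.range_subtype, Submodule.map_top]⟩
  exact (le_sSup this : _ ≤ pol k M) ⟨_, hL v⟩

end FormSpan

/-! ### Transport along linear maps out of `𝐕` -/

section Push

variable {k : Type u} [Field k]

section Forms

variable {M N : Type u} [AddCommGroup M] [Module k M] [DistribMulAction (GLinf k) M]
  [AddCommGroup N] [Module k N] [DistribMulAction (GLinf k) N]
variable {U U' : Type u} [AddCommGroup U] [Module k U] [AddCommGroup U'] [Module k U']

/-- The multilinear map `Uⁿ → M{U}` given by an equivariant multilinear map `𝐕ⁿ → M`. -/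
def evalForm (U : Type u) [AddCommGroup U] [Module k U] {n : ℕ}
    {f : MultilinearMap k (fun _ : Fin n => StdRep k) M} (hf : GLEquivariant f) :
    MultilinearMap k (fun _ : Fin n => U) (PolEval k M U) where
  toFun u := PolEval.mk (genFun f u) (genFun_mem hf u)
  map_update_add' u i a b := by
    refine PolEval.ext fun φ => ?_
    have h : ∀ c, (fun j => φ (Function.update u i c j)) =
        Function.update (fun j => φ (u j)) i (φ c) := fun c =>
      funext fun j => Function.apply_update (fun _ => φ) u i c j
    simp only [PolEval.fn_mk, genFun, PolEval.fn_add, h, map_add, MultilinearMap.map_update_add]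
  map_update_smul' u i c a := by
    refine PolEval.ext fun φ => ?_
    have h : ∀ c, (fun j => φ (Function.update u i c j)) =
        Function.update (fun j => φ (u j)) i (φ c) := fun c =>
      funext fun j => Function.apply_update (fun _ => φ) u i c j
    simp only [PolEval.fn_mk, genFun, PolEval.fn_smul, h, map_smul,
      MultilinearMap.map_update_smul]

@[simp] lemma evalForm_fn {n : ℕ} {f : MultilinearMap k (fun _ : Fin n => StdRep k) M}
    (hf : GLEquivariant f) (u : Fin n → U) (φ : U →ₗ[k] StdRep k) :
    (evalForm U hf u).fn φ = f fun i => φ (u i) := rfl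

lemma PolEval.fn_sum {ι : Type*} (s : Finset ι) (h : ι → PolEval k M U) (φ : U →ₗ[k] StdRep k) :
    (∑ i ∈ s, h i).fn φ = ∑ i ∈ s, (h i).fn φ := by
  classical
  induction s using Finset.induction_on with
  | empty => simp
  | insert a s ha ih => rw [Finset.sum_insert ha, Finset.sum_insert ha, PolEval.fn_add, ih]

lemma exists_sum_evalForm [SMulCommClass (GLinf k) k M] (h : PolEval k M U) :
    ∃ (m : ℕ) (n : Fin m → ℕ) (f : ∀ i, MultilinearMap k (fun _ : Fin (n i) => StdRep k) M)
      (hf : ∀ i, GLEquivariant (f i)) (u : ∀ i, Fin (n i) → U),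
        h = ∑ i, evalForm U (hf i) (u i) := by
  obtain ⟨m, c, g, hg⟩ := Submodule.mem_span_set'.1 h.fn_mem
  choose n f u hf hu using fun i => (g i).2
  refine ⟨m, n, fun i => c i • f i, fun i => (hf i).smul (c i), u, PolEval.ext fun φ => ?_⟩
  rw [← hg, PolEval.fn_sum, Finset.sum_apply]
  refine Finset.sum_congr rfl fun i _ => ?_
  rw [evalForm_fn, Pi.smul_apply, hu]
  rfl

lemma PolEval.induction [SMulCommClass (GLinf k) k M] {p : PolEval k M U → Prop}
    (hform : ∀ (n : ℕ) (f : MultilinearMap k (fun _ : Fin n => StdRep k) M) (hf : GLEquivariant f)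
      (u : Fin n → U), p (evalForm U hf u))
    (hzero : p 0) (hadd : ∀ a b, p a → p b → p (a + b)) (h : PolEval k M U) : p h := by
  obtain ⟨m, n, f, hf, u, rfl⟩ := exists_sum_evalForm h
  exact Finset.sum_induction _ p hadd hzero fun i _ => hform _ _ _ _

@[simp] lemma evalTransport_evalForm (e : U →ₗ[k] U') {n : ℕ}
    {f : MultilinearMap k (fun _ : Fin n => StdRep k) M}
    (hf : GLEquivariant f) (u : Fin n → U) :
    evalTransport M e (evalForm U hf u) = evalForm U' hf fun i => e (u i) := rfl

@[simp] lemma evalMap_evalForm (L : M →ₗ[k] N)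
    (hL : ∀ (g : GLinf k) (m : M), L (g • m) = g • L m) {n : ℕ}
    {f : MultilinearMap k (fun _ : Fin n => StdRep k) M} (hf : GLEquivariant f) (u : Fin n → U) :
    evalMap U L hL (evalForm U hf u) = evalForm U (hf.comp L hL) u := rfl

/-- The value `h(id)` of an element `h` of `M{𝐕}`. -/
def evalId (M : Type u) [AddCommGroup M] [Module k M] [DistribMulAction (GLinf k) M] :
    PolEval k M (StdRep k) →ₗ[k] M where
  toFun h := h.fn LinearMap.id
  map_add' _ _ := rfl
  map_smul' _ _ := rfl

variable [CharZero k]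

/-- A sum of forms that vanishes at the identity vanishes after every endomorphism, by
`sum_form_endo_mem` with `Y = ⊥`. -/
lemma evalId_injective [SMulCommClass (GLinf k) k M] :
    Function.Injective (evalId (k := k) M) := by
  rw [injective_iff_map_eq_zero]
  intro h h0
  obtain ⟨m, n, f, hf, u, rfl⟩ := exists_sum_evalForm h
  refine PolEval.ext fun φ => ?_
  have := sum_form_endo_mem (⊥ : Submodule k M) (fun g y hy => by
    rw [Submodule.mem_bot] at hy ⊢; rw [hy, smul_zero]) Finset.univ f hf u ?_ φ
  · rw [PolEval.fn_sum]
    exact this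
  · have h1 : (∑ i, evalForm _ (hf i) (u i)).fn LinearMap.id = 0 := h0
    rw [PolEval.fn_sum] at h1
    exact h1

end Forms

/-- A representation spanned by the values of equivariant multilinear maps `𝐕ⁿ → M`. -/
class IsFormSpanned (k M : Type u) [Field k] [AddCommGroup M] [Module k M]
    [DistribMulAction (GLinf k) M] : Prop where
  smulCommClass : SMulCommClass (GLinf k) k M
  formSpan_top : formSpan (⊤ : Submodule k M) = ⊤

attribute [instance] IsFormSpanned.smulCommClass

variable [CharZero k]
variable {M N : Type u} [AddCommGroup M] [Module k M] [DistribMulAction (GLinf k) M]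
  [IsFormSpanned k M] [AddCommGroup N] [Module k N] [DistribMulAction (GLinf k) N]
  [IsFormSpanned k N]
variable {U U' : Type u} [AddCommGroup U] [Module k U] [AddCommGroup U'] [Module k U']

lemma exists_sum_form (m : M) :
    ∃ (p : ℕ) (n : Fin p → ℕ) (f : ∀ i, MultilinearMap k (fun _ : Fin (n i) => StdRep k) M)
      (hf : ∀ i, GLEquivariant (f i)) (v : ∀ i, Fin (n i) → StdRep k), m = ∑ i, f i (v i) := by
  obtain ⟨p, n, f, v, hf, -, h⟩ := exists_sum_of_mem_formSpan
    (k := k) (Y := (⊤ : Submodule k M)) (x := m) (by rw [IsFormSpanned.formSpan_top]; trivial)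
  exact ⟨p, n, f, hf, v, h⟩

lemma form_induction {p : M → Prop}
    (hform : ∀ (n : ℕ) (f : MultilinearMap k (fun _ : Fin n => StdRep k) M) (hf : GLEquivariant f)
      (v : Fin n → StdRep k), p (f v))
    (hzero : p 0) (hadd : ∀ a b, p a → p b → p (a + b)) (m : M) : p m := by
  obtain ⟨q, n, f, hf, u, rfl⟩ := exists_sum_form (k := k) m
  exact Finset.sum_induction _ p hadd hzero fun i _ => hform _ _ (hf i) _

lemma evalId_surjective : Function.Surjective (evalId (k := k) M) := by
  rw [← LinearMap.range_eq_top, eq_top_iff]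
  rintro m -
  refine form_induction (k := k) (p := fun m => m ∈ LinearMap.range (evalId (k := k) M))
    (fun n f hf v => ?_) (Submodule.zero_mem _) (fun a b ha hb => Submodule.add_mem _ ha hb) m
  exact ⟨evalForm _ hf v, rfl⟩

variable (k M) in
/-- The identification `M{𝐕} = M` for a polynomial representation `M`. -/
def evalIdEquiv : PolEval k M (StdRep k) ≃ₗ[k] M :=
  LinearEquiv.ofBijective (evalId M) ⟨evalId_injective, evalId_surjective⟩

/-- The map `M = M{𝐕} → M{U}` induced by a linear map `𝐕 → U`. -/
def push (ψ : StdRep k →ₗ[k] U) : M →ₗ[k] PolEval k M U :=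
  evalTransport M ψ ∘ₗ (evalIdEquiv k M).symm.toLinearMap

lemma push_evalId (ψ : StdRep k →ₗ[k] U) (h : PolEval k M (StdRep k)) :
    push ψ (h.fn LinearMap.id) = evalTransport M ψ h := by
  rw [push, LinearMap.comp_apply]
  congr 1
  exact (evalIdEquiv k M).symm_apply_apply h

/-- Taking the single value `h φ` and pushing it along `ψ` is the functorial action of `ψ ∘ φ`. This
is the passage between `M{U}` and `M` used throughout: `h φ` determines `h` once `ψ ∘ φ` fixes a
subspace supporting `h`. -/
lemma push_fn (ψ : StdRep k →ₗ[k] U) (φ : U' →ₗ[k] StdRep k) (h : PolEval k M U') :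
    push ψ (h.fn φ) = evalTransport M (ψ ∘ₗ φ) h :=
  push_evalId ψ (evalTransport M φ h)

@[simp] lemma push_form (ψ : StdRep k →ₗ[k] U) {n : ℕ}
    {f : MultilinearMap k (fun _ : Fin n => StdRep k) M} (hf : GLEquivariant f)
    (v : Fin n → StdRep k) : push ψ (f v) = evalForm U hf fun i => ψ (v i) :=
  push_evalId ψ (evalForm _ hf v)

lemma evalMap_push (ψ : StdRep k →ₗ[k] U) (L : M →ₗ[k] N)
    (hL : ∀ (g : GLinf k) (m : M), L (g • m) = g • L m) (m : M) :
    evalMap U L hL (push ψ m) = push ψ (L m) := by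
  refine form_induction (k := k) (p := fun m => evalMap U L hL (push ψ m) = push ψ (L m))
    (fun n f hf v => ?_) (by simp only [map_zero]) (fun a b ha hb => ?_) m
  · rw [push_form ψ hf, evalMap_evalForm,
      ← push_form ψ (hf.comp L hL) v, LinearMap.compMultilinearMap_apply]
  · rw [map_add, map_add, map_add, map_add, ha, hb]

lemma push_group_smul (ψ : StdRep k →ₗ[k] U) (g : GLinf k) (m : M) :
    push ψ (g • m) = push (ψ ∘ₗ g.toEquiv.toLinearMap) m := by
  refine form_induction (k := k)
    (p := fun m => push ψ (g • m) = push (ψ ∘ₗ g.toEquiv.toLinearMap) m)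
    (fun n f hf v => ?_) (by simp only [map_zero, smul_zero]) (fun a b ha hb => ?_) m
  · rw [← hf g v, push_form _ hf, push_form _ hf]
    rfl
  · rw [map_add, smul_add, map_add, ha, hb]

/-- Only finitely many basis vectors occur in an expression of `m` by forms. -/
lemma exists_push_bound (m : M) : ∃ l : ℕ, ∀ (U : Type u) [AddCommGroup U] [Module k U]
    (ψ ψ' : StdRep k →ₗ[k] U),
    (∀ i < l, ψ (Finsupp.single i 1) = ψ' (Finsupp.single i 1)) → push ψ m = push ψ' m := by
  obtain ⟨p, n, f, hf, v, rfl⟩ := exists_sum_form (k := k) m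
  obtain ⟨l, hl⟩ := exists_bound Finset.univ v
  refine ⟨l, fun U _ _ ψ ψ' h => ?_⟩
  rw [map_sum, map_sum]
  refine Finset.sum_congr rfl fun i _ => ?_
  rw [push_form ψ (hf i), push_form ψ' (hf i)]
  congr 1
  funext a
  rw [sum_single_of_bound (hl i (Finset.mem_univ i) a)]
  simp only [map_sum, map_smul]
  exact Finset.sum_congr rfl fun s _ => by rw [h s s.2]

/-- `h ∈ M{U}` comes from `M{W}`, in the sense that it is fixed by all endomorphisms of `U` which
are the identity on `W`. -/
def SupportedOn (W : Submodule k U) (h : PolEval k M U) : Prop :=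
  ∀ e : U →ₗ[k] U, (∀ w ∈ W, e w = w) → evalTransport M e h = h

lemma SupportedOn.mono {W W' : Submodule k U} (hW : W ≤ W') {h : PolEval k M U}
    (hh : SupportedOn W h) : SupportedOn W' h :=
  fun e he => hh e fun w hw => he w (hW hw)

lemma SupportedOn.add {W : Submodule k U} {h h' : PolEval k M U}
    (hh : SupportedOn W h) (hh' : SupportedOn W h') : SupportedOn W (h + h') :=
  fun e he => by rw [map_add, hh e he, hh' e he]

lemma supportedOn_evalForm {W : Submodule k U} {n : ℕ}
    {f : MultilinearMap k (fun _ : Fin n => StdRep k) M} (hf : GLEquivariant f)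
    {u : Fin n → U} (hu : ∀ i, u i ∈ W) : SupportedOn W (evalForm U hf u) := fun e he => by
  rw [evalTransport_evalForm]
  congr 1
  exact funext fun i => he _ (hu i)

lemma exists_supportedOn (h : PolEval k M U) :
    ∃ W : Submodule k U, FiniteDimensional k W ∧ SupportedOn W h := by
  induction h using PolEval.induction with
  | hform n f hf u =>
    exact ⟨Submodule.span k (Set.range u), FiniteDimensional.span_of_finite k (Set.finite_range u),
      supportedOn_evalForm hf fun i => Submodule.subset_span ⟨i, rfl⟩⟩
  | hzero => exact ⟨⊥, inferInstance, fun e he => map_zero _⟩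
  | hadd a b ha hb =>
    obtain ⟨W, _, hW⟩ := ha
    obtain ⟨W', _, hW'⟩ := hb
    exact ⟨W ⊔ W', inferInstance, (hW.mono le_sup_left).add (hW'.mono le_sup_right)⟩

lemma SupportedOn.push_eq {W : Submodule k U} {h : PolEval k M U} (hh : SupportedOn W h)
    {ψ : StdRep k →ₗ[k] U} {φ : U →ₗ[k] StdRep k} (H : ∀ w ∈ W, ψ (φ w) = w) :
    push ψ (h.fn φ) = h := by
  rw [push_fn]
  exact hh _ H

/-- A finite dimensional subspace of `U` is parametrized by a linear map `𝐕 → U`, which can be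
prescribed on finitely many basis vectors. -/
lemma exists_section (W : Submodule k U) [FiniteDimensional k W] (ψ₁ : StdRep k →ₗ[k] U) (l : ℕ) :
    ∃ (ψ : StdRep k →ₗ[k] U) (φ : U →ₗ[k] StdRep k),
      (∀ i < l, ψ (Finsupp.single i 1) = ψ₁ (Finsupp.single i 1)) ∧ ∀ w ∈ W, ψ (φ w) = w := by
  classical
  let b := Module.finBasis k W
  -- The first `l` basis vectors carry `ψ₁` and the next ones carry a basis of `W`; `φ` sends that
  -- basis back to them.
  let ψ : StdRep k →ₗ[k] U := Finsupp.linearCombination k fun i =>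
    if i < l then ψ₁ (Finsupp.single i 1) else
      if h : i - l < Module.finrank k W then (b ⟨i - l, h⟩ : U) else 0
  let φ₀ : W →ₗ[k] StdRep k := b.constr k fun i => Finsupp.single (l + i) 1
  obtain ⟨φ, hφ⟩ := φ₀.exists_extend
  refine ⟨ψ, φ, fun i hi => by simp [ψ, hi], fun w hw => ?_⟩
  have h1 : φ w = φ₀ ⟨w, hw⟩ := congrArg (fun F => F ⟨w, hw⟩) hφ
  rw [h1]
  have h2 : ψ ∘ₗ φ₀ = W.subtype := by
    refine b.ext fun i => ?_
    simp [φ₀, ψ]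
  exact congrArg (fun F => F ⟨w, hw⟩) h2

/-- An element of `N{U}` with values in the image of an injective map `M → N` comes from `M{U}`. -/
lemma exists_evalMap_eq (L : M →ₗ[k] N) (hL : ∀ (g : GLinf k) (m : M), L (g • m) = g • L m)
    (h : PolEval k N U) (H : ∀ φ, ∃ m, L m = h.fn φ) : ∃ h', evalMap U L hL h' = h := by
  obtain ⟨W, _, hW⟩ := exists_supportedOn h
  obtain ⟨ψ, φ, -, hψ⟩ := exists_section W 0 0
  -- A preimage of one value suffices, since `h` is the push of `h φ`.
  obtain ⟨m, hm⟩ := H φ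
  exact ⟨push ψ m, by rw [evalMap_push, hm, hW.push_eq hψ]⟩

end Push

/-! ### Local membership -/

section LocalSat

variable {R : Type*} [CommRing R]

/-- The elements that lie in `S` locally at the prime ideal `𝔭`. -/
def localSat {M : Type*} [AddCommGroup M] [Module R M] (𝔭 : Ideal R) [h𝔭 : 𝔭.IsPrime]
    (S : Submodule R M) : Submodule R M where
  carrier := {m | ∃ s ∉ 𝔭, s • m ∈ S}
  zero_mem' := ⟨1, (Ideal.ne_top_iff_one 𝔭).1 h𝔭.ne_top, by rw [smul_zero]; exact S.zero_mem⟩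
  add_mem' := by
    rintro a b ⟨s, hs, ha⟩ ⟨t, ht, hb⟩
    refine ⟨s * t, fun h => (h𝔭.mem_or_mem h).elim hs ht, ?_⟩
    rw [smul_add, mul_comm, mul_smul, mul_comm, mul_smul]
    exact S.add_mem (S.smul_mem _ ha) (S.smul_mem _ hb)
  smul_mem' := by
    rintro c a ⟨s, hs, ha⟩
    exact ⟨s, hs, by rw [smul_comm]; exact S.smul_mem _ ha⟩

lemma mem_localSat {M : Type*} [AddCommGroup M] [Module R M] {𝔭 : Ideal R} [𝔭.IsPrime]
    {S : Submodule R M} {m : M} : m ∈ localSat 𝔭 S ↔ ∃ s ∉ 𝔭, s • m ∈ S := Iff.rfl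

lemma mem_localSat_of_smul {M : Type*} [AddCommGroup M] [Module R M] {𝔭 : Ideal R}
    [h𝔭 : 𝔭.IsPrime] {S : Submodule R M} {m : M} {t : R} (ht : t ∉ 𝔭) (h : t • m ∈ localSat 𝔭 S) :
    m ∈ localSat 𝔭 S := by
  obtain ⟨s, hs, h⟩ := h
  exact ⟨s * t, fun h => (h𝔭.mem_or_mem h).elim hs ht, by rwa [mul_smul]⟩

end LocalSat

/-! ### The algebra case -/

section PushAlg

variable {k : Type u} [Field k] [CharZero k]
variable {R : Type u} [CommRing R] [Algebra k R] [MulSemiringAction (GLinf k) R]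
  [IsFormSpanned k R]
variable {M : Type u} [AddCommGroup M] [Module k M] [Module R M] [IsScalarTower k R M]
  [DistribMulAction (GLinf k) M] [SMulDistribClass (GLinf k) R M] [IsFormSpanned k M]
variable {U U' : Type u} [AddCommGroup U] [Module k U] [AddCommGroup U'] [Module k U']

/-- The element of `R{U}`, as an algebra, given by an element of `R{U}`, as a vector space. -/
def toAlgEval : PolEval k R U →ₗ[k] AlgEval k R U where
  toFun h := AlgEval.mk h.fn h.fn_mem
  map_add' _ _ := rfl
  map_smul' _ _ := rfl

lemma toAlgEval_surjective (a : AlgEval k R U) : ∃ h : PolEval k R U, toAlgEval h = a :=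
  ⟨PolEval.mk a.fn a.fn_mem, rfl⟩

lemma push_smul (ψ : StdRep k →ₗ[k] U) (r : R) (m : M) :
    push ψ (r • m) = toAlgEval (push ψ r) • push ψ m := by
  obtain ⟨r, rfl⟩ := (evalIdEquiv k R).surjective r
  obtain ⟨m, rfl⟩ := (evalIdEquiv k M).surjective m
  have h1 : push ψ (r.fn LinearMap.id) = evalTransport R ψ r := push_evalId ψ r
  have h2 : push ψ (m.fn LinearMap.id) = evalTransport M ψ m := push_evalId ψ m
  change push ψ ((toAlgEval r • m).fn LinearMap.id) =
    toAlgEval (push ψ (r.fn LinearMap.id)) • push ψ (m.fn LinearMap.id)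
  rw [h1, h2]
  exact push_evalId ψ (toAlgEval r • m)

/-- The algebra homomorphism `R = R{𝐕} → R{U}` induced by a linear map `𝐕 → U`. -/
def pushAlg (ψ : StdRep k →ₗ[k] U) : R →ₐ[k] AlgEval k R U :=
  AlgHom.ofLinearMap (toAlgEval ∘ₗ push ψ)
    (by
      have h1 : GLEquivariant (MultilinearMap.constOfIsEmpty k (fun _ : Fin 0 => StdRep k)
        (1 : R)) := fun g _ => (smul_one g).symm
      exact congrArg toAlgEval (push_form ψ h1 fun i => i.elim0))
    (fun r s => by
      obtain ⟨r, rfl⟩ := (evalIdEquiv k R).surjective r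
      obtain ⟨s, rfl⟩ := (evalIdEquiv k R).surjective s
      let rs : PolEval k R (StdRep k) := PolEval.mk (fun φ => r.fn φ * s.fn φ)
        (toAlgEval r * toAlgEval s).fn_mem
      have h1 : push ψ (r.fn LinearMap.id) = evalTransport R ψ r := push_evalId ψ r
      have h2 : push ψ (s.fn LinearMap.id) = evalTransport R ψ s := push_evalId ψ s
      have h3 : push ψ (rs.fn LinearMap.id) = evalTransport R ψ rs := push_evalId ψ rs
      change toAlgEval (push ψ (rs.fn LinearMap.id)) =
        toAlgEval (push ψ (r.fn LinearMap.id)) * toAlgEval (push ψ (s.fn LinearMap.id))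
      rw [h1, h2, h3]
      rfl)

lemma pushAlg_apply (ψ : StdRep k →ₗ[k] U) (r : R) : pushAlg ψ r = toAlgEval (push ψ r) := rfl

lemma push_smul' (ψ : StdRep k →ₗ[k] U) (r : R) (m : M) :
    push ψ (r • m) = pushAlg ψ r • push ψ m := push_smul ψ r m

variable (x : AlgEval k R U →ₐ[k] k)

/-- The `k`-point of `Spec R` obtained from a `k`-point of `Spec R{U}` and a map `𝐕 → U`. -/
def pointAt (ψ : StdRep k →ₗ[k] U) : R →ₐ[k] k := x.comp (pushAlg ψ)

lemma pointAt_apply (ψ : StdRep k →ₗ[k] U) (r : R) : pointAt x ψ r = x (pushAlg ψ r) := rfl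

variable {x}

/-- The elements of `R` vanishing at all points `pointAt x ψ` form a radical `GL`-stable ideal whose
zero locus contains `x`, so genericity forces this ideal to be zero. -/
lemma exists_pointAt_ne_zero (hx : IsGLGeneric x) {b : R} (hb : b ≠ 0) :
    ∃ ψ : StdRep k →ₗ[k] U, pointAt x ψ b ≠ 0 := by
  by_contra! hcon
  let I : Ideal R := ⨅ ψ : StdRep k →ₗ[k] U, RingHom.ker (pointAt x ψ)
  have hI : ∀ r, r ∈ I ↔ ∀ ψ : StdRep k →ₗ[k] U, pointAt x ψ r = 0 := fun r => by
    simp [I, Submodule.mem_iInf, RingHom.mem_ker]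
  have : I = ⊥ := by
    refine hx I ?_ ?_ ?_
    · rintro r ⟨n, hn⟩
      refine (hI r).2 fun ψ => ?_
      have := (hI _).1 hn ψ
      rw [map_pow] at this
      exact eq_zero_of_pow_eq_zero this
    · intro g r hr
      refine (hI _).2 fun ψ => ?_
      have := (hI _).1 hr (ψ ∘ₗ g.toEquiv.toLinearMap)
      rw [← this, pointAt_apply, pointAt_apply, pushAlg_apply, pushAlg_apply]
      rw [push_group_smul]
    -- The point `x` lies on the locus: as `ψ (φ u) = u`, the value at `x` of `f` evaluated at `u`
    -- is the value of `f (φ u) ∈ I` at `pointAt x ψ`.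
    · intro n f u hf hfI
      have : FiniteDimensional k (Submodule.span k (Set.range u)) :=
        FiniteDimensional.span_of_finite k (Set.finite_range u)
      obtain ⟨ψ, φ, -, h⟩ := exists_section (k := k) (Submodule.span k (Set.range u)) 0 0
      have h1 := (hI _).1 (hfI fun i => φ (u i)) ψ
      rw [pointAt_apply, pushAlg_apply, push_form ψ hf] at h1
      rw [← h1]
      congr 1
      have : u = fun i => ψ (φ (u i)) := funext fun i => (h _ (Submodule.subset_span ⟨i, rfl⟩)).symm
      conv_lhs => rw [this]
      rfl
  exact hb (by
    have : b ∈ I := (hI b).2 hcon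
    rwa [‹I = ⊥›, Submodule.mem_bot] at this)

/-- Along the line `ψ₁ + t ψ₀` the value is a polynomial in `t` with nonzero constant term. -/
lemma finite_pointAt_eq_zero {ψ₁ : StdRep k →ₗ[k] U} {b : R} (hψ₁ : pointAt x ψ₁ b ≠ 0)
    (ψ₀ : StdRep k →ₗ[k] U) : {t : k | pointAt x (ψ₁ + t • ψ₀) b = 0}.Finite := by
  by_contra hinf
  obtain ⟨p, n', F, hF, v, rfl⟩ := exists_sum_form (k := k) b
  have key : ∀ ψ : StdRep k →ₗ[k] U, pointAt x ψ (∑ i, F i (v i)) =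
      ∑ i, ((x.toLinearMap ∘ₗ toAlgEval).compMultilinearMap (evalForm U (hF i)))
        (fun a => ψ (v i a)) := by
    intro ψ
    rw [map_sum]
    refine Finset.sum_congr rfl fun i _ => ?_
    rw [pointAt_apply, pushAlg_apply, push_form ψ (hF i)]
    rfl
  have := multilinear_const_mem (⊥ : Submodule k k) Finset.univ
    (fun i => (x.toLinearMap ∘ₗ toAlgEval).compMultilinearMap (evalForm U (hF i)))
    (fun i a => ψ₁ (v i a)) (fun i a => ψ₀ (v i a)) hinf (fun t ht => ?_)
  · rw [Submodule.mem_bot, ← key] at this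
    exact hψ₁ this
  · rw [Submodule.mem_bot, ← ht, key]
    rfl

instance ker_isPrime : (RingHom.ker x).IsPrime := RingHom.ker_isPrime x

variable (k U) in
/-- The elements of `M{U}` with values in the submodule `Y` of `M`. -/
def evalSub (Y : Submodule R M) : Submodule (AlgEval k R U) (PolEval k M U) where
  carrier := {h | ∀ φ, h.fn φ ∈ Y}
  zero_mem' _ := Y.zero_mem
  add_mem' ha hb φ := Y.add_mem (ha φ) (hb φ)
  smul_mem' c _ ha φ := Y.smul_mem (c.fn φ) (ha φ)

lemma smul_mem_localSat_iff {S : Submodule (AlgEval k R U) (PolEval k M U)} {c : k}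
    {h : PolEval k M U} (hh : h ∈ localSat (RingHom.ker x) S) :
    c • h ∈ localSat (RingHom.ker x) S := by
  rw [← algebraMap_smul (AlgEval k R U)]
  exact Submodule.smul_mem _ _ hh

/-- The multiplier `b` can be removed at those `ψ` for which it is nonzero at `pointAt x ψ`. These
include almost all points of a line `ψ₁ + t ψ₀` whose direction sends basis vectors to `u`, and the
leading coefficient along this line is the value at `u`. -/
lemma evalForm_mem_localSat (hx : IsGLGeneric x)
    (S : Submodule (AlgEval k R U) (PolEval k M U)) {n : ℕ}
    {f : MultilinearMap k (fun _ : Fin n => StdRep k) M} (hf : GLEquivariant f)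
    (hS : ∀ v, ∃ b : R, b ≠ 0 ∧ ∀ ψ : StdRep k →ₗ[k] U, push ψ (b • f v) ∈ S) (u : Fin n → U) :
    evalForm U hf u ∈ localSat (RingHom.ker x) S := by
  let T : Submodule k (PolEval k M U) :=
    { localSat (RingHom.ker x) S with smul_mem' := fun c h hh => smul_mem_localSat_iff hh }
  -- The values at `e_0, …, e_{n-1}` are enough, as a linear map can send these vectors to any `u`.
  obtain ⟨b, hb, hbS⟩ := hS fun i => Finsupp.single (i : ℕ) 1
  obtain ⟨ψ₁, hψ₁⟩ := exists_pointAt_ne_zero hx hb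
  let ψ₀ : StdRep k →ₗ[k] U := Finsupp.linearCombination k fun i =>
    if h : i < n then u ⟨i, h⟩ else 0
  have hψ₀ : ∀ i : Fin n, ψ₀ (Finsupp.single (i : ℕ) 1) = u i := fun i => by simp [ψ₀]
  have htop := multilinear_top_mem T (evalForm U hf)
    (fun i => ψ₁ (Finsupp.single (i : ℕ) 1)) (fun i => ψ₀ (Finsupp.single (i : ℕ) 1))
    (finite_pointAt_eq_zero hψ₁ ψ₀).infinite_compl fun t ht => ?_
  · simp only [hψ₀] at htop
    exact htop
  · have h1 := hbS (ψ₁ + t • ψ₀)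
    rw [push_smul', push_form _ hf] at h1
    exact ⟨_, ht, h1⟩

/-- The elements of `M{U}` with values in a `GL`-stable submodule are sums of values of equivariant
multilinear maps into the submodule. -/
lemma exists_sum_evalForm_of_mem {Y : Submodule R M} (hY : ∀ (g : GLinf k), ∀ y ∈ Y, g • y ∈ Y)
    {h : PolEval k M U} (hh : h ∈ evalSub k U Y) :
    ∃ (m : ℕ) (n : Fin m → ℕ) (f : ∀ i, MultilinearMap k (fun _ : Fin (n i) => StdRep k) M)
      (hf : ∀ i, GLEquivariant (f i)) (u : ∀ i, Fin (n i) → U), (∀ i w, f i w ∈ Y) ∧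
        h = ∑ i, evalForm U (hf i) (u i) := by
  obtain ⟨W, _, hW⟩ := exists_supportedOn h
  obtain ⟨ψ, φ, -, hψ⟩ := exists_section W 0 0
  have h1 := mem_formSpan_of_mem (k := k) (Y := Y.restrictScalars k) hY
    (by rw [IsFormSpanned.formSpan_top]; trivial) (hh φ)
  obtain ⟨m, n, f, v, hf, hfY, hs⟩ := exists_sum_of_mem_formSpan h1
  refine ⟨m, n, f, hf, fun i a => ψ (v i a), hfY, ?_⟩
  rw [← hW.push_eq hψ, hs, map_sum]
  exact Finset.sum_congr rfl fun i _ => push_form ψ (hf i) (v i)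

/-- Elements of `M{U}` with values in a `GL`-stable submodule lie in `S`, up to functions on `X{U}`
that do not vanish at `x`, if the elements of the submodule do, up to nonzero functions on `X`. -/
theorem evalSub_le_localSat (hx : IsGLGeneric x) (S : Submodule (AlgEval k R U) (PolEval k M U))
    {Y : Submodule R M} (hY : ∀ (g : GLinf k), ∀ y ∈ Y, g • y ∈ Y)
    (hS : ∀ m ∈ Y, ∃ b : R, b ≠ 0 ∧ ∀ ψ : StdRep k →ₗ[k] U, push ψ (b • m) ∈ S) :
    evalSub k U Y ≤ localSat (RingHom.ker x) S := by
  intro h hh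
  obtain ⟨m, n, f, hf, u, hfY, rfl⟩ := exists_sum_evalForm_of_mem hY hh
  exact Submodule.sum_mem _ fun i _ =>
    evalForm_mem_localSat hx S (hf i) (fun v => hS _ (hfY i v)) _

end PushAlg

/-! ### Relations between multi-indexed families that are stable under raising indices -/

section Raise

variable {R : Type*} [CommRing R] {n : ℕ}

/-- The number of entries of a multi-index that are at least `l`. -/
def highDeg (l : ℕ) (I : Fin n → ℕ) : ℕ := (Finset.univ.filter fun i => l ≤ I i).card

lemma highDeg_le (l : ℕ) (I : Fin n → ℕ) : highDeg l I ≤ n :=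
  (Finset.card_le_univ _).trans (by simp)

lemma highDeg_anti {l l' : ℕ} (h : l ≤ l') (I : Fin n → ℕ) : highDeg l' I ≤ highDeg l I :=
  Finset.card_le_card fun i hi => by
    rw [Finset.mem_filter] at hi ⊢
    exact ⟨hi.1, h.trans hi.2⟩

lemma highDeg_update_le (l : ℕ) (I : Fin n → ℕ) (i : Fin n) (u : ℕ) :
    highDeg l (Function.update I i u) ≤ highDeg l I + 1 := by
  refine (Finset.card_le_card (t := insert i (Finset.univ.filter fun i => l ≤ I i))
    fun a ha => ?_).trans (Finset.card_insert_le _ _)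
  rw [Finset.mem_filter] at ha
  by_cases h : a = i
  · exact h ▸ Finset.mem_insert_self _ _
  · rw [Function.update_of_ne h] at ha
    exact Finset.mem_insert_of_mem (Finset.mem_filter.2 ha)

variable (R n) in
/-- The combinations of multi-indices having fewer than `d` entries that are at least `l`. -/
def lowDeg (l d : ℕ) : Submodule R ((Fin n → ℕ) →₀ R) :=
  Finsupp.supported R R {I | highDeg l I < d}

lemma mem_lowDeg {l d : ℕ} {ω : (Fin n → ℕ) →₀ R} :
    ω ∈ lowDeg R n l d ↔ ∀ I, d ≤ highDeg l I → ω I = 0 := by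
  rw [lowDeg, Finsupp.mem_supported']
  simp only [Set.mem_ofPred_eq, not_lt]

lemma lowDeg_mono {l l' d d' : ℕ} (hl : l ≤ l') (hd : d ≤ d') :
    lowDeg R n l d ≤ lowDeg R n l' d' := fun ω hω =>
  mem_lowDeg.2 fun I hI => mem_lowDeg.1 hω I (hd.trans (hI.trans (highDeg_anti hl I)))

lemma lowDeg_top (l : ℕ) : lowDeg R n l (n + 1) = ⊤ := by
  refine eq_top_iff.2 fun ω _ => mem_lowDeg.2 fun I hI => ?_
  have := highDeg_le l I
  omega

lemma lowDeg_bot (l : ℕ) : lowDeg R n l 0 = ⊥ :=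
  eq_bot_iff.2 fun _ hω => Finsupp.ext fun I => mem_lowDeg.1 hω I (Nat.zero_le _)

variable (R n) in
/-- The derivation replacing, one at a time, the entries `j` of a multi-index by `u`. -/
def raise (j u : ℕ) : ((Fin n → ℕ) →₀ R) →ₗ[R] (Fin n → ℕ) →₀ R :=
  Finsupp.linearCombination R fun I => ∑ i with I i = j, Finsupp.single (Function.update I i u) 1

lemma raise_single (j u : ℕ) (I : Fin n → ℕ) :
    raise R n j u (Finsupp.single I 1) =
      ∑ i with I i = j, Finsupp.single (Function.update I i u) 1 := by
  simp [raise]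

lemma raise_mem_lowDeg (j u : ℕ) {l d : ℕ} {ω : (Fin n → ℕ) →₀ R} (h : ω ∈ lowDeg R n l d) :
    raise R n j u ω ∈ lowDeg R n l (d + 1) := by
  rw [raise, Finsupp.linearCombination_apply, Finsupp.sum]
  refine Submodule.sum_mem _ fun I hI => Submodule.smul_mem _ _ <| Submodule.sum_mem _ fun i _ =>
    Finsupp.single_mem_supported _ _ ?_
  have h1 : highDeg l I < d := by
    by_contra hc
    exact Finsupp.mem_support_iff.1 hI (mem_lowDeg.1 h I (by omega))
  have h2 := highDeg_update_le l I i u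
  exact Set.mem_ofPred_eq ▸ (by omega)

open Classical in
variable (R n) in
/-- The operator replacing simultaneously, at distinct places, the entries `j s` by `u s`. -/
def raises {d : ℕ} (j u : Fin d → ℕ) : ((Fin n → ℕ) →₀ R) →ₗ[R] (Fin n → ℕ) →₀ R :=
  Finsupp.linearCombination R fun I => ∑ τ : Fin d ↪ Fin n,
    if ∀ s, I (τ s) = j s then Finsupp.single (Function.extend τ u I) 1 else 0

open Classical in
lemma raises_single {d : ℕ} (j u : Fin d → ℕ) (I : Fin n → ℕ) :
    raises R n j u (Finsupp.single I 1) = ∑ τ : Fin d ↪ Fin n,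
      if ∀ s, I (τ s) = j s then Finsupp.single (Function.extend τ u I) 1 else 0 := by
  simp [raises]

lemma raises_zero (j u : Fin 0 → ℕ) : raises R n j u = LinearMap.id := by
  classical
  refine Finsupp.lhom_ext' fun I => LinearMap.ext_ring ?_
  simp only [LinearMap.comp_apply, Finsupp.lsingle_apply, raises_single, LinearMap.id_apply]
  have e : ∀ τ : Fin 0 ↪ Fin n, Function.extend τ u I = I := fun τ => by
    funext i
    exact Function.extend_apply' _ _ _ fun ⟨s, _⟩ => s.elim0
  simp [e]

lemma extend_cons {d : ℕ} (τ : Fin (d + 1) ↪ Fin n) (u : Fin (d + 1) → ℕ) (I : Fin n → ℕ) :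
    Function.update (Function.extend (fun s : Fin d => τ s.succ) (fun s => u s.succ) I) (τ 0) (u 0)
      = Function.extend τ u I := by
  have hinj : Function.Injective fun s : Fin d => τ s.succ :=
    τ.injective.comp (Fin.succ_injective d)
  funext i
  by_cases hi : ∃ s, τ s = i
  · obtain ⟨s, rfl⟩ := hi
    rw [τ.injective.extend_apply]
    refine Fin.cases ?_ (fun s => ?_) s
    · rw [Function.update_self]
    · rw [Function.update_of_ne (fun h => Fin.succ_ne_zero s (τ.injective h))]
      exact hinj.extend_apply _ _ s
  · rw [Function.update_of_ne (fun h => hi ⟨0, h.symm⟩), Function.extend_apply' _ _ _ hi,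
      Function.extend_apply' _ _ _ fun ⟨s, hs⟩ => hi ⟨s.succ, hs⟩]

/-- An embedding of `Fin (d + 1)` is an embedding of `Fin d` together with a place outside its
range. The hypothesis `h` prevents an entry just inserted from being raised again, so the outer
`raise` acts only at new places. -/
lemma raises_succ {d : ℕ} (j u : Fin (d + 1) → ℕ) (h : ∀ s s', u s ≠ j s') :
    raises R n j u = raise R n (j 0) (u 0) ∘ₗ raises R n (fun s => j s.succ) fun s => u s.succ := by
  classical
  refine Finsupp.lhom_ext' fun I => LinearMap.ext_ring ?_
  simp only [LinearMap.comp_apply, Finsupp.lsingle_apply, raises_single, map_sum]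
  rw [Fintype.sum_equiv (Equiv.embeddingFinSucc d (Fin n)) _
    (fun p => if ∀ s, I ((Equiv.embeddingFinSucc d (Fin n)).symm p s) = j s then
      Finsupp.single (Function.extend ((Equiv.embeddingFinSucc d (Fin n)).symm p) u I) (1 : R)
      else 0) (fun τ => by simp), Fintype.sum_sigma]
  refine Finset.sum_congr rfl fun τ _ => ?_
  have e0 : ∀ i, (Equiv.embeddingFinSucc d (Fin n)).symm ⟨τ, i⟩ 0 = i := fun i => by
    simp [Equiv.coe_embeddingFinSucc_symm]
  have e1 : ∀ i s, (Equiv.embeddingFinSucc d (Fin n)).symm ⟨τ, i⟩ (Fin.succ s) = τ s :=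
    fun i s => by simp [Equiv.coe_embeddingFinSucc_symm]
  have e2 : ∀ i, Function.extend ((Equiv.embeddingFinSucc d (Fin n)).symm ⟨τ, i⟩) u I =
      Function.update (Function.extend τ (fun s => u s.succ) I) i (u 0) := by
    intro i
    rw [← extend_cons, e0]
    congr 2
  simp only [Fin.forall_fin_succ, e0, e1, e2]
  by_cases hτ : ∀ s, I (τ s) = j s.succ
  · simp only [hτ, implies_true, and_true, if_true]
    rw [raise_single]
    rw [← Finset.sum_filter]
    refine Finset.sum_bij (fun i _ => i.1) (fun i hi => ?_) (fun i _ i' _ => Subtype.ext)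
      (fun i hi => ?_) (fun i _ => rfl)
    · rw [Finset.mem_filter] at hi ⊢
      refine ⟨Finset.mem_univ _, ?_⟩
      rw [Function.extend_apply' _ _ _ fun hs => i.2 hs]
      exact hi.2
    · rw [Finset.mem_filter] at hi
      have hir : i ∉ Set.range τ := by
        rintro ⟨s, rfl⟩
        rw [τ.injective.extend_apply] at hi
        exact h _ _ hi.2
      refine ⟨⟨i, hir⟩, ?_, rfl⟩
      rw [Finset.mem_filter]
      refine ⟨Finset.mem_univ _, ?_⟩
      rw [Function.extend_apply' _ _ _ fun hs => hir hs] at hi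
      exact hi.2
  · simp only [hτ, and_false, if_false, map_zero, Finset.sum_const_zero]

/-- A submodule `S` of relations is stable under raising indices, up to terms involving the same
multi-indices. -/
def RaiseStable (S : Submodule R ((Fin n → ℕ) →₀ R)) : Prop :=
  ∀ ω ∈ S, ∀ j u : ℕ, ∃ ω' ∈ S, ω' - raise R n j u ω ∈ Finsupp.supported R R (ω.support : Set _)

variable {S : Submodule R ((Fin n → ℕ) →₀ R)}

/-- All multi-indices occurring in `ω` have entries less than `l`. -/
def IndexLT (l : ℕ) (ω : (Fin n → ℕ) →₀ R) : Prop := ∀ I, ω I ≠ 0 → ∀ i, I i < l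

lemma IndexLT.mem_lowDeg {l : ℕ} {ω : (Fin n → ℕ) →₀ R} (h : IndexLT l ω) :
    ω ∈ lowDeg R n l 1 := by
  refine SemilinearGL.mem_lowDeg.2 fun I hI => ?_
  by_contra hne
  obtain ⟨i, hi⟩ := Finset.card_pos.1 (show 0 < highDeg l I from hI)
  have := h I hne i
  rw [Finset.mem_filter] at hi
  omega

lemma exists_indexLT (ω : (Fin n → ℕ) →₀ R) : ∃ l, ∀ l', l ≤ l' → IndexLT l' ω := by
  refine ⟨(ω.support.sup fun I => Finset.univ.sup I) + 1, fun l' hl' I hI i => ?_⟩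
  have h1 : I i ≤ Finset.univ.sup I := Finset.le_sup (f := I) (Finset.mem_univ i)
  have h2 : Finset.univ.sup I ≤ ω.support.sup fun I => Finset.univ.sup I :=
    Finset.le_sup (f := fun I : Fin n → ℕ => Finset.univ.sup I) (Finsupp.mem_support_iff.2 hI)
  omega

/-- Each use of stability costs an error supported on the multi-indices already present, which have
no more high entries than before, while the raised part may have one more. So the error always stays
below the leading degree. -/
lemma RaiseStable.exists_raises (hS : RaiseStable S) {ω : (Fin n → ℕ) →₀ R} (hω : ω ∈ S) {l : ℕ}
    (hl : IndexLT l ω) {d : ℕ} (j u : Fin d → ℕ) (hj : ∀ s, j s < l) (hu : ∀ s, l ≤ u s) :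
    raises R n j u ω ∈ lowDeg R n l (d + 1) ∧
      ∃ ω' ∈ S, ω' - raises R n j u ω ∈ lowDeg R n l d := by
  induction d with
  | zero =>
    rw [raises_zero]
    exact ⟨hl.mem_lowDeg, ω, hω, by simp⟩
  | succ d ih =>
    obtain ⟨h1, ω', hω', h2⟩ := ih (fun s => j s.succ) (fun s => u s.succ) (fun s => hj _)
      fun s => hu _
    rw [raises_succ j u fun s s' => by have := hj s'; have := hu s; omega, LinearMap.comp_apply]
    refine ⟨raise_mem_lowDeg _ _ h1, ?_⟩
    obtain ⟨ω'', hω'', h3⟩ := hS ω' hω' (j 0) (u 0)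
    refine ⟨ω'', hω'', ?_⟩
    have h4 : ω' ∈ lowDeg R n l (d + 1) := by
      have := (lowDeg R n l (d + 1)).add_mem (lowDeg_mono le_rfl (Nat.le_succ d) h2) h1
      rwa [sub_add_cancel] at this
    have h5 : ω'' - raise R n (j 0) (u 0) ω' ∈ lowDeg R n l (d + 1) := by
      refine Finsupp.supported_mono ?_ h3
      exact (Finsupp.mem_supported R ω').1 h4
    have h6 := (lowDeg R n l (d + 1)).add_mem h5 (raise_mem_lowDeg (j 0) (u 0) h2)
    rwa [map_sub, sub_add_sub_cancel] at h6

end Raise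

/-! ### Echelon form over a domain -/

section Echelon

variable {R : Type*} [CommRing R] [IsDomain R]

/-- A submodule of `Rᵖ` over a domain has, up to a nonzero scalar, a basis in reduced
echelon form. -/
lemma exists_echelon {P : Type*} [Fintype P] [DecidableEq P] (V : Submodule R (P → R)) :
    ∃ (Q : Finset P) (β : R) (c : P → P → R), β ≠ 0 ∧ (∀ q ∈ Q, c q ∈ V) ∧
      (∀ q ∈ Q, ∀ q' ∈ Q, c q q' = if q = q' then β else 0) ∧
      ∀ v ∈ V, β • v = ∑ q ∈ Q, v q • c q := by
  -- Pivot sets: vectors of `V` that restrict to `β` times the identity on the coordinates in `Q`.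
  -- One of maximal size is used.
  let good : Finset P → Prop := fun Q => ∃ (β : R) (c : P → P → R), β ≠ 0 ∧ (∀ q ∈ Q, c q ∈ V) ∧
      (∀ q ∈ Q, ∀ q' ∈ Q, c q q' = if q = q' then β else 0)
  obtain ⟨Q, hQ, hmax⟩ : ∃ Q, good Q ∧ ∀ Q', good Q' → Q'.card ≤ Q.card := by
    classical
    obtain ⟨Q, hQ, h⟩ := Finset.exists_max_image (Finset.univ.filter good) Finset.card
      ⟨∅, Finset.mem_filter.2 ⟨Finset.mem_univ _, 1, 0, one_ne_zero, by simp, by simp⟩⟩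
    exact ⟨Q, (Finset.mem_filter.1 hQ).2, fun Q' hQ' =>
      h Q' (Finset.mem_filter.2 ⟨Finset.mem_univ _, hQ'⟩)⟩
  obtain ⟨β, c, hβ, hc, hδ⟩ := hQ
  refine ⟨Q, β, c, hβ, hc, hδ, fun v hv => ?_⟩
  by_contra hne
  -- `w` vanishes on the pivots. A nonzero coordinate `p` of `w` would be a further pivot, by
  -- fraction-free elimination with the new scalar `β * w p`, contradicting maximality.
  set w := β • v - ∑ q ∈ Q, v q • c q with hw
  have hwV : w ∈ V := V.sub_mem (V.smul_mem _ hv)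
    (V.sum_mem fun q hq => V.smul_mem _ (hc q hq))
  have hwQ : ∀ q ∈ Q, w q = 0 := by
    intro q hq
    rw [hw, Pi.sub_apply, Finset.sum_apply, Finset.sum_eq_single q]
    · rw [Pi.smul_apply, Pi.smul_apply, hδ q hq q hq, if_pos rfl, smul_eq_mul, smul_eq_mul,
        mul_comm, sub_self]
    · intro q' hq' hne
      rw [Pi.smul_apply, hδ q' hq' q hq, if_neg hne, smul_zero]
    · exact fun h => absurd hq h
  obtain ⟨p, hp⟩ : ∃ p, w p ≠ 0 := by
    by_contra! h
    exact hne (sub_eq_zero.1 (funext h))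
  have hpQ : p ∉ Q := fun h => hp (hwQ p h)
  have := hmax (insert p Q) ⟨β * w p,
    fun q => if q = p then β • w else w p • c q - c q p • w, mul_ne_zero hβ hp, ?_, ?_⟩
  · rw [Finset.card_insert_of_notMem hpQ] at this
    omega
  · intro q hq
    dsimp only
    split_ifs with h
    · exact V.smul_mem _ hwV
    · have := hc q (Finset.mem_of_mem_insert_of_ne hq h)
      exact V.sub_mem (V.smul_mem _ this) (V.smul_mem _ hwV)
  · intro q hq q' hq'
    dsimp only
    by_cases h : q = p <;> by_cases h' : q' = p
    · subst h h'
      simp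
    · subst h
      rw [if_pos rfl, if_neg (Ne.symm h'), Pi.smul_apply,
        hwQ q' (Finset.mem_of_mem_insert_of_ne hq' h'), smul_zero]
    · subst h'
      rw [if_neg h, if_neg h]
      simp [mul_comm]
    · have h1 := Finset.mem_of_mem_insert_of_ne hq h
      have h2 := Finset.mem_of_mem_insert_of_ne hq' h'
      rw [if_neg h, Pi.sub_apply, Pi.smul_apply, Pi.smul_apply, hδ q h1 q' h2, hwQ q' h2]
      split_ifs <;> simp [mul_comm]

end Echelon

/-! ### Leading patterns -/

section Patterns

/-- A pattern: `d` marked places of a multi-index, and the remaining entries, all less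
than `L`. -/
abbrev Pattern (n d L : ℕ) : Type := Σ τ : Fin d ↪ Fin n, ({i // i ∉ Set.range τ} → Fin L)

variable {n d L : ℕ}

open Classical in
/-- The multi-index obtained by inserting the entries `u` at the marked places of a pattern. -/
def Pattern.ins (p : Pattern n d L) (u : Fin d → ℕ) : Fin n → ℕ :=
  Function.extend p.1 u fun i => if h : i ∈ Set.range p.1 then 0 else p.2 ⟨i, h⟩

lemma Pattern.ins_apply (p : Pattern n d L) (u : Fin d → ℕ) (s : Fin d) :
    p.ins u (p.1 s) = u s := p.1.injective.extend_apply _ _ s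

lemma Pattern.ins_apply_of_notMem (p : Pattern n d L) (u : Fin d → ℕ) {i : Fin n}
    (h : i ∉ Set.range p.1) : p.ins u i = p.2 ⟨i, h⟩ := by
  rw [Pattern.ins, Function.extend_apply' _ _ _ (fun hs => h hs), dif_neg h]

lemma Pattern.extend_ins (p : Pattern n d L) (u j : Fin d → ℕ) :
    Function.extend p.1 u (p.ins j) = p.ins u := by
  funext i
  by_cases h : i ∈ Set.range p.1
  · obtain ⟨s, rfl⟩ := h
    rw [p.1.injective.extend_apply, p.ins_apply]
  · rw [Function.extend_apply' _ _ _ (fun hs => h hs), p.ins_apply_of_notMem _ h,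
      p.ins_apply_of_notMem _ h]

lemma Pattern.ext_of_ins {p q : Pattern n d L} (h : p.1 = q.1) {j j' : Fin d → ℕ}
    (hj : p.ins j = q.ins j') : p = q := by
  obtain ⟨τ, w⟩ := p
  obtain ⟨τ', w'⟩ := q
  obtain rfl : τ = τ' := h
  congr 1
  funext i
  have h1 := congrFun hj i.1
  rw [Pattern.ins_apply_of_notMem _ _ i.2, Pattern.ins_apply_of_notMem _ _ i.2] at h1
  exact Fin.ext h1

lemma Pattern.highDeg_ins (p : Pattern n d L) {l : ℕ} (hl : L ≤ l) {u : Fin d → ℕ}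
    (hu : ∀ s, l ≤ u s) : highDeg l (p.ins u) = d := by
  have : (Finset.univ.filter fun i => l ≤ p.ins u i) = Finset.univ.map p.1 := by
    ext i
    simp only [Finset.mem_filter, Finset.mem_univ, true_and, Finset.mem_map]
    constructor
    · intro hi
      by_contra h
      rw [p.ins_apply_of_notMem u h] at hi
      have := (p.2 ⟨i, h⟩).2
      omega
    · rintro ⟨s, rfl⟩
      rw [p.ins_apply]
      exact hu s
  rw [highDeg, this, Finset.card_map, Finset.card_univ, Fintype.card_fin]

/-- `τ` already accounts for `d` entries that are at least `L`, so every other entry is below `L`.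
-/
lemma exists_pattern {I : Fin n → ℕ} (hI : highDeg L I ≤ d) (τ : Fin d ↪ Fin n)
    (hτ : ∀ s, L ≤ I (τ s)) :
    ∃ w : {i // i ∉ Set.range τ} → Fin L,
      Pattern.ins (⟨τ, w⟩ : Pattern n d L) (fun s => I (τ s)) = I := by
  have hlt : ∀ i : {i // i ∉ Set.range τ}, I i < L := by
    rintro ⟨i, hi⟩
    by_contra hc
    have h1 : (Finset.cons i (Finset.univ.map τ) (by simpa using hi)).card ≤ highDeg L I := by
      refine Finset.card_le_card fun a ha => ?_
      rw [Finset.mem_filter]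
      refine ⟨Finset.mem_univ _, ?_⟩
      rcases Finset.mem_cons.1 ha with rfl | ha
      · exact not_lt.1 hc
      · obtain ⟨s, -, rfl⟩ := Finset.mem_map.1 ha
        exact hτ s
    rw [Finset.card_cons, Finset.card_map, Finset.card_univ, Fintype.card_fin] at h1
    omega
  refine ⟨fun i => ⟨I i, hlt i⟩, funext fun i => ?_⟩
  by_cases h : i ∈ Set.range τ
  · obtain ⟨s, rfl⟩ := h
    exact Pattern.ins_apply (⟨τ, _⟩ : Pattern n d L) _ s
  · exact Pattern.ins_apply_of_notMem (⟨τ, _⟩ : Pattern n d L) _ h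

/-- The entries `u s` are distinct and at least `L`, so they reveal the marked places together with
their order. -/
lemma Pattern.ins_injective {u : Fin d → ℕ} (hu : Function.Injective u) (hL : ∀ s, L ≤ u s)
    {p q : Pattern n d L} (h : p.ins u = q.ins u) : p = q := by
  refine Pattern.ext_of_ins (DFunLike.ext _ _ fun s => ?_) h
  have h1 : q.ins u (p.1 s) = u s := by rw [← h, p.ins_apply]
  by_cases hr : p.1 s ∈ Set.range q.1
  · obtain ⟨s', hs'⟩ := hr
    rw [← hs', q.ins_apply] at h1
    rw [← hs', hu h1]
  · rw [q.ins_apply_of_notMem u hr] at h1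
    have := (q.2 ⟨p.1 s, hr⟩).2
    have := hL s
    omega

variable {R : Type*} [CommRing R]

open Classical in
variable (R) in
/-- The combination of the multi-indices `p.ins u` with given coefficients. -/
def lead (u : Fin d → ℕ) : (Pattern n d L → R) →ₗ[R] (Fin n → ℕ) →₀ R :=
  ∑ p : Pattern n d L, Finsupp.lsingle (p.ins u) ∘ₗ LinearMap.proj p

open Classical in
lemma lead_apply (u : Fin d → ℕ) (c : Pattern n d L → R) :
    lead R u c = ∑ p, Finsupp.single (p.ins u) (c p) := by
  simp [lead]

variable (L) in
/-- The coefficients of the multi-indices `p.ins j`. -/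
def symb (j : Fin d → ℕ) : ((Fin n → ℕ) →₀ R) →ₗ[R] Pattern n d L → R :=
  LinearMap.pi fun p => Finsupp.lapply (p.ins j)

lemma symb_apply (j : Fin d → ℕ) (ω : (Fin n → ℕ) →₀ R) (p : Pattern n d L) :
    symb L j ω p = ω (p.ins j) := rfl

/-- Places `τ` with `I ∘ τ = j` exhaust the entries of `I` that are at least `L`, so the
multi-indices that contribute are of the form `p.ins j`, and raising turns `p.ins j` into `p.ins u`.
-/
lemma raises_eq_lead {ω : (Fin n → ℕ) →₀ R} (hω : ω ∈ lowDeg R n L (d + 1)) (j u : Fin d → ℕ)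
    (hj : ∀ s, L ≤ j s) : raises R n j u ω = lead R u (symb L j ω) := by
  classical
  rw [lead_apply, raises, Finsupp.linearCombination_apply, Finsupp.sum, Fintype.sum_sigma]
  simp only [Finset.smul_sum]
  rw [Finset.sum_comm]
  refine Finset.sum_congr rfl fun τ _ => ?_
  simp only [smul_ite, Finsupp.smul_single, smul_eq_mul, mul_one, smul_zero]
  rw [← Finset.sum_filter, ← Finset.sum_filter_of_ne
    (p := fun w => ω (Pattern.ins (⟨τ, w⟩ : Pattern n d L) j) ≠ 0)
    (fun w _ hw h => hw (by rw [symb_apply, h, Finsupp.single_zero]))]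
  symm
  refine Finset.sum_bij (fun w _ => Pattern.ins (⟨τ, w⟩ : Pattern n d L) j) (fun w hw => ?_)
    (fun w _ w' _ h => ?_) (fun I hI => ?_) (fun w _ => ?_)
  · rw [Finset.mem_filter] at hw ⊢
    exact ⟨Finsupp.mem_support_iff.2 hw.2,
      fun s => Pattern.ins_apply (⟨τ, w⟩ : Pattern n d L) j s⟩
  · have := Pattern.ext_of_ins (p := ⟨τ, w⟩) (q := ⟨τ, w'⟩) rfl h
    exact eq_of_heq (Sigma.mk.inj this).2
  · rw [Finset.mem_filter] at hI
    have hne := Finsupp.mem_support_iff.1 hI.1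
    have h1 : highDeg L I ≤ d := by
      by_contra hc
      exact hne (mem_lowDeg.1 hω I (by omega))
    obtain ⟨w, hw⟩ := exists_pattern h1 τ fun s => by rw [hI.2]; exact hj s
    have hj' : (fun s => I (τ s)) = j := funext hI.2
    rw [hj'] at hw
    exact ⟨w, Finset.mem_filter.2 ⟨Finset.mem_univ _, by rw [hw]; exact hne⟩, hw⟩
  · have := Pattern.extend_ins (⟨τ, w⟩ : Pattern n d L) u j
    dsimp only at this
    rw [this]
    rfl

variable (S : Submodule R ((Fin n → ℕ) →₀ R))

variable (d L) in
/-- The coefficients that occur as the leading coefficients of relations, for all large entries at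
the marked places. -/
def leadRel : Submodule R (Pattern n d L → R) where
  carrier := {c | ∃ l, ∀ u : Fin d → ℕ, (∀ s, l ≤ u s) → ∃ κ ∈ S, κ - lead R u c ∈ lowDeg R n l d}
  zero_mem' := ⟨0, fun u _ => ⟨0, S.zero_mem, by simp⟩⟩
  add_mem' := by
    rintro c c' ⟨l, h⟩ ⟨l', h'⟩
    refine ⟨max l l', fun u hu => ?_⟩
    obtain ⟨κ, hκ, h1⟩ := h u fun s => (le_max_left _ _).trans (hu s)
    obtain ⟨κ', hκ', h2⟩ := h' u fun s => (le_max_right _ _).trans (hu s)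
    refine ⟨κ + κ', S.add_mem hκ hκ', ?_⟩
    rw [map_add, add_sub_add_comm]
    exact Submodule.add_mem _ (lowDeg_mono (le_max_left _ _) le_rfl h1)
      (lowDeg_mono (le_max_right _ _) le_rfl h2)
  smul_mem' := by
    rintro r c ⟨l, h⟩
    refine ⟨l, fun u hu => ?_⟩
    obtain ⟨κ, hκ, h1⟩ := h u hu
    refine ⟨r • κ, S.smul_mem r hκ, ?_⟩
    rw [map_smul, ← smul_sub]
    exact Submodule.smul_mem _ r h1

variable {S}

/-- Leading coefficients seen at one `j` recur at all large `u`, because `j` can be raised to `u`.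
Relations in infinitely many multi-indices are thereby governed by a submodule of a free module on
the finite set of patterns. -/
lemma RaiseStable.symb_mem (hS : RaiseStable S) {ω : (Fin n → ℕ) →₀ R} (hω : ω ∈ S)
    (hL : ω ∈ lowDeg R n L (d + 1)) (j : Fin d → ℕ) (hj : ∀ s, L ≤ j s) :
    symb L j ω ∈ leadRel d L S := by
  obtain ⟨l, hl⟩ := exists_indexLT ω
  -- All indices of `ω` and all `j s` have to be below the threshold for `exists_raises`.
  let l' := max l (Finset.univ.sup j + 1)
  refine ⟨l', fun u hu => ?_⟩
  rw [← raises_eq_lead hL j u hj]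
  refine (hS.exists_raises hω (hl l' (le_max_left _ _)) j u (fun s => ?_) hu).2
  have h1 : j s ≤ Finset.univ.sup j := Finset.le_sup (f := j) (Finset.mem_univ s)
  have h2 : Finset.univ.sup j + 1 ≤ l' := le_max_right _ _
  omega

-- The bounds force exactly `d` entries of `I` to be at least `L`, and these are even at least `L'`.
-- Each ordering of their places gives one pair.
open Classical in
lemma card_ins_eq {L' B : ℕ} (hLL : L ≤ L') {I : Fin n → ℕ} (hL : highDeg L I ≤ d)
    (hL' : d ≤ highDeg L' I) (hB : ∀ i, I i < B) :
    ((Fintype.piFinset (fun _ : Fin d => Finset.Ico L' B) ×ˢ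
      (Finset.univ : Finset (Pattern n d L))).filter fun a => a.2.ins a.1 = I).card =
        d.factorial := by
  have hc : Fintype.card {i // L' ≤ I i} = d := by
    rw [Fintype.card_subtype]
    exact le_antisymm ((highDeg_anti hLL I).trans hL) hL'
  have : Fintype.card (Fin d ↪ {i // L' ≤ I i}) = d.factorial := by
    rw [Fintype.card_embedding_eq, hc, Fintype.card_fin, Nat.descFactorial_self]
  rw [← this, ← Finset.card_univ]
  have hmem : ∀ a ∈ ((Fintype.piFinset (fun _ : Fin d => Finset.Ico L' B) ×ˢ
      (Finset.univ : Finset (Pattern n d L))).filter fun a => a.2.ins a.1 = I),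
      (∀ s, I (a.2.1 s) = a.1 s) ∧ ∀ s, L' ≤ I (a.2.1 s) := by
    intro a ha
    rw [Finset.mem_filter, Finset.mem_product, Fintype.mem_piFinset] at ha
    have h1 : ∀ s, I (a.2.1 s) = a.1 s := fun s => by rw [← ha.2, a.2.ins_apply]
    exact ⟨h1, fun s => by rw [h1]; exact (Finset.mem_Ico.1 (ha.1.1 s)).1⟩
  refine Finset.card_bij (fun a ha => ⟨fun s => ⟨a.2.1 s, (hmem a ha).2 s⟩, fun s s' h =>
    a.2.1.injective (congrArg Subtype.val h)⟩) (fun _ _ => Finset.mem_univ _) ?_ ?_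
  · intro a ha b hb h
    have h1 : a.2.1 = b.2.1 := DFunLike.ext _ _ fun s =>
      congrArg Subtype.val (DFunLike.congr_fun h s)
    have h2 : a.1 = b.1 := funext fun s => by
      rw [← (hmem a ha).1, ← (hmem b hb).1, h1]
    refine Prod.ext h2 (Pattern.ext_of_ins h1 (j := a.1) (j' := b.1) ?_)
    rw [(Finset.mem_filter.1 ha).2, (Finset.mem_filter.1 hb).2]
  · intro e _
    obtain ⟨w, hw⟩ := exists_pattern hL (e.trans (Function.Embedding.subtype _))
      fun s => hLL.trans (e s).2
    refine ⟨(fun s => I (e s), ⟨_, w⟩), ?_, rfl⟩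
    rw [Finset.mem_filter, Finset.mem_product, Fintype.mem_piFinset]
    exact ⟨⟨fun s => Finset.mem_Ico.2 ⟨(e s).2, hB _⟩, Finset.mem_univ _⟩, hw⟩

/-- Multi-indices with at least `d` entries from `L'` on are counted `d!` times, by `card_ins_eq`;
the others are absorbed by `lowDeg`. -/
lemma sum_lead_symb {L' B : ℕ} (hLL : L ≤ L') {z : (Fin n → ℕ) →₀ R}
    (hz : z ∈ lowDeg R n L (d + 1)) (hB : IndexLT B z) :
    (d.factorial : R) • z - ∑ j ∈ Fintype.piFinset (fun _ : Fin d => Finset.Ico L' B),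
      lead R j (symb L j z) ∈ lowDeg R n L' d := by
  classical
  refine mem_lowDeg.2 fun I hI => ?_
  have h1 : (∑ j ∈ Fintype.piFinset (fun _ : Fin d => Finset.Ico L' B),
      lead R j (symb L j z)) I = ∑ a ∈ ((Fintype.piFinset (fun _ : Fin d => Finset.Ico L' B) ×ˢ
      (Finset.univ : Finset (Pattern n d L))).filter fun a => a.2.ins a.1 = I), z I := by
    rw [Finset.sum_filter, Finset.sum_product, Finsupp.finsetSum_apply]
    refine Finset.sum_congr rfl fun j _ => ?_
    rw [lead_apply, Finsupp.finsetSum_apply]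
    refine Finset.sum_congr rfl fun p _ => ?_
    rw [Finsupp.single_apply, symb_apply]
    split_ifs with h
    · rw [h]
    · rfl
  rw [Finsupp.sub_apply, h1, Finset.sum_const, Finsupp.smul_apply]
  by_cases hzI : z I = 0
  · rw [hzI, smul_zero, smul_zero, sub_zero]
  · rw [card_ins_eq hLL ?_ hI (hB I hzI), Nat.cast_smul_eq_nsmul, sub_self]
    by_contra hc
    exact hzI (mem_lowDeg.1 hz I (by omega))

variable [IsDomain R]

open Classical in
variable (S d L) in
/-- The relations in top degree `d`, in echelon form. -/
lemma exists_leadRel_echelon : ∃ (L' : ℕ) (Q : Finset (Pattern n d L)) (β : R)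
    (c : Pattern n d L → Pattern n d L → R), L ≤ L' ∧ β ≠ 0 ∧
      (∀ q ∈ Q, ∀ q' ∈ Q, c q q' = if q = q' then β else 0) ∧
      (∀ v ∈ leadRel d L S, β • v = ∑ q ∈ Q, v q • c q) ∧
      ∀ q ∈ Q, ∀ u : Fin d → ℕ, (∀ s, L' ≤ u s) → ∃ κ ∈ S, κ - lead R u (c q) ∈ lowDeg R n L' d := by
  obtain ⟨Q, β, c, hβ, hc, hδ, h⟩ := exists_echelon (leadRel d L S)
  choose! l hl using hc
  -- One threshold serves the finitely many pivot relations.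
  refine ⟨L + Q.sup l, Q, β, c, Nat.le_add_right _ _, hβ, hδ, h, fun q hq u hu => ?_⟩
  have h1 : l q ≤ L + Q.sup l := (Finset.le_sup hq).trans (Nat.le_add_left _ _)
  obtain ⟨κ, hκ, h2⟩ := hl q hq u fun s => h1.trans (hu s)
  exact ⟨κ, hκ, lowDeg_mono h1 le_rfl h2⟩

/-- The coefficients of `ω` lie in `I`. -/
def CoeffIn (I : Ideal R) (ω : (Fin n → ℕ) →₀ R) : Prop := ∀ J, ω J ∈ I

lemma CoeffIn.of_mem_smul {I : Ideal R} {ω : (Fin n → ℕ) →₀ R} (h : ω ∈ I • S) : CoeffIn I ω := by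
  induction h using Submodule.smul_induction_on' with
  | smul r hr m hm => exact fun J => I.mul_mem_right _ hr
  | add y hy z hz h1 h2 => exact fun J => I.add_mem (h1 J) (h2 J)

variable (d L) in
/-- Relations with coefficients in an ideal `I` can be reduced to lower degree, up to a nonzero
scalar independent of `I`, by subtracting relations multiplied by elements of `I`. -/
lemma RaiseStable.exists_reduction [CharZero R] (hS : RaiseStable S) :
    ∃ (L' : ℕ) (b : R), b ≠ 0 ∧ ∀ (I : Ideal R), ∀ z ∈ S, z ∈ lowDeg R n L (d + 1) → CoeffIn I z →
      ∃ A ∈ I • S, b • z - A ∈ lowDeg R n L' d := by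
  classical
  obtain ⟨L', Q, β, c, hLL, hβ, hδ, h, hκ⟩ := exists_leadRel_echelon d L S
  choose! κ hκS hκ using hκ
  refine ⟨L', β * d.factorial, mul_ne_zero hβ (Nat.cast_ne_zero.2 d.factorial_ne_zero),
    fun I z hz hzL hzI => ?_⟩
  obtain ⟨B, hB⟩ := exists_indexLT z
  set J := Fintype.piFinset (fun _ : Fin d => Finset.Ico L' B) with hJ
  have hJL : ∀ j ∈ J, ∀ s, L' ≤ j s := fun j hj s =>
    (Finset.mem_Ico.1 (Fintype.mem_piFinset.1 hj s)).1
  -- Each leading term is replaced by a relation `κ q j` having it. The multipliers are coefficients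
  -- of `z`, hence lie in `I`, and the scalar `β d!` depends neither on `z` nor on `I`.
  refine ⟨∑ j ∈ J, ∑ q ∈ Q, symb L j z q • κ q j, Submodule.sum_mem _ fun j hj =>
    Submodule.sum_mem _ fun q hq => Submodule.smul_mem_smul (hzI _) (hκS q hq j (hJL j hj)), ?_⟩
  have h1 : ∑ j ∈ J, ∑ q ∈ Q, symb L j z q • (κ q j - lead R j (c q)) ∈ lowDeg R n L' d :=
    Submodule.sum_mem _ fun j hj => Submodule.sum_mem _ fun q hq =>
      Submodule.smul_mem _ _ (hκ q hq j (hJL j hj))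
  have h2 := Submodule.smul_mem _ β (sum_lead_symb (B := B) hLL hzL (hB B le_rfl))
  rw [← hJ] at h2
  have h3 : ∑ j ∈ J, ∑ q ∈ Q, symb L j z q • lead R j (c q) =
      β • ∑ j ∈ J, lead R j (symb L j z) := by
    rw [Finset.smul_sum]
    refine Finset.sum_congr rfl fun j hj => ?_
    rw [← map_smul, h _ (hS.symb_mem hz hzL j fun s => hLL.trans (hJL j hj s)), map_sum]
    simp only [map_smul]
  convert Submodule.sub_mem _ h2 h1 using 1
  simp only [smul_sub, Finset.sum_sub_distrib, h3, mul_smul]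
  abel

end Patterns

/-! ### Generic flatness for relations that are stable under raising indices -/

section GenericFlatness

variable {R : Type*} [CommRing R]

variable {n : ℕ} {S : Submodule R ((Fin n → ℕ) →₀ R)} [IsDomain R]

/-- Generic flatness: at primes in a nonempty open set, relations with coefficients in the prime
ideal are locally combinations of relations with coefficients in that ideal. -/
theorem RaiseStable.exists_flat [CharZero R] (hS : RaiseStable S) :
    ∃ b : R, b ≠ 0 ∧ ∀ (𝔭 : Ideal R) [𝔭.IsPrime], b ∉ 𝔭 → ∀ z ∈ S, CoeffIn 𝔭 z →
      z ∈ localSat 𝔭 (𝔭 • S) := by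
  have key : ∀ e ≤ n + 1, ∃ (L : ℕ) (b : R), b ≠ 0 ∧ ∀ (𝔭 : Ideal R) [𝔭.IsPrime], b ∉ 𝔭 →
      ∀ z ∈ S, CoeffIn 𝔭 z → ∃ s ∉ 𝔭, ∃ z' ∈ S, z' ∈ lowDeg R n L (n + 1 - e) ∧
        s • z - z' ∈ 𝔭 • S := by
    intro e
    induction e with
    | zero =>
      refine fun _ => ⟨0, 1, one_ne_zero, fun 𝔭 h𝔭 h1 z hz _ => ⟨1, h1, z, hz, ?_, ?_⟩⟩
      · rw [Nat.sub_zero, lowDeg_top]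
        trivial
      · rw [one_smul, sub_self]
        exact Submodule.zero_mem _
    | succ e ih =>
      intro he
      obtain ⟨L, b, hb, ih⟩ := ih (by omega)
      obtain ⟨L', β, hβ, h⟩ := hS.exists_reduction (n + 1 - (e + 1)) L
      refine ⟨L', b * β, mul_ne_zero hb hβ, fun 𝔭 h𝔭 hbβ z hz hzI => ?_⟩
      obtain ⟨s, hs, z', hz', hzL, hsub⟩ := ih 𝔭 (fun h => hbβ (𝔭.mul_mem_right _ h)) z hz hzI
      -- `z'` differs from `s • z` by an element of `𝔭 • S`, so its coefficients lie in `𝔭` again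
      -- and the induction can go on.
      have hzI' : CoeffIn 𝔭 z' := fun J => by
        have h1 := CoeffIn.of_mem_smul hsub J
        have h2 : (s • z) J ∈ 𝔭 := 𝔭.mul_mem_left _ (hzI J)
        have h3 := 𝔭.sub_mem h2 h1
        rwa [Finsupp.sub_apply, sub_sub_cancel] at h3
      obtain ⟨A, hA, hAL⟩ := h 𝔭 z' hz' (by
        rwa [show n + 1 - (e + 1) + 1 = n + 1 - e by omega]) hzI'
      refine ⟨β * s, fun h => (h𝔭.mem_or_mem h).elim (fun h => hbβ (𝔭.mul_mem_left _ h)) hs,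
        β • z' - A, S.sub_mem (S.smul_mem _ hz') (Submodule.smul_le_right hA), hAL, ?_⟩
      have := Submodule.add_mem _ (Submodule.smul_mem _ β hsub) hA
      rwa [smul_sub, sub_add, ← mul_smul] at this
  obtain ⟨L, b, hb, h⟩ := key (n + 1) le_rfl
  refine ⟨b, hb, fun 𝔭 h𝔭 hb𝔭 z hz hzI => ?_⟩
  obtain ⟨s, hs, z', -, hz', hsub⟩ := h 𝔭 hb𝔭 z hz hzI
  rw [Nat.sub_self, lowDeg_bot, Submodule.mem_bot] at hz'
  rw [hz', sub_zero] at hsub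
  exact ⟨s, hs, hsub⟩

lemma mem_smul_top_of_coeffIn {I : Ideal R} {ω : (Fin n → ℕ) →₀ R} (h : CoeffIn I ω) :
    ω ∈ I • (⊤ : Submodule R ((Fin n → ℕ) →₀ R)) := by
  rw [← Finsupp.sum_single ω]
  refine Submodule.sum_mem _ fun J _ => ?_
  have : Finsupp.single J (ω J) = ω J • (Finsupp.single J 1 : (Fin n → ℕ) →₀ R) := by simp
  rw [this]
  exact Submodule.smul_mem_smul (h J) trivial

lemma CoeffIn.add {I : Ideal R} {ω ω' : (Fin n → ℕ) →₀ R} (h : CoeffIn I ω) (h' : CoeffIn I ω') :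
    CoeffIn I (ω + ω') := fun J => I.add_mem (h J) (h' J)

lemma CoeffIn.smul {I : Ideal R} {ω : (Fin n → ℕ) →₀ R} (h : CoeffIn I ω) (r : R) :
    CoeffIn I (r • ω) := fun J => I.mul_mem_left r (h J)

/-- Locally every element is a relation plus an element of low degree. Multiplying such
decompositions by coefficients in `𝔭` keeps the coefficients of the low part in `𝔭`. -/
lemma exists_lowDeg_of_coeffIn {𝔭 : Ideal R} [h𝔭 : 𝔭.IsPrime] {L d : ℕ}
    (hT : localSat 𝔭 (S ⊔ lowDeg R n L d) = ⊤) {μ : (Fin n → ℕ) →₀ R} (hμ : CoeffIn 𝔭 μ) :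
    ∃ t ∉ 𝔭, ∃ μ' ∈ lowDeg R n L d, CoeffIn 𝔭 μ' ∧ t • μ - μ' ∈ S := by
  have h := mem_smul_top_of_coeffIn hμ
  clear hμ
  induction h using Submodule.smul_induction_on' with
  | smul r hr m hm =>
    obtain ⟨t, ht, h⟩ : m ∈ localSat 𝔭 (S ⊔ lowDeg R n L d) := by rw [hT]; trivial
    obtain ⟨σ, hσ, μ', hμ', h⟩ := Submodule.mem_sup.1 h
    refine ⟨t, ht, r • μ', Submodule.smul_mem _ _ hμ', fun J => 𝔭.mul_mem_right _ hr, ?_⟩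
    rw [smul_comm, ← smul_sub, ← h, add_sub_cancel_right]
    exact S.smul_mem _ hσ
  | add y hy z hz h1 h2 =>
    obtain ⟨t, ht, μ, hμ, hc, h⟩ := h1
    obtain ⟨t', ht', μ', hμ', hc', h'⟩ := h2
    refine ⟨t * t', fun h => (h𝔭.mem_or_mem h).elim ht ht', t' • μ + t • μ',
      Submodule.add_mem _ (Submodule.smul_mem _ _ hμ) (Submodule.smul_mem _ _ hμ'),
      (hc.smul _).add (hc'.smul _), ?_⟩
    have := S.add_mem (S.smul_mem t' h) (S.smul_mem t h')
    convert this using 1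
    rw [smul_add, mul_comm, mul_smul, mul_comm, mul_smul, smul_sub, smul_sub]
    abel

variable (S) in
/-- The relations span the given basis vectors modulo `𝔭`, locally at `𝔭`. -/
def SpansMod (𝔭 : Ideal R) (X : Finset (Fin n → ℕ)) : Prop :=
  ∀ I ∈ X, ∃ s ∉ 𝔭, ∃ ν ∈ S, CoeffIn 𝔭 (s • Finsupp.single I 1 - ν)

-- If the relations span enough basis vectors modulo `𝔭`, every pattern is a pivot of the echelon
-- form, and then `β` times a basis vector with large marked entries is a relation up to lower
-- degree. A test at one tuple `v` thus decides about all large tuples `u`.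
variable (L d : ℕ) in
lemma RaiseStable.exists_all_patterns (hS : RaiseStable S) :
    ∃ (L' : ℕ) (β : R) (X : Finset (Fin n → ℕ)), L ≤ L' ∧ β ≠ 0 ∧
      ∀ (𝔭 : Ideal R) [𝔭.IsPrime], β ∉ 𝔭 → SpansMod S 𝔭 X →
      localSat 𝔭 (S ⊔ lowDeg R n L (d + 1)) = ⊤ → ∀ (p : Pattern n d L) (u : Fin d → ℕ),
        (∀ s, L' ≤ u s) → β • Finsupp.single (p.ins u) 1 ∈ S ⊔ lowDeg R n L' d := by
  classical
  obtain ⟨L', Q, β, c, hLL, hβ, hδ, h, hκ⟩ := exists_leadRel_echelon d L S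
  -- Distinct entries, all at least `L`, so that different patterns give different multi-indices.
  let v : Fin d → ℕ := fun s => L + s
  refine ⟨L', β, Finset.univ.image fun p : Pattern n d L => p.ins v, hLL, hβ,
    fun 𝔭 h𝔭 hβ𝔭 hspan hT p u hu => ?_⟩
  have hpQ : ∀ p, p ∈ Q := by
    intro p
    by_contra hp
    have hv : ∀ s, L ≤ v s := fun s => Nat.le_add_right _ _
    have hvi : Function.Injective v := fun s s' h => Fin.ext (Nat.add_left_cancel h)
    obtain ⟨s, hs, ν, hν, hμ⟩ :=
      hspan (p.ins v) (Finset.mem_image_of_mem _ (Finset.mem_univ p))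
    obtain ⟨t, ht, μ', hμ', hc, hS'⟩ := exists_lowDeg_of_coeffIn hT hμ
    -- A relation whose symbol at `v` has entries in `𝔭` at all pivots but not at `p`. The echelon
    -- identity contradicts this: it makes `β` times the entry at `p` a combination of the entries
    -- at the pivots.
    let ν' := (t * s) • Finsupp.single (p.ins v) 1 - μ'
    have hν' : ν' ∈ S := by
      have := S.add_mem hS' (S.smul_mem t hν)
      convert this using 1
      simp only [ν', smul_sub, mul_smul]
      abel
    have hν'L : ν' ∈ lowDeg R n L (d + 1) := by
      refine Submodule.sub_mem _ (Submodule.smul_mem _ _ (Finsupp.single_mem_supported _ _ ?_)) hμ'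
      change highDeg L (p.ins v) < d + 1
      rw [p.highDeg_ins le_rfl hv]
      exact Nat.lt_succ_self d
    have h1 := congrFun (h _ (hS.symb_mem hν' hν'L v hv)) p
    have h2 : ∀ q ∈ Q, symb L v ν' q ∈ 𝔭 := by
      intro q hq
      rw [symb_apply]
      have hne : p.ins v ≠ q.ins v := fun h => hp (Pattern.ins_injective hvi hv h ▸ hq)
      simp only [ν', Finsupp.sub_apply, Finsupp.smul_apply, Finsupp.single_eq_of_ne hne.symm,
        smul_zero, zero_sub]
      exact 𝔭.neg_mem (hc _)
    rw [Pi.smul_apply, Finset.sum_apply, smul_eq_mul] at h1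
    have h3 : β * symb L v ν' p ∈ 𝔭 := by
      rw [h1]
      exact 𝔭.sum_mem fun q hq => 𝔭.mul_mem_right _ (h2 q hq)
    have h4 : symb L v ν' p ∈ 𝔭 := (h𝔭.mem_or_mem h3).resolve_left hβ𝔭
    rw [symb_apply] at h4
    have h5 := 𝔭.add_mem h4 (hc (p.ins v))
    simp only [ν', Finsupp.sub_apply, sub_add_cancel, Finsupp.smul_apply,
      Finsupp.single_eq_same, smul_eq_mul, mul_one] at h5
    exact (h𝔭.mem_or_mem h5).elim ht hs
  obtain ⟨κ, hκS, hκL⟩ := hκ p (hpQ p) u hu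
  have hlead : lead R u (c p) = β • Finsupp.single (p.ins u) 1 := by
    rw [lead_apply, Finset.sum_eq_single p]
    · rw [hδ p (hpQ p) p (hpQ p), if_pos rfl]
      simp
    · intro q _ hne
      rw [hδ p (hpQ p) q (hpQ q), if_neg hne.symm, Finsupp.single_zero]
    · exact fun h => absurd (Finset.mem_univ _) h
  rw [← hlead]
  refine Submodule.mem_sup.2 ⟨κ, hκS, lead R u (c p) - κ, ?_, by abel⟩
  rw [← neg_sub]
  exact Submodule.neg_mem _ hκL

/-- At primes in a nonempty open set, if the relations span everything modulo the prime, then they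
locally span everything. -/
theorem RaiseStable.exists_nakayama (hS : RaiseStable S) :
    ∃ (b : R) (X : Finset (Fin n → ℕ)), b ≠ 0 ∧
      ∀ (𝔭 : Ideal R) [𝔭.IsPrime], b ∉ 𝔭 → SpansMod S 𝔭 X → localSat 𝔭 S = ⊤ := by
  classical
  have key : ∀ e ≤ n + 1, ∃ (L : ℕ) (b : R) (X : Finset (Fin n → ℕ)), b ≠ 0 ∧
      ∀ (𝔭 : Ideal R) [𝔭.IsPrime], b ∉ 𝔭 → SpansMod S 𝔭 X → localSat 𝔭 (S ⊔ lowDeg R n L (n + 1 - e)) = ⊤ := by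
    intro e
    induction e with
    | zero =>
      refine fun _ => ⟨0, 1, ∅, one_ne_zero, fun 𝔭 h𝔭 h1 _ => eq_top_iff.2 fun z _ => ⟨1, h1, ?_⟩⟩
      rw [Nat.sub_zero, lowDeg_top, sup_top_eq]
      trivial
    | succ e ih =>
      intro he
      obtain ⟨L, b, X, hb, ih⟩ := ih (by omega)
      obtain ⟨L', β, X', hLL, hβ, h⟩ := hS.exists_all_patterns L (n + 1 - (e + 1))
      refine ⟨L', b * β, X ∪ X', mul_ne_zero hb hβ, fun 𝔭 h𝔭 hbβ hspan' => ?_⟩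
      have hspan : SpansMod S 𝔭 X := fun I hI => hspan' I (Finset.mem_union_left _ hI)
      replace hspan' : SpansMod S 𝔭 X' := fun I hI => hspan' I (Finset.mem_union_right _ hI)
      have hT := ih 𝔭 (fun h => hbβ (𝔭.mul_mem_right _ h)) hspan
      rw [show n + 1 - e = n + 1 - (e + 1) + 1 by omega] at hT
      have hβ𝔭 : β ∉ 𝔭 := fun h => hbβ (𝔭.mul_mem_left _ h)
      replace h := h 𝔭 hβ𝔭 hspan' hT
      set d := n + 1 - (e + 1)
      -- A multi-index with `d` entries from `L'` on has the form `p.ins u` with `u` large, and `β`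
      -- moves it into `S` plus lower degree; one with fewer such entries is already low.
      have h1 : S ⊔ lowDeg R n L (d + 1) ≤ localSat 𝔭 (S ⊔ lowDeg R n L' d) := by
        refine sup_le (fun z hz => ⟨β, hβ𝔭, Submodule.smul_mem _ _ (Submodule.mem_sup_left hz)⟩)
          fun z hz => ?_
        refine ⟨β, hβ𝔭, ?_⟩
        rw [← Finsupp.sum_single z, Finsupp.sum, Finset.smul_sum]
        refine Submodule.sum_mem _ fun I hI => ?_
        have hsingle : Finsupp.single I (z I) = z I • (Finsupp.single I 1 : (Fin n → ℕ) →₀ R) := by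
          simp
        rw [hsingle, smul_comm]
        refine Submodule.smul_mem _ _ ?_
        have hIL : highDeg L I ≤ d := by
          by_contra hc
          exact Finsupp.mem_support_iff.1 hI (mem_lowDeg.1 hz I (by omega))
        by_cases hId : d ≤ highDeg L' I
        · have hcard : Fintype.card (Fin d) ≤ Fintype.card {i // L' ≤ I i} := by
            rw [Fintype.card_fin, Fintype.card_subtype]
            exact hId
          obtain ⟨τ⟩ := Function.Embedding.nonempty_of_card_le hcard
          obtain ⟨w, hw⟩ := exists_pattern hIL (τ.trans (Function.Embedding.subtype _))
            fun s => hLL.trans (τ s).2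
          rw [← hw]
          exact h _ _ fun s => (τ s).2
        · exact Submodule.smul_mem _ _ (Submodule.mem_sup_right
            (Finsupp.single_mem_supported _ _ (show highDeg L' I < d by omega)))
      refine eq_top_iff.2 fun z _ => ?_
      obtain ⟨s, hs, hz⟩ : z ∈ localSat 𝔭 (S ⊔ lowDeg R n L (d + 1)) := by rw [hT]; trivial
      exact mem_localSat_of_smul hs (h1 hz)
  obtain ⟨L, b, X, hb, h⟩ := key (n + 1) le_rfl
  refine ⟨b, X, hb, fun 𝔭 h𝔭 hb𝔭 hspan => ?_⟩
  have := h 𝔭 hb𝔭 hspan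
  rwa [Nat.sub_self, lowDeg_bot, sup_bot_eq] at this

end GenericFlatness

/-! ### Relations between the values of an equivariant multilinear map -/

section FormRelations

variable {k : Type u} [Field k] [CharZero k]
variable {R : Type u} [CommRing R] [Algebra k R] [MulSemiringAction (GLinf k) R]
  [IsFormSpanned k R]
variable {N : Type u} [AddCommGroup N] [Module k N] [Module R N] [IsScalarTower k R N]
  [DistribMulAction (GLinf k) N] [SMulDistribClass (GLinf k) R N]

/-- The product of an equivariant multilinear map to `R` and one to `N`. -/
def smulForm {p n : ℕ} (F : MultilinearMap k (fun _ : Fin p => StdRep k) R)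
    (f : MultilinearMap k (fun _ : Fin n => StdRep k) N) :
    MultilinearMap k (fun _ : Fin (p + n) => StdRep k) N :=
  ((TensorProduct.lift (Algebra.lsmul k k N : R →ₐ[k] Module.End k N).toLinearMap).compMultilinearMap
    (F.domCoprod f)).domDomCongr finSumFinEquiv

lemma smulForm_apply {p n : ℕ} (F : MultilinearMap k (fun _ : Fin p => StdRep k) R)
    (f : MultilinearMap k (fun _ : Fin n => StdRep k) N) (v : Fin (p + n) → StdRep k) :
    smulForm F f v = F (fun i => v (Fin.castAdd n i)) • f fun i => v (Fin.natAdd p i) := rfl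

lemma smulForm_equivariant {p n : ℕ} {F : MultilinearMap k (fun _ : Fin p => StdRep k) R}
    {f : MultilinearMap k (fun _ : Fin n => StdRep k) N} (hF : GLEquivariant F)
    (hf : GLEquivariant f) : GLEquivariant (smulForm F f) := fun g v => by
  rw [smulForm_apply, smulForm_apply, hF g fun i => v (Fin.castAdd n i),
    hf g fun i => v (Fin.natAdd p i)]
  exact (smul_distrib_smul g _ _).symm

lemma update_append_left {α : Type*} {p n : ℕ} (v : Fin p → α) (w : Fin n → α) (a : Fin p) (e : α) :
    Function.update (Fin.append v w) (Fin.castAdd n a) e = Fin.append (Function.update v a e) w := by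
  funext b
  refine Fin.addCases (fun b => ?_) (fun b => ?_) b
  · by_cases hb : b = a
    · subst hb; simp
    · rw [Function.update_of_ne (by simpa [Fin.ext_iff] using hb), Fin.append_left, Fin.append_left,
        Function.update_of_ne hb]
  · rw [Function.update_of_ne (by simp [Fin.ext_iff]; omega), Fin.append_right, Fin.append_right]

lemma update_append_right {α : Type*} {p n : ℕ} (v : Fin p → α) (w : Fin n → α) (a : Fin n)
    (e : α) :
    Function.update (Fin.append v w) (Fin.natAdd p a) e = Fin.append v (Function.update w a e) := by
  funext b
  refine Fin.addCases (fun b => ?_) (fun b => ?_) b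
  · rw [Function.update_of_ne (by simp [Fin.ext_iff]; omega), Fin.append_left, Fin.append_left]
  · by_cases hb : b = a
    · subst hb; simp
    · rw [Function.update_of_ne (by simpa [Fin.ext_iff] using hb), Fin.append_right,
        Fin.append_right, Function.update_of_ne hb]

lemma smulForm_append {p n : ℕ} (F : MultilinearMap k (fun _ : Fin p => StdRep k) R)
    (f : MultilinearMap k (fun _ : Fin n => StdRep k) N) (v : Fin p → StdRep k)
    (w : Fin n → StdRep k) : smulForm F f (Fin.append v w) = F v • f w := by
  rw [smulForm_apply]
  simp only [Fin.append_left, Fin.append_right]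

/-- The Leibniz rule for the infinitesimal action of `E` on a product. -/
lemma sum_smulForm_update {p n : ℕ} (F : MultilinearMap k (fun _ : Fin p => StdRep k) R)
    (f : MultilinearMap k (fun _ : Fin n => StdRep k) N) (v : Fin p → StdRep k)
    (w : Fin n → StdRep k) (E : StdRep k →ₗ[k] StdRep k) :
    ∑ a, smulForm F f (Function.update (Fin.append v w) a (E (Fin.append v w a))) =
      (∑ a, F (Function.update v a (E (v a)))) • f w +
        F v • ∑ a, f (Function.update w a (E (w a))) := by
  rw [Fin.sum_univ_add, Finset.sum_smul, Finset.smul_sum]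
  congr 1
  · refine Finset.sum_congr rfl fun a _ => ?_
    rw [Fin.append_left, update_append_left, smulForm_append]
  · refine Finset.sum_congr rfl fun a _ => ?_
    rw [Fin.append_right, update_append_right, smulForm_append]

variable (R) in
/-- The map sending a multi-index `I` to the value of `f` at the basis vectors `e_{I 0}, …`. -/
def basisValues {n : ℕ} (f : MultilinearMap k (fun _ : Fin n => StdRep k) N) :
    ((Fin n → ℕ) →₀ R) →ₗ[R] N :=
  Finsupp.linearCombination R fun I => f fun i => Finsupp.single (I i) 1

lemma basisValues_single {n : ℕ} (f : MultilinearMap k (fun _ : Fin n => StdRep k) N)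
    (I : Fin n → ℕ) (r : R) :
    basisValues R f (Finsupp.single I r) = r • f fun i => Finsupp.single (I i) 1 := by
  simp [basisValues]

lemma basisValues_apply {n : ℕ} (f : MultilinearMap k (fun _ : Fin n => StdRep k) N)
    (ω : (Fin n → ℕ) →₀ R) :
    basisValues R f ω = ∑ I ∈ ω.support, ω I • f fun i => Finsupp.single (I i) 1 := by
  rw [basisValues, Finsupp.linearCombination_apply, Finsupp.sum]

/-- The endomorphism of `𝐕` taking `e_j` to `e_u` and killing the other basis vectors. -/
def matrixUnit (k : Type u) [Field k] (j u : ℕ) : StdRep k →ₗ[k] StdRep k :=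
  Finsupp.lsingle u ∘ₗ Finsupp.lapply j

/-- `raise` is the infinitesimal action of a matrix unit on basis tensors; places with an entry
other than `j` contribute zero. -/
lemma basisValues_raise_single {n : ℕ} (f : MultilinearMap k (fun _ : Fin n => StdRep k) N)
    (j u : ℕ) (I : Fin n → ℕ) :
    basisValues R f (raise R n j u (Finsupp.single I 1)) =
      ∑ i, f (Function.update (fun i => Finsupp.single (I i) 1) i
        (matrixUnit k j u (Finsupp.single (I i) 1))) := by
  rw [raise_single, map_sum, Finset.sum_filter]
  refine Finset.sum_congr rfl fun i _ => ?_
  split_ifs with h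
  · rw [basisValues_single, one_smul]
    congr 1
    funext a
    by_cases ha : a = i
    · subst ha
      simp [matrixUnit, h]
    · simp [Function.update_of_ne ha]
  · have : matrixUnit k j u (Finsupp.single (I i) 1) = 0 := by
      simp [matrixUnit, Finsupp.single_eq_of_ne (Ne.symm h)]
    rw [this]
    exact (f.map_coord_zero i (by simp)).symm

/-- Relations between values of equivariant multilinear maps can be differentiated along
endomorphisms of `𝐕`. -/
lemma sum_form_derivation {Λ : Type*} (q : Finset Λ) {p : Λ → ℕ}
    (H : ∀ i, MultilinearMap k (fun _ : Fin (p i) => StdRep k) N) (hH : ∀ i, GLEquivariant (H i))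
    (x : ∀ i, Fin (p i) → StdRep k) {Y : Submodule k N}
    (hY : ∀ (g : GLinf k), ∀ y ∈ Y, g • y ∈ Y) (h : ∑ i ∈ q, H i (x i) ∈ Y)
    (E : StdRep k →ₗ[k] StdRep k) :
    ∑ i ∈ q, ∑ a, H i (Function.update (x i) a (E (x i a))) ∈ Y := by
  refine multilinear_linear_mem Y q H x (fun i a => E (x i a))
    (Set.infinite_univ (α := k)) fun t _ => ?_
  exact sum_form_endo_mem Y hY q H hH x h (LinearMap.id + t • E)

lemma sum_form_smul_derivation {Λ : Type*} (q : Finset Λ) {p : Λ → ℕ} {n : ℕ}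
    {F : ∀ i, MultilinearMap k (fun _ : Fin (p i) => StdRep k) R} (hF : ∀ i, GLEquivariant (F i))
    {f : MultilinearMap k (fun _ : Fin n => StdRep k) N} (hf : GLEquivariant f)
    (v : ∀ i, Fin (p i) → StdRep k) (w : Λ → Fin n → StdRep k)
    {Y : Submodule k N} (hY : ∀ (g : GLinf k), ∀ y ∈ Y, g • y ∈ Y)
    (h : ∑ i ∈ q, F i (v i) • f (w i) ∈ Y) (E : StdRep k →ₗ[k] StdRep k) :
    ∑ i ∈ q, ((∑ a, F i (Function.update (v i) a (E (v i a)))) • f (w i) +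
      F i (v i) • ∑ a, f (Function.update (w i) a (E (w i a)))) ∈ Y := by
  have key := sum_form_derivation q (fun i => smulForm (F i) f)
    (fun i => smulForm_equivariant (hF i) hf) (fun i => Fin.append (v i) (w i)) hY (by
      convert h using 2 with i
      exact smulForm_append _ _ _ _) E
  convert key using 2 with i
  exact (sum_smulForm_update _ _ _ _ _).symm

/-- Write the coefficients of a relation as sums of values of forms and differentiate along the
matrix unit. By the Leibniz rule the result is the raised relation plus the old basis values with
differentiated coefficients, and the latter involve no new multi-indices. -/
theorem raiseStable_comap {n : ℕ} {f : MultilinearMap k (fun _ : Fin n => StdRep k) N}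
    (hf : GLEquivariant f) {Y : Submodule R N} (hY : ∀ (g : GLinf k), ∀ y ∈ Y, g • y ∈ Y) :
    RaiseStable (Y.comap (basisValues R f)) := by
  intro ω hω j u
  rw [Submodule.mem_comap, basisValues_apply] at hω
  choose m p F hF v hωF using fun I => exists_sum_form (k := k) (ω I)
  have key := sum_form_smul_derivation (ω.support.sigma fun I => (Finset.univ : Finset (Fin (m I))))
    (fun i => hF i.1 i.2) hf (fun i => v i.1 i.2) (fun i a => Finsupp.single (i.1 a) 1) (Y := Y.restrictScalars k) hY (by
      rw [Submodule.restrictScalars_mem]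
      convert hω using 1
      rw [Finset.sum_sigma]
      refine Finset.sum_congr rfl fun I _ => ?_
      conv_rhs => rw [hωF I, Finset.sum_smul]) (matrixUnit k j u)
  rw [Submodule.restrictScalars_mem] at key
  obtain ⟨c, hc⟩ : ∃ c : (Fin n → ℕ) → R, ∀ I, c I = ∑ s, ∑ a,
      F I s (Function.update (v I s) a (matrixUnit k j u (v I s a))) := ⟨_, fun _ => rfl⟩
  obtain ⟨ζ, hζdef⟩ : ∃ ζ : (Fin n → ℕ) →₀ R, ζ = ∑ I ∈ ω.support, Finsupp.single I (c I) :=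
    ⟨_, rfl⟩
  have hζ : ζ ∈ Finsupp.supported R R (ω.support : Set (Fin n → ℕ)) := by
    rw [hζdef]
    exact Submodule.sum_mem _ fun I hI => Finsupp.single_mem_supported _ _ hI
  have h1 : ∀ I, basisValues R f (raise R n j u (Finsupp.single I (ω I))) =
      ω I • basisValues R f (raise R n j u (Finsupp.single I 1)) := fun I => by
    rw [← map_smul, ← map_smul, Finsupp.smul_single, smul_eq_mul, mul_one]
  have h2 : raise R n j u ω = ∑ I ∈ ω.support, raise R n j u (Finsupp.single I (ω I)) := by
    conv_lhs => rw [← Finsupp.sum_single ω]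
    rw [Finsupp.sum, map_sum]
  refine ⟨ζ + raise R n j u ω, ?_, by rwa [add_sub_cancel_right]⟩
  rw [Submodule.mem_comap]
  convert key using 1
  rw [map_add, Finset.sum_sigma, h2, hζdef, map_sum, map_sum, ← Finset.sum_add_distrib]
  refine Finset.sum_congr rfl fun I _ => ?_
  rw [h1, basisValues_raise_single, basisValues_single, Finset.sum_add_distrib, hc, hωF I,
    Finset.sum_smul, Finset.sum_smul]

end FormRelations

/-! ### Fibers at generic points -/

section GenericFiber

variable {k : Type u} [Field k] [CharZero k]
variable {R : Type u} [CommRing R] [Algebra k R] [MulSemiringAction (GLinf k) R]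
  [IsFormSpanned k R]
variable {A B C : Type u}
  [AddCommGroup A] [Module k A] [Module R A] [IsScalarTower k R A]
  [DistribMulAction (GLinf k) A] [SMulDistribClass (GLinf k) R A] [IsFormSpanned k A]
  [AddCommGroup B] [Module k B] [Module R B] [IsScalarTower k R B]
  [DistribMulAction (GLinf k) B] [SMulDistribClass (GLinf k) R B] [IsFormSpanned k B]
  [AddCommGroup C] [Module k C] [Module R C] [IsScalarTower k R C]
  [DistribMulAction (GLinf k) C] [SMulDistribClass (GLinf k) R C] [IsFormSpanned k C]
variable {U : Type u} [AddCommGroup U] [Module k U]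

variable (k U) in
/-- The filter of pairs of maps `ψ : 𝐕 → U` and `φ : U → 𝐕` such that `ψ ∘ φ` is the identity on
larger and larger finite dimensional subspaces of `U`. -/
def sectionFilter : Filter ((StdRep k →ₗ[k] U) × (U →ₗ[k] StdRep k)) :=
  ⨅ w : U, Filter.principal {p | p.1 (p.2 w) = w}

lemma eventually_section (w : U) : ∀ᶠ p in sectionFilter k U, p.1 (p.2 w) = w :=
  Filter.mem_iInf_of_mem w (Filter.mem_principal_self _)

lemma eventually_push_eq (h : PolEval k B U) :
    ∀ᶠ p in sectionFilter k U, push p.1 (h.fn p.2) = h := by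
  induction h using PolEval.induction with
  | hform n f hf u =>
    filter_upwards [Filter.eventually_all.2 fun i => eventually_section (u i)] with p hp
    rw [evalForm_fn, push_form _ hf]
    simp only [hp]
  | hzero => exact Filter.Eventually.of_forall fun p => map_zero _
  | hadd a b ha hb =>
    filter_upwards [ha, hb] with p h1 h2
    rw [PolEval.fn_add, map_add, h1, h2]

lemma eventually_pushAlg_eq (a : AlgEval k R U) :
    ∀ᶠ p in sectionFilter k U, pushAlg p.1 (a.fn p.2) = a := by
  obtain ⟨h, rfl⟩ := toAlgEval_surjective a
  filter_upwards [eventually_push_eq h] with p hp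
  exact congrArg toAlgEval hp

lemma exists_subspace_of_eventually {P : (StdRep k →ₗ[k] U) × (U →ₗ[k] StdRep k) → Prop}
    (hP : ∀ᶠ p in sectionFilter k U, P p) :
    ∃ W : Submodule k U, FiniteDimensional k W ∧ ∀ p, (∀ w ∈ W, p.1 (p.2 w) = w) → P p := by
  obtain ⟨t, ht, h⟩ := (Filter.hasBasis_iInf_principal_finite
    fun w : U => {p : (StdRep k →ₗ[k] U) × (U →ₗ[k] StdRep k) | p.1 (p.2 w) = w}).mem_iff.1 hP
  refine ⟨Submodule.span k t, FiniteDimensional.span_of_finite k ht, fun p hp => h ?_⟩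
  exact Set.mem_iInter₂.2 fun w hw => hp w (Submodule.subset_span hw)

variable {x : AlgEval k R U →ₐ[k] k}

/-- `pointAt x ψ b` depends only on finitely many values of `ψ`, and `exists_section` leaves these
free. -/
lemma exists_section_pointAt_ne_zero (hx : IsGLGeneric x) {b : R} (hb : b ≠ 0)
    {P : (StdRep k →ₗ[k] U) × (U →ₗ[k] StdRep k) → Prop}
    (hP : ∀ᶠ p in sectionFilter k U, P p) : ∃ p, P p ∧ pointAt x p.1 b ≠ 0 := by
  obtain ⟨W, _, hW⟩ := exists_subspace_of_eventually hP
  obtain ⟨ψ₁, hψ₁⟩ := exists_pointAt_ne_zero hx hb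
  obtain ⟨l, hl⟩ := exists_push_bound (k := k) b
  obtain ⟨ψ, φ, h, hφ⟩ := exists_section W ψ₁ l
  refine ⟨(ψ, φ), hW _ hφ, ?_⟩
  rwa [pointAt_apply, pushAlg_apply, hl U ψ ψ₁ h]

/-- The residue field at `x` is `k`: the function `s` differs from the nonzero scalar `x s` by an
element of the maximal ideal, and that difference times `h` already lies in the product. -/
lemma mem_smul_of_mem_localSat {S : Submodule (AlgEval k R U) (PolEval k B U)}
    {h : PolEval k B U} (hS : h ∈ S) (hh : h ∈ localSat (RingHom.ker x) (RingHom.ker x • S)) :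
    h ∈ RingHom.ker x • S := by
  obtain ⟨s, hs, hsh⟩ := hh
  have h1 : s - algebraMap k _ (x s) ∈ RingHom.ker x := by
    rw [RingHom.mem_ker, map_sub, AlgHom.commutes]
    exact sub_self _
  have h2 := Submodule.sub_mem _ hsh (Submodule.smul_mem_smul h1 hS)
  rw [sub_smul, sub_sub_cancel] at h2
  have h3 := Submodule.smul_mem _ (algebraMap k (AlgEval k R U) (x s)⁻¹) h2
  rwa [smul_smul, ← map_mul, inv_mul_cancel₀ (fun h => hs h), map_one, one_smul] at h3

lemma smul_le_localSat {S T : Submodule (AlgEval k R U) (PolEval k B U)}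
    (h : S ≤ localSat (RingHom.ker x) T) (I : Ideal (AlgEval k R U)) :
    I • S ≤ localSat (RingHom.ker x) (I • T) := by
  refine Submodule.smul_le.2 fun a ha m hm => ?_
  obtain ⟨s, hs, hsm⟩ := h hm
  exact ⟨s, hs, by rw [smul_comm]; exact Submodule.smul_mem_smul ha hsm⟩

lemma evalSub_mono {Y Z : Submodule R B} (h : Y ≤ Z) : evalSub k U Y ≤ evalSub k U Z :=
  fun _ hh φ => h (hh φ)

lemma push_mem_evalSub {Y : Submodule R B} (hY : ∀ (g : GLinf k), ∀ y ∈ Y, g • y ∈ Y)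
    (ψ : StdRep k →ₗ[k] U) {y : B} (hy : y ∈ Y) : push ψ y ∈ evalSub k U Y := by
  have h1 := mem_formSpan_of_mem (k := k) (Y := Y.restrictScalars k) hY
    (by rw [IsFormSpanned.formSpan_top]; trivial) hy
  obtain ⟨m, n, f, v, hf, hfY, rfl⟩ := exists_sum_of_mem_formSpan h1
  rw [map_sum]
  refine Submodule.sum_mem _ fun i _ φ => ?_
  rw [push_form ψ (hf i)]
  exact hfY i _

lemma push_mem_smul_evalSub {Y : Submodule R B} (hY : ∀ (g : GLinf k), ∀ y ∈ Y, g • y ∈ Y)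
    (ψ : StdRep k →ₗ[k] U) {y : B} (hy : y ∈ RingHom.ker (pointAt x ψ) • Y) :
    push ψ y ∈ RingHom.ker x • evalSub k U Y := by
  induction hy using Submodule.smul_induction_on' with
  | smul r hr m hm =>
    rw [push_smul']
    exact Submodule.smul_mem_smul hr (push_mem_evalSub hY ψ hm)
  | add y hy z hz h1 h2 =>
    rw [map_add]
    exact Submodule.add_mem _ h1 h2

section Span

variable {n : ℕ} {f : MultilinearMap k (fun _ : Fin n => StdRep k) B}

variable (R) in
/-- The `R`-submodule spanned by the values of `f`. -/
def valueSpan (f : MultilinearMap k (fun _ : Fin n => StdRep k) B) : Submodule R B :=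
  Submodule.span R (Set.range f)

lemma mem_valueSpan (f : MultilinearMap k (fun _ : Fin n => StdRep k) B) (v : Fin n → StdRep k) :
    f v ∈ valueSpan R f := Submodule.subset_span ⟨v, rfl⟩

lemma valueSpan_stable (hf : GLEquivariant f) (g : GLinf k) {y : B} (hy : y ∈ valueSpan R f) :
    g • y ∈ valueSpan R f := by
  induction hy using Submodule.span_induction with
  | mem y hy =>
    obtain ⟨v, rfl⟩ := hy
    rw [← hf]
    exact mem_valueSpan f _
  | zero => rw [smul_zero]; exact Submodule.zero_mem _
  | add a b _ _ ha hb => rw [smul_add]; exact Submodule.add_mem _ ha hb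
  | smul r a _ ha => rw [smul_distrib_smul]; exact Submodule.smul_mem _ _ ha

lemma sup_stable {Y Z : Submodule R B} (hY : ∀ (g : GLinf k), ∀ y ∈ Y, g • y ∈ Y)
    (hZ : ∀ (g : GLinf k), ∀ y ∈ Z, g • y ∈ Z) (g : GLinf k) {y : B} (hy : y ∈ Y ⊔ Z) :
    g • y ∈ Y ⊔ Z := by
  obtain ⟨a, ha, b, hb, rfl⟩ := Submodule.mem_sup.1 hy
  rw [smul_add]
  exact Submodule.add_mem_sup (hY g a ha) (hZ g b hb)

lemma exists_basisValues_eq (f : MultilinearMap k (fun _ : Fin n => StdRep k) B)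
    (v : Fin n → StdRep k) : ∃ ω : (Fin n → ℕ) →₀ R, basisValues R f ω = f v := by
  obtain ⟨l, hl⟩ := exists_bound ({()} : Finset Unit) fun _ => v
  refine ⟨∑ j : Fin n → Fin l, algebraMap k R (∏ a, v a (j a)) • Finsupp.single (fun a => (j a : ℕ)) 1,
    ?_⟩
  rw [map_sum, ← multilinear_sum_basis f v (fun a => hl () (Finset.mem_singleton_self _) a)
    (Equiv.refl _)]
  refine Finset.sum_congr rfl fun j _ => ?_
  rw [map_smul, basisValues_single, one_smul, algebraMap_smul]
  rfl

lemma evalSub_sup_le_localSat (hx : IsGLGeneric x) {Y : Submodule R B}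
    (hY : ∀ (g : GLinf k), ∀ y ∈ Y, g • y ∈ Y) (hf : GLEquivariant f) [Nontrivial R] :
    evalSub k U (Y ⊔ valueSpan R f) ≤ localSat (RingHom.ker x)
      (evalSub k U Y ⊔ Submodule.span (AlgEval k R U) (Set.range (evalForm U hf))) := by
  refine evalSub_le_localSat hx _ (fun g y => sup_stable hY (fun g y => valueSpan_stable hf g) g)
    fun m hm => ⟨1, one_ne_zero, fun ψ => ?_⟩
  obtain ⟨y, hy, z, hz, rfl⟩ := Submodule.mem_sup.1 hm
  rw [one_smul, map_add]
  refine Submodule.add_mem_sup (push_mem_evalSub hY ψ hy) ?_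
  clear hm
  induction hz using Submodule.span_induction with
  | mem y hy =>
    obtain ⟨v, rfl⟩ := hy
    rw [push_form ψ hf]
    exact Submodule.subset_span ⟨_, rfl⟩
  | zero => rw [map_zero]; exact Submodule.zero_mem _
  | add a b _ _ ha hb => rw [map_add]; exact Submodule.add_mem _ ha hb
  | smul r a _ ha => rw [push_smul']; exact Submodule.smul_mem _ _ ha

variable [IsDomain R]

lemma coeffIn_sum {ι : Type*} (s : Finset ι) {n : ℕ} (I : Ideal R)
    {a : ι → R} (ha : ∀ i ∈ s, a i ∈ I) (ω : ι → (Fin n → ℕ) →₀ R) :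
    CoeffIn I (∑ i ∈ s, a i • ω i) := fun J => by
  rw [Finsupp.finsetSum_apply]
  exact I.sum_mem fun i hi => I.mul_mem_right _ (ha i hi)

/-- This undoes the enlargement of `Y` by one form. After localizing, the part of `h` not in `𝔪
Y{U}` is a combination of values of `f` with coefficients in `𝔪`. Pulled back along a good section
it becomes a relation modulo `Y` between the `f (e_I)`, with coefficients in a prime of `R`, to
which `RaiseStable.exists_flat` applies; the result is pushed forward again. -/
lemma flat_step (hx : IsGLGeneric x) {Y : Submodule R B}
    (hY : ∀ (g : GLinf k), ∀ y ∈ Y, g • y ∈ Y) (hf : GLEquivariant f) {h : PolEval k B U}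
    (hhY : h ∈ evalSub k U Y) (hZ : h ∈ RingHom.ker x • evalSub k U (Y ⊔ valueSpan R f)) :
    h ∈ RingHom.ker x • evalSub k U Y := by
  refine mem_smul_of_mem_localSat hhY ?_
  obtain ⟨s, hs, hsh⟩ := smul_le_localSat (evalSub_sup_le_localSat hx hY hf) _ hZ
  refine mem_localSat_of_smul hs ?_
  rw [Submodule.smul_sup] at hsh
  obtain ⟨h₁, hh₁, h₂, hh₂, hsum⟩ := Submodule.mem_sup.1 hsh
  rw [← hsum]
  refine Submodule.add_mem _ ⟨1, by simp [RingHom.mem_ker], by rwa [one_smul]⟩ ?_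
  have h₂Y : h₂ ∈ evalSub k U Y := by
    have := Submodule.sub_mem _ (Submodule.smul_mem _ s hhY) (Submodule.smul_le_right hh₁)
    rwa [← hsum, add_sub_cancel_left] at this
  obtain ⟨a, ha, hsum₂⟩ := (Submodule.mem_ideal_smul_span_iff_exists_sum _ _ _).1 hh₂
  have : CharZero R := charZero_of_injective_algebraMap (algebraMap k R).injective
  obtain ⟨b, hb, hflat⟩ := (raiseStable_comap hf hY).exists_flat
  -- The section recovers `h₂` and all its coefficients from their values at `φ`, and keeps `b`
  -- outside the prime `ker (pointAt x ψ)`.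
  obtain ⟨p, ⟨hp₂, hpa⟩, hpb⟩ := exists_section_pointAt_ne_zero hx hb
    ((eventually_push_eq h₂).and
      ((Filter.eventually_all_finset a.support).2 fun u _ => eventually_pushAlg_eq (a u)))
  obtain ⟨ψ, φ⟩ := p
  choose ω hω using exists_basisValues_eq (R := R) f
  let z : (Fin n → ℕ) →₀ R := ∑ u ∈ a.support, (a u).fn φ • ω fun i => φ (u i)
  have hz : basisValues R f z = h₂.fn φ := by
    rw [map_sum, ← hsum₂, Finsupp.sum, PolEval.fn_sum]
    exact Finset.sum_congr rfl fun u _ => by rw [map_smul, hω]; rfl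
  have hzI : CoeffIn (RingHom.ker (pointAt x ψ)) z := by
    refine coeffIn_sum _ _ (fun u hu => ?_) _
    rw [RingHom.mem_ker, pointAt_apply, hpa u hu]
    exact ha u
  have : (RingHom.ker (pointAt x ψ)).IsPrime := RingHom.ker_isPrime _
  obtain ⟨t, ht, htz⟩ := hflat (RingHom.ker (pointAt x ψ)) hpb z
    (by rw [Submodule.mem_comap, hz]; exact h₂Y φ) hzI
  have h3 : t • h₂.fn φ ∈ RingHom.ker (pointAt x ψ) • Y := by
    rw [← hz, ← map_smul]
    have := Submodule.mem_map_of_mem (f := basisValues R f) htz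
    rw [Submodule.map_smul''] at this
    exact Submodule.smul_mono le_rfl (Submodule.map_comap_le _ _) this
  have h4 := push_mem_smul_evalSub hY ψ h3
  rw [push_smul', hp₂] at h4
  exact ⟨pushAlg ψ t, ht, h4⟩

end Span

variable [IsDomain R]

open Classical in
/-- Fibers at generic points are flat: a `GL`-stable submodule is pure at generic points. -/
theorem mem_smul_evalSub (hx : IsGLGeneric x) {Y : Submodule R B}
    (hY : ∀ (g : GLinf k), ∀ y ∈ Y, g • y ∈ Y) {h : PolEval k B U} (hhY : h ∈ evalSub k U Y)
    (hh : h ∈ RingHom.ker x • (⊤ : Submodule (AlgEval k R U) (PolEval k B U))) :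
    h ∈ RingHom.ker x • evalSub k U Y := by
  let Λ : Type u := Σ n : ℕ, {f : MultilinearMap k (fun _ : Fin n => StdRep k) B // GLEquivariant f}
  let Z : Λ → Submodule R B := fun i => valueSpan R i.2.1
  -- Only finitely many forms enter a given element of `𝔪 B{U}`; they are then removed one at a time
  -- by `flat_step`.
  obtain ⟨s, hs⟩ : ∃ s : Finset Λ, h ∈ RingHom.ker x • evalSub k U (s.sup Z) := by
    clear hhY
    induction hh using Submodule.smul_induction_on' with
    | smul a ha m hm =>
      obtain ⟨q, n, f, hf, u, rfl⟩ := exists_sum_evalForm m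
      let F : Fin q → Λ := fun i => ⟨n i, f i, hf i⟩
      refine ⟨Finset.univ.image F, Submodule.smul_mem_smul ha (Submodule.sum_mem _ fun i _ φ => ?_)⟩
      have h1 : Z (F i) ≤ (Finset.univ.image F).sup Z :=
        Finset.le_sup (f := Z) (Finset.mem_image_of_mem F (Finset.mem_univ i))
      exact h1 (mem_valueSpan (f i) _)
    | add y hy z hz h1 h2 =>
      obtain ⟨s, h1⟩ := h1
      obtain ⟨t, h2⟩ := h2
      refine ⟨s ∪ t, Submodule.add_mem _ (Submodule.smul_mono le_rfl (evalSub_mono ?_) h1)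
        (Submodule.smul_mono le_rfl (evalSub_mono ?_) h2)⟩
      · exact Finset.sup_mono Finset.subset_union_left
      · exact Finset.sup_mono Finset.subset_union_right
  have key : ∀ (s : Finset Λ) (Y : Submodule R B), (∀ (g : GLinf k), ∀ y ∈ Y, g • y ∈ Y) →
      h ∈ evalSub k U Y → h ∈ RingHom.ker x • evalSub k U (Y ⊔ s.sup Z) →
      h ∈ RingHom.ker x • evalSub k U Y := by
    intro s
    induction s using Finset.induction_on with
    | empty =>
      intro Y _ _ h1
      rwa [Finset.sup_empty, sup_bot_eq] at h1
    | insert F s _ ih =>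
      intro Y hY hhY h1
      rw [Finset.sup_insert, ← sup_assoc] at h1
      exact flat_step hx hY F.2.2 hhY (ih _
        (fun g y => sup_stable hY (fun g y => valueSpan_stable F.2.2 g) g)
        (evalSub_mono le_sup_left hhY) h1)
  exact key s Y hY hhY (Submodule.smul_mono le_rfl (evalSub_mono le_sup_right) hs)

/-- The map `A{U} → B{U}` induced by an equivariant `R`-linear map, as an `R{U}`-linear map. -/
def evalMapLin (U : Type u) [AddCommGroup U] [Module k U] (L : A →ₗ[k] B)
    (hL : ∀ (g : GLinf k) (a : A), L (g • a) = g • L a) (hR : ∀ (r : R) (a : A), L (r • a) = r • L a) :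
    PolEval k A U →ₗ[AlgEval k R U] PolEval k B U where
  toFun := evalMap U L hL
  map_add' := map_add _
  map_smul' a m := PolEval.ext fun φ => hR (a.fn φ) (m.fn φ)

lemma mkQ_eq_smul_of_smul_eq {s : AlgEval k R U} (hs : x s ≠ 0) (h : PolEval k B U) :
    (maxSub B x).mkQ h = (x s)⁻¹ • (maxSub B x).mkQ (s • h) := by
  have h1 : (s - algebraMap k _ (x s)) • h ∈ maxSub B x := smul_mem_maxSub (by simp) h
  have h2 : (maxSub B x).mkQ (s • h) = x s • (maxSub B x).mkQ h := by
    rw [← map_smul]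
    refine (Submodule.Quotient.eq _).2 ?_
    rwa [sub_smul, algebraMap_smul] at h1
  rw [h2, smul_smul, inv_mul_cancel₀ hs, one_smul]

/-- A sequence of modules that is exact up to torsion is exact on fibers at generic points. -/
theorem fiberMap_exact (hx : IsGLGeneric x) (f : A →ₗ[k] B)
    (hf : ∀ (g : GLinf k) (a : A), f (g • a) = g • f a) (hfR : ∀ (r : R) (a : A), f (r • a) = r • f a)
    (g : B →ₗ[k] C) (hg : ∀ (γ : GLinf k) (b : B), g (γ • b) = γ • g b)
    (hgR : ∀ (r : R) (b : B), g (r • b) = r • g b)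
    (H : ∀ b, g b = 0 → ∃ r : R, r ≠ 0 ∧ ∃ a, f a = r • b) (t : Fiber B x)
    (ht : fiberMap x g hg hgR t = 0) : ∃ t', fiberMap x f hf hfR t' = t := by
  obtain ⟨h, rfl⟩ := Submodule.mkQ_surjective _ t
  have h1 : evalMap U g hg h ∈ maxSub C x := (Submodule.Quotient.mk_eq_zero _).1 ht
  rw [maxSub, Submodule.restrictScalars_mem] at h1
  -- Purity is applied to the image of `g`: membership of `g h` in `𝔪 C{U}` improves to membership
  -- in `𝔪 Y{U}`, which is the image of `𝔪 B{U}`.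
  let Y : Submodule R C :=
    { carrier := Set.range g
      zero_mem' := ⟨0, map_zero g⟩
      add_mem' := by rintro _ _ ⟨a, rfl⟩ ⟨b, rfl⟩; exact ⟨a + b, map_add g a b⟩
      smul_mem' := by rintro r _ ⟨a, rfl⟩; exact ⟨r • a, hgR r a⟩ }
  have hY : ∀ (γ : GLinf k), ∀ y ∈ Y, γ • y ∈ Y := by
    rintro γ _ ⟨a, rfl⟩
    exact ⟨γ • a, hg γ a⟩
  have h2 : evalMap U g hg h ∈ evalSub k U Y := fun φ => ⟨h.fn φ, rfl⟩
  have h3 := mem_smul_evalSub hx hY h2 h1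
  have h4 : RingHom.ker x • evalSub k U Y ≤
      (RingHom.ker x • (⊤ : Submodule (AlgEval k R U) (PolEval k B U))).map
        (evalMapLin U g hg hgR) := by
    rw [Submodule.map_smul'']
    refine Submodule.smul_mono le_rfl fun y hy => ?_
    obtain ⟨b, hb⟩ := exists_evalMap_eq g hg y hy
    exact ⟨b, trivial, hb⟩
  obtain ⟨h', hh', heq⟩ := h4 h3
  -- Changed by an element of `𝔪 B{U}`, `h` takes values in the kernel of `g`, where the hypothesis
  -- gives preimages of nonzero multiples.
  have h5 : h - h' ∈ evalSub k U (LinearMap.ker ({ g with map_smul' := hgR } : B →ₗ[R] C)) := by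
    intro φ
    have h6 : g (h'.fn φ) = g (h.fn φ) := congrArg (fun z => PolEval.fn z φ) heq
    change g (h.fn φ - h'.fn φ) = 0
    rw [map_sub, h6, sub_self]
  obtain ⟨s, hs, a, ha⟩ := evalSub_le_localSat hx (LinearMap.range (evalMapLin U f hf hfR))
    (Y := LinearMap.ker ({ g with map_smul' := hgR } : B →ₗ[R] C)) (fun γ y hy => by
      change g (γ • y) = 0
      rw [hg, show g y = 0 from hy, smul_zero]) (fun m hm => by
      obtain ⟨r, hr, a, ha⟩ := H m hm
      exact ⟨r, hr, fun ψ => ⟨push ψ a, by rw [← ha]; exact evalMap_push ψ f hf a⟩⟩) h5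
  refine ⟨(x s)⁻¹ • (maxSub A x).mkQ a, ?_⟩
  rw [map_smul, fiberMap_mk]
  have h7 : evalMap U f hf a = s • (h - h') := ha
  rw [h7, ← mkQ_eq_smul_of_smul_eq (fun h => hs h), map_sub]
  have h8 : (maxSub B x).mkQ h' = 0 := (Submodule.Quotient.mk_eq_zero _).2 (by
    rw [maxSub, Submodule.restrictScalars_mem]
    exact hh')
  rw [h8, sub_zero]

/-! ### Vanishing of fibers -/

lemma exists_linearIndependent_mod (hU : ¬ FiniteDimensional k U) (W : Submodule k U)
    [FiniteDimensional k W] (l : ℕ) :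
    ∃ w : Fin l → U, LinearIndependent k fun i => W.mkQ (w i) := by
  have hinf : ¬ Module.Finite k (U ⧸ W) := fun h =>
    hU (Module.Finite.of_submodule_quotient W)
  have h1 : Cardinal.aleph0 ≤ Module.rank k (U ⧸ W) := by
    by_contra hc
    exact hinf (Module.rank_lt_aleph0_iff.1 (not_le.1 hc))
  obtain ⟨v, hv⟩ := exists_linearIndependent_of_le_rank (R := k) (M := U ⧸ W) (n := l)
    (Cardinal.natCast_lt_aleph0.le.trans h1)
  choose w hw using fun i => W.mkQ_surjective (v i)
  exact ⟨w, by simpa only [hw] using hv⟩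

/-- Add to `ψ₁` a multiple `t` of a map whose values are independent modulo the first values of
`ψ₁`; almost every `t` keeps `b` nonzero. The infinite dimension of `U` provides room for these
values. -/
lemma exists_independent_pointAt_ne_zero (hU : ¬ FiniteDimensional k U) (hx : IsGLGeneric x)
    {b : R} (hb : b ≠ 0) (l : ℕ) : ∃ ψ : StdRep k →ₗ[k] U,
      LinearIndependent k (fun i : Fin l => ψ (Finsupp.single (i : ℕ) 1)) ∧ pointAt x ψ b ≠ 0 := by
  obtain ⟨ψ₁, hψ₁⟩ := exists_pointAt_ne_zero hx hb
  let W := Submodule.span k (Set.range fun i : Fin l => ψ₁ (Finsupp.single (i : ℕ) 1))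
  have : FiniteDimensional k W := FiniteDimensional.span_of_finite k (Set.finite_range _)
  obtain ⟨w, hw⟩ := exists_linearIndependent_mod hU W l
  let ψ₀ : StdRep k →ₗ[k] U := Finsupp.linearCombination k fun i =>
    if h : i < l then w ⟨i, h⟩ else 0
  have hψ₀ : ∀ i : Fin l, ψ₀ (Finsupp.single (i : ℕ) 1) = w i := fun i => by simp [ψ₀]
  obtain ⟨t, ht⟩ := ((finite_pointAt_eq_zero hψ₁ ψ₀).union
    (Set.finite_singleton (0 : k))).infinite_compl.nonempty
  have ht0 : t ≠ 0 := fun h => ht (Or.inr h)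
  refine ⟨ψ₁ + t • ψ₀, ?_, fun h => ht (Or.inl h)⟩
  refine LinearIndependent.of_comp W.mkQ ?_
  have h1 : (W.mkQ ∘ fun i : Fin l => (ψ₁ + t • ψ₀) (Finsupp.single (i : ℕ) 1)) =
      fun i => t • W.mkQ (w i) := by
    funext i
    have h2 : W.mkQ (ψ₁ (Finsupp.single (i : ℕ) 1)) = 0 :=
      (Submodule.Quotient.mk_eq_zero _).2 (Submodule.subset_span ⟨i, rfl⟩)
    simp only [Function.comp_apply, LinearMap.add_apply, LinearMap.smul_apply, map_add, h2,
      zero_add, hψ₀, map_smul]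
  rw [h1]
  exact hw.units_smul fun _ => Units.mk0 t ht0

/-- `φ` can be altered by any map into `ker ψ` without changing `ψ ∘ φ`, and on the independent
vectors `ψ₁ e_i` the defect `e_i - φ (ψ₁ e_i)` lies in that kernel. -/
lemma exists_adapted_section {l : ℕ} {ψ₁ : StdRep k →ₗ[k] U}
    (hψ₁ : LinearIndependent k (fun i : Fin l => ψ₁ (Finsupp.single (i : ℕ) 1)))
    {P : (StdRep k →ₗ[k] U) × (U →ₗ[k] StdRep k) → Prop} (hP : ∀ᶠ p in sectionFilter k U, P p) :
    ∃ p, P p ∧ (∀ i < l, p.1 (Finsupp.single i 1) = ψ₁ (Finsupp.single i 1)) ∧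
      ∀ i < l, p.2 (ψ₁ (Finsupp.single i 1)) = Finsupp.single i 1 := by
  have hP' : ∀ᶠ p in sectionFilter k U, P p ∧
      ∀ i : Fin l, p.1 (p.2 (ψ₁ (Finsupp.single (i : ℕ) 1))) = ψ₁ (Finsupp.single (i : ℕ) 1) :=
    hP.and (Filter.eventually_all.2 fun i => eventually_section _)
  obtain ⟨W, _, hW⟩ := exists_subspace_of_eventually hP'
  obtain ⟨ψ, φ, hψ, hφ⟩ := exists_section W ψ₁ l
  have hψφ := (hW (ψ, φ) hφ).2
  obtain ⟨δ, hδ⟩ : ∃ δ : U →ₗ[k] LinearMap.ker ψ, ∀ i : Fin l,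
      (δ (ψ₁ (Finsupp.single (i : ℕ) 1)) : StdRep k) =
        Finsupp.single (i : ℕ) 1 - φ (ψ₁ (Finsupp.single (i : ℕ) 1)) := by
    let b := Module.Basis.span hψ₁
    let c : Fin l → LinearMap.ker ψ := fun i =>
      ⟨Finsupp.single (i : ℕ) 1 - φ (ψ₁ (Finsupp.single (i : ℕ) 1)), by
        rw [LinearMap.mem_ker, map_sub, hψφ i, hψ i i.2, sub_self]⟩
    let F : Submodule.span k (Set.range fun i : Fin l => ψ₁ (Finsupp.single (i : ℕ) 1)) →ₗ[k]
      LinearMap.ker ψ := b.constr k c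
    obtain ⟨δ, hδ⟩ := LinearMap.exists_extend (K := k) (V := U) (V' := LinearMap.ker ψ) F
    refine ⟨δ, fun i => ?_⟩
    have h1 : δ (b i : U) = F (b i) := congrArg (fun F => F (b i)) hδ
    rw [Module.Basis.constr_basis] at h1
    have h2 : (b i : U) = ψ₁ (Finsupp.single (i : ℕ) 1) := by simp [b, Module.Basis.span_apply]
    rw [← h2, h1]
    simp only [c]
    rw [h2]
  refine ⟨(ψ, φ + (LinearMap.ker ψ).subtype ∘ₗ δ), (hW _ fun w hw => ?_).1, hψ, fun i hi => ?_⟩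
  · change ψ (φ w + (δ w : StdRep k)) = w
    rw [map_add, hφ w hw, (δ w).2, add_zero]
  · change φ _ + (δ _ : StdRep k) = _
    rw [hδ ⟨i, hi⟩]
    abel

/-- An equivariant multilinear map to a torsion free module that vanishes on the fiber at a generic
point is zero. -/
theorem form_eq_zero_of_fiber (hU : ¬ FiniteDimensional k U) (hx : IsGLGeneric x)
    (hB : ∀ (r : R) (b : B), r ≠ 0 → r • b = 0 → b = 0) {n : ℕ}
    {f : MultilinearMap k (fun _ : Fin n => StdRep k) B} (hf : GLEquivariant f)
    (H : ∀ u : Fin n → U, evalForm U hf u ∈ maxSub B x) (v : Fin n → StdRep k) : f v = 0 := by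
  have hbot : ∀ (g : GLinf k), ∀ y ∈ (⊥ : Submodule R B), g • y ∈ (⊥ : Submodule R B) :=
    fun g y hy => by rw [Submodule.mem_bot] at hy ⊢; rw [hy, smul_zero]
  -- These are the relations between the `f (e_I)` themselves. If they span everything locally at a
  -- prime of `R`, each value of `f` is torsion, hence zero; it suffices to test on `X`, modulo the
  -- prime.
  obtain ⟨b, X, hb, hnak⟩ := (raiseStable_comap hf hbot).exists_nakayama
  -- By purity and localization, each value of `f` on `U`, multiplied by a function nonzero at `x`,
  -- is a combination of such values with coefficients in `𝔪`.
  have hloc : ∀ u : Fin n → U, ∃ s : AlgEval k R U, x s ≠ 0 ∧ ∃ a : (Fin n → U) →₀ AlgEval k R U,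
      (∀ i, x (a i) = 0) ∧ s • evalForm U hf u = a.sum fun i c => c • evalForm U hf i := by
    intro u
    have h1 := H u
    rw [maxSub, Submodule.restrictScalars_mem] at h1
    have h2 := mem_smul_evalSub hx (Y := ⊥ ⊔ valueSpan R f)
      (fun g y => sup_stable hbot (fun g y => valueSpan_stable hf g) g)
      (fun φ => Submodule.mem_sup_right (mem_valueSpan f _)) h1
    obtain ⟨s, hs, h3⟩ := smul_le_localSat (evalSub_sup_le_localSat hx hbot hf) _ h2
    have h4 : evalSub k U (⊥ : Submodule R B) = ⊥ :=
      eq_bot_iff.2 fun h hh => PolEval.ext fun φ => hh φ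
    rw [h4, bot_sup_eq] at h3
    obtain ⟨a, ha, hsum⟩ := (Submodule.mem_ideal_smul_span_iff_exists_sum _ _ _).1 h3
    exact ⟨s, fun h => hs h, a, ha, hsum.symm⟩
  choose s hs a ha hsa using hloc
  obtain ⟨l₀, hl₀⟩ := exists_push_bound (k := k) b
  -- Enough basis vectors to control `b` and all entries of the multi-indices in `X`.
  let l := l₀ + (X.sup fun I => Finset.univ.sup I) + 1
  have hXl : ∀ I ∈ X, ∀ i, I i < l := fun I hI i => by
    have h1 : I i ≤ Finset.univ.sup I := Finset.le_sup (f := I) (Finset.mem_univ i)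
    have h2 : Finset.univ.sup I ≤ X.sup fun I => Finset.univ.sup I :=
      Finset.le_sup (f := fun I : Fin n → ℕ => Finset.univ.sup I) hI
    omega
  obtain ⟨ψ₁, hli, hψ₁⟩ := exists_independent_pointAt_ne_zero hU hx hb l
  let u : (Fin n → ℕ) → Fin n → U := fun I i => ψ₁ (Finsupp.single (I i) 1)
  obtain ⟨⟨ψ, φ⟩, hP, hψ, hφ⟩ := exists_adapted_section hli
    (P := fun p => ∀ I ∈ X, pushAlg p.1 ((s (u I)).fn p.2) = s (u I) ∧
      ∀ j ∈ (a (u I)).support, pushAlg p.1 ((a (u I) j).fn p.2) = a (u I) j)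
    ((Filter.eventually_all_finset X).2 fun I _ => (eventually_pushAlg_eq _).and
      ((Filter.eventually_all_finset _).2 fun j _ => eventually_pushAlg_eq _))
  have hprime : (RingHom.ker (pointAt x ψ)).IsPrime := RingHom.ker_isPrime _
  choose ω hω using exists_basisValues_eq (R := R) f
  have htop := hnak (RingHom.ker (pointAt x ψ)) (by
    rw [RingHom.mem_ker, pointAt_apply, pushAlg_apply,
      hl₀ U ψ ψ₁ fun i hi => hψ i (by omega)]
    exact hψ₁) fun I hI => by
      -- Evaluated at `φ`, the local identity for `u I` is a relation between values of `f`. It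
      -- involves `e_I` itself, because `φ (ψ₁ e_i) = e_i`, with a coefficient outside the prime,
      -- while the other terms have coefficients in the prime.
      refine ⟨(s (u I)).fn φ, ?_, (s (u I)).fn φ • Finsupp.single I 1 -
        ∑ j ∈ (a (u I)).support, (a (u I) j).fn φ • ω fun i => φ (j i), ?_, ?_⟩
      · rw [RingHom.mem_ker, pointAt_apply, (hP I hI).1]
        exact hs _
      · rw [Submodule.mem_comap, Submodule.mem_bot, map_sub, map_smul, basisValues_single, one_smul,
          map_sum, sub_eq_zero]
        have h1 := congrArg (fun h => PolEval.fn h φ) (hsa (u I))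
        simp only [Finsupp.sum, PolEval.fn_sum, fn_alg_smul, evalForm_fn, u] at h1
        have h2 : (fun i => φ (ψ₁ (Finsupp.single (I i) 1))) = fun i => Finsupp.single (I i) 1 :=
          funext fun i => hφ _ (hXl I hI i)
        rw [h2] at h1
        rw [h1]
        exact Finset.sum_congr rfl fun j _ => by rw [map_smul, hω]
      · rw [sub_sub_cancel]
        refine coeffIn_sum _ _ (fun j hj => ?_) _
        rw [RingHom.mem_ker, pointAt_apply, (hP I hI).2 j hj]
        exact ha _ _
  obtain ⟨t, ht, h1⟩ : ω v ∈ localSat (RingHom.ker (pointAt x ψ))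
      ((⊥ : Submodule R B).comap (basisValues R f)) := by rw [htop]; trivial
  rw [Submodule.mem_comap, map_smul, hω, Submodule.mem_bot] at h1
  exact hB t _ (fun h => ht (by rw [h]; exact Submodule.zero_mem _)) h1

end GenericFiber

/-! ### Polynomial elements of `K`-modules -/

section PolMod

variable {k R K : Type u} [Field k] [CharZero k] [CommRing R] [IsDomain R] [Algebra k R]
  [MulSemiringAction (GLinf k) R] [SMulCommClass (GLinf k) k R] [IsPolynomialRep k R]
  [Field K] [Algebra k K] [Algebra R K] [IsScalarTower k R K] [IsFractionRing R K]
  [MulSemiringAction (GLinf k) K] [SMulCommClass (GLinf k) k K] [SMulDistribClass (GLinf k) R K]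

instance isFormSpanned_of_isPolynomialRep : IsFormSpanned k R where
  smulCommClass := inferInstance
  formSpan_top := top_le_iff.1 (IsPolynomialSub.le_formSpan IsPolynomialRep.polynomial)

lemma pol_le_formSpan {M : Type u} [AddCommGroup M] [Module k M] [DistribMulAction (GLinf k) M]
    [SMulCommClass (GLinf k) k M] : pol k M ≤ formSpan ⊤ :=
  sSup_le fun P hP => hP.le_formSpan.trans (formSpan_mono le_top)

instance (N : KMod k K) : SMulCommClass (GLinf k) k (polMod N) :=
  ⟨fun g c n => polMod.ext (smul_comm g c n.val)⟩

namespace polMod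

/-- An equivariant multilinear map to a `K`-module takes polynomial values. -/
def form {N : KMod k K} {n : ℕ} {f : MultilinearMap k (fun _ : Fin n => StdRep k) N.carrier}
    (hf : GLEquivariant f) : MultilinearMap k (fun _ : Fin n => StdRep k) (polMod N) :=
  f.codRestrict (pol k N.carrier) fun v => form_mem_pol hf v

lemma form_equivariant {N : KMod k K} {n : ℕ}
    {f : MultilinearMap k (fun _ : Fin n => StdRep k) N.carrier} (hf : GLEquivariant f) :
    GLEquivariant (form hf) := fun g v => ext (hf g v)

variable (N : KMod k K)

/-- The inclusion of `N^pol` in `N`, as a linear map. -/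
def valLin : polMod N →ₗ[k] N.carrier := (pol k N.carrier).subtype

instance : IsFormSpanned k (polMod N) where
  smulCommClass := inferInstance
  formSpan_top := by
    refine eq_top_iff.2 ?_
    rintro n -
    have h := pol_le_formSpan (k := k) n.val_mem
    obtain ⟨m, p, f, v, hf, -, hs⟩ := exists_sum_of_mem_formSpan h
    have : n = ∑ i, form (hf i) (v i) := by
      refine ext (hs.trans ?_)
      exact (map_sum (valLin N) (fun i => form (hf i) (v i)) Finset.univ).symm
    rw [this]
    exact Submodule.sum_mem _ fun i _ =>
      form_mem_formSpan (Y := ⊤) (form_equivariant (hf i)) (fun _ => trivial) _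

lemma eq_zero_of_smul_eq_zero {N : KMod k K} (r : R) (n : polMod N) (hr : r ≠ 0)
    (h : r • n = 0) : n = 0 := by
  have h1 : algebraMap R K r • n.val = 0 := congrArg val h
  refine ext ((smul_eq_zero.1 h1).resolve_left ?_)
  simpa using hr

variable (R) in
/-- Every element of a `K`-module becomes polynomial after multiplication by a nonzero element of
`R`. -/
lemma exists_smul_mem {N : KMod k K} (n : N.carrier) :
    ∃ r : R, r ≠ 0 ∧ algebraMap R K r • n ∈ pol k N.carrier := by
  have hn : n ∈ Submodule.span K (pol k N.carrier : Set N.carrier) := by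
    rw [N.span_pol]
    trivial
  induction hn using Submodule.span_induction with
  | mem n hn => exact ⟨1, one_ne_zero, by rwa [map_one, one_smul]⟩
  | zero => exact ⟨1, one_ne_zero, by rw [smul_zero]; exact Submodule.zero_mem _⟩
  | add a b _ _ ha hb =>
    obtain ⟨r, hr, ha⟩ := ha
    obtain ⟨s, hs, hb⟩ := hb
    refine ⟨r * s, mul_ne_zero hr hs, ?_⟩
    rw [smul_add, map_mul, mul_comm, mul_smul, mul_comm, mul_smul]
    exact Submodule.add_mem _ (smul_mem_pol_of_polynomial N s ha)
      (smul_mem_pol_of_polynomial N r hb)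
  | smul a n _ ha =>
    obtain ⟨r, hr, ha⟩ := ha
    obtain ⟨p, q, hq, rfl⟩ := IsFractionRing.div_surjective (A := R) a
    have hq0 : q ≠ 0 := nonZeroDivisors.ne_zero hq
    refine ⟨q * r, mul_ne_zero hq0 hr, ?_⟩
    have hqK : algebraMap R K q ≠ 0 := by simpa using hq0
    have : algebraMap R K (q * r) • (algebraMap R K p / algebraMap R K q) • n =
        algebraMap R K p • algebraMap R K r • n := by
      rw [smul_smul, smul_smul, map_mul]
      congr 1
      field_simp
    rw [this]
    exact smul_mem_pol_of_polynomial N p ha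

end polMod

/-! ### Subobjects, quotients and direct sums of `K`-modules -/

namespace KMod

section Sub

variable (M : KMod k K) (S : Submodule K M.carrier)
  (hS : ∀ (g : GLinf k), ∀ m ∈ S, g • m ∈ S)

/-- The action on a stable subspace. -/
@[reducible] def subAction : DistribMulAction (GLinf k) S where
  smul g s := ⟨g • s.1, hS g s.1 s.2⟩
  one_smul s := Subtype.ext (one_smul _ s.1)
  mul_smul g h s := Subtype.ext (mul_smul g h s.1)
  smul_zero g := Subtype.ext (smul_zero g)
  smul_add g s t := Subtype.ext (smul_add g s.1 t.1)

-- A nonzero multiple of a vector of `S` is polynomial in `M`. It is then a sum of values of forms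
-- into `S ∩ M^pol`, and these are forms into `S`, so it is polynomial in `S` as well.
include R in
variable (R) in
lemma span_pol_sub : letI := subAction M S hS
    Submodule.span K (pol k S : Set S) = ⊤ := by
  let _ := subAction M S hS
  have hsl : SMulDistribClass (GLinf k) K S :=
    ⟨fun g a s => Subtype.ext (smul_distrib_smul g a s.1)⟩
  have := smulCommClass_of_semilinear (k := k) (K := K) S
  refine eq_top_iff.2 ?_
  rintro s -
  obtain ⟨r, hr, h⟩ := polMod.exists_smul_mem R s.1
  have hrK : algebraMap R K r ≠ 0 := by simpa using hr
  have h1 : algebraMap R K r • s ∈ pol k S := by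
    have h2 := mem_formSpan_of_mem (k := k) (Y := S.restrictScalars k ⊓ pol k M.carrier)
      (fun g y hy => ⟨hS g y hy.1, smul_mem_pol g hy.2⟩) (pol_le_formSpan h)
      ⟨S.smul_mem _ s.2, h⟩
    obtain ⟨m, n, f, v, hf, hfY, hs⟩ := exists_sum_of_mem_formSpan h2
    let F : ∀ i, MultilinearMap k (fun _ : Fin (n i) => StdRep k) S := fun i =>
      { toFun := fun w => ⟨f i w, (hfY i w).1⟩
        map_update_add' := fun w j x y => Subtype.ext ((f i).map_update_add w j x y)
        map_update_smul' := fun w j c x => Subtype.ext ((f i).map_update_smul w j c x) }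
    have h3 : algebraMap R K r • s = ∑ i, F i (v i) := by
      refine Subtype.ext (hs.trans ?_)
      exact (map_sum S.subtype (fun i => F i (v i)) Finset.univ).symm
    rw [h3]
    exact Submodule.sum_mem _ fun i _ => form_mem_pol (f := F i)
      (fun g w => Subtype.ext (hf i g w)) (v i)
  have h4 := Submodule.smul_mem _ (algebraMap R K r)⁻¹ (Submodule.subset_span (R := K) h1)
  rwa [smul_smul, inv_mul_cancel₀ hrK, one_smul] at h4

variable (R) in
/-- The `K`-module given by a stable subspace of a `K`-module. -/
def sub : KMod k K :=
  letI := subAction M S hS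
  { carrier := S
    semilinear := ⟨fun g a s => Subtype.ext (smul_distrib_smul g a s.1)⟩
    span_pol := span_pol_sub R M S hS }

variable (R) in
/-- The inclusion of a stable subspace. -/
def subι : sub R M S hS ⟶ M := homMk (M := sub R M S hS) S.subtype fun _ _ => rfl

end Sub

section Quot

variable (M : KMod k K) (S : Submodule K M.carrier)
  (hS : ∀ (g : GLinf k), ∀ m ∈ S, g • m ∈ S)

/-- The action on the quotient by a stable subspace. -/
@[reducible] def quotAction : DistribMulAction (GLinf k) (M.carrier ⧸ S) where
  smul g t := S.mapQ S (actSemilinear g M) (hS g) t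
  one_smul t := by
    obtain ⟨m, rfl⟩ := S.mkQ_surjective t
    exact congrArg S.mkQ (one_smul _ m)
  mul_smul g h t := by
    obtain ⟨m, rfl⟩ := S.mkQ_surjective t
    exact congrArg S.mkQ (mul_smul g h m)
  smul_zero g := map_zero (S.mapQ S (actSemilinear g M) (hS g))
  smul_add g := map_add (S.mapQ S (actSemilinear g M) (hS g))

/-- The quotient of a `K`-module by a stable subspace. -/
def quot : KMod k K :=
  letI := quotAction M S hS
  { carrier := M.carrier ⧸ S
    semilinear := ⟨fun g a t => LinearMap.map_smulₛₗ (S.mapQ S (actSemilinear g M) (hS g)) a t⟩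
    span_pol := by
      have : SMulCommClass (GLinf k) k (M.carrier ⧸ S) := by
        have : SMulDistribClass (GLinf k) K (M.carrier ⧸ S) :=
          ⟨fun g a t => LinearMap.map_smulₛₗ (S.mapQ S (actSemilinear g M) (hS g)) a t⟩
        exact smulCommClass_of_semilinear (K := K) _
      have h := congrArg (Submodule.map S.mkQ) M.span_pol
      rw [Submodule.map_span, Submodule.map_top, Submodule.range_mkQ] at h
      refine eq_top_iff.2 (h.symm.le.trans (Submodule.span_mono ?_))
      rintro _ ⟨m, hm, rfl⟩
      exact map_mem_pol (S.mkQ.restrictScalars k) (fun _ _ => rfl) hm }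

/-- The projection to the quotient by a stable subspace. -/
def quotπ : M ⟶ quot M S hS := homMk (N := quot M S hS) S.mkQ fun _ _ => rfl

end Quot

section DSum

variable {ι : Type u} (X : ι → KMod k K)

open Classical in
lemma dsum_smul_single (g : GLinf k) (i : ι) (m : (X i).carrier) :
    g • (DFinsupp.single i m : Π₀ i, (X i).carrier) = DFinsupp.single i (g • m) := by
  refine DFinsupp.ext fun j => ?_
  rcases eq_or_ne i j with rfl | hij
  · simp
  · simp [DFinsupp.single_eq_of_ne hij.symm]

/-- The direct sum of a family of `K`-modules. -/
def dsum : KMod k K where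
  carrier := Π₀ i, (X i).carrier
  semilinear := ⟨fun g a x => DFinsupp.ext fun i => smul_distrib_smul g a (x i)⟩
  span_pol := by
    classical
    have hsl : SMulDistribClass (GLinf k) K (Π₀ i, (X i).carrier) :=
      ⟨fun g a x => DFinsupp.ext fun i => smul_distrib_smul g a (x i)⟩
    have := smulCommClass_of_semilinear (k := k) (K := K) (Π₀ i, (X i).carrier)
    refine eq_top_iff.2 ?_
    rintro x -
    induction x using DFinsupp.induction with
    | h0 => exact Submodule.zero_mem _
    | ha i b x _ _ ih =>
      refine Submodule.add_mem _ ?_ ih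
      have h := congrArg (Submodule.map (DFinsupp.lsingle (R := K) (M := fun i => (X i).carrier) i))
        (X i).span_pol
      rw [Submodule.map_span] at h
      have hb : DFinsupp.lsingle (R := K) (M := fun i => (X i).carrier) i b ∈
          Submodule.map (DFinsupp.lsingle (R := K) (M := fun i => (X i).carrier) i) ⊤ :=
        ⟨b, trivial, rfl⟩
      rw [← h] at hb
      refine Submodule.span_mono ?_ hb
      rintro _ ⟨m, hm, rfl⟩
      exact map_mem_pol (DFinsupp.lsingle (R := k) (M := fun i => (X i).carrier) i)
        (fun g m => (dsum_smul_single X g i m).symm) hm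

open Classical in
/-- The inclusions in the direct sum. -/
def dsumι (i : ι) : X i ⟶ dsum X :=
  homMk (N := dsum X) (DFinsupp.lsingle (R := K) (M := fun i => (X i).carrier) i) fun g m =>
    (dsum_smul_single X g i m).symm

/-- The projections from the direct sum. -/
def dsumπ (i : ι) : dsum X ⟶ X i :=
  homMk (M := dsum X) (DFinsupp.lapply (R := K) (M := fun i => (X i).carrier) i) fun g m => rfl

open Classical in
lemma dsum_lsum_smul {N : KMod k K} (f : ∀ i, X i ⟶ N) (g : GLinf k) (m : Π₀ i, (X i).carrier) :
    DFinsupp.lsum ℕ (M := fun i => (X i).carrier) (fun i => lin (f i)) (g • m) =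
      g • DFinsupp.lsum ℕ (M := fun i => (X i).carrier) (fun i => lin (f i)) m := by
  induction m using DFinsupp.induction with
  | h0 => rw [smul_zero, map_zero, smul_zero]
  | ha i b x _ _ ih =>
    rw [smul_add, map_add, map_add, smul_add, ih, dsum_smul_single, DFinsupp.lsum_single,
      DFinsupp.lsum_single, lin_smul]

open Classical in
/-- The universal property of the direct sum. -/
def dsumDesc {N : KMod k K} (f : ∀ i, X i ⟶ N) : dsum X ⟶ N :=
  homMk (M := dsum X) (DFinsupp.lsum ℕ (M := fun i => (X i).carrier) fun i => lin (f i))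
    (dsum_lsum_smul X f)

lemma dsumι_desc {N : KMod k K} (f : ∀ i, X i ⟶ N) (i : ι) : dsumι X i ≫ dsumDesc X f = f i := by
  classical
  refine hom_ext (LinearMap.ext fun m => ?_)
  change DFinsupp.lsum ℕ (M := fun i => (X i).carrier) (fun i => lin (f i))
    (DFinsupp.single i m) = _
  simp

lemma dsum_hom_ext {N : KMod k K} {f g : dsum X ⟶ N}
    (h : ∀ i, dsumι X i ≫ f = dsumι X i ≫ g) : f = g := by
  classical
  refine hom_ext ?_
  refine DFinsupp.lhom_ext (R := K) (M := fun i => (X i).carrier) fun i m => ?_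
  exact congrArg (fun F => lin F m) (h i)

lemma dsumι_π_self (i : ι) : dsumι X i ≫ dsumπ X i = 𝟙 _ := by
  classical
  refine hom_ext (LinearMap.ext fun m => ?_)
  change (DFinsupp.single i m : Π₀ i, (X i).carrier) i = m
  simp

lemma dsum_sum_π_ι [Fintype ι] : ∑ i, dsumπ X i ≫ dsumι X i = 𝟙 (dsum X) := by
  classical
  refine dsum_hom_ext X fun j => ?_
  rw [Preadditive.comp_sum, Category.comp_id, Finset.sum_eq_single j]
  · rw [← Category.assoc, dsumι_π_self, Category.id_comp]
  · intro i _ hij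
    refine hom_ext (LinearMap.ext fun m => ?_)
    change DFinsupp.single i ((DFinsupp.single j m : Π₀ i, (X i).carrier) i) = (0 : Π₀ i, (X i).carrier)
    simp [DFinsupp.single_eq_of_ne hij]
  · exact fun h => absurd (Finset.mem_univ _) h

end DSum

end KMod

end PolMod

/-! ### Tensor powers of the standard `K`-module -/

namespace KMod

section Std

variable (k K : Type u) [Field k] [Field K] [Algebra k K]
  [MulSemiringAction (GLinf k) K] [SMulCommClass (GLinf k) k K]

/-- The action of a group element on `K ⊗ 𝐕`. -/
def stdAct (g : GLinf k) : K ⊗[k] StdRep k →ₗ[k] K ⊗[k] StdRep k :=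
  TensorProduct.map (DistribSMul.toLinearMap k K g) g.toEquiv.toLinearMap

lemma stdAct_tmul (g : GLinf k) (a : K) (v : StdRep k) :
    stdAct k K g (a ⊗ₜ v) = (g • a) ⊗ₜ g.toEquiv v := rfl

/-- The diagonal action on `K ⊗ 𝐕`. -/
@[reducible] def stdAction : DistribMulAction (GLinf k) (K ⊗[k] StdRep k) where
  smul g t := stdAct k K g t
  one_smul t := by
    change stdAct k K 1 t = t
    induction t with
    | zero => exact map_zero _
    | tmul a v => rw [stdAct_tmul, one_smul, GLinf.one_toEquiv]
    | add x y hx hy => rw [map_add, hx, hy]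
  mul_smul g h t := by
    change stdAct k K (g * h) t = stdAct k K g (stdAct k K h t)
    induction t with
    | zero => simp only [map_zero]
    | tmul a v => rw [stdAct_tmul, stdAct_tmul, stdAct_tmul, mul_smul, GLinf.mul_toEquiv]
    | add x y hx hy => rw [map_add, map_add, map_add, hx, hy]
  smul_zero g := map_zero (stdAct k K g)
  smul_add g := map_add (stdAct k K g)

lemma stdAct_smul (g : GLinf k) (a : K) (t : K ⊗[k] StdRep k) :
    stdAct k K g (a • t) = (g • a) • stdAct k K g t := by
  induction t with
  | zero => simp only [smul_zero, map_zero]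
  | tmul b v =>
    rw [TensorProduct.smul_tmul', smul_eq_mul, stdAct_tmul, stdAct_tmul, TensorProduct.smul_tmul',
      smul_eq_mul, smul_mul']
  | add x y hx hy => rw [smul_add, map_add, map_add, smul_add, hx, hy]

variable {k K} in
lemma ofSubsingleton_equivariant {M : Type u} [AddCommGroup M] [Module k M]
    [DistribMulAction (GLinf k) M] (L : StdRep k →ₗ[k] M)
    (hL : ∀ (g : GLinf k) v, L (g.toEquiv v) = g • L v) :
    GLEquivariant (LinearMap.compMultilinearMap L
      (MultilinearMap.ofSubsingleton k (StdRep k) (StdRep k) (0 : Fin 1) LinearMap.id)) :=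
  fun g v => hL g (v 0)

variable [CharZero k]

/-- The standard `K`-module `K ⊗ 𝐕`. -/
def std : KMod k K :=
  letI := stdAction k K
  have hsl : SMulDistribClass (GLinf k) K (K ⊗[k] StdRep k) := ⟨stdAct_smul k K⟩
  { carrier := K ⊗[k] StdRep k
    span_pol := by
      have : SMulCommClass (GLinf k) k (K ⊗[k] StdRep k) := smulCommClass_of_semilinear (K := K) _
      refine eq_top_iff.2 ?_
      rintro t -
      induction t with
      | zero => exact Submodule.zero_mem _
      | add x y hx hy => exact Submodule.add_mem _ hx hy
      | tmul a v =>
        have h1 : a ⊗ₜ[k] v = a • ((1 : K) ⊗ₜ[k] v) := by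
          rw [TensorProduct.smul_tmul', smul_eq_mul, mul_one]
        rw [h1]
        refine Submodule.smul_mem _ _ (Submodule.subset_span ?_)
        exact form_mem_pol (ofSubsingleton_equivariant (TensorProduct.mk k K (StdRep k) 1)
          fun g v => by
            change (1 : K) ⊗ₜ[k] g.toEquiv v = stdAct k K g ((1 : K) ⊗ₜ[k] v)
            rw [stdAct_tmul, smul_one]) fun _ => v }

variable {k} in
/-- The vector `1 ⊗ v` of the standard module. -/
def stdVec : StdRep k →ₗ[k] (std k K).carrier := TensorProduct.mk k K (StdRep k) 1

lemma stdVec_smul (g : GLinf k) (v : StdRep k) :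
    stdVec K (g.toEquiv v) = g • stdVec K v := by
  change (1 : K) ⊗ₜ[k] g.toEquiv v = stdAct k K g ((1 : K) ⊗ₜ[k] v)
  rw [stdAct_tmul, smul_one]

lemma span_stdVec : Submodule.span K (Set.range (stdVec (k := k) K)) = ⊤ := by
  refine eq_top_iff.2 ?_
  rintro t -
  induction t using TensorProduct.induction_on with
  | zero => exact Submodule.zero_mem _
  | add x y hx hy => exact Submodule.add_mem _ hx hy
  | tmul a v =>
    have h1 : a ⊗ₜ[k] v = a • ((1 : K) ⊗ₜ[k] v) := by
      rw [TensorProduct.smul_tmul', smul_eq_mul, mul_one]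
    rw [h1]
    exact Submodule.smul_mem _ _ (Submodule.subset_span ⟨v, rfl⟩)

/-- The tensor powers of the standard `K`-module. -/
def tpow : ℕ → KMod k K
  | 0 => unit
  | n + 1 => tensorObj (tpow n) (std k K)

/-- The bilinear map used to construct `tpowForm`. -/
def tpowMul (n : ℕ) : (tpow k K n).carrier →ₗ[k] StdRep k →ₗ[k] (tpow k K (n + 1)).carrier :=
  LinearMap.mk₂ k (fun t v => t ⊗ₜ[K] stdVec K v)
    (fun t t' v => TensorProduct.add_tmul t t' _)
    (fun c t v => rfl)
    (fun t v v' => by rw [map_add]; exact TensorProduct.tmul_add t _ _)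
    (fun c t v => by rw [map_smul]; exact TensorProduct.tmul_smul c t _)

/-- The universal equivariant multilinear map `𝐕ⁿ → (K ⊗ 𝐕)^{⊗ n}`. -/
def tpowForm : ∀ n, MultilinearMap k (fun _ : Fin n => StdRep k) (tpow k K n).carrier
  | 0 => MultilinearMap.constOfIsEmpty k _ (1 : K)
  | n + 1 => MultilinearMap.uncurryRight (M := fun _ : Fin (n + 1) => StdRep k)
      ((tpowMul k K n).compMultilinearMap (tpowForm n))

lemma tpowForm_succ (n : ℕ) (v : Fin (n + 1) → StdRep k) :
    tpowForm k K (n + 1) v =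
      (tpowForm k K n (fun i => v i.castSucc) ⊗ₜ[K] stdVec K (v (Fin.last n)) :
        (tpow k K n).carrier ⊗[K] (std k K).carrier) := rfl

lemma tpowForm_equivariant (n : ℕ) : GLEquivariant (tpowForm k K n) := by
  induction n with
  | zero => exact fun g v => (smul_one g : g • (1 : K) = 1).symm
  | succ n ih =>
    intro g v
    rw [tpowForm_succ, tpowForm_succ, ih g fun i => v i.castSucc, stdVec_smul]
    rfl

variable {k K} in
lemma span_tmul_eq_top {M N : Type u} [AddCommGroup M] [Module K M] [AddCommGroup N] [Module K N]
    {S : Set M} {T : Set N} (hS : Submodule.span K S = ⊤) (hT : Submodule.span K T = ⊤) :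
    Submodule.span K {t : M ⊗[K] N | ∃ x ∈ S, ∃ y ∈ T, x ⊗ₜ[K] y = t} = ⊤ := by
  refine eq_top_iff.2 ?_
  rw [← TensorProduct.span_tmul_eq_top, Submodule.span_le]
  rintro _ ⟨x, y, rfl⟩
  have hx : x ∈ Submodule.span K S := by rw [hS]; trivial
  have hy : y ∈ Submodule.span K T := by rw [hT]; trivial
  induction hx, hy using Submodule.span_induction₂ with
  | mem_mem x y hx hy => exact Submodule.subset_span ⟨x, hx, y, hy, rfl⟩
  | zero_left y hy => rw [TensorProduct.zero_tmul]; exact Submodule.zero_mem _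
  | zero_right x hx => rw [TensorProduct.tmul_zero]; exact Submodule.zero_mem _
  | add_left x y z hx hy hz h1 h2 =>
    rw [TensorProduct.add_tmul]; exact Submodule.add_mem _ h1 h2
  | add_right x y z hx hy hz h1 h2 =>
    rw [TensorProduct.tmul_add]; exact Submodule.add_mem _ h1 h2
  | smul_left r x y hx hy h1 =>
    rw [← TensorProduct.smul_tmul']; exact Submodule.smul_mem _ r h1
  | smul_right r x y hx hy h1 =>
    rw [TensorProduct.tmul_smul]; exact Submodule.smul_mem _ r h1

lemma span_tpowForm (n : ℕ) : Submodule.span K (Set.range (tpowForm k K n)) = ⊤ := by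
  induction n with
  | zero =>
    refine eq_top_iff.2 fun (t : K) _ => ?_
    have h1 : (tpowForm k K 0 fun i => i.elim0) ∈
        Submodule.span K (Set.range (tpowForm k K 0)) := Submodule.subset_span ⟨_, rfl⟩
    have h2 := Submodule.smul_mem _ t h1
    have h3 : t • (tpowForm k K 0 fun i => i.elim0) = (t : (tpow k K 0).carrier) := mul_one t
    rwa [h3] at h2
  | succ n ih =>
    have h := span_tmul_eq_top ih (span_stdVec k K)
    refine eq_top_iff.2 (h.symm.le.trans (Submodule.span_le.2 ?_))
    rintro _ ⟨_, ⟨v, rfl⟩, _, ⟨w, rfl⟩, rfl⟩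
    have h1 : tpowForm k K (n + 1) (Fin.snoc (α := fun _ => StdRep k) v w) =
        (tpowForm k K n v ⊗ₜ[K] stdVec K w : (tpow k K n).carrier ⊗[K] (std k K).carrier) := by
      refine (tpowForm_succ k K n _).trans ?_
      simp only [Fin.snoc_castSucc, Fin.snoc_last]
      rfl
    have h2 : tpowForm k K (n + 1) (Fin.snoc (α := fun _ => StdRep k) v w) ∈
        Submodule.span K (Set.range (tpowForm k K (n + 1))) := Submodule.subset_span ⟨_, rfl⟩
    rw [h1] at h2
    exact h2

lemma tpow_linear_ext {n : ℕ} {N : Type*} [AddCommGroup N] [Module K N]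
    {F G : (tpow k K n).carrier →ₗ[K] N} (h : ∀ v, F (tpowForm k K n v) = G (tpowForm k K n v)) :
    F = G := by
  refine LinearMap.ext_on (span_tpowForm k K n) ?_
  rintro _ ⟨v, rfl⟩
  exact h v

lemma tpow_hom_ext {n : ℕ} {N : KMod k K} {F G : tpow k K n ⟶ N}
    (h : ∀ v, lin F (tpowForm k K n v) = lin G (tpowForm k K n v)) : F = G :=
  hom_ext (tpow_linear_ext k K h)

/-- Every multilinear map to a `K`-vector space factors through the universal one. -/
lemma exists_tpow_lift (n : ℕ) : ∀ {N : Type u} [AddCommGroup N] [Module K N] [Module k N]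
    [IsScalarTower k K N] (f : MultilinearMap k (fun _ : Fin n => StdRep k) N),
    ∃ F : (tpow k K n).carrier →ₗ[K] N, ∀ v, F (tpowForm k K n v) = f v := by
  induction n with
  | zero =>
    intro N _ _ _ _ f
    refine ⟨LinearMap.toSpanSingleton K N (f fun i => i.elim0), fun v => ?_⟩
    refine (one_smul K (f fun i => i.elim0)).trans ?_
    exact congrArg f (Subsingleton.elim _ _)
  | succ n ih =>
    intro N _ _ _ _ f
    have : SMulCommClass k K N := IsScalarTower.to_smulCommClass
    -- The last variable is curried. `Hom(𝐕, N)` is again a `K`-vector space, which is why the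
    -- induction quantifies over all `N`.
    obtain ⟨F, hF⟩ := ih (N := StdRep k →ₗ[k] N)
      (MultilinearMap.curryRight (M := fun _ : Fin (n + 1) => StdRep k) f)
    refine ⟨TensorProduct.lift ((LinearMap.liftBaseChangeEquiv K).toLinearMap ∘ₗ F), fun v => ?_⟩
    rw [tpowForm_succ]
    change (LinearMap.liftBaseChangeEquiv K) (F (tpowForm k K n fun i => v i.castSucc))
      ((1 : K) ⊗ₜ v (Fin.last n)) = f v
    rw [hF]
    refine (LinearMap.liftBaseChange_tmul (A := K) _ _ _).trans ?_
    rw [one_smul]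
    change f (Fin.snoc (fun i => v i.castSucc) (v (Fin.last n))) = f v
    congr 1
    exact Fin.snoc_init_self v

variable {k K}

/-- The morphism from a tensor power given by an equivariant multilinear map. -/
lemma exists_tpow_hom {N : KMod k K} {n : ℕ}
    {f : MultilinearMap k (fun _ : Fin n => StdRep k) N.carrier} (hf : GLEquivariant f) :
    ∃ F : tpow k K n ⟶ N, ∀ v, lin F (tpowForm k K n v) = f v := by
  obtain ⟨F, hF⟩ := exists_tpow_lift k K n f
  refine ⟨homMk F fun g t => ?_, hF⟩
  have ht : t ∈ Submodule.span K (Set.range (tpowForm k K n)) := by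
    rw [span_tpowForm]
    trivial
  induction ht using Submodule.span_induction with
  | mem t ht =>
    obtain ⟨v, rfl⟩ := ht
    rw [← tpowForm_equivariant, hF, hF, hf]
  | zero => rw [smul_zero, map_zero, smul_zero]
  | add x y _ _ hx hy => rw [smul_add, map_add, map_add, smul_add, hx, hy]
  | smul a x _ hx => rw [smul_distrib_smul g a x, F.map_smul, F.map_smul, smul_distrib_smul g a (F x), hx]

/-- The morphism from a tensor power given by an equivariant multilinear map. -/
def tpowDesc {N : KMod k K} {n : ℕ}
    {f : MultilinearMap k (fun _ : Fin n => StdRep k) N.carrier} (hf : GLEquivariant f) :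
    tpow k K n ⟶ N := (exists_tpow_hom hf).choose

lemma tpowDesc_form {N : KMod k K} {n : ℕ}
    {f : MultilinearMap k (fun _ : Fin n => StdRep k) N.carrier} (hf : GLEquivariant f)
    (v : Fin n → StdRep k) : lin (tpowDesc hf) (tpowForm k K n v) = f v :=
  (exists_tpow_hom hf).choose_spec v

end Std

end KMod

/-! ### Exact sequences of `K`-modules -/

section KModLimits

open Limits

namespace KMod

section Exact

variable {k K : Type u} [Field k] [CharZero k] [Field K] [Algebra k K]
  [MulSemiringAction (GLinf k) K] [SMulCommClass (GLinf k) k K]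

/-- Exactness of a pair of morphisms of `K`-modules at the middle term. -/
def Exact {A B C : KMod k K} (f : A ⟶ B) (g : B ⟶ C) : Prop :=
  ∀ b, lin g b = 0 → ∃ a, lin f a = b

lemma lin_comp_eq_zero {A B C : KMod k K} {f : A ⟶ B} {g : B ⟶ C} (w : f ≫ g = 0) (a : A.carrier) :
    lin g (lin f a) = 0 := congrArg (fun F => lin F a) w

lemma isLimit_of_exact {A B C : KMod k K} {f : A ⟶ B} {g : B ⟶ C} (w : f ≫ g = 0)
    (h : Exact f g) (hf : Function.Injective (lin f)) :
    Nonempty (IsLimit (KernelFork.ofι f w)) := by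
  have key : ∀ {W : KMod k K} (t : W ⟶ B), t ≫ g = 0 → ∃ s : W ⟶ A, s ≫ f = t := by
    intro W t ht
    let e := LinearEquiv.ofInjective (lin f) hf
    have hr : ∀ x, lin t x ∈ LinearMap.range (lin f) := fun x => h _ (lin_comp_eq_zero ht x)
    have hs : ∀ x, lin f (e.symm ⟨lin t x, hr x⟩) = lin t x := fun x =>
      congrArg Subtype.val (e.apply_symm_apply ⟨lin t x, hr x⟩)
    refine ⟨homMk (e.symm.toLinearMap ∘ₗ (lin t).codRestrict _ hr) fun g x => hf ?_,
      hom_ext (LinearMap.ext hs)⟩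
    refine (hs _).trans ?_
    rw [lin_smul, lin_smul]
    exact congrArg _ (hs x).symm
  choose s hs using @key
  refine ⟨KernelFork.IsLimit.ofι f w (fun t ht => s t ht) (fun t ht => hs t ht)
    fun t ht m hm => hom_ext (LinearMap.ext fun x => hf ?_)⟩
  exact congrArg (fun F => lin F x) (hm.trans (hs t ht).symm)

lemma isColimit_of_exact {A B C : KMod k K} {f : A ⟶ B} {g : B ⟶ C} (w : f ≫ g = 0)
    (h : Exact f g) (hg : Function.Surjective (lin g)) :
    Nonempty (IsColimit (CokernelCofork.ofπ g w)) := by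
  have key : ∀ {W : KMod k K} (t : B ⟶ W), f ≫ t = 0 → ∃ s : C ⟶ W, g ≫ s = t := by
    intro W t ht
    let e := (lin g).quotKerEquivOfSurjective hg
    have hk : LinearMap.ker (lin g) ≤ LinearMap.ker (lin t) := fun b hb => by
      obtain ⟨a, rfl⟩ := h b hb
      exact lin_comp_eq_zero ht a
    have hs : ∀ b, (LinearMap.ker (lin g)).liftQ (lin t) hk (e.symm (lin g b)) = lin t b := by
      intro b
      have : e.symm (lin g b) = (LinearMap.ker (lin g)).mkQ b := (LinearEquiv.symm_apply_eq e).2 rfl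
      rw [this]
      rfl
    refine ⟨homMk ((LinearMap.ker (lin g)).liftQ (lin t) hk ∘ₗ e.symm.toLinearMap) fun γ c => ?_,
      hom_ext (LinearMap.ext hs)⟩
    obtain ⟨b, rfl⟩ := hg c
    rw [← lin_smul]
    refine (hs _).trans ((lin_smul t γ b).trans ?_)
    exact congrArg _ (hs b).symm
  choose s hs using @key
  refine ⟨CokernelCofork.IsColimit.ofπ g w (fun t ht => s t ht) (fun t ht => hs t ht)
    fun t ht m hm => hom_ext (LinearMap.ext fun c => ?_)⟩
  obtain ⟨b, rfl⟩ := hg c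
  exact congrArg (fun F => lin F b) (hm.trans (hs t ht).symm)

/-- The quotient by the range of a morphism. -/
lemma range_stable {A B : KMod k K} (f : A ⟶ B) (g : GLinf k) :
    ∀ b ∈ LinearMap.range (lin f), g • b ∈ LinearMap.range (lin f) := by
  rintro _ ⟨a, rfl⟩
  exact ⟨g • a, lin_smul f g a⟩

lemma ker_stable {A B : KMod k K} (f : A ⟶ B) (g : GLinf k) :
    ∀ a ∈ LinearMap.ker (lin f), g • a ∈ LinearMap.ker (lin f) := by
  intro a ha
  rw [LinearMap.mem_ker] at ha ⊢
  rw [lin_smul, ha, smul_zero]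

instance : HasCokernels (KMod k K) where
  has_colimit {A B} f := by
    have w : f ≫ quotπ B _ (range_stable f) = 0 :=
      hom_ext (LinearMap.ext fun a => (Submodule.Quotient.mk_eq_zero _).2 ⟨a, rfl⟩)
    obtain ⟨h⟩ := isColimit_of_exact w (fun b hb => (Submodule.Quotient.mk_eq_zero _).1 hb)
      (Submodule.mkQ_surjective _)
    exact ⟨⟨_, h⟩⟩

/-- The direct sum is a coproduct. -/
def dsumIsColimit {ι : Type u} (X : ι → KMod k K) :
    IsColimit (Cofan.mk (dsum X) (dsumι X)) :=
  Cofan.IsColimit.mk _ (fun s => dsumDesc X s.inj) (fun s i => dsumι_desc X s.inj i)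
    fun s m hm => dsum_hom_ext X fun i => (hm i).trans (dsumι_desc X s.inj i).symm

instance : HasCoproducts.{u} (KMod k K) := fun ι =>
  ⟨fun F => by
    have : HasColimit (Discrete.functor (F.obj ∘ Discrete.mk)) :=
      ⟨⟨_, dsumIsColimit (F.obj ∘ Discrete.mk)⟩⟩
    exact hasColimit_of_iso Discrete.natIsoFunctor⟩

instance : HasFiniteCoproducts (KMod k K) := hasFiniteCoproducts_of_hasCoproducts.{u} _

instance : HasFiniteBiproducts (KMod k K) := HasFiniteBiproducts.of_hasFiniteCoproducts

instance : HasBinaryBiproducts (KMod k K) := hasBinaryBiproducts_of_finite_biproducts _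

instance : HasZeroObject (KMod k K) := hasZeroObject_of_hasInitial_object

instance : HasCoequalizers (KMod k K) := Preadditive.hasCoequalizers_of_hasCokernels

lemma epi_of_surjective {A B : KMod k K} {f : A ⟶ B} (hf : Function.Surjective (lin f)) : Epi f :=
  ⟨fun g h w => hom_ext (LinearMap.ext fun b => by
    obtain ⟨a, rfl⟩ := hf b
    exact congrArg (fun F => lin F a) w)⟩

end Exact

/-! ### Kernels and exact functors -/

section HasKernels

variable (k R K : Type u) [Field k] [CharZero k] [CommRing R] [IsDomain R] [Algebra k R]
  [MulSemiringAction (GLinf k) R] [SMulCommClass (GLinf k) k R] [IsPolynomialRep k R]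
  [Field K] [Algebra k K] [Algebra R K] [IsScalarTower k R K] [IsFractionRing R K]
  [MulSemiringAction (GLinf k) K] [SMulCommClass (GLinf k) k K] [SMulDistribClass (GLinf k) R K]

-- `R` supplies the denominators that make the kernel a `K`-module, through `span_pol_sub`.
include R in
lemma hasKernels : HasKernels (KMod k K) where
  has_limit {A B} f := by
    have w : subι R A _ (ker_stable f) ≫ f = 0 :=
      hom_ext (LinearMap.ext fun a => a.2)
    obtain ⟨h⟩ := isLimit_of_exact w (fun b hb => ⟨⟨b, hb⟩, rfl⟩) Subtype.val_injective
    exact ⟨⟨_, h⟩⟩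

variable {k K}

/-- A functor is exact if it takes exact pairs of morphisms to exact pairs. -/
def IsExactFunctor (F : KMod k K ⥤ ModuleCat.{u} k) : Prop :=
  ∀ ⦃A B C : KMod k K⦄ (f : A ⟶ B) (g : B ⟶ C), f ≫ g = 0 → Exact f g →
    ∀ t : F.obj B, F.map g t = 0 → ∃ s : F.obj A, F.map f s = t

variable {F : KMod k K ⥤ ModuleCat.{u} k} [F.Additive]

lemma IsExactFunctor.injective (hF : IsExactFunctor F) {A B : KMod k K} {f : A ⟶ B}
    (hf : Function.Injective (lin f)) : Function.Injective (F.map f) := by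
  refine (injective_iff_map_eq_zero (F.map f).hom).2 fun t ht => ?_
  obtain ⟨s, rfl⟩ := hF (0 : A ⟶ A) f zero_comp
    (fun a ha => ⟨0, (map_zero _).trans (hf (ha.trans (map_zero _).symm)).symm⟩) t ht
  rw [F.map_zero]
  rfl

lemma IsExactFunctor.surjective (hF : IsExactFunctor F) {A B : KMod k K} {f : A ⟶ B}
    (hf : Function.Surjective (lin f)) : Function.Surjective (F.map f) := fun t =>
  hF f (0 : B ⟶ B) comp_zero (fun b _ => hf b) t (by rw [F.map_zero]; rfl)

include R in
lemma IsExactFunctor.preservesFiniteLimits (hF : IsExactFunctor F) :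
    PreservesFiniteLimits F := by
  have := hasKernels k R K
  have : HasEqualizers (KMod k K) := Preadditive.hasEqualizers_of_hasKernels
  have : ∀ {A B : KMod k K} (f : A ⟶ B), PreservesLimit (parallelPair f 0) F := by
    intro A B f
    have w : subι R A _ (ker_stable f) ≫ f = 0 := hom_ext (LinearMap.ext fun a => a.2)
    have hex : Exact (subι R A _ (ker_stable f)) f := fun b hb => ⟨⟨b, hb⟩, rfl⟩
    obtain ⟨h⟩ := isLimit_of_exact w hex Subtype.val_injective
    refine preservesLimit_of_preserves_limit_cone h ((isLimitMapConeForkEquiv' F w).symm ?_)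
    let S : ShortComplex (ModuleCat.{u} k) := ⟨F.map (subι R A _ (ker_stable f)), F.map f,
      by rw [← F.map_comp, w, F.map_zero]⟩
    have hS : S.Exact := S.moduleCat_exact_iff.2 (hF _ _ w hex)
    have : Mono S.f := (ModuleCat.mono_iff_injective _).2
      (hF.injective (f := subι R A _ (ker_stable f)) Subtype.val_injective)
    exact hS.fIsKernel
  exact Functor.preservesFiniteLimits_of_preservesKernels F

lemma IsExactFunctor.preservesCokernels (hF : IsExactFunctor F) {A B : KMod k K} (f : A ⟶ B) :
    PreservesColimit (parallelPair f 0) F := by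
  have w : f ≫ quotπ B _ (range_stable f) = 0 :=
    hom_ext (LinearMap.ext fun a => (Submodule.Quotient.mk_eq_zero _).2 ⟨a, rfl⟩)
  have hex : Exact f (quotπ B _ (range_stable f)) :=
    fun b hb => (Submodule.Quotient.mk_eq_zero _).1 hb
  have hsurj : Function.Surjective (lin (quotπ B _ (range_stable f))) :=
    Submodule.mkQ_surjective _
  obtain ⟨h⟩ := isColimit_of_exact w hex hsurj
  refine preservesColimit_of_preserves_colimit_cocone h
    ((isColimitMapCoconeCoforkEquiv' F w).symm ?_)
  let S : ShortComplex (ModuleCat.{u} k) := ⟨F.map f, F.map (quotπ B _ (range_stable f)),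
    by rw [← F.map_comp, w, F.map_zero]⟩
  have hS : S.Exact := S.moduleCat_exact_iff.2 (hF _ _ w hex)
  have : Epi S.g := (ModuleCat.epi_iff_surjective _).2 (hF.surjective hsurj)
  exact hS.gIsCokernel

lemma IsExactFunctor.preservesFiniteColimits (hF : IsExactFunctor F) :
    PreservesFiniteColimits F := by
  have : ∀ {A B : KMod k K} (f : A ⟶ B), PreservesColimit (parallelPair f 0) F :=
    fun f => hF.preservesCokernels f
  exact Functor.preservesFiniteColimits_of_preservesCokernels F

/-- Colimits are built from coproducts and coequalizers, and the latter reduce to cokernels. -/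
lemma IsExactFunctor.preservesColimits (hF : IsExactFunctor F)
    (h : ∀ {ι : Type u} (X : ι → KMod k K), Nonempty
      (IsColimit (Cofan.mk (F.obj (dsum X)) fun i => F.map (dsumι X i)))) :
    PreservesColimitsOfSize.{u, u} F := by
  have : ∀ {A B : KMod k K} (f : A ⟶ B), PreservesColimit (parallelPair f 0) F :=
    fun f => hF.preservesCokernels f
  have := Functor.preservesCoequalizers_of_preservesCokernels F
  have : ∀ J : Type u, PreservesColimitsOfShape (Discrete J) F := fun J => by
    refine ⟨fun {D} => ?_⟩
    have : PreservesColimit (Discrete.functor (D.obj ∘ Discrete.mk)) F := by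
      obtain ⟨h'⟩ := h (D.obj ∘ Discrete.mk)
      exact preservesColimit_of_preserves_colimit_cocone (dsumIsColimit _)
        ((isColimitMapCoconeCofanMkEquiv F _ _).symm h')
    exact preservesColimit_of_iso_diagram F Discrete.natIsoFunctor.symm
  exact preservesColimits_of_preservesCoequalizers_and_coproducts F

-- `f` factors as an epimorphism onto the kernel of `g` followed by the inclusion, and `F` preserves
-- both.
include R in
lemma isExactFunctor_of_preserves [PreservesFiniteLimits F] [PreservesFiniteColimits F] :
    IsExactFunctor F := by
  intro A B C f g w h t ht
  have w' : subι R B _ (ker_stable g) ≫ g = 0 := hom_ext (LinearMap.ext fun a => a.2)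
  obtain ⟨hl⟩ := isLimit_of_exact w' (fun b hb => ⟨⟨b, hb⟩, rfl⟩) Subtype.val_injective
  obtain ⟨s, hs⟩ : ∃ s : F.obj (sub R B _ (ker_stable g)),
      F.map (subι R B _ (ker_stable g)) s = t := by
    have hl' := isLimitForkMapOfIsLimit' F w' hl
    -- An element of `F.obj B` is a map from `k`, to which the universal property of the kernel
    -- applies.
    let τ : ModuleCat.of k k ⟶ F.obj B := ModuleCat.ofHom (LinearMap.toSpanSingleton k _ t)
    have hτ : τ ≫ F.map g = 0 := ModuleCat.hom_ext (LinearMap.ext_ring (by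
      change F.map g ((1 : k) • t) = 0
      rw [one_smul, ht]))
    refine ⟨hl'.lift (KernelFork.ofι τ hτ) (1 : k), ?_⟩
    have := hl'.fac (KernelFork.ofι τ hτ) WalkingParallelPair.zero
    refine (congrArg (fun G : ModuleCat.of k k ⟶ F.obj B => G (1 : k)) this).trans ?_
    exact one_smul k t
  let p : A ⟶ sub R B _ (ker_stable g) :=
    homMk (N := sub R B _ (ker_stable g))
      ((lin f).codRestrict (LinearMap.ker (lin g)) fun a => lin_comp_eq_zero w a)
      fun γ a => Subtype.ext (lin_smul f γ a)
  have hp : p ≫ subι R B _ (ker_stable g) = f := rfl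
  have : Epi p := epi_of_surjective fun ⟨b, hb⟩ => by
    obtain ⟨a, rfl⟩ := h b hb
    exact ⟨a, rfl⟩
  obtain ⟨a, rfl⟩ := (ModuleCat.epi_iff_surjective (F.map p)).1 inferInstance s
  refine ⟨a, ?_⟩
  rw [← hs, ← hp, F.map_comp]
  rfl

end HasKernels

end KMod

end KModLimits

/-! ### Properties of the functor attached to a generic point -/

section Phi

variable {k R K : Type u} [Field k] [CharZero k] [CommRing R] [IsDomain R] [Algebra k R]
  [MulSemiringAction (GLinf k) R] [SMulCommClass (GLinf k) k R] [IsPolynomialRep k R]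
  [Field K] [Algebra k K] [Algebra R K] [IsScalarTower k R K] [IsFractionRing R K]
  [MulSemiringAction (GLinf k) K] [SMulCommClass (GLinf k) k K] [SMulDistribClass (GLinf k) R K]

lemma polMod.val_add {N : KMod k K} (n n' : polMod N) : (n + n').val = n.val + n'.val := rfl

lemma polMod.val_sum {N : KMod k K} {ι : Type*} (s : Finset ι) (n : ι → polMod N) :
    (∑ i ∈ s, n i).val = ∑ i ∈ s, (n i).val := map_sum (polMod.valLin N) n s

variable (R) in
/-- If `W` spans `N` over `K`, then every element of `N^pol` has a nonzero multiple in the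
`R`-module spanned by `W`. -/
lemma polMod.exists_smul_mem_span {N : KMod k K} {W : Set (polMod N)}
    (hW : Submodule.span K (val '' W) = ⊤) (n : polMod N) :
    ∃ r : R, r ≠ 0 ∧ r • n ∈ Submodule.span R W := by
  have key : ∀ n : N.carrier, ∃ r : R, r ≠ 0 ∧ ∃ n' ∈ Submodule.span R W,
      n'.val = algebraMap R K r • n := by
    intro n
    have hn : n ∈ Submodule.span K (val '' W) := by rw [hW]; trivial
    induction hn using Submodule.span_induction with
    | mem n hn =>
      obtain ⟨w, hw, rfl⟩ := hn
      exact ⟨1, one_ne_zero, w, Submodule.subset_span hw, by rw [map_one, one_smul]⟩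
    | zero => exact ⟨1, one_ne_zero, 0, Submodule.zero_mem _, by rw [smul_zero]; rfl⟩
    | add a b _ _ ha hb =>
      obtain ⟨r, hr, a', ha', ha⟩ := ha
      obtain ⟨s, hs, b', hb', hb⟩ := hb
      refine ⟨r * s, mul_ne_zero hr hs, s • a' + r • b',
        Submodule.add_mem _ (Submodule.smul_mem _ _ ha') (Submodule.smul_mem _ _ hb'), ?_⟩
      rw [val_add, val_smul_alg, val_smul_alg, ha, hb, smul_add, map_mul, smul_smul, smul_smul,
        mul_comm (algebraMap R K r)]
    | smul a n _ ha =>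
      obtain ⟨r, hr, n', hn', ha⟩ := ha
      obtain ⟨p, q, hq, rfl⟩ := IsFractionRing.div_surjective (A := R) a
      have hq0 : q ≠ 0 := nonZeroDivisors.ne_zero hq
      have hqK : algebraMap R K q ≠ 0 := by simpa using hq0
      refine ⟨q * r, mul_ne_zero hq0 hr, p • n', Submodule.smul_mem _ _ hn', ?_⟩
      rw [val_smul_alg, ha, smul_smul, smul_smul, map_mul]
      congr 1
      field_simp
  obtain ⟨r, hr, n', hn', h⟩ := key n.val
  refine ⟨r, hr, ?_⟩
  have : r • n = n' := polMod.ext h.symm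
  rwa [this]

section Point

variable {U : Type u} [AddCommGroup U] [Module k U] {x : AlgEval k R U →ₐ[k] k}

/-- Every polynomial element has a nonzero multiple in the `R`-span of `W`, so `evalSub_le_localSat`
applies with `Y = ⊤`. -/
lemma top_le_localSat (hx : IsGLGeneric x) {N : KMod k K} {W : Set (polMod N)}
    (hW : Submodule.span K (polMod.val '' W) = ⊤)
    (S : Submodule (AlgEval k R U) (PolEval k (polMod N) U))
    (hS : ∀ w ∈ W, ∀ ψ : StdRep k →ₗ[k] U, push ψ w ∈ S) : ⊤ ≤ localSat (RingHom.ker x) S := by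
  have h := evalSub_le_localSat (Y := (⊤ : Submodule R (polMod N))) hx S
    (fun _ _ _ => trivial) fun m _ => ?_
  · exact fun t _ => h fun _ => trivial
  obtain ⟨r, hr, hm⟩ := polMod.exists_smul_mem_span R hW m
  refine ⟨r, hr, fun ψ => ?_⟩
  generalize r • m = m' at hm
  induction hm using Submodule.span_induction with
  | mem w hw => exact hS w hw ψ
  | zero => rw [map_zero]; exact S.zero_mem
  | add a b _ _ ha hb => rw [map_add]; exact S.add_mem ha hb
  | smul a w _ h => rw [push_smul']; exact S.smul_mem _ h

variable {B : Type u} [AddCommGroup B] [Module k B] [Module R B] [IsScalarTower k R B]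
  [DistribMulAction (GLinf k) B] [SMulDistribClass (GLinf k) R B] [IsFormSpanned k B]

lemma mkQ_alg_smul (a : AlgEval k R U) (h : PolEval k B U) :
    (maxSub B x).mkQ (a • h) = x a • (maxSub B x).mkQ h := by
  rw [← map_smul, ← sub_eq_zero, ← map_sub]
  refine (Submodule.Quotient.mk_eq_zero _).2 ?_
  have : a • h - x a • h = (a - algebraMap k _ (x a)) • h := by
    rw [sub_smul, algebraMap_smul]
  rw [this]
  exact smul_mem_maxSub (by rw [map_sub, AlgHom.commutes, Algebra.algebraMap_self_apply, sub_self]) h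

/-- If `W` spans `N` over `K`, then the fiber of `N^pol` is spanned by the images of `W`. -/
lemma fiber_mem_of_span (hx : IsGLGeneric x) {N : KMod k K} {W : Set (polMod N)}
    (hW : Submodule.span K (polMod.val '' W) = ⊤) (T : Submodule k (Fiber (polMod N) x))
    (hT : ∀ w ∈ W, ∀ ψ : StdRep k →ₗ[k] U, (maxSub (polMod N) x).mkQ (push ψ w) ∈ T)
    (t : Fiber (polMod N) x) : t ∈ T := by
  obtain ⟨h, rfl⟩ := Submodule.mkQ_surjective _ t
  let S : Submodule (AlgEval k R U) (PolEval k (polMod N) U) :=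
    { carrier := {h | (maxSub (polMod N) x).mkQ h ∈ T}
      add_mem' := fun {a b} ha hb => by
        rw [Set.mem_ofPred_eq] at *
        rw [map_add]
        exact T.add_mem ha hb
      zero_mem' := by
        rw [Set.mem_ofPred_eq, map_zero]
        exact T.zero_mem
      smul_mem' := fun a b hb => by
        rw [Set.mem_ofPred_eq] at *
        rw [mkQ_alg_smul]
        exact T.smul_mem _ hb }
  obtain ⟨s, hs, h'⟩ := mem_localSat.1 (top_le_localSat (x := x) hx hW S hT (trivial : h ∈ ⊤))
  rw [mkQ_eq_smul_of_smul_eq (x := x) (s := s) (fun h0 => hs h0)]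
  exact T.smul_mem _ h'

end Point

variable (P : GenericPair k R)

instance : (phiFunctor K P).Additive where
  map_add {A B f g} := by
    refine ModuleCat.hom_ext (LinearMap.ext fun t => ?_)
    obtain ⟨h, rfl⟩ := Submodule.mkQ_surjective _ t
    rfl

instance : (phiFunctor K P).Linear k where
  map_smul {A B} f c := by
    refine ModuleCat.hom_ext (LinearMap.ext fun t => ?_)
    obtain ⟨h, rfl⟩ := Submodule.mkQ_surjective _ t
    rfl

/-- A polynomial element in the image of `f` need not have a polynomial preimage, but a nonzero
multiple of it does, which is all that `fiberMap_exact` asks for. -/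
lemma phi_isExactFunctor : KMod.IsExactFunctor (phiFunctor K P) := by
  intro A B C f g w h t ht
  refine fiberMap_exact P.generic (polMod.map f) (polMod.map_smul_group f) (polMod.map_smul_alg f)
    (polMod.map g) (polMod.map_smul_group g) (polMod.map_smul_alg g) (fun b hb => ?_) t ht
  obtain ⟨a, ha⟩ := h b.val (congrArg polMod.val hb)
  obtain ⟨r, hr, hra⟩ := polMod.exists_smul_mem R a
  refine ⟨r, hr, polMod.mk _ hra, polMod.ext ?_⟩
  change KMod.lin f (algebraMap R K r • a) = algebraMap R K r • b.val
  rw [map_smul, ha]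

/-- Forms span the source, and the target is torsion free over `R`, so a form into it that dies on
the fiber is zero by `form_eq_zero_of_fiber`. -/
lemma polMod.map_eq_zero {A B : KMod k K} (f : A ⟶ B) (h : (phiFunctor K P).map f = 0)
    (a : polMod A) : polMod.map f a = 0 := by
  refine form_induction (k := k) (p := fun a => polMod.map f a = 0) (fun n F hF v => ?_)
    (map_zero _) (fun a b ha hb => by rw [map_add, ha, hb, add_zero]) a
  refine form_eq_zero_of_fiber P.infinite P.generic
    (fun r b hr hb => polMod.eq_zero_of_smul_eq_zero r b hr hb)
    (hF.comp (polMod.map f) (polMod.map_smul_group f)) (fun u => ?_) v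
  rw [← evalMap_evalForm]
  refine (Submodule.Quotient.mk_eq_zero _).1 ?_
  exact congrArg (fun F => F ((maxSub (polMod A) P.x).mkQ (evalForm P.V hF u))) h

instance : (phiFunctor K P).Faithful where
  map_injective {A B f g} h := by
    have h0 : (phiFunctor K P).map (f - g) = 0 := by rw [Functor.map_sub, h, sub_self]
    have h1 : KMod.lin (f - g) = 0 := by
      refine LinearMap.ext_on A.span_pol fun a ha => ?_
      exact congrArg polMod.val (polMod.map_eq_zero P (f - g) h0 (polMod.mk a ha))
    exact sub_eq_zero.1 (KMod.hom_ext h1)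

/-! #### The unit -/

/-- The element `1` of `K^pol`. -/
def polMod.one : polMod (KMod.unit : KMod k K) :=
  polMod.mk (N := KMod.unit) (1 : K) (one_mem_pol (K := K))

lemma push_one {U : Type u} [AddCommGroup U] [Module k U] (ψ : StdRep k →ₗ[k] U) :
    push ψ (polMod.one (k := k) (K := K)) = unitFn U :=
  push_evalId ψ (unitFn (StdRep k))

lemma span_one : Submodule.span K (polMod.val '' {polMod.one (k := k) (K := K)}) = ⊤ := by
  refine eq_top_iff.2 fun (t : K) _ => ?_
  have h1 : (polMod.one (k := k) (K := K)).val ∈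
      Submodule.span K (polMod.val '' {polMod.one (k := k) (K := K)}) :=
    Submodule.subset_span ⟨_, rfl, rfl⟩
  have h2 := Submodule.smul_mem _ t h1
  have h3 : t • (polMod.one (k := k) (K := K)).val = (t : (KMod.unit : KMod k K).carrier) :=
    mul_one t
  rwa [h3] at h2

/-- Elements of `K^pol{U}` are locally multiples of `1`. If `1` were in `𝔪 K^pol{U}`, then `s • 1 =
a • 1` with `a ∈ 𝔪` and `s ∉ 𝔪`, but `a = s` because `R` embeds in `K`. -/
lemma unitFn_notMem {U : Type u} [AddCommGroup U] [Module k U] {x : AlgEval k R U →ₐ[k] k}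
    (hx : IsGLGeneric x) : unitFn (K := K) U ∉ maxSub (polMod (KMod.unit : KMod k K)) x := by
  intro h
  have h1 := top_le_localSat (x := x) hx (span_one (k := k) (K := K))
    (Submodule.span (AlgEval k R U) {unitFn U}) fun w hw ψ => by
      rw [Set.mem_singleton_iff.1 hw, push_one]
      exact Submodule.subset_span rfl
  obtain ⟨s, hs, h2⟩ := mem_localSat.1 (smul_le_localSat h1 (RingHom.ker x) h)
  obtain ⟨a, ha, h3⟩ := Submodule.mem_smul_span_singleton.1 h2
  have h4 : a = s := AlgEval.ext fun φ => by
    have h5 := congrArg (fun F : PolEval k (polMod (KMod.unit : KMod k K)) U => (F.fn φ).val) h3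
    have h6 : algebraMap R K (a.fn φ) * 1 = algebraMap R K (s.fn φ) * 1 := h5
    rw [mul_one, mul_one] at h6
    exact IsFractionRing.injective R K h6
  exact hs (h4 ▸ ha)

open Functor.LaxMonoidal in
lemma phi_isIso_ε : IsIso (ε (phiFunctor K P)) := by
  refine (ConcreteCategory.isIso_iff_bijective _).2 ⟨?_, fun t => ?_⟩
  · refine (injective_iff_map_eq_zero (ε (phiFunctor K P)).hom).2 fun (c : k) hc => ?_
    have h : c • (maxSub (polMod (KMod.unit : KMod k K)) P.x).mkQ (unitFn P.V) = 0 := hc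
    refine (smul_eq_zero.1 h).resolve_right fun h => ?_
    exact unitFn_notMem P.generic ((Submodule.Quotient.mk_eq_zero _).1 h)
  · exact fiber_mem_of_span (x := P.x) P.generic (span_one (k := k) (K := K))
      (LinearMap.range (LinearMap.toSpanSingleton k (Fiber (polMod (KMod.unit : KMod k K)) P.x)
        ((maxSub _ P.x).mkQ (unitFn P.V))))
      (fun w hw ψ => ⟨1, by
        rw [Set.mem_singleton_iff.1 hw, push_one, LinearMap.toSpanSingleton_apply, one_smul]⟩) t

/-! #### The tensor product -/

lemma push_bilin {A B C : Type u} [AddCommGroup A] [Module k A] [DistribMulAction (GLinf k) A]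
    [IsFormSpanned k A] [AddCommGroup B] [Module k B] [DistribMulAction (GLinf k) B]
    [IsFormSpanned k B] [AddCommGroup C] [Module k C] [DistribMulAction (GLinf k) C]
    [IsFormSpanned k C] {U : Type u} [AddCommGroup U] [Module k U] (ψ : StdRep k →ₗ[k] U)
    (b : A →ₗ[k] B →ₗ[k] C) (hb : ∀ (g : GLinf k) (x : A) (y : B), b (g • x) (g • y) = g • b x y)
    (x : A) (y : B) : push ψ (b x y) = evalMap₂ U b hb (push ψ x) (push ψ y) := by
  obtain ⟨h, rfl⟩ := (evalIdEquiv k A).surjective x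
  obtain ⟨h', rfl⟩ := (evalIdEquiv k B).surjective y
  have e1 : push ψ (evalIdEquiv k A h) = evalTransport A ψ h := push_evalId ψ h
  have e2 : push ψ (evalIdEquiv k B h') = evalTransport B ψ h' := push_evalId ψ h'
  rw [e1, e2]
  exact push_evalId ψ (evalMap₂ (StdRep k) b hb h h')

lemma span_val_tmul {A B : KMod k K} {S : Set (polMod A)} {T : Set (polMod B)}
    (hS : Submodule.span K (polMod.val '' S) = ⊤) (hT : Submodule.span K (polMod.val '' T) = ⊤) :
    Submodule.span K (polMod.val '' {t | ∃ a ∈ S, ∃ b ∈ T, polMod.tmul A B a b = t}) = ⊤ := by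
  have h := KMod.span_tmul_eq_top hS hT
  refine eq_top_iff.2 (h.symm.le.trans (Submodule.span_mono ?_))
  rintro _ ⟨_, ⟨a, ha, rfl⟩, _, ⟨b, hb, rfl⟩, rfl⟩
  exact ⟨_, ⟨a, ha, b, hb, rfl⟩, rfl⟩

lemma span_val_univ (A : KMod k K) :
    Submodule.span K (polMod.val '' (Set.univ : Set (polMod A))) = ⊤ := by
  refine eq_top_iff.2 (A.span_pol.symm.le.trans (Submodule.span_mono ?_))
  exact fun a ha => ⟨polMod.mk a ha, trivial, rfl⟩

-- Tensors of polynomial elements span `A ⊗ B` over `K`, and `fiber_mem_of_span` turns this into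
-- generation of the fiber.
open Functor.LaxMonoidal in
lemma phi_μ_surjective (A B : KMod k K) : Function.Surjective (μ (phiFunctor K P) A B) := by
  intro t
  refine fiber_mem_of_span (x := P.x) P.generic (span_val_tmul (span_val_univ A) (span_val_univ B))
    (LinearMap.range (TensorProduct.lift (fiberTmul P A B))) ?_ t
  rintro _ ⟨a, -, b, -, rfl⟩ ψ
  refine ⟨(maxSub _ P.x).mkQ (push ψ a) ⊗ₜ (maxSub _ P.x).mkQ (push ψ b), ?_⟩
  rw [push_bilin ψ (polMod.tmul A B) (polMod.tmul_smul_group A B)]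
  rfl

/-! #### Coproducts -/

lemma fiber_dsum_span {ι : Type u} (X : ι → KMod k K) (t : Fiber (polMod (KMod.dsum X)) P.x) :
    t ∈ ⨆ i, LinearMap.range ((phiFunctor K P).map (KMod.dsumι X i)).hom := by
  classical
  refine fiber_mem_of_span (x := P.x) P.generic (W := {w | ∃ i a, polMod.map (KMod.dsumι X i) a = w})
    ?_ (⨆ i, LinearMap.range (fiberMap P.x (polMod.map (KMod.dsumι X i))
      (polMod.map_smul_group _) (polMod.map_smul_alg _))) ?_ t
  · refine eq_top_iff.2 ?_
    rintro (y : Π₀ i, (X i).carrier) -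
    induction y using DFinsupp.induction with
    | h0 => exact Submodule.zero_mem _
    | ha i b y _ _ ih =>
      refine Submodule.add_mem _ ?_ ih
      have hb : b ∈ Submodule.span K (pol k (X i).carrier : Set (X i).carrier) := by
        rw [(X i).span_pol]; trivial
      change KMod.lin (KMod.dsumι X i) b ∈ _
      have := Submodule.mem_map_of_mem (f := KMod.lin (KMod.dsumι X i)) hb
      rw [Submodule.map_span] at this
      refine Submodule.span_mono ?_ this
      rintro _ ⟨a, ha, rfl⟩
      exact ⟨_, ⟨i, polMod.mk a ha, rfl⟩, rfl⟩
  · rintro _ ⟨i, a, rfl⟩ ψ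
    refine Submodule.mem_iSup_of_mem i ⟨(maxSub _ P.x).mkQ (push ψ a), ?_⟩
    rw [← evalMap_push ψ (polMod.map (KMod.dsumι X i)) (polMod.map_smul_group _)]
    rfl

end Phi

/-! ### Additive functors and infinite direct sums -/

section Cofan

variable {k K : Type u} [Field k] [CharZero k] [Field K] [Algebra k K]
  [MulSemiringAction (GLinf k) K] [SMulCommClass (GLinf k) k K]

lemma KMod.dsumι_π_ne {ι : Type u} (X : ι → KMod k K) {i j : ι} (h : i ≠ j) :
    dsumι X i ≫ dsumπ X j = 0 := by
  classical
  refine hom_ext (LinearMap.ext fun m => ?_)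
  change (DFinsupp.single i m : Π₀ i, (X i).carrier) j = 0
  rw [DFinsupp.single_eq_of_ne h.symm]

-- The projections make the comparison map from `⨁ F(X i)` injective for any additive functor; the
-- spanning hypothesis makes it surjective.
open Limits in
lemma isColimit_map_dsum (F : KMod k K ⥤ ModuleCat.{u} k) [F.Additive] {ι : Type u}
    (X : ι → KMod k K)
    (h : ∀ t : F.obj (KMod.dsum X), t ∈ ⨆ i, LinearMap.range (F.map (KMod.dsumι X i)).hom) :
    Nonempty (IsColimit (Cofan.mk (F.obj (KMod.dsum X)) fun i => F.map (KMod.dsumι X i))) := by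
  classical
  let E : (Π₀ i, F.obj (X i)) →ₗ[k] F.obj (KMod.dsum X) :=
    DFinsupp.lsum ℕ fun i => (F.map (KMod.dsumι X i)).hom
  have hE : ∀ i t, E (DFinsupp.single i t) = F.map (KMod.dsumι X i) t := fun i t =>
    DFinsupp.lsum_single ..
  have hπ : ∀ j t, F.map (KMod.dsumπ X j) (E t) = t j := by
    intro j t
    induction t using DFinsupp.induction with
    | h0 => simp
    | ha i b t _ _ ih =>
      rw [map_add, map_add, ih, hE, DFinsupp.add_apply]
      congr 1
      rw [← ConcreteCategory.comp_apply, ← F.map_comp]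
      rcases eq_or_ne i j with rfl | hij
      · rw [KMod.dsumι_π_self, F.map_id, DFinsupp.single_eq_same]
        rfl
      · rw [KMod.dsumι_π_ne X hij, F.map_zero, DFinsupp.single_eq_of_ne hij.symm]
        rfl
  have hinj : Function.Injective E := fun s t hst => DFinsupp.ext fun j => by
    rw [← hπ j s, ← hπ j t, hst]
  have hsurj : Function.Surjective E := fun t => by
    have : ⨆ i, LinearMap.range (F.map (KMod.dsumι X i)).hom ≤ LinearMap.range E := by
      refine iSup_le fun i => ?_
      rintro _ ⟨s, rfl⟩
      exact ⟨_, hE i s⟩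
    exact this (h t)
  let e := LinearEquiv.ofBijective E ⟨hinj, hsurj⟩
  refine ⟨Cofan.IsColimit.mk _ (fun s => ModuleCat.ofHom
    (DFinsupp.lsum ℕ (fun i => (s.inj i).hom) ∘ₗ e.symm.toLinearMap)) (fun s i => ?_)
    fun s m hm => ?_⟩
  · refine ModuleCat.hom_ext (LinearMap.ext fun t => ?_)
    have h1 : e.symm (F.map (KMod.dsumι X i) t) = DFinsupp.single i t :=
      (LinearEquiv.symm_apply_eq e).2 (hE i t).symm
    change DFinsupp.lsum ℕ (fun i => (s.inj i).hom) (e.symm (F.map (KMod.dsumι X i) t)) = _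
    rw [h1, DFinsupp.lsum_single]
  · refine ModuleCat.hom_ext (LinearMap.ext fun t => ?_)
    obtain ⟨t, rfl⟩ := hsurj t
    have h1 : e.symm (E t) = t := e.symm_apply_apply t
    change m (E t) = DFinsupp.lsum ℕ (fun i => (s.inj i).hom) (e.symm (E t))
    rw [h1]
    induction t using DFinsupp.induction with
    | h0 => simp
    | ha i b t _ _ ih =>
      rw [map_add, map_add, map_add, ih (e.symm_apply_apply t), hE, DFinsupp.lsum_single]
      congr 1
      exact congrArg (fun G => G b) (hm i)

end Cofan

/-! ### Injectivity of natural transformations -/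

section Natural

variable {k K : Type u} [Field k] [CharZero k] [Field K] [Algebra k K]
  [MulSemiringAction (GLinf k) K] [SMulCommClass (GLinf k) k K]

/-- The values of the functor `F` are spanned by the images of the values on tensor powers of the
standard module. -/
def IsTpowSpanned (F : KMod k K ⥤ ModuleCat.{u} k) : Prop :=
  ∀ (N : KMod k K) (t : F.obj N), t ∈ Submodule.span k
    {y : F.obj N | ∃ (n : ℕ) (f : KMod.tpow k K n ⟶ N) (s : F.obj (KMod.tpow k K n)), F.map f s = y}

lemma IsTpowSpanned.exists_sum {F : KMod k K ⥤ ModuleCat.{u} k} (hF : IsTpowSpanned F)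
    {N : KMod k K} (t : F.obj N) : ∃ (m : ℕ) (n : Fin m → ℕ) (f : ∀ i, KMod.tpow k K (n i) ⟶ N)
      (s : ∀ i, F.obj (KMod.tpow k K (n i))), t = ∑ i, F.map (f i) (s i) := by
  obtain ⟨m, c, g, h⟩ := Submodule.mem_span_set'.1 (hF N t)
  choose n f s hs using fun i => (g i).2
  refine ⟨m, n, f, fun i => c i • s i, ?_⟩
  rw [← h]
  exact Finset.sum_congr rfl fun i _ => by rw [map_smul, hs]

variable {F G : KMod k K ⥤ ModuleCat.{u} k} [F.Additive] [G.Additive]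

/-- The identity of a finite direct sum is the sum of its projections followed by inclusions, so an
element is determined by its components. -/
lemma app_dsum_injective (θ : F ⟶ G) {ι : Type u} [Finite ι] (X : ι → KMod k K)
    (h : ∀ i, Function.Injective (θ.app (X i))) : Function.Injective (θ.app (KMod.dsum X)) := by
  have := Fintype.ofFinite ι
  refine (injective_iff_map_eq_zero (θ.app (KMod.dsum X)).hom).2 fun t ht => ?_
  have h1 : ∀ i, F.map (KMod.dsumπ X i) t = 0 := fun i => by
    refine (injective_iff_map_eq_zero (θ.app (X i)).hom).1 (h i) _ ?_
    have := congrArg (fun H => H t) (θ.naturality (KMod.dsumπ X i))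
    refine this.trans ?_
    refine (congrArg (G.map (KMod.dsumπ X i)) ht).trans ?_
    exact map_zero (G.map (KMod.dsumπ X i)).hom
  have h2 : F.map (∑ i, KMod.dsumπ X i ≫ KMod.dsumι X i) t = t := by
    rw [KMod.dsum_sum_π_ι, F.map_id]
    rfl
  rw [← h2, F.map_sum]
  have h3 : (∑ i, F.map (KMod.dsumπ X i ≫ KMod.dsumι X i)).hom t =
      ∑ i, F.map (KMod.dsumπ X i ≫ KMod.dsumι X i) t := by
    rw [ModuleCat.hom_sum, LinearMap.sum_apply]
  refine h3.trans (Finset.sum_eq_zero fun i _ => ?_)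
  rw [F.map_comp]
  refine (congrArg (F.map (KMod.dsumι X i)) (h1 i)).trans ?_
  exact map_zero (F.map (KMod.dsumι X i)).hom

section Injective

variable (R : Type u) [CommRing R] [IsDomain R] [Algebra k R]
  [MulSemiringAction (GLinf k) R] [SMulCommClass (GLinf k) k R] [IsPolynomialRep k R]
  [Algebra R K] [IsScalarTower k R K] [IsFractionRing R K] [SMulDistribClass (GLinf k) R K]

include R in
/-- A surjective natural transformation to an exact functor is injective if it is injective on
tensor powers of the standard module. -/
theorem app_injective_of_tpow (θ : F ⟶ G) (hF : IsTpowSpanned F) (hG : KMod.IsExactFunctor G)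
    (hθ : ∀ N, Function.Surjective (θ.app N))
    (h : ∀ n, Function.Injective (θ.app (KMod.tpow k K n))) (N : KMod k K) :
    Function.Injective (θ.app N) := by
  refine (injective_iff_map_eq_zero (θ.app N).hom).2 fun t ht => ?_
  obtain ⟨m, n, f, s, rfl⟩ := hF.exists_sum t
  let X : ULift.{u} (Fin m) → KMod k K := fun i => KMod.tpow k K (n i.down)
  let g : KMod.dsum X ⟶ N := KMod.dsumDesc X fun i => f i.down
  -- The element is lifted to a finite direct sum of tensor powers, where `θ` is already injective.
  let s' : F.obj (KMod.dsum X) := ∑ i, F.map (KMod.dsumι X ⟨i⟩) (s i)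
  have hs' : F.map g s' = ∑ i, F.map (f i) (s i) := by
    rw [map_sum]
    refine Finset.sum_congr rfl fun i _ => ?_
    rw [← ConcreteCategory.comp_apply, ← F.map_comp, KMod.dsumι_desc]
  have nat : ∀ {A B : KMod k K} (p : A ⟶ B) (a : F.obj A),
      θ.app B (F.map p a) = G.map p (θ.app A a) := fun p a =>
    congrArg (fun H => H a) (θ.naturality p)
  rw [← hs'] at ht ⊢
  have ht' : G.map g (θ.app _ s') = 0 := (nat g s').symm.trans ht
  have w : KMod.subι R _ _ (KMod.ker_stable g) ≫ g = 0 :=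
    KMod.hom_ext (LinearMap.ext fun a => a.2)
  -- By exactness of `G` the image of `s'` comes from `G` of the kernel of `g`, and by surjectivity
  -- of `θ` from `F` of that kernel. Injectivity then shows that `s'` itself comes from there, so
  -- `g` kills it.
  obtain ⟨z, hz⟩ := hG _ g w (fun b hb => ⟨⟨b, hb⟩, rfl⟩) _ ht'
  obtain ⟨z, rfl⟩ := hθ _ z
  rw [← nat] at hz
  have hz' := app_dsum_injective θ X (fun i => h _) hz
  rw [← hz', ← ConcreteCategory.comp_apply, ← F.map_comp, w, F.map_zero]
  rfl

end Injective

end Natural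

/-! ### The functor attached to a generic point is monoidal -/

section Phi

variable {k R K : Type u} [Field k] [CharZero k] [CommRing R] [IsDomain R] [Algebra k R]
  [MulSemiringAction (GLinf k) R] [SMulCommClass (GLinf k) k R] [IsPolynomialRep k R]
  [Field K] [Algebra k K] [Algebra R K] [IsScalarTower k R K] [IsFractionRing R K]
  [MulSemiringAction (GLinf k) K] [SMulCommClass (GLinf k) k K] [SMulDistribClass (GLinf k) R K]

variable (K) in
/-- The vector `1 ⊗ v` of the standard module, as a polynomial element. -/
def polMod.std (v : StdRep k) : polMod (KMod.std k K) :=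
  polMod.mk (KMod.stdVec K v) (form_mem_pol
    (KMod.ofSubsingleton_equivariant (KMod.stdVec K) (KMod.stdVec_smul k K)) fun _ => v)

variable (k K) in
lemma span_std : Submodule.span K (polMod.val '' Set.range (polMod.std (k := k) K)) = ⊤ := by
  rw [← Set.range_comp]
  exact KMod.span_stdVec k K

/-- The equivariant linear map `𝐕 → (K ⊗ 𝐕)^pol` as a multilinear map in one variable. -/
lemma stdForm_equivariant : GLEquivariant (LinearMap.compMultilinearMap (KMod.stdVec K)
      (MultilinearMap.ofSubsingleton k (StdRep k) (StdRep k) (0 : Fin 1) LinearMap.id)) :=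
  KMod.ofSubsingleton_equivariant (KMod.stdVec K) (KMod.stdVec_smul k K)

/-- `Γ` plays the role of the graph of a linear map that is defined only on part of `N`; projecting
`I • Γ` replaces applying that map to `I • span T`. -/
lemma exists_mem_rel {S M N : Type*} [CommRing S] [AddCommGroup M] [Module S M] [AddCommGroup N]
    [Module S N] (Γ : Submodule S (M × N)) {T : Set N} (I : Ideal S)
    (hT : ∀ z ∈ T, ∃ w, (w, z) ∈ Γ) {z : N} (hz : z ∈ I • Submodule.span S T) :
    ∃ w ∈ I • (⊤ : Submodule S M), (w, z) ∈ Γ := by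
  have h1 : Submodule.span S T ≤ Γ.map (LinearMap.snd S M N) :=
    Submodule.span_le.2 fun z hz => by
      obtain ⟨w, hw⟩ := hT z hz
      exact ⟨_, hw, rfl⟩
  have h2 := Submodule.smul_mono le_rfl h1 hz
  rw [← Submodule.map_smul''] at h2
  obtain ⟨⟨w, z⟩, hp, rfl⟩ := h2
  refine ⟨w, ?_, Submodule.smul_le_right hp⟩
  have h3 : w ∈ (I • Γ).map (LinearMap.fst S M N) := ⟨_, hp, rfl⟩
  rw [Submodule.map_smul''] at h3
  exact Submodule.smul_mono le_rfl le_top h3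

section Vec

variable {U : Type u} [AddCommGroup U] [Module k U]

variable (K) in
/-- The map `U → (K ⊗ 𝐕)^pol{U}`. -/
def evalStd : U →ₗ[k] PolEval k (polMod (KMod.std k K)) U where
  toFun u := evalForm U (polMod.form_equivariant (stdForm_equivariant (K := K))) fun _ => u
  map_add' u v := PolEval.ext fun φ => polMod.ext (by
    change KMod.stdVec K (φ (u + v)) = KMod.stdVec K (φ u) + KMod.stdVec K (φ v)
    rw [map_add, map_add])
  map_smul' c v := PolEval.ext fun φ => polMod.ext (by
    change KMod.stdVec K (φ (c • v)) = c • KMod.stdVec K (φ v)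
    rw [map_smul, map_smul])

lemma push_std (ψ : StdRep k →ₗ[k] U) (v : StdRep k) :
    push ψ (polMod.std K v) = evalStd K (ψ v) :=
  push_form ψ (polMod.form_equivariant (stdForm_equivariant (K := K))) fun _ => v

variable (A : KMod k K)

/-- The contraction of `A ⊗ 𝐕` with a linear form on `𝐕`. -/
def contract (θ : StdRep k →ₗ[k] k) : (KMod.tensorObj A (KMod.std k K)).carrier →ₗ[K] A.carrier :=
  (TensorProduct.rid K A.carrier).toLinearMap ∘ₗ
    TensorProduct.map (LinearMap.id : A.carrier →ₗ[K] A.carrier)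
      ((Algebra.linearMap k K ∘ₗ θ).liftBaseChange K)

lemma contract_tmul (θ : StdRep k →ₗ[k] k) (a : A.carrier) (v : StdRep k) :
    contract A θ (a ⊗ₜ[K] KMod.stdVec K v : A.carrier ⊗[K] (KMod.std k K).carrier) = θ v • a := by
  change ((1 : K) • algebraMap k K (θ v)) • a = θ v • a
  rw [one_smul, algebraMap_smul]

variable {A} in
/-- The relation between elements of `A{U}` and elements of `E{U}` given by a family of linear maps
`E → A`. -/
def contractRel {E : KMod k K}
    (c : (StdRep k →ₗ[k] U) × (U →ₗ[k] StdRep k) → E.carrier →ₗ[K] A.carrier) :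
    Submodule (AlgEval k R U) (PolEval k (polMod A) U × PolEval k (polMod E) U) where
  carrier := {p | ∀ᶠ q in sectionFilter k U, c q (p.2.fn q.2).val = (p.1.fn q.2).val}
  add_mem' {p p'} hp hp' := by
    filter_upwards [hp, hp'] with q h h'
    exact (map_add (c q) _ _).trans (congrArg₂ (· + ·) h h')
  zero_mem' := Filter.Eventually.of_forall fun q => map_zero (c q)
  smul_mem' a p hp := by
    filter_upwards [hp] with q h
    exact (map_smul (c q) (algebraMap R K (a.fn q.2)) _).trans
      (congrArg (algebraMap R K (a.fn q.2) • ·) h)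

/-- The relation is single valued: at a suitable section `h` is recovered from `h φ`, and this value
is the image of `0`. -/
lemma eq_zero_of_mem_contractRel {E : KMod k K}
    {c : (StdRep k →ₗ[k] U) × (U →ₗ[k] StdRep k) → E.carrier →ₗ[K] A.carrier}
    {x : AlgEval k R U →ₐ[k] k} (hx : IsGLGeneric x)
    {h : PolEval k (polMod A) U} (hh : (h, 0) ∈ contractRel (R := R) c) : h = 0 := by
  obtain ⟨q, ⟨h1, h2⟩, -⟩ := exists_section_pointAt_ne_zero hx one_ne_zero
    ((eventually_push_eq h).and hh)
  have h3 : h.fn q.2 = 0 := polMod.ext (h2.symm.trans (map_zero (c q)))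
  rw [← h1, h3, map_zero]

/-- The product `A{U} × U → (A ⊗ 𝐕){U}`. -/
def evalTmulStd (u : U) : PolEval k (polMod A) U →ₗ[k]
    PolEval k (polMod (KMod.tensorObj A (KMod.std k K))) U :=
  (evalMap₂ U (polMod.tmul A (KMod.std k K)) (polMod.tmul_smul_group A (KMod.std k K))).flip
    (evalStd K u)

/-- At a section `(ψ, φ)` that fixes `u`, contraction with `l ∘ ψ` takes `a ⊗ φ u` to `l u • a`. So
the relation computes the contraction with `l` without requiring a map on `(A ⊗ 𝐕){U}`. -/
lemma mem_contractRel (l : U →ₗ[k] k) (h : PolEval k (polMod A) U) (u : U) :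
    (l u • h, evalTmulStd A u h) ∈ contractRel (R := R) (fun q => contract A (l ∘ₗ q.1)) := by
  filter_upwards [eventually_section u] with q hq
  refine (contract_tmul A (l ∘ₗ q.1) (h.fn q.2).val (q.2 u)).trans ?_
  rw [LinearMap.comp_apply, hq]
  rfl

lemma exists_mem_contractRel {x : AlgEval k R U →ₐ[k] k} (l : U →ₗ[k] k)
    {z : PolEval k (polMod (KMod.tensorObj A (KMod.std k K))) U}
    (hz : z ∈ RingHom.ker x • Submodule.span (AlgEval k R U) {z | ∃ h u, z = evalTmulStd A u h}) :
    ∃ w ∈ RingHom.ker x • (⊤ : Submodule (AlgEval k R U) (PolEval k (polMod A) U)),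
      (w, z) ∈ contractRel (R := R) (fun q => contract A (l ∘ₗ q.1)) := by
  refine exists_mem_rel _ _ (fun z hz => ?_) hz
  obtain ⟨h, u, rfl⟩ := hz
  exact ⟨_, mem_contractRel A l h u⟩

lemma top_le_localSat_tmulStd {x : AlgEval k R U →ₐ[k] k} (hx : IsGLGeneric x) :
    ⊤ ≤ localSat (RingHom.ker x)
      (Submodule.span (AlgEval k R U) {z | ∃ h u, z = evalTmulStd (U := U) A u h}) := by
  refine top_le_localSat (x := x) hx (span_val_tmul (span_val_univ A) (span_std k K)) _ ?_
  rintro _ ⟨a, -, _, ⟨v, rfl⟩, rfl⟩ ψ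
  refine Submodule.subset_span ⟨push ψ a, ψ v, ?_⟩
  rw [push_bilin ψ (polMod.tmul A (KMod.std k K)) (polMod.tmul_smul_group _ _), push_std]
  rfl

/-- If a sum of products of elements of `A{U}` with linearly independent vectors vanishes in the
fiber, then so do the elements. -/
lemma mkQ_eq_zero_of_sum_tmulStd {x : AlgEval k R U →ₐ[k] k} (hx : IsGLGeneric x) {ι : Type*}
    [Fintype ι] (h : ι → PolEval k (polMod A) U) (u : ι → U) (hu : LinearIndependent k u)
    (H : ∑ i, evalTmulStd A (u i) (h i) ∈
      maxSub (polMod (KMod.tensorObj A (KMod.std k K))) x) (j : ι) :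
    (maxSub (polMod A) x).mkQ (h j) = 0 := by
  classical
  -- The functional dual to `u j`; contraction with it isolates `h j`.
  obtain ⟨l, hl⟩ : ∃ l : U →ₗ[k] k, ∀ i, l (u i) = if i = j then 1 else 0 := by
    obtain ⟨l, hl⟩ := LinearMap.exists_extend (K := k)
      (V := U) (V' := ι →₀ k) (p := Submodule.span k (Set.range u)) hu.repr
    refine ⟨Finsupp.lapply j ∘ₗ l, fun i => ?_⟩
    have h1 := congrArg (fun F => F ⟨u i, Submodule.subset_span ⟨i, rfl⟩⟩) hl
    have h2 : l (u i) = Finsupp.single i 1 := by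
      refine h1.trans ?_
      exact hu.repr_eq_single i ⟨u i, Submodule.subset_span ⟨i, rfl⟩⟩ rfl
    rw [LinearMap.comp_apply, h2, Finsupp.lapply_apply, Finsupp.single_apply]
  obtain ⟨s, hs, h1⟩ := mem_localSat.1
    (smul_le_localSat (top_le_localSat_tmulStd A hx) (RingHom.ker x) H)
  obtain ⟨w, hw, h2⟩ := exists_mem_contractRel A l h1
  -- The sum contracts to `h j`, and its multiple by `s` also contracts to the element `w` of `𝔪
  -- A{U}`. Single-valuedness gives `s • h j = w`.
  have h3 : (h j, ∑ i, evalTmulStd A (u i) (h i)) ∈ contractRel (R := R) (fun q => contract A (l ∘ₗ q.1)) := by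
    have := Submodule.sum_mem (contractRel (R := R) (fun q => contract A (l ∘ₗ q.1))) (t := Finset.univ)
      fun i _ => mem_contractRel A l (h i) (u i)
    have e : ∑ i, (l (u i) • h i, evalTmulStd A (u i) (h i)) =
        (h j, ∑ i, evalTmulStd A (u i) (h i)) := by
      rw [Prod.ext_iff, Prod.fst_sum, Prod.snd_sum]
      refine ⟨?_, rfl⟩
      simp only [hl, ite_smul, one_smul, zero_smul, Finset.sum_ite_eq', Finset.mem_univ, if_true]
    rwa [e] at this
  have h4 := Submodule.sub_mem _ (Submodule.smul_mem _ s h3) h2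
  have h5 : (s • h j - w, (0 : PolEval k (polMod (KMod.tensorObj A (KMod.std k K))) U)) ∈
      contractRel (R := R) (fun q => contract A (l ∘ₗ q.1)) := by
    convert h4 using 1
    rw [Prod.ext_iff]
    exact ⟨rfl, (sub_self _).symm⟩
  have h6 := sub_eq_zero.1 (eq_zero_of_mem_contractRel A hx h5)
  rw [mkQ_eq_smul_of_smul_eq (x := x) (s := s) (fun h0 => hs h0), h6]
  have h7 : (maxSub (polMod A) x).mkQ w = 0 := (Submodule.Quotient.mk_eq_zero _).2 hw
  rw [h7, smul_zero]

end Vec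

end Phi

/-! ### Compatibility with tensoring by the standard module -/

section Phi

variable {k R K : Type u} [Field k] [CharZero k] [CommRing R] [IsDomain R] [Algebra k R]
  [MulSemiringAction (GLinf k) R] [SMulCommClass (GLinf k) k R] [IsPolynomialRep k R]
  [Field K] [Algebra k K] [Algebra R K] [IsScalarTower k R K] [IsFractionRing R K]
  [MulSemiringAction (GLinf k) K] [SMulCommClass (GLinf k) k K] [SMulDistribClass (GLinf k) R K]
  (P : GenericPair k R)

open Functor.LaxMonoidal

variable (K) in
/-- The map from `V` to the fiber of the standard module. -/
def fiberStd : P.V →ₗ[k] Fiber (polMod (KMod.std k K)) P.x :=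
  (maxSub (polMod (KMod.std k K)) P.x).mkQ ∘ₗ evalStd K

lemma fiberStd_surjective : Function.Surjective (fiberStd K P) := fun t =>
  fiber_mem_of_span (x := P.x) P.generic (span_std k K) (LinearMap.range (fiberStd K P)) (by
    rintro _ ⟨v, rfl⟩ ψ
    rw [push_std]
    exact ⟨_, rfl⟩) t

lemma fiberTmul_fiberStd (A : KMod k K) (h : PolEval k (polMod A) P.V) (u : P.V) :
    fiberTmul P A (KMod.std k K) ((maxSub (polMod A) P.x).mkQ h) (fiberStd K P u) =
      (maxSub (polMod (KMod.tensorObj A (KMod.std k K))) P.x).mkQ (evalTmulStd A u h) := rfl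

lemma eq_zero_of_sum_fiberTmul_std (A : KMod k K) {ι : Type*} [Fintype ι]
    (d : ι → Fiber (polMod A) P.x) (u : ι → P.V) (hu : LinearIndependent k u)
    (H : ∑ i, fiberTmul P A (KMod.std k K) (d i) (fiberStd K P (u i)) = 0) (j : ι) : d j = 0 := by
  choose h hh using fun i => Submodule.mkQ_surjective _ (d i)
  rw [← hh j]
  refine mkQ_eq_zero_of_sum_tmulStd A P.generic h u hu ((Submodule.Quotient.mk_eq_zero _).1 ?_) j
  have h1 := map_sum (maxSub (polMod (KMod.tensorObj A (KMod.std k K))) P.x).mkQ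
    (fun i => evalTmulStd A (u i) (h i)) Finset.univ
  refine h1.trans (Eq.trans ?_ H)
  refine Finset.sum_congr rfl fun i _ => ?_
  rw [← fiberTmul_fiberStd, hh]

/-- Expand the factor `V` in a basis and apply the contraction argument to the basis vectors that
occur. -/
lemma lift_fiberTmul_std_injective (A : KMod k K) :
    Function.Injective (TensorProduct.lift (fiberTmul P A (KMod.std k K)) ∘ₗ
      (fiberStd K P).lTensor (Fiber (polMod A) P.x)) := by
  refine (injective_iff_map_eq_zero _).2 fun t ht => ?_
  obtain ⟨b, rfl⟩ := TensorProduct.eq_repr_basis_right (Module.Basis.ofVectorSpace k P.V) t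
  rw [Finsupp.sum, map_sum, ← Finset.sum_coe_sort b.support] at ht
  have h2 := eq_zero_of_sum_fiberTmul_std P A (fun i : b.support => b i.1) _
    ((Module.Basis.ofVectorSpace k P.V).linearIndependent.comp _ Subtype.val_injective) ht
  refine Finset.sum_eq_zero fun i hi => ?_
  have h3 : b i = 0 := h2 ⟨i, hi⟩
  rw [h3]
  exact TensorProduct.zero_tmul _ _

/-- `V` surjects onto the fiber of the standard module, so injectivity on `Φ(A) ⊗ V` descends to
`Φ(A) ⊗ Φ(K ⊗ 𝐕)`. -/
lemma phi_isIso_μ_std (A : KMod k K) : IsIso (μ (phiFunctor K P) A (KMod.std k K)) := by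
  refine (ConcreteCategory.isIso_iff_bijective _).2 ⟨?_, phi_μ_surjective P A _⟩
  have h := lift_fiberTmul_std_injective P A
  have hs : Function.Surjective ((fiberStd K P).lTensor (Fiber (polMod A) P.x)) :=
    LinearMap.lTensor_surjective _ (fiberStd_surjective P)
  intro s t hst
  obtain ⟨s, rfl⟩ := hs s
  obtain ⟨t, rfl⟩ := hs t
  exact congrArg _ (h hst)

/-- This is the contraction argument for `A = K`: a nonzero vector mapping to zero would make `1`
vanish in the fiber of the unit. -/
lemma fiberStd_injective : Function.Injective (fiberStd K P) := by
  refine (injective_iff_map_eq_zero _).2 fun v hv => ?_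
  by_contra hv0
  refine unitFn_notMem (K := K) P.generic ((Submodule.Quotient.mk_eq_zero _).1 ?_)
  refine mkQ_eq_zero_of_sum_tmulStd (KMod.unit : KMod k K) P.generic (fun _ : Unit => unitFn P.V)
    (fun _ => v) (linearIndependent_unique_iff.2 hv0) ?_ ()
  refine (Submodule.Quotient.mk_eq_zero _).1 ?_
  rw [Fintype.sum_unique]
  exact (congrArg (fiberTmul P (KMod.unit : KMod k K) (KMod.std k K)
    ((maxSub _ P.x).mkQ (unitFn P.V))) hv).trans (map_zero _)

end Phi

/-! ### Structure maps at tensor powers -/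

section Monoidal

open MonoidalCategory Functor.LaxMonoidal

/-- The structure maps of a lax monoidal functor at tensor powers of an object are isomorphisms if
those at the object are. -/
lemma isIso_μ_tpow {k K : Type u} [Field k] [CharZero k] [Field K] [Algebra k K]
    [MulSemiringAction (GLinf k) K] [SMulCommClass (GLinf k) k K]
    (F : KMod k K ⥤ ModuleCat.{u} k) [F.LaxMonoidal] (hε : IsIso (ε F))
    (hF : ∀ A, IsIso (μ F A (KMod.std k K))) (n : ℕ) :
    ∀ A, IsIso (μ F A (KMod.tpow k K n)) := by
  induction n with
  | zero =>
    intro A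
    have h := Functor.LaxMonoidal.right_unitality F A
    have h2 : IsIso (F.obj A ◁ ε F ≫ μ F A (𝟙_ _)) := by
      -- Right unitality expresses this composite through unitors, which are invertible.
      have : F.obj A ◁ ε F ≫ μ F A (𝟙_ _) = (ρ_ (F.obj A)).hom ≫ inv (F.map (ρ_ A).hom) := by
        rw [h]; simp
      rw [this]
      infer_instance
    exact IsIso.of_isIso_comp_left (F.obj A ◁ ε F) (μ F A (𝟙_ _))
  | succ n ih =>
    intro A
    -- Associativity writes the structure map at the next tensor power in terms of three that are
    -- known to be invertible.
    have h := Functor.LaxMonoidal.associativity F A (KMod.tpow k K n) (KMod.std k K)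
    have := hF (A ⊗ KMod.tpow k K n)
    have := hF (KMod.tpow k K n)
    have := ih A
    have h2 : IsIso ((α_ _ _ _).hom ≫ F.obj A ◁ μ F (KMod.tpow k K n) (KMod.std k K) ≫
        μ F A (KMod.tpow k K n ⊗ KMod.std k K)) := by
      rw [← h]
      infer_instance
    have h3 := IsIso.of_isIso_comp_left (α_ (F.obj A) _ _).hom
      (F.obj A ◁ μ F (KMod.tpow k K n) (KMod.std k K) ≫
        μ F A (KMod.tpow k K n ⊗ KMod.std k K))
    exact IsIso.of_isIso_comp_left (F.obj A ◁ μ F (KMod.tpow k K n) (KMod.std k K))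
        (μ F A (KMod.tpow k K n ⊗ KMod.std k K))

end Monoidal

/-! ### Exactness and spanning for tensored functors -/

section Tensor

open MonoidalCategory Functor.LaxMonoidal

variable {k K : Type u} [Field k] [CharZero k] [Field K] [Algebra k K]
    [MulSemiringAction (GLinf k) K] [SMulCommClass (GLinf k) k K]
    (F : KMod k K ⥤ ModuleCat.{u} k) [F.LaxMonoidal] (A : KMod k K)

/-- The structure maps of a lax monoidal functor, as a natural transformation in the second
variable. -/
def μNat : F ⋙ tensorLeft (F.obj A) ⟶ tensorLeft A ⋙ F where
  app N := μ F A N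
  naturality {M N} f := μ_natural_right F A f

/-- Modules over the field `K` are flat. -/
lemma KMod.exact_whiskerLeft {B C D : KMod k K} {f : B ⟶ C} {g : C ⟶ D} (w : f ≫ g = 0)
    (h : Exact f g) : Exact (A ◁ f) (A ◁ g) := by
  have h1 : Function.Exact (lin f) (lin g) := fun c =>
    ⟨h c, by rintro ⟨b, rfl⟩; exact lin_comp_eq_zero w b⟩
  have h2 := Module.Flat.lTensor_exact A.carrier h1
  exact fun b hb => (h2 b).1 hb

instance [F.Additive] : (tensorLeft A ⋙ F).Additive where
  map_add {B C f g} := by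
    have : A ◁ (f + g) = A ◁ f + A ◁ g :=
      KMod.hom_ext (TensorProduct.map_add_right _ _ _)
    change F.map (A ◁ (f + g)) = F.map (A ◁ f) + F.map (A ◁ g)
    rw [this, F.map_add]

lemma KMod.IsExactFunctor.tensorLeft_comp {F : KMod k K ⥤ ModuleCat.{u} k} [F.Additive]
    (hF : IsExactFunctor F) : IsExactFunctor (tensorLeft A ⋙ F) := by
  intro B C D f g w h t ht
  refine hF (A ◁ f) (A ◁ g) ?_ (exact_whiskerLeft A w h) t ht
  rw [← MonoidalCategory.whiskerLeft_comp, w]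
  exact KMod.hom_ext (TensorProduct.map_zero_right _)

lemma IsTpowSpanned.comp_tensorLeft {F : KMod k K ⥤ ModuleCat.{u} k} (hF : IsTpowSpanned F)
    (Q : ModuleCat.{u} k) : IsTpowSpanned (F ⋙ tensorLeft Q) := by
  intro N t
  induction t using TensorProduct.induction_on with
  | zero => exact Submodule.zero_mem _
  | add x y hx hy => exact Submodule.add_mem _ hx hy
  | tmul q y =>
    have := hF N y
    induction this using Submodule.span_induction with
    | mem y hy =>
      obtain ⟨n, f, s, rfl⟩ := hy
      exact Submodule.subset_span ⟨n, f, (q ⊗ₜ s : Q ⊗[k] F.obj (KMod.tpow k K n)), rfl⟩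
    | zero => rw [TensorProduct.tmul_zero]; exact Submodule.zero_mem _
    | add y z _ _ h1 h2 => rw [TensorProduct.tmul_add]; exact Submodule.add_mem _ h1 h2
    | smul c y _ h => rw [TensorProduct.tmul_smul]; exact Submodule.smul_mem _ c h

end Tensor

/-! ### The functor of a pair is a fiber functor -/

section FiberFunctor

open MonoidalCategory Functor.LaxMonoidal

variable {k R K : Type u} [Field k] [CharZero k] [CommRing R] [IsDomain R] [Algebra k R]
  [MulSemiringAction (GLinf k) R] [SMulCommClass (GLinf k) k R] [IsPolynomialRep k R]
  [Field K] [Algebra k K] [Algebra R K] [IsScalarTower k R K] [IsFractionRing R K]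
  [MulSemiringAction (GLinf k) K] [SMulCommClass (GLinf k) k K] [SMulDistribClass (GLinf k) R K]
  (P : GenericPair k R)

variable (k K) in
/-- The universal multilinear map to the tensor power of the standard module, evaluated on a vector
space. -/
def evalTpow (U : Type u) [AddCommGroup U] [Module k U] (n : ℕ) :
    MultilinearMap k (fun _ : Fin n => U) (PolEval k (polMod (KMod.tpow k K n)) U) :=
  evalForm U (polMod.form_equivariant (KMod.tpowForm_equivariant k K n))

/-- The morphism from a tensor power given by an equivariant multilinear map to `N^pol`. -/
def polMod.desc {N : KMod k K} {n : ℕ} {f : MultilinearMap k (fun _ : Fin n => StdRep k) (polMod N)}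
    (hf : GLEquivariant f) : KMod.tpow k K n ⟶ N :=
  KMod.tpowDesc (hf.comp (polMod.valLin N) fun _ _ => rfl)

lemma evalMap_evalTpow {N : KMod k K} {n : ℕ}
    {f : MultilinearMap k (fun _ : Fin n => StdRep k) (polMod N)} (hf : GLEquivariant f)
    {U : Type u} [AddCommGroup U] [Module k U] (u : Fin n → U) :
    evalMap U (polMod.map (polMod.desc hf)) (polMod.map_smul_group _) (evalTpow k K U n u) =
      evalForm U hf u :=
  PolEval.ext fun φ => polMod.ext (KMod.tpowDesc_form _ _)

lemma phi_map_desc {N : KMod k K} {n : ℕ}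
    {f : MultilinearMap k (fun _ : Fin n => StdRep k) (polMod N)} (hf : GLEquivariant f)
    (u : Fin n → P.V) : (phiFunctor K P).map (polMod.desc hf)
      ((maxSub (polMod (KMod.tpow k K n)) P.x).mkQ (evalTpow k K P.V n u)) =
        (maxSub (polMod N) P.x).mkQ (evalForm P.V hf u) :=
  congrArg (maxSub (polMod N) P.x).mkQ (evalMap_evalTpow hf u)

/-- The value of a form at `u` is the image of the value of the universal form, under the morphism
that the form defines. -/
lemma phi_isTpowSpanned : IsTpowSpanned (phiFunctor K P) := by
  intro N t
  obtain ⟨h, rfl⟩ := Submodule.mkQ_surjective _ t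
  induction h using PolEval.induction with
  | hform n f hf u => exact Submodule.subset_span ⟨n, _, _, phi_map_desc P hf u⟩
  | hzero => rw [map_zero]; exact Submodule.zero_mem _
  | hadd a b ha hb => rw [map_add]; exact Submodule.add_mem _ ha hb

/-- For fixed `A` the structure maps are natural in `B`, surjective, and invertible on tensor
powers; `app_injective_of_tpow` extends injectivity to all `B`. -/
lemma phi_isIso_μ (A B : KMod k K) : IsIso (μ (phiFunctor K P) A B) := by
  have : ((phiFunctor K P) ⋙ tensorLeft ((phiFunctor K P).obj A)).Additive := inferInstance
  refine (ConcreteCategory.isIso_iff_bijective _).2 ⟨?_, phi_μ_surjective P A _⟩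
  refine app_injective_of_tpow R (μNat (phiFunctor K P) A)
    ((phi_isTpowSpanned P).comp_tensorLeft _) ((phi_isExactFunctor P).tensorLeft_comp A)
    (fun N => phi_μ_surjective P A N) (fun n => ?_) B
  have := isIso_μ_tpow (phiFunctor K P) (phi_isIso_ε P) (phi_isIso_μ_std P) n A
  exact ((ConcreteCategory.isIso_iff_bijective _).1 this).1

theorem phi_isFiberFunctor : IsFiberFunctor (phi K P) where
  isIso_ε := phi_isIso_ε P
  isIso_μ := phi_isIso_μ P
  additive := inferInstanceAs (phiFunctor K P).Additive
  linear := inferInstanceAs ((phiFunctor K P).Linear k)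
  leftExact := (phi_isExactFunctor P).preservesFiniteLimits R
  rightExact := (phi_isExactFunctor P).preservesFiniteColimits
  faithful := inferInstanceAs (phiFunctor K P).Faithful
  cocontinuous := (phi_isExactFunctor P).preservesColimits fun X =>
    isColimit_map_dsum _ X (fiber_dsum_span P X)

end FiberFunctor

/-! ### Lax monoidal functors on elements -/

section Elements

open MonoidalCategory Functor.LaxMonoidal

variable {k K : Type u} [Field k] [CharZero k] [Field K] [Algebra k K]
  [MulSemiringAction (GLinf k) K] [SMulCommClass (GLinf k) k K]
  (F : KMod k K ⥤ ModuleCat.{u} k)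

lemma map_comp_apply {A B C : KMod k K} (f : A ⟶ B) (g : B ⟶ C) (x : F.obj A) :
    F.map (f ≫ g) x = F.map g (F.map f x) := by
  rw [F.map_comp]
  rfl

lemma map_id_apply {A : KMod k K} (x : F.obj A) : F.map (𝟙 A) x = x := by
  rw [F.map_id]
  rfl

lemma map_zero_apply [F.Additive] {A B : KMod k K} (x : F.obj A) :
    F.map (0 : A ⟶ B) x = 0 := by
  rw [F.map_zero]
  rfl

lemma map_sum_apply [F.Additive] {A B : KMod k K} {ι : Type*} (s : Finset ι) (f : ι → (A ⟶ B))
    (x : F.obj A) : F.map (∑ i ∈ s, f i) x = ∑ i ∈ s, F.map (f i) x := by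
  rw [F.map_sum]
  have : (∑ i ∈ s, F.map (f i)).hom x = ∑ i ∈ s, F.map (f i) x := by
    rw [ModuleCat.hom_sum, LinearMap.sum_apply]
  exact this

lemma map_smul_apply [F.Additive] [F.Linear k] {A B : KMod k K} (c : k) (f : A ⟶ B) (x : F.obj A) :
    F.map (c • f) x = c • F.map f x := by
  rw [F.map_smul]
  rfl

variable [F.LaxMonoidal]

/-- The structure map of a lax monoidal functor, as a bilinear map. -/
def muEl (A B : KMod k K) : F.obj A →ₗ[k] F.obj B →ₗ[k] F.obj (KMod.tensorObj A B) :=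
  (TensorProduct.mk k (F.obj A) (F.obj B)).compr₂ (μ F A B).hom

/-- The image of `1` under the unit of a lax monoidal functor. -/
def epsEl : F.obj (KMod.unit : KMod k K) := ε F (1 : k)

variable {F}

lemma map_tensorHom_muEl {A A' B B' : KMod k K} (f : A ⟶ A') (g : B ⟶ B') (x : F.obj A)
    (y : F.obj B) : F.map (f ⊗ₘ g) (muEl F A B x y) = muEl F A' B' (F.map f x) (F.map g y) :=
  (congrArg (fun H : F.obj A ⊗ F.obj B ⟶ F.obj (A' ⊗ B') => H (x ⊗ₜ[k] y)) (μ_natural F f g)).symm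

lemma map_whiskerLeft_muEl (A : KMod k K) {B B' : KMod k K} (g : B ⟶ B') (x : F.obj A)
    (y : F.obj B) : F.map (A ◁ g) (muEl F A B x y) = muEl F A B' x (F.map g y) :=
  (congrArg (fun H : F.obj A ⊗ F.obj B ⟶ F.obj (A ⊗ B') => H (x ⊗ₜ[k] y))
    (μ_natural_right F A g)).symm

lemma map_whiskerRight_muEl {A A' : KMod k K} (f : A ⟶ A') (B : KMod k K) (x : F.obj A)
    (y : F.obj B) : F.map (f ▷ B) (muEl F A B x y) = muEl F A' B (F.map f x) y :=
  (congrArg (fun H : F.obj A ⊗ F.obj B ⟶ F.obj (A' ⊗ B) => H (x ⊗ₜ[k] y))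
    (μ_natural_left F f B)).symm

lemma map_associator_muEl {A B C : KMod k K} (x : F.obj A) (y : F.obj B) (z : F.obj C) :
    F.map (α_ A B C).hom (muEl F (A ⊗ B) C (muEl F A B x y) z) =
      muEl F A (B ⊗ C) x (muEl F B C y z) :=
  congrArg (fun H : (F.obj A ⊗ F.obj B) ⊗ F.obj C ⟶ F.obj (A ⊗ B ⊗ C) =>
    H ((x ⊗ₜ[k] y) ⊗ₜ[k] z)) (Functor.LaxMonoidal.associativity F A B C)

lemma map_leftUnitor_muEl {A : KMod k K} (x : F.obj A) :
    F.map (λ_ A).hom (muEl F (𝟙_ _) A (epsEl F) x) = x := by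
  have h := congrArg (fun H : 𝟙_ (ModuleCat.{u} k) ⊗ F.obj A ⟶ F.obj A => H ((1 : k) ⊗ₜ[k] x))
    (Functor.LaxMonoidal.left_unitality F A)
  exact h.symm.trans (one_smul k x)

lemma map_rightUnitor_muEl {A : KMod k K} (x : F.obj A) :
    F.map (ρ_ A).hom (muEl F A (𝟙_ _) x (epsEl F)) = x := by
  have h := congrArg (fun H : F.obj A ⊗ 𝟙_ (ModuleCat.{u} k) ⟶ F.obj A => H (x ⊗ₜ[k] (1 : k)))
    (Functor.LaxMonoidal.right_unitality F A)
  exact h.symm.trans (one_smul k x)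

lemma map_braiding_muEl {F : KMod k K ⥤ ModuleCat.{u} k} [F.LaxBraided] {A B : KMod k K}
    (x : F.obj A) (y : F.obj B) :
    F.map (β_ A B).hom (muEl F A B x y) = muEl F B A y x :=
  congrArg (fun H : F.obj A ⊗ F.obj B ⟶ F.obj (B ⊗ A) => H (x ⊗ₜ[k] y))
    (Functor.LaxBraided.braided (F := F) A B)

variable (F) in
/-- The structure map `F(𝐕^{⊗ n}) × F(𝐕) → F(𝐕^{⊗ (n + 1)})`. -/
def nuMul (n : ℕ) : F.obj (KMod.tpow k K n) →ₗ[k] F.obj (KMod.std k K) →ₗ[k]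
    F.obj (KMod.tpow k K (n + 1)) := muEl F (KMod.tpow k K n) (KMod.std k K)

variable (F) in
/-- The multilinear map `F(𝐕)ⁿ → F(𝐕^{⊗ n})`. -/
def nu : ∀ n, MultilinearMap k (fun _ : Fin n => F.obj (KMod.std k K)) (F.obj (KMod.tpow k K n))
  | 0 => MultilinearMap.constOfIsEmpty k _ (epsEl F)
  | n + 1 => MultilinearMap.uncurryRight (M := fun _ : Fin (n + 1) => F.obj (KMod.std k K))
      ((nuMul F n).compMultilinearMap (nu n))

lemma nu_succ (n : ℕ) (u : Fin (n + 1) → F.obj (KMod.std k K)) :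
    nu F (n + 1) u = nuMul F n (nu F n fun i => u i.castSucc) (u (Fin.last n)) := rfl

/-- The values of `nu` span. -/
lemma nu_span (hε : Function.Surjective (ε F))
    (hμ : ∀ A, Function.Surjective (μ F A (KMod.std k K))) (n : ℕ) :
    Submodule.span k (Set.range (nu F n)) = ⊤ := by
  induction n with
  | zero =>
    refine eq_top_iff.2 fun t _ => ?_
    obtain ⟨c, rfl⟩ := hε t
    have h : ε F c = c • nu F 0 fun i => i.elim0 := by
      refine Eq.trans ?_ (map_smul (ε F).hom c (1 : k))
      exact congrArg (ε F) (mul_one c).symm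
    rw [h]
    exact Submodule.smul_mem _ _ (Submodule.subset_span (Set.mem_range_self _))
  | succ n ih =>
    have h : ∀ x y, nuMul F n x y ∈ Submodule.span k (Set.range (nu F (n + 1))) := by
      intro x y
      have h1 : Submodule.span k (Set.range (nu F n)) ≤
          (Submodule.span k (Set.range (nu F (n + 1)))).comap ((nuMul F n).flip y) := by
        refine Submodule.span_le.2 ?_
        rintro _ ⟨u, rfl⟩
        refine Submodule.subset_span ⟨Fin.snoc (α := fun _ => F.obj (KMod.std k K)) u y, ?_⟩
        rw [nu_succ]
        simp only [Fin.snoc_castSucc, Fin.snoc_last]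
        rfl
      rw [ih] at h1
      exact h1 trivial
    have h2 : LinearMap.range (TensorProduct.lift (nuMul F n)) ≤
        Submodule.span k (Set.range (nu F (n + 1))) := by
      rintro _ ⟨t, rfl⟩
      induction t with
      | zero => rw [map_zero]; exact Submodule.zero_mem _
      | tmul x y => exact h x y
      | add x y hx hy => rw [map_add]; exact Submodule.add_mem _ hx hy
    have h3 : TensorProduct.lift (nuMul F n) = (μ F (KMod.tpow k K n) (KMod.std k K)).hom :=
      TensorProduct.ext' fun x y => rfl
    refine eq_top_iff.2 fun t _ => h2 ?_
    rw [h3]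
    exact hμ _ t

section Perm

variable (k K) in
/-- The map between tensor powers given by a permutation of the factors. -/
def tpowPerm {n m : ℕ} (σ : Fin n ≃ Fin m) : KMod.tpow k K m ⟶ KMod.tpow k K n :=
  KMod.tpowDesc ((KMod.tpowForm_equivariant k K n).domDomCongr σ)

lemma tpowPerm_form {n m : ℕ} (σ : Fin n ≃ Fin m) (v : Fin m → StdRep k) :
    KMod.lin (tpowPerm k K σ) (KMod.tpowForm k K m v) = KMod.tpowForm k K n fun i => v (σ i) :=
  KMod.tpowDesc_form _ v

lemma tpowPerm_one (n : ℕ) : tpowPerm k K (1 : Equiv.Perm (Fin n)) = 𝟙 _ :=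
  KMod.tpow_hom_ext k K fun v => tpowPerm_form _ v

lemma tpowPerm_mul {n : ℕ} (σ τ : Equiv.Perm (Fin n)) :
    tpowPerm k K (σ * τ) = tpowPerm k K σ ≫ tpowPerm k K τ :=
  KMod.tpow_hom_ext k K fun v => by
    rw [KMod.lin_comp, LinearMap.comp_apply, tpowPerm_form, tpowPerm_form, tpowPerm_form]
    rfl

variable {F : KMod k K ⥤ ModuleCat.{u} k} [F.LaxBraided]

/-- Up to associators, the transposition of the last two factors is the braiding. -/
lemma tpowPerm_swap_last (n : ℕ) :
    tpowPerm k K (Equiv.swap (Fin.last n).castSucc (Fin.last (n + 1))) ≫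
        (α_ (KMod.tpow k K n) (KMod.std k K) (KMod.std k K)).hom =
      (α_ (KMod.tpow k K n) (KMod.std k K) (KMod.std k K)).hom ≫
        (KMod.tpow k K n ◁ (β_ (KMod.std k K) (KMod.std k K)).hom) := by
  refine KMod.tpow_hom_ext k K (n := n + 2) fun v => ?_
  refine (congrArg (KMod.lin (α_ (KMod.tpow k K n) (KMod.std k K) (KMod.std k K)).hom)
    (tpowPerm_form _ v)).trans ?_
  have h1 : (fun i : Fin n => v (Equiv.swap (Fin.last n).castSucc (Fin.last (n + 1))
      i.castSucc.castSucc)) = fun i => v i.castSucc.castSucc := funext fun i => by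
    rw [Equiv.swap_apply_of_ne_of_ne]
    · exact fun h => (Fin.castSucc_lt_last i).ne (Fin.castSucc_injective _ h)
    · exact (Fin.castSucc_lt_last _).ne
  have h2 : v (Equiv.swap (Fin.last n).castSucc (Fin.last (n + 1)) (Fin.last n).castSucc) =
      v (Fin.last (n + 1)) := by rw [Equiv.swap_apply_left]
  have h3 : v (Equiv.swap (Fin.last n).castSucc (Fin.last (n + 1)) (Fin.last (n + 1))) =
      v (Fin.last n).castSucc := by rw [Equiv.swap_apply_right]
  exact congrArg₂ (fun a b => (a ⊗ₜ[K] b :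
      (KMod.tpow k K n).carrier ⊗[K] ((KMod.std k K).carrier ⊗[K] (KMod.std k K).carrier)))
    (congrArg (KMod.tpowForm k K n) h1)
    (congrArg₂ (fun a b => KMod.stdVec K a ⊗ₜ[K] KMod.stdVec K b) h2 h3)

lemma tpowPerm_whiskerRight {n : ℕ} (σ : Equiv.Perm (Fin n)) (τ : Equiv.Perm (Fin (n + 1)))
    (h : ∀ i, τ i.castSucc = (σ i).castSucc) (hl : τ (Fin.last n) = Fin.last n) :
    tpowPerm k K τ = tpowPerm k K σ ▷ KMod.std k K := by
  refine KMod.tpow_hom_ext k K (n := n + 1) fun v => ?_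
  refine (tpowPerm_form _ v).trans ?_
  refine congrArg₂ (fun a b => (a ⊗ₜ[K] b : (KMod.tpow k K n).carrier ⊗[K] (KMod.std k K).carrier))
    (Eq.trans ?_ (tpowPerm_form σ fun i => v i.castSucc).symm)
    (congrArg (fun i => KMod.stdVec K (v i)) hl)
  exact congrArg (KMod.tpowForm k K n) (funext fun i => congrArg v (h i))

/-- By induction on the number of factors: an adjacent transposition either exchanges the last two
factors, where `F` respects the braiding, or leaves the last factor alone and is a whiskering. -/
lemma map_tpowPerm_swap_nu : ∀ {n : ℕ} (i : Fin n) (u : Fin (n + 1) → F.obj (KMod.std k K)),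
    F.map (tpowPerm k K (Equiv.swap i.castSucc i.succ)) (nu F (n + 1) u) =
      nu F (n + 1) fun j => u (Equiv.swap i.castSucc i.succ j) := by
  intro n
  induction n with
  | zero => exact fun i => i.elim0
  | succ n ih =>
    intro i u
    induction i using Fin.lastCases with
    | last =>
      have hinj : Function.Injective
          (F.map (α_ (KMod.tpow k K n) (KMod.std k K) (KMod.std k K)).hom) :=
        ((ConcreteCategory.isIso_iff_bijective _).1 inferInstance).1
      refine hinj ?_
      have h1 := congrArg (fun H => F.map H (nu F (n + 2) u)) (tpowPerm_swap_last (k := k) (K := K) n)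
      refine ((map_comp_apply F (tpowPerm k K (Equiv.swap (Fin.last n).castSucc (Fin.last (n + 1))))
        (α_ (KMod.tpow k K n) (KMod.std k K) (KMod.std k K)).hom (nu F (n + 2) u)).symm.trans
          h1).trans ?_
      refine (map_comp_apply F (α_ (KMod.tpow k K n) (KMod.std k K) (KMod.std k K)).hom
        (KMod.tpow k K n ◁ (β_ (KMod.std k K) (KMod.std k K)).hom) _).trans ?_
      refine (congrArg (F.map (KMod.tpow k K n ◁ (β_ (KMod.std k K) (KMod.std k K)).hom))
        (map_associator_muEl _ _ _)).trans ?_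
      refine (map_whiskerLeft_muEl _ _ _ _).trans ?_
      refine (congrArg (muEl F _ _ _) (map_braiding_muEl _ _)).trans ?_
      refine Eq.trans ?_ (map_associator_muEl _ _ _).symm
      have e1 : (fun j : Fin n => u (Equiv.swap (Fin.last n).castSucc (Fin.last n).succ
          j.castSucc.castSucc)) = fun j => u j.castSucc.castSucc := funext fun j => by
        rw [Equiv.swap_apply_of_ne_of_ne]
        · exact fun h => (Fin.castSucc_lt_last j).ne (Fin.castSucc_injective _ h)
        · exact (Fin.castSucc_lt_last _).ne
      have e2 : u (Equiv.swap (Fin.last n).castSucc (Fin.last n).succ (Fin.last n).castSucc) =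
          u (Fin.last (n + 1)) := by rw [Equiv.swap_apply_left]; rfl
      have e3 : u (Equiv.swap (Fin.last n).castSucc (Fin.last n).succ (Fin.last (n + 1))) =
          u (Fin.last n).castSucc := congrArg u (Equiv.swap_apply_right _ _)
      exact congrArg₂ (fun a b => muEl F _ _ a b) (congrArg (nu F n) e1.symm)
        (congrArg₂ (fun a b => muEl F _ _ a b) e2.symm e3.symm)
    | cast i =>
      have hA : ∀ j : Fin (n + 1), Equiv.swap i.castSucc.castSucc i.castSucc.succ j.castSucc =
          (Equiv.swap i.castSucc i.succ j).castSucc := fun j => by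
        rw [Fin.succ_castSucc]
        exact ((Fin.castSucc_injective (n + 1)).map_swap _ _ _).symm
      have hB : Equiv.swap i.castSucc.castSucc i.castSucc.succ (Fin.last (n + 1)) =
          Fin.last (n + 1) :=
        Equiv.swap_apply_of_ne_of_ne (Fin.castSucc_lt_last _).ne' (Fin.castSucc_lt_last i.succ).ne'
      rw [tpowPerm_whiskerRight (Equiv.swap i.castSucc i.succ)
        (Equiv.swap i.castSucc.castSucc i.castSucc.succ)]
      · refine (map_whiskerRight_muEl _ _ _ _).trans ?_
        refine Eq.trans (congrArg (fun a => muEl F _ _ a _) (ih i _)) ?_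
        exact congrArg₂ (fun a b => muEl F _ _ a b)
          (congrArg (nu F (n + 1)) (funext fun j => congrArg u (hA j).symm)) (congrArg u hB.symm)
      · exact hA
      · exact hB

/-- Adjacent transpositions generate the symmetric group as a monoid. -/
lemma map_tpowPerm_nu : ∀ {n : ℕ} (σ : Equiv.Perm (Fin n)) (u : Fin n → F.obj (KMod.std k K)),
    F.map (tpowPerm k K σ) (nu F n u) = nu F n fun i => u (σ i)
  | 0, σ, u => by
    rw [Subsingleton.elim σ 1, tpowPerm_one, map_id_apply]
    rfl
  | n + 1, σ, u => by
    have hσ : σ ∈ Submonoid.closure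
        (Set.range fun i : Fin n => Equiv.swap i.castSucc i.succ) := by
      rw [Equiv.Perm.mclosure_swap_castSucc_succ]
      trivial
    induction hσ using Submonoid.closure_induction generalizing u with
    | mem σ hσ =>
      obtain ⟨i, rfl⟩ := hσ
      exact map_tpowPerm_swap_nu i u
    | one =>
      rw [tpowPerm_one, map_id_apply]
      rfl
    | mul σ τ _ _ h1 h2 =>
      rw [tpowPerm_mul, map_comp_apply, h1, h2]
      rfl

end Perm

/-- The map `𝐕^{⊗ (n + m)} → 𝐕^{⊗ n} ⊗ 𝐕^{⊗ m}`. -/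
lemma exists_tpowSplit (n m : ℕ) : ∃ j : KMod.tpow k K (n + m) ⟶
      KMod.tensorObj (KMod.tpow k K n) (KMod.tpow k K m),
    (∀ v, KMod.lin j (KMod.tpowForm k K (n + m) v) =
      (KMod.tpowForm k K n (fun i => v (Fin.castAdd m i)) ⊗ₜ[K]
        KMod.tpowForm k K m (fun i => v (Fin.natAdd n i)) :
          (KMod.tpow k K n).carrier ⊗[K] (KMod.tpow k K m).carrier)) ∧
    ∀ u, F.map j (nu F (n + m) u) = muEl F _ _ (nu F n fun i => u (Fin.castAdd m i))
      (nu F m fun i => u (Fin.natAdd n i)) := by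
  induction m with
  | zero =>
    refine ⟨(ρ_ _).inv, fun v => rfl, fun u => ?_⟩
    have h := map_rightUnitor_muEl (F := F) (nu F n u)
    refine (congrArg (F.map (ρ_ _).inv) h.symm).trans ?_
    rw [← map_comp_apply, Iso.hom_inv_id, map_id_apply]
    rfl
  | succ m ih =>
    obtain ⟨j, h1, h2⟩ := ih
    refine ⟨(j ▷ KMod.std k K) ≫ (α_ _ _ _).hom, fun v => ?_, fun u => ?_⟩
    · exact congrArg (fun t => TensorProduct.assoc K (KMod.tpow k K n).carrier
        (KMod.tpow k K m).carrier (KMod.std k K).carrier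
          (t ⊗ₜ[K] KMod.stdVec K (v (Fin.last (n + m))))) (h1 fun i => v i.castSucc)
    · refine (map_comp_apply F (j ▷ KMod.std k K) (α_ _ _ _).hom _).trans ?_
      refine (congrArg (F.map (α_ _ _ _).hom) (map_whiskerRight_muEl j (KMod.std k K) _ _)).trans ?_
      refine (congrArg (fun t => F.map (α_ _ _ _).hom (muEl F _ (KMod.std k K) t (u (Fin.last _))))
        (h2 fun i => u i.castSucc)).trans ?_
      exact map_associator_muEl _ _ _

end Elements

/-! ### Values of tensor functors as quotients of values of polynomial functors -/

section Polarization

variable {k E : Type u} [Field k] [CharZero k] [AddCommGroup E] [Module k E]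

/-- A sum of values of multilinear maps vanishes if its polarizations vanish. -/
lemma sum_eq_zero_of_polarForm {m : ℕ} {n : Fin m → ℕ}
    (H : ∀ i, MultilinearMap k (fun _ : Fin (n i) => StdRep k) E)
    (v : ∀ i, Fin (n i) → StdRep k)
    (h : ∀ (N : ℕ) (j : Fin N → ℕ) (w : Fin N → StdRep k),
      ∑ i, ∑ σ : Fin (n i) ≃ Fin N, (∏ a, v i a (j (σ a))) • H i (fun a => w (σ a)) = 0) :
    ∑ i, H i (v i) = 0 := by
  classical
  -- The polarization identities do not involve the group; a trivial action makes them available for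
  -- `E`.
  let _ : DistribMulAction (GLinf k) E :=
    { smul := fun _ x => x
      one_smul := fun _ => rfl
      mul_smul := fun _ _ _ => rfl
      smul_zero := fun _ => rfl
      smul_add := fun _ _ _ => rfl }
  obtain ⟨l, hl⟩ := exists_bound Finset.univ v
  rw [← Finset.sum_fiberwise_of_maps_to (t := Finset.univ.image n) (g := n)
      (fun i hi => Finset.mem_image_of_mem _ hi)]
  refine Finset.sum_eq_zero fun N _ => ?_
  have h1 := sum_polarForm H v (fun i a => hl i (Finset.mem_univ i) a) N
  rw [Finset.sum_eq_zero fun j _ => (polarForm_apply H v N _ _).trans (h N _ _)] at h1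
  exact (smul_eq_zero.1 h1.symm).resolve_left (Nat.cast_ne_zero.2 N.factorial_ne_zero)

end Polarization

/-! ### The comparison map `N^pol{F(K ⊗ 𝐕)} → F(N)` -/

section Theta

open MonoidalCategory Functor.LaxMonoidal

variable {k K : Type u} [Field k] [CharZero k] [Field K] [Algebra k K]
  [MulSemiringAction (GLinf k) K] [SMulCommClass (GLinf k) k K]
  {F : KMod k K ⥤ ModuleCat.{u} k} [F.Additive] [F.Linear k] [F.LaxBraided]

lemma map_tpowPerm_nu' {n m : ℕ} (σ : Fin n ≃ Fin m) (u : Fin m → F.obj (KMod.std k K)) :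
    F.map (tpowPerm k K σ) (nu F m u) = nu F n fun i => u (σ i) := by
  have h : n = m := by simpa using Fintype.card_congr σ
  subst h
  exact map_tpowPerm_nu σ u

lemma polMod.desc_form {N : KMod k K} {n : ℕ}
    {f : MultilinearMap k (fun _ : Fin n => StdRep k) (polMod N)} (hf : GLEquivariant f)
    (v : Fin n → StdRep k) : KMod.lin (polMod.desc hf) (KMod.tpowForm k K n v) = (f v).val :=
  KMod.tpowDesc_form _ v

lemma KMod.lin_sum {A B : KMod k K} {ι : Type*} (s : Finset ι) (f : ι → (A ⟶ B)) (a : A.carrier) :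
    KMod.lin (∑ i ∈ s, f i) a = ∑ i ∈ s, KMod.lin (f i) a := by
  classical
  induction s using Finset.induction_on with
  | empty => rfl
  | insert i s hi ih => rw [Finset.sum_insert hi, Finset.sum_insert hi, ← ih]; rfl

variable (F) in
/-- The multilinear map `F(𝐕)ⁿ → F(N)` given by an equivariant multilinear map `𝐕ⁿ → N`. -/
def formMap {N : KMod k K} {n : ℕ} {f : MultilinearMap k (fun _ : Fin n => StdRep k) (polMod N)}
    (hf : GLEquivariant f) : MultilinearMap k (fun _ : Fin n => F.obj (KMod.std k K)) (F.obj N) :=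
  (F.map (polMod.desc hf)).hom.compMultilinearMap (nu F n)

lemma formMap_apply {N : KMod k K} {n : ℕ}
    {f : MultilinearMap k (fun _ : Fin n => StdRep k) (polMod N)} (hf : GLEquivariant f)
    (u : Fin n → F.obj (KMod.std k K)) : formMap F hf u = F.map (polMod.desc hf) (nu F n u) := rfl

/-- Polarization is a combination of permuted forms, hence of morphisms composed with `tpowPerm`, to
which `F` can be applied. -/
lemma desc_polarForm {N : KMod k K} {m : ℕ} {n : Fin m → ℕ}
    {f : ∀ i, MultilinearMap k (fun _ : Fin (n i) => StdRep k) (polMod N)}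
    (hf : ∀ i, GLEquivariant (f i)) (v : ∀ i, Fin (n i) → StdRep k) (p : ℕ) (j : Fin p → ℕ) :
    polMod.desc (polarForm_equivariant f v hf p j) =
      ∑ i, ∑ σ : Fin (n i) ≃ Fin p, (∏ a, v i a (j (σ a))) •
        (tpowPerm k K σ ≫ polMod.desc (hf i)) := by
  refine KMod.tpow_hom_ext k K fun w => ?_
  rw [polMod.desc_form, polarForm_apply, KMod.lin_sum, polMod.val_sum]
  refine Finset.sum_congr rfl fun i _ => ?_
  rw [KMod.lin_sum, polMod.val_sum]
  refine Finset.sum_congr rfl fun σ _ => ?_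
  have h : KMod.lin (tpowPerm k K σ ≫ polMod.desc (hf i)) (KMod.tpowForm k K p w) =
      (f i fun a => w (σ a)).val := by
    rw [KMod.lin_comp, LinearMap.comp_apply, tpowPerm_form, polMod.desc_form]
  exact congrArg (fun t : N.carrier => (∏ a, v i a (j (σ a))) • t) h.symm

lemma desc_eq_zero {N : KMod k K} {n : ℕ}
    {f : MultilinearMap k (fun _ : Fin n => StdRep k) (polMod N)} (hf : GLEquivariant f)
    (h : ∀ v, f v = 0) : polMod.desc hf = 0 :=
  KMod.tpow_hom_ext k K fun v => by
    rw [polMod.desc_form, h]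
    rfl

/-- This makes the comparison map well defined. If the forms cancel in `N^pol{F(K ⊗ 𝐕)}`, all
polarizations vanish as forms, hence as morphisms. Applying `F` shows that the polarizations of the
maps `formMap` vanish, and in characteristic zero they determine the sum. -/
lemma sum_formMap_eq_zero {N : KMod k K} {m : ℕ} {n : Fin m → ℕ}
    {f : ∀ i, MultilinearMap k (fun _ : Fin (n i) => StdRep k) (polMod N)}
    (hf : ∀ i, GLEquivariant (f i)) (u : ∀ i, Fin (n i) → F.obj (KMod.std k K))
    (h : ∑ i, evalForm (F.obj (KMod.std k K)) (hf i) (u i) = 0) :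
    ∑ i, formMap F (hf i) (u i) = 0 := by
  let W : Submodule k (F.obj (KMod.std k K)) := Submodule.span k (⋃ i, Set.range (u i))
  have : FiniteDimensional k W :=
    FiniteDimensional.span_of_finite k (Set.finite_iUnion fun i => Set.finite_range (u i))
  -- The arguments are moved to `𝐕`, where coordinates are available for polarization.
  obtain ⟨ψ, φ, -, hψ⟩ := exists_section W 0 0
  have hu : ∀ i a, ψ (φ (u i a)) = u i a := fun i a =>
    hψ _ (Submodule.subset_span (Set.mem_iUnion.2 ⟨i, a, rfl⟩))
  have h0 := sum_eq_zero_of_polarForm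
    (fun i => (formMap F (hf i)).compLinearMap fun _ => ψ) (fun i a => φ (u i a)) ?_
  · refine Eq.trans (Finset.sum_congr rfl fun i _ => ?_) h0
    refine congrArg (formMap F (hf i)) (funext fun a => (hu i a).symm)
  intro p j w
  have hz : polMod.desc (polarForm_equivariant f (fun i a => φ (u i a)) hf p j) = 0 :=
    desc_eq_zero _ fun v => (Submodule.mem_bot k).1 <| polarForm_mem f _ (fun θ => by
      rw [Submodule.mem_bot]
      have h1 := congrArg (fun t => PolEval.fn t (θ ∘ₗ φ)) h
      simp only [PolEval.fn_sum] at h1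
      exact h1) p j v
  rw [desc_polarForm] at hz
  -- `F` of a permutation permutes the arguments of `nu`; this is the use of the symmetric structure
  -- of `F`.
  have h2 := congrArg (fun H => F.map H (nu F p fun a => ψ (w a))) hz
  simp only [map_sum_apply, map_smul_apply, map_comp_apply, map_tpowPerm_nu', map_zero_apply] at h2
  exact h2

variable (F) in
/-- The relation between `N^pol{F(𝐕)}` and `F(N)` given by the multilinear maps `formMap`. -/
def thetaGraph (N : KMod k K) :
    Submodule k (PolEval k (polMod N) (F.obj (KMod.std k K)) × F.obj N) :=
  Submodule.span k {t | ∃ (n : ℕ) (f : MultilinearMap k (fun _ : Fin n => StdRep k) (polMod N))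
    (hf : GLEquivariant f) (u : Fin n → F.obj (KMod.std k K)),
      t = (evalForm _ hf u, formMap F hf u)}

lemma thetaGraph_mem {N : KMod k K} {n : ℕ}
    {f : MultilinearMap k (fun _ : Fin n => StdRep k) (polMod N)} (hf : GLEquivariant f)
    (u : Fin n → F.obj (KMod.std k K)) :
    (evalForm _ hf u, formMap F hf u) ∈ thetaGraph F N :=
  Submodule.subset_span ⟨n, f, hf, u, rfl⟩

lemma formMap_smul {N : KMod k K} {n : ℕ}
    {f : MultilinearMap k (fun _ : Fin n => StdRep k) (polMod N)} (hf : GLEquivariant f) (c : k)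
    (u : Fin n → F.obj (KMod.std k K)) : formMap F (hf.smul c) u = c • formMap F hf u := by
  have h : polMod.desc (hf.smul c) = c • polMod.desc hf := KMod.tpow_hom_ext k K fun v => by
    rw [polMod.desc_form]
    exact (congrArg (fun t : N.carrier => c • t) (polMod.desc_form hf v)).symm
  rw [formMap_apply, h, map_smul_apply, formMap_apply]

lemma thetaGraph_eq_zero {N : KMod k K} {t : PolEval k (polMod N) (F.obj (KMod.std k K)) × F.obj N}
    (ht : t ∈ thetaGraph F N) (h0 : t.1 = 0) : t.2 = 0 := by
  obtain ⟨m, c, g, rfl⟩ := Submodule.mem_span_set'.1 ht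
  choose n f hf u hu using fun i => (g i).2
  rw [Prod.fst_sum] at h0
  rw [Prod.snd_sum]
  refine Eq.trans (Finset.sum_congr rfl fun i _ => ?_)
    (sum_formMap_eq_zero (fun i => (hf i).smul (c i)) u (Eq.trans ?_ h0))
  · rw [formMap_smul, Prod.smul_snd, hu]
  · refine Finset.sum_congr rfl fun i _ => ?_
    rw [Prod.smul_fst, hu]
    rfl

lemma exists_thetaGraph {N : KMod k K} (h : PolEval k (polMod N) (F.obj (KMod.std k K))) :
    ∃ y, (h, y) ∈ thetaGraph F N := by
  induction h using PolEval.induction with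
  | hform n f hf u => exact ⟨_, thetaGraph_mem hf u⟩
  | hzero => exact ⟨0, Submodule.zero_mem _⟩
  | hadd a b ha hb =>
    obtain ⟨x, hx⟩ := ha
    obtain ⟨y, hy⟩ := hb
    exact ⟨x + y, Submodule.add_mem _ hx hy⟩

lemma thetaGraph_unique {N : KMod k K} {h : PolEval k (polMod N) (F.obj (KMod.std k K))}
    {x y : F.obj N} (hx : (h, x) ∈ thetaGraph F N) (hy : (h, y) ∈ thetaGraph F N) : x = y :=
  sub_eq_zero.1 (thetaGraph_eq_zero (Submodule.sub_mem _ hx hy) (sub_self h))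

variable (F) in
/-- The map `N^pol{F(𝐕)} → F(N)`. -/
def theta (N : KMod k K) : PolEval k (polMod N) (F.obj (KMod.std k K)) →ₗ[k] F.obj N where
  toFun h := (exists_thetaGraph h).choose
  map_add' h h' := thetaGraph_unique (exists_thetaGraph (h + h')).choose_spec
    (Submodule.add_mem _ (exists_thetaGraph h).choose_spec (exists_thetaGraph h').choose_spec)
  map_smul' c h := thetaGraph_unique (exists_thetaGraph (c • h)).choose_spec
    (Submodule.smul_mem _ c (exists_thetaGraph h).choose_spec)

lemma theta_evalForm {N : KMod k K} {n : ℕ}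
    {f : MultilinearMap k (fun _ : Fin n => StdRep k) (polMod N)} (hf : GLEquivariant f)
    (u : Fin n → F.obj (KMod.std k K)) :
    theta F N (evalForm _ hf u) = F.map (polMod.desc hf) (nu F n u) :=
  thetaGraph_unique (exists_thetaGraph (evalForm _ hf u)).choose_spec (thetaGraph_mem hf u)

lemma theta_evalMap {M N : KMod k K} (g : M ⟶ N)
    (h : PolEval k (polMod M) (F.obj (KMod.std k K))) :
    theta F N (evalMap _ (polMod.map g) (polMod.map_smul_group g) h) = F.map g (theta F M h) := by
  induction h using PolEval.induction with
  | hform n f hf u =>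
    rw [evalMap_evalForm, theta_evalForm, theta_evalForm, ← map_comp_apply]
    have h : polMod.desc (hf.comp (polMod.map g) (polMod.map_smul_group g)) =
        polMod.desc hf ≫ g := KMod.tpow_hom_ext k K fun v => by
      rw [polMod.desc_form, KMod.lin_comp, LinearMap.comp_apply, polMod.desc_form]
      rfl
    rw [h]
  | hzero => simp only [map_zero]
  | hadd a b ha hb => simp only [map_add, ha, hb]

/-- The form on `C` given by a bilinear map and forms on `A` and `B`. -/
def bilinForm {A B C : Type u} [AddCommGroup A] [Module k A] [AddCommGroup B] [Module k B]
    [AddCommGroup C] [Module k C] (b : A →ₗ[k] B →ₗ[k] C) {n m : ℕ}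
    (f : MultilinearMap k (fun _ : Fin n => StdRep k) A)
    (f' : MultilinearMap k (fun _ : Fin m => StdRep k) B) :
    MultilinearMap k (fun _ : Fin (n + m) => StdRep k) C :=
  ((TensorProduct.lift b).compMultilinearMap (f.domCoprod f')).domDomCongr finSumFinEquiv

lemma bilinForm_apply {A B C : Type u} [AddCommGroup A] [Module k A] [AddCommGroup B] [Module k B]
    [AddCommGroup C] [Module k C] (b : A →ₗ[k] B →ₗ[k] C) {n m : ℕ}
    (f : MultilinearMap k (fun _ : Fin n => StdRep k) A)
    (f' : MultilinearMap k (fun _ : Fin m => StdRep k) B) (v : Fin (n + m) → StdRep k) :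
    bilinForm b f f' v = b (f fun i => v (Fin.castAdd m i)) (f' fun i => v (Fin.natAdd n i)) := by
  simp [bilinForm, MultilinearMap.domCoprod, MultilinearMap.domCoprodDep]

lemma bilinForm_equivariant {A B C : Type u} [AddCommGroup A] [Module k A] [AddCommGroup B]
    [Module k B] [AddCommGroup C] [Module k C] [DistribMulAction (GLinf k) A]
    [DistribMulAction (GLinf k) B] [DistribMulAction (GLinf k) C] (b : A →ₗ[k] B →ₗ[k] C)
    (hb : ∀ (g : GLinf k) (x : A) (y : B), b (g • x) (g • y) = g • b x y) {n m : ℕ}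
    {f : MultilinearMap k (fun _ : Fin n => StdRep k) A}
    {f' : MultilinearMap k (fun _ : Fin m => StdRep k) B} (hf : GLEquivariant f)
    (hf' : GLEquivariant f') : GLEquivariant (bilinForm b f f') := fun g v => by
  rw [bilinForm_apply, bilinForm_apply, ← hb, ← hf, ← hf']

lemma evalMap₂_evalForm {A B C : Type u} [AddCommGroup A] [Module k A] [AddCommGroup B]
    [Module k B] [AddCommGroup C] [Module k C] [DistribMulAction (GLinf k) A]
    [DistribMulAction (GLinf k) B] [DistribMulAction (GLinf k) C] (b : A →ₗ[k] B →ₗ[k] C)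
    (hb : ∀ (g : GLinf k) (x : A) (y : B), b (g • x) (g • y) = g • b x y) {n m : ℕ}
    {f : MultilinearMap k (fun _ : Fin n => StdRep k) A}
    {f' : MultilinearMap k (fun _ : Fin m => StdRep k) B} (hf : GLEquivariant f)
    (hf' : GLEquivariant f') {U : Type u} [AddCommGroup U] [Module k U] (u : Fin n → U)
    (u' : Fin m → U) : evalMap₂ U b hb (evalForm U hf u) (evalForm U hf' u') =
      evalForm U (bilinForm_equivariant b hb hf hf') (Fin.append u u') :=
  PolEval.ext fun φ => by
    rw [evalForm_fn, bilinForm_apply]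
    simp only [Fin.append_left, Fin.append_right]
    rfl

/-- The product of two forms factors through the splitting of a tensor power into two, and on the
elements `nu` the functor turns this splitting into its structure map. -/
lemma theta_tmul {M N : KMod k K} (h : PolEval k (polMod M) (F.obj (KMod.std k K)))
    (h' : PolEval k (polMod N) (F.obj (KMod.std k K))) :
    theta F (KMod.tensorObj M N) (evalMap₂ _ (polMod.tmul M N) (polMod.tmul_smul_group M N) h h') =
      muEl F M N (theta F M h) (theta F N h') := by
  induction h using PolEval.induction with
  | hform n f hf u =>
    induction h' using PolEval.induction with
    | hform m f' hf' u' =>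
      rw [evalMap₂_evalForm, theta_evalForm, theta_evalForm, theta_evalForm]
      obtain ⟨j, h1, h2⟩ := exists_tpowSplit (F := F) n m
      have h3 := h2 (Fin.append u u')
      simp only [Fin.append_left, Fin.append_right] at h3
      rw [← map_tensorHom_muEl]
      refine Eq.trans ?_ (congrArg (F.map (polMod.desc hf ⊗ₘ polMod.desc hf')) h3)
      refine Eq.trans ?_ (map_comp_apply F _ _ _)
      refine congrArg (fun H => F.map H (nu F (n + m) (Fin.append u u'))) ?_
      refine KMod.tpow_hom_ext k K fun v => ?_
      rw [polMod.desc_form, bilinForm_apply]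
      refine Eq.trans ?_ (congrArg (KMod.lin (polMod.desc hf ⊗ₘ polMod.desc hf')) (h1 v)).symm
      exact congrArg₂ (fun (a : M.carrier) (b : N.carrier) => a ⊗ₜ[K] b)
        (polMod.desc_form hf _).symm (polMod.desc_form hf' _).symm
    | hzero => simp only [map_zero]
    | hadd a b ha hb => simp only [map_add, ha, hb]
  | hzero => simp only [map_zero, LinearMap.zero_apply]
  | hadd a b ha hb => simp only [map_add, LinearMap.add_apply, ha, hb]

lemma theta_unitFn : theta F (KMod.unit : KMod k K) (unitFn _) = epsEl F := by
  have hc : GLEquivariant (MultilinearMap.constOfIsEmpty k (fun _ : Fin 0 => StdRep k)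
      (polMod.one (k := k) (K := K))) := fun g v => polMod.ext (smul_one g : g • (1 : K) = 1).symm
  have h1 : (unitFn (F.obj (KMod.std k K)) : PolEval k (polMod (KMod.unit : KMod k K)) _) =
      evalForm _ hc fun i => i.elim0 := rfl
  have h2 : polMod.desc hc = 𝟙 _ := KMod.tpow_hom_ext k K fun v => by
    rw [polMod.desc_form]
    rfl
  rw [h1, theta_evalForm, h2]
  exact map_id_apply F _

end Theta

/-! ### The generic point of a fiber functor -/

section Dimension

open MonoidalCategory Functor.LaxMonoidal

variable {k K : Type u} [Field k] [CharZero k] [Field K] [Algebra k K]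
  [MulSemiringAction (GLinf k) K] [SMulCommClass (GLinf k) k K]

/-- Morphisms from a tensor power that are killed by a faithful functor on the values of `nu`
vanish. -/
lemma eq_zero_of_map_nu {F : KMod k K ⥤ ModuleCat.{u} k} [F.Additive] [F.LaxMonoidal]
    [F.Faithful] (hε : Function.Surjective (ε F))
    (hμ : ∀ A, Function.Surjective (μ F A (KMod.std k K))) {n : ℕ} {N : KMod k K}
    (f : KMod.tpow k K n ⟶ N) (h : ∀ u, F.map f (nu F n u) = 0) : f = 0 := by
  refine F.map_injective ?_
  rw [F.map_zero]
  refine ModuleCat.hom_ext (LinearMap.ext_on (nu_span hε hμ n) ?_)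
  rintro _ ⟨u, rfl⟩
  exact h u

variable (k K) in
/-- The antisymmetrization on a tensor power. -/
def tpowAlt (n : ℕ) : KMod.tpow k K n ⟶ KMod.tpow k K n :=
  ∑ σ : Equiv.Perm (Fin n), ((Equiv.Perm.sign σ : ℤ) : k) • tpowPerm k K σ

/-- Pair the antisymmetrization of `e_0 ⊗ ⋯ ⊗ e_{n-1}` with the product over `i` of the `i`-th
coordinate of the `i`-th argument: only the identity permutation contributes. -/
lemma tpowAlt_ne_zero (n : ℕ) : tpowAlt k K n ≠ 0 := by
  intro h
  obtain ⟨L, hL⟩ := KMod.exists_tpow_lift k K n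
    ((MultilinearMap.mkPiAlgebra k (Fin n) K).compLinearMap fun i =>
      Algebra.linearMap k K ∘ₗ Finsupp.lapply (i : ℕ))
  let e : Fin n → StdRep k := fun i => Finsupp.single (i : ℕ) 1
  have h1 : KMod.lin (tpowAlt k K n) (KMod.tpowForm k K n e) = 0 := by
    rw [h]
    rfl
  rw [tpowAlt, KMod.lin_sum] at h1
  have h2 := congrArg L h1
  rw [map_sum, map_zero] at h2
  have h3 : ∀ σ : Equiv.Perm (Fin n), L (KMod.lin (((Equiv.Perm.sign σ : ℤ) : k) • tpowPerm k K σ)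
      (KMod.tpowForm k K n e)) = if σ = 1 then 1 else 0 := by
    intro σ
    have h4 : KMod.lin (((Equiv.Perm.sign σ : ℤ) : k) • tpowPerm k K σ) (KMod.tpowForm k K n e) =
        ((Equiv.Perm.sign σ : ℤ) : k) • KMod.tpowForm k K n fun i => e (σ i) :=
      congrArg (fun t : (KMod.tpow k K n).carrier => ((Equiv.Perm.sign σ : ℤ) : k) • t)
        (tpowPerm_form σ e)
    rw [h4]
    refine (map_smul (L.restrictScalars k) _ _).trans ?_
    refine (congrArg (fun t : K => ((Equiv.Perm.sign σ : ℤ) : k) • t) (hL _)).trans ?_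
    split_ifs with hσ
    · subst hσ
      simp [e]
    · obtain ⟨i, hi⟩ : ∃ i, σ i ≠ i := by
        by_contra! hc
        exact hσ (Equiv.ext hc)
      have : ∏ i, algebraMap k K (e (σ i) (i : ℕ)) = 0 :=
        Finset.prod_eq_zero (Finset.mem_univ i) (by
          rw [show e (σ i) (i : ℕ) = 0 from Finsupp.single_eq_of_ne fun hc => hi (Fin.ext hc.symm),
            map_zero])
      simp only [MultilinearMap.compLinearMap_apply, MultilinearMap.mkPiAlgebra_apply,
        LinearMap.comp_apply, Finsupp.lapply_apply, Algebra.linearMap_apply]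
      rw [this, smul_zero]
  rw [Finset.sum_congr rfl fun σ _ => h3 σ] at h2
  simp at h2

lemma map_tpowAlt_nu {F : KMod k K ⥤ ModuleCat.{u} k} [F.Additive] [F.Linear k] [F.LaxBraided]
    (n : ℕ) (u : Fin n → F.obj (KMod.std k K)) :
    F.map (tpowAlt k K n) (nu F n u) = MultilinearMap.alternatization (nu F n) u := by
  rw [tpowAlt, map_sum_apply, MultilinearMap.alternatization_apply]
  refine Finset.sum_congr rfl fun σ _ => ?_
  rw [map_smul_apply, map_tpowPerm_nu, Int.cast_smul_eq_zsmul, Units.smul_def]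
  rfl

/-- On more than `dim F(K ⊗ 𝐕)` vectors the alternatization of `nu` vanishes, so the faithful
functor `F` would kill the antisymmetrizer on that many factors, which is nonzero. -/
lemma not_finiteDimensional_std {F : KMod k K ⥤ ModuleCat.{u} k} [F.Additive] [F.Linear k]
    [F.LaxBraided] [F.Faithful] (hε : Function.Surjective (ε F))
    (hμ : ∀ A, Function.Surjective (μ F A (KMod.std k K))) :
    ¬ FiniteDimensional k (F.obj (KMod.std k K)) := by
  intro hfin
  refine tpowAlt_ne_zero (k := k) (K := K) (Module.finrank k (F.obj (KMod.std k K)) + 1)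
    (eq_zero_of_map_nu hε hμ _ fun u => ?_)
  rw [map_tpowAlt_nu]
  refine AlternatingMap.map_linearDependent _ u fun hu => ?_
  have := hu.fintype_card_le_finrank
  rw [Fintype.card_fin] at this
  omega

end Dimension

/-! ### The point attached to a tensor functor -/

section Point

open MonoidalCategory Functor.LaxMonoidal

variable {k R K : Type u} [Field k] [CharZero k] [CommRing R] [IsDomain R] [Algebra k R]
  [MulSemiringAction (GLinf k) R] [SMulCommClass (GLinf k) k R] [IsPolynomialRep k R]
  [Field K] [Algebra k K] [Algebra R K] [IsScalarTower k R K] [IsFractionRing R K]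
  [MulSemiringAction (GLinf k) K] [SMulCommClass (GLinf k) k K] [SMulDistribClass (GLinf k) R K]
  {F : KMod k K ⥤ ModuleCat.{u} k} [F.Additive] [F.Linear k] [F.LaxBraided] [IsIso (ε F)]

variable (F) in
/-- The inverse of the unit of a tensor functor. -/
def epsInv : F.obj (KMod.unit : KMod k K) →ₗ[k] k := (inv (ε F)).hom

lemma epsInv_epsEl : epsInv F (epsEl F) = 1 :=
  congrArg (fun H : 𝟙_ (ModuleCat.{u} k) ⟶ 𝟙_ (ModuleCat.{u} k) => H (1 : k))
    (IsIso.hom_inv_id (ε F))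

lemma epsInv_smul (t : F.obj (KMod.unit : KMod k K)) : epsInv F t • epsEl F = t := by
  have h1 : ε F (epsInv F t) = t :=
    congrArg (fun H : F.obj (𝟙_ _) ⟶ F.obj (𝟙_ _) => H t) (IsIso.inv_hom_id (ε F))
  refine Eq.trans ?_ h1
  refine (map_smul (ε F).hom (epsInv F t) (1 : k)).symm.trans ?_
  exact congrArg (ε F) (mul_one (epsInv F t))

variable (R F) in
/-- The functional on `R{F(𝐕)}` given by a tensor functor. -/
def pointLin : AlgEval k R (F.obj (KMod.std k K)) →ₗ[k] k :=
  epsInv F ∘ₗ theta F KMod.unit ∘ₗ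
    (LinearMap.toSpanSingleton (AlgEval k R (F.obj (KMod.std k K))) _
      (unitFn (F.obj (KMod.std k K)))).restrictScalars k

lemma theta_smul_unitFn (a : AlgEval k R (F.obj (KMod.std k K))) :
    theta F KMod.unit (a • unitFn (F.obj (KMod.std k K))) = pointLin R F a • epsEl F :=
  (epsInv_smul _).symm

/-- `a • h` is the product of `a • 1` and `h` followed by the left unitor, and the comparison map
takes `a • 1` to a scalar multiple of the unit. For `N = K` this yields multiplicativity of the
functional. -/
lemma theta_alg_smul {N : KMod k K} (a : AlgEval k R (F.obj (KMod.std k K)))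
    (h : PolEval k (polMod N) (F.obj (KMod.std k K))) :
    theta F N (a • h) = pointLin R F a • theta F N h := by
  have h1 : a • h = evalMap _ (polMod.map (λ_ N).hom) (polMod.map_smul_group (λ_ N).hom)
      (evalMap₂ _ (polMod.tmul KMod.unit N) (polMod.tmul_smul_group KMod.unit N)
        (a • unitFn (F.obj (KMod.std k K))) h) := by
    refine PolEval.ext fun φ => polMod.ext ?_
    change algebraMap R K (a.fn φ) • (h.fn φ).val =
      (algebraMap R K (a.fn φ) * 1 : K) • (h.fn φ).val
    rw [mul_one]
  rw [h1, theta_evalMap]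
  refine (congrArg (F.map (λ_ N).hom) (theta_tmul _ _)).trans ?_
  refine (congrArg (fun t => F.map (λ_ N).hom (muEl F _ N t (theta F N h)))
    (theta_smul_unitFn a)).trans ?_
  rw [map_smul, LinearMap.smul_apply]
  refine (map_smul (F.map (λ_ N).hom).hom _ _).trans ?_
  exact congrArg _ (map_leftUnitor_muEl _)

variable (R F) in
/-- The `k`-point of `R{F(𝐕)}` given by a tensor functor. -/
def point : AlgEval k R (F.obj (KMod.std k K)) →ₐ[k] k :=
  AlgHom.ofLinearMap (pointLin R F)
    (by
      have h := theta_smul_unitFn (F := F) (1 : AlgEval k R (F.obj (KMod.std k K)))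
      rw [one_smul, theta_unitFn] at h
      have h2 := congrArg (epsInv F) h
      rw [map_smul, epsInv_epsEl, smul_eq_mul, mul_one] at h2
      exact h2.symm)
    fun a b => by
      have h := theta_smul_unitFn (F := F) (a * b)
      rw [mul_smul, theta_alg_smul, theta_smul_unitFn, smul_smul] at h
      have h2 := congrArg (epsInv F) h
      rw [map_smul, map_smul, epsInv_epsEl, smul_eq_mul, mul_one, smul_eq_mul, mul_one] at h2
      exact h2.symm

lemma theta_point_smul {N : KMod k K} (a : AlgEval k R (F.obj (KMod.std k K)))
    (h : PolEval k (polMod N) (F.obj (KMod.std k K))) :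
    theta F N (a • h) = point R F a • theta F N h := theta_alg_smul a h

lemma exists_form_ne_zero {I : Ideal R} (hI : ∀ (g : GLinf k), ∀ r ∈ I, g • r ∈ I) (h : I ≠ ⊥) :
    ∃ (n : ℕ) (f : MultilinearMap k (fun _ : Fin n => StdRep k) R) (v : Fin n → StdRep k),
      GLEquivariant f ∧ (∀ w, f w ∈ I) ∧ f v ≠ 0 := by
  obtain ⟨r, hr, hr0⟩ := Submodule.exists_mem_ne_zero_of_ne_bot h
  by_contra! hc
  refine hr0 ?_
  have h1 : r ∈ formSpan (I.restrictScalars k) := mem_formSpan_of_mem (fun g y hy => hI g y hy)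
    (by rw [IsFormSpanned.formSpan_top]; trivial) hr
  obtain ⟨m, n, f, v, hf, hfI, rfl⟩ := exists_sum_of_mem_formSpan h1
  exact Finset.sum_eq_zero fun i _ => hc (n i) (f i) (v i) (hf i) (hfI i)

variable (K) in
/-- The linear map `R → K^pol`. -/
def toPolUnit : R →ₗ[k] polMod (KMod.unit : KMod k K) where
  toFun r := r • polMod.one
  map_add' r s := add_smul r s _
  map_smul' c r := smul_assoc c r _

lemma toPolUnit_smul (g : GLinf k) (r : R) : toPolUnit (k := k) K (g • r) = g • toPolUnit (k := k) K r := by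
  refine Eq.trans ?_ (smul_distrib_smul g r
    (polMod.one (k := k) (K := K) : polMod (KMod.unit : KMod k K))).symm
  have : g • polMod.one (k := k) (K := K) = polMod.one := polMod.ext (smul_one g : g • (1 : K) = 1)
  rw [this]
  rfl

/-- A nonzero stable ideal contains the values of a nonzero form. If the point lay on the zero
locus, `F` would annihilate the corresponding morphism to the unit on all `nu u`, and by
faithfulness the form would be zero. -/
lemma point_generic [F.Faithful] (hε : Function.Surjective (ε F))
    (hμ : ∀ A, Function.Surjective (μ F A (KMod.std k K))) : IsGLGeneric (point R F) := by
  intro I _ hI hx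
  by_contra hI0
  obtain ⟨n, f, v, hf, hfI, hv⟩ := exists_form_ne_zero hI hI0
  have hd : polMod.desc (hf.comp (toPolUnit K) toPolUnit_smul) = 0 :=
    eq_zero_of_map_nu hε hμ _ fun u => by
      rw [← theta_evalForm]
      have h1 : evalForm (F.obj (KMod.std k K)) (hf.comp (toPolUnit K) toPolUnit_smul) u =
        AlgEval.mk (genFun f u) (genFun_mem hf u) • unitFn _ := rfl
      rw [h1, theta_point_smul, hx n f u hf hfI, zero_smul]
  refine hv ?_
  have h2 := polMod.desc_form (hf.comp (toPolUnit K) toPolUnit_smul) v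
  rw [hd] at h2
  have h3 : algebraMap R K (f v) * 1 = 0 := h2.symm
  rw [mul_one] at h3
  exact (IsFractionRing.injective R K) (h3.trans (map_zero _).symm)

end Point

/-! ### Fiber functors are given by generic points -/

section Comparison

open MonoidalCategory Functor.LaxMonoidal Limits

variable {k R K : Type u} [Field k] [CharZero k] [CommRing R] [IsDomain R] [Algebra k R]
  [MulSemiringAction (GLinf k) R] [SMulCommClass (GLinf k) k R] [IsPolynomialRep k R]
  [Field K] [Algebra k K] [Algebra R K] [IsScalarTower k R K] [IsFractionRing R K]
  [MulSemiringAction (GLinf k) K] [SMulCommClass (GLinf k) k K] [SMulDistribClass (GLinf k) R K]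

/-- The values of a cocontinuous functor on a direct sum are spanned by the values on the
summands. -/
lemma map_dsum_span (F : KMod k K ⥤ ModuleCat.{u} k) [PreservesColimitsOfSize.{u, u} F] {ι : Type u}
    (X : ι → KMod k K) :
    ⨆ i, LinearMap.range (F.map (KMod.dsumι X i)).hom = ⊤ := by
  have hc : IsColimit (F.mapCocone (Cofan.mk (KMod.dsum X) (KMod.dsumι X))) :=
    isColimitOfPreserves F (KMod.dsumIsColimit X)
  set S : Submodule k (F.obj (KMod.dsum X)) :=
    ⨆ i, LinearMap.range (F.map (KMod.dsumι X i)).hom with hS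
  have h : (ModuleCat.ofHom S.mkQ : F.obj (KMod.dsum X) ⟶ ModuleCat.of k _) = 0 := by
    refine hc.hom_ext fun ⟨i⟩ => ModuleCat.hom_ext (LinearMap.ext fun t => ?_)
    refine (Submodule.Quotient.mk_eq_zero S).2 ?_
    exact (le_iSup (fun i => LinearMap.range (F.map (KMod.dsumι X i)).hom) i) ⟨t, rfl⟩
  refine eq_top_iff.2 fun t _ => (Submodule.Quotient.mk_eq_zero S).1 ?_
  exact congrArg (fun H : F.obj (KMod.dsum X) ⟶ ModuleCat.of k _ => H t) h

/-- Every `K`-module is a quotient of the direct sum of tensor powers over all morphisms to it, and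
`F` respects direct sums and surjections. -/
lemma isTpowSpanned_of_surjective {F : KMod k K ⥤ ModuleCat.{u} k}
    [PreservesColimitsOfSize.{u, u} F]
    (hF : ∀ {A B : KMod k K} (f : A ⟶ B), Function.Surjective (KMod.lin f) →
      Function.Surjective (F.map f)) : IsTpowSpanned F := by
  intro N t
  let X : (Σ n, (KMod.tpow k K n ⟶ N)) → KMod k K := fun i => KMod.tpow k K i.1
  let q : KMod.dsum X ⟶ N := KMod.dsumDesc X fun i => i.2
  have hq : Function.Surjective (KMod.lin q) := by
    rw [← LinearMap.range_eq_top, eq_top_iff, ← N.span_pol, Submodule.span_le]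
    intro y hy
    have h : ∀ y : polMod N, y.val ∈ LinearMap.range (KMod.lin q) := fun y => by
      refine form_induction (k := k) (p := fun y : polMod N => y.val ∈ LinearMap.range (KMod.lin q))
        (fun n f hf v => ?_) (Submodule.zero_mem _)
        (fun a b ha hb => Submodule.add_mem _ ha hb) y
      refine ⟨KMod.lin (KMod.dsumι X ⟨n, polMod.desc hf⟩) (KMod.tpowForm k K n v), ?_⟩
      have h1 := KMod.dsumι_desc X (fun i => i.2) ⟨n, polMod.desc hf⟩
      have h2 := congrArg (fun H => KMod.lin H (KMod.tpowForm k K n v)) h1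
      exact h2.trans (polMod.desc_form hf v)
    exact h (polMod.mk y hy)
  obtain ⟨s, rfl⟩ := hF q hq t
  have hs : s ∈ ⨆ i, LinearMap.range (F.map (KMod.dsumι X i)).hom := by
    rw [map_dsum_span]
    trivial
  induction hs using Submodule.iSup_induction' with
  | mem i s hs =>
    obtain ⟨r, rfl⟩ := hs
    refine Submodule.subset_span ⟨i.1, i.2, r, ?_⟩
    have h1 := KMod.dsumι_desc X (fun i => i.2) i
    rw [← h1]
    exact map_comp_apply F _ _ r
  | zero => rw [map_zero]; exact Submodule.zero_mem _
  | add a b _ _ ha hb => rw [map_add]; exact Submodule.add_mem _ ha hb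

variable (R) in
/-- The pair given by a fiber functor. -/
def pairOf (F : KMod k K ⥤ ModuleCat.{u} k) [F.Additive] [F.Linear k] [F.LaxBraided] [F.Faithful]
    [IsIso (ε F)] (hμ : ∀ A, Function.Surjective (μ F A (KMod.std k K))) : GenericPair k R where
  V := F.obj (KMod.std k K)
  infinite := not_finiteDimensional_std
    ((ConcreteCategory.isIso_iff_bijective (ε F)).1 inferInstance).2 hμ
  x := point R F
  generic := point_generic ((ConcreteCategory.isIso_iff_bijective (ε F)).1 inferInstance).2 hμ

variable {F : KMod k K ⥤ ModuleCat.{u} k} [F.Additive] [F.Linear k] [F.LaxBraided] [F.Faithful]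
  [IsIso (ε F)] (hμ : ∀ A, Function.Surjective (μ F A (KMod.std k K)))

variable (R) in
/-- The map from the fiber of `N^pol` at the point given by a fiber functor `F` to `F(N)`. -/
def thetaFiber (N : KMod k K) : Fiber (polMod N) (point R F) →ₗ[k] F.obj N :=
  (maxSub (polMod N) (point R F)).liftQ (theta F N) <| maxSub_le fun a ha h => by
    rw [LinearMap.mem_ker]
    refine (theta_point_smul a h).trans ?_
    rw [ha, zero_smul]

variable (R) in
/-- The natural transformation from the fiber functor of the pair given by `F` to `F`. -/
def thetaNat : phiFunctor K (pairOf R F hμ) ⟶ F where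
  app N := ModuleCat.ofHom (thetaFiber R (F := F) N)
  naturality {M N} f := by
    refine ModuleCat.hom_ext (LinearMap.ext fun t => ?_)
    obtain ⟨h, rfl⟩ := Submodule.mkQ_surjective _ t
    exact theta_evalMap f h

lemma thetaNat_ε : ε (phiFunctor K (pairOf R F hμ)) ≫ (thetaNat R hμ).app (𝟙_ _) = ε F := by
  refine ModuleCat.hom_ext (LinearMap.ext_ring ?_)
  have h : ε (phiFunctor K (pairOf R F hμ)) (1 : k) =
      (maxSub (polMod (KMod.unit : KMod k K)) (pairOf R F hμ).x).mkQ (unitFn _) := one_smul k _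
  exact (congrArg ((thetaNat R hμ).app (𝟙_ _)) h).trans theta_unitFn

lemma thetaNat_μ (M N : KMod k K) : μ (phiFunctor K (pairOf R F hμ)) M N ≫
    (thetaNat R hμ).app (M ⊗ N) =
      ((thetaNat R hμ).app M ⊗ₘ (thetaNat R hμ).app N) ≫ μ F M N := by
  refine ModuleCat.MonoidalCategory.tensor_ext fun m n => ?_
  obtain ⟨m, rfl⟩ := Submodule.mkQ_surjective _ m
  obtain ⟨n, rfl⟩ := Submodule.mkQ_surjective _ n
  exact theta_tmul m n

/-- `F(N)` is spanned by the images of the `nu u` under morphisms from tensor powers, and each such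
morphism comes from a form. -/
lemma thetaNat_surjective (hF : IsTpowSpanned F) (N : KMod k K) :
    Function.Surjective ((thetaNat R hμ).app N) := by
  have hε : Function.Surjective (ε F) :=
    ((ConcreteCategory.isIso_iff_bijective (ε F)).1 inferInstance).2
  suffices h : LinearMap.range (thetaFiber R (F := F) N) = ⊤ from LinearMap.range_eq_top.1 h
  refine eq_top_iff.2 fun t _ => ?_
  have ht := hF N t
  refine (Submodule.span_le.2 ?_ : _ ≤ LinearMap.range (thetaFiber R (F := F) N)) ht
  rintro _ ⟨n, f, s, rfl⟩
  have hs : s ∈ Submodule.span k (Set.range (nu F n)) := by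
    rw [nu_span hε hμ n]
    trivial
  have h1 : Submodule.span k (Set.range (nu F n)) ≤
      (LinearMap.range (thetaFiber R (F := F) N)).comap (F.map f).hom := by
    refine Submodule.span_le.2 ?_
    rintro _ ⟨u, rfl⟩
    have hf : GLEquivariant (((KMod.lin f).restrictScalars k).compMultilinearMap
        (KMod.tpowForm k K n)) :=
      (KMod.tpowForm_equivariant k K n).comp ((KMod.lin f).restrictScalars k) (KMod.lin_smul f)
    have hd : polMod.desc (polMod.form_equivariant hf) = f :=
      KMod.tpow_hom_ext k K fun v => polMod.desc_form _ v
    refine ⟨(maxSub (polMod N) (pairOf R F hμ).x).mkQ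
      (evalForm (F.obj (KMod.std k K)) (polMod.form_equivariant hf) u), ?_⟩
    refine (theta_evalForm _ _).trans ?_
    rw [hd]
  exact h1 hs

/-- `tpow 1` is `K ⊗ (K ⊗ 𝐕)` rather than the standard module itself, so the form `v ↦ 1 ⊗ v`
corresponds to the left unitor. -/
lemma thetaFiber_fiberStd (u : F.obj (KMod.std k K)) :
    thetaFiber R (F := F) (KMod.std k K) (fiberStd K (pairOf R F hμ) u) = u := by
  have hs := stdForm_equivariant (k := k) (K := K)
  have h1 : fiberStd K (pairOf R F hμ) u = (maxSub (polMod (KMod.std k K)) (pairOf R F hμ).x).mkQ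
      (evalForm (F.obj (KMod.std k K)) (polMod.form_equivariant hs) fun _ : Fin 1 => u) := rfl
  rw [h1]
  refine (theta_evalForm _ _).trans ?_
  have h2 : polMod.desc (polMod.form_equivariant hs) = (λ_ (KMod.std k K)).hom :=
    KMod.tpow_hom_ext k K fun v => by
      rw [polMod.desc_form]
      exact (one_smul K (KMod.stdVec K (v 0))).symm
  rw [h2]
  exact map_leftUnitor_muEl u

lemma thetaNat_isIso_std : IsIso ((thetaNat R hμ).app (KMod.std k K)) := by
  refine (ConcreteCategory.isIso_iff_bijective _).2 ⟨fun s t hst => ?_, fun u => ⟨_,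
    thetaFiber_fiberStd (R := R) hμ u⟩⟩
  obtain ⟨s, rfl⟩ := fiberStd_surjective _ s
  obtain ⟨t, rfl⟩ := fiberStd_surjective _ t
  have h := (thetaFiber_fiberStd hμ s).symm.trans (hst.trans (thetaFiber_fiberStd hμ t))
  exact congrArg _ h

/-- The transformation is monoidal and both functors have invertible structure maps, so
invertibility spreads from the unit and the standard module to tensor powers. -/
lemma thetaNat_isIso_tpow (hμ' : ∀ A, IsIso (μ F A (KMod.std k K))) (n : ℕ) :
    IsIso ((thetaNat R hμ).app (KMod.tpow k K n)) := by
  induction n with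
  | zero =>
    have h := thetaNat_ε (R := R) hμ
    have h1 := phi_isIso_ε (K := K) (pairOf R F hμ)
    have h2 : IsIso (ε (phiFunctor K (pairOf R F hμ)) ≫ (thetaNat R hμ).app (𝟙_ _)) := by
      rw [h]
      infer_instance
    exact IsIso.of_isIso_comp_left (ε (phiFunctor K (pairOf R F hμ)))
      ((thetaNat R hμ).app (𝟙_ _))
  | succ n ih =>
    have h := thetaNat_μ (R := R) hμ (KMod.tpow k K n) (KMod.std k K)
    have h1 := phi_isIso_μ (pairOf R F hμ) (KMod.tpow k K n) (KMod.std k K)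
    have h2 := hμ' (KMod.tpow k K n)
    have h3 := thetaNat_isIso_std (R := R) hμ
    have h4 : IsIso (μ (phiFunctor K (pairOf R F hμ)) (KMod.tpow k K n) (KMod.std k K) ≫
        (thetaNat R hμ).app (KMod.tpow k K n ⊗ KMod.std k K)) := by
      rw [h]
      infer_instance
    exact IsIso.of_isIso_comp_left
      (μ (phiFunctor K (pairOf R F hμ)) (KMod.tpow k K n) (KMod.std k K))
      ((thetaNat R hμ).app (KMod.tpow k K n ⊗ KMod.std k K))

/-- As `F` is exact and the transformation surjective, injectivity passes from tensor powers to all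
objects. -/
lemma thetaNat_isIso (hE : KMod.IsExactFunctor F) (hF : IsTpowSpanned F)
    (hμ' : ∀ A, IsIso (μ F A (KMod.std k K))) (N : KMod k K) :
    IsIso ((thetaNat R hμ).app N) := by
  refine (ConcreteCategory.isIso_iff_bijective _).2 ⟨?_, thetaNat_surjective hμ hF N⟩
  refine app_injective_of_tpow R (thetaNat R hμ) (phi_isTpowSpanned _) hE
    (thetaNat_surjective hμ hF) (fun n => ?_) N
  have := thetaNat_isIso_tpow (R := R) hμ hμ' n
  exact ((ConcreteCategory.isIso_iff_bijective _).1 this).1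

variable (R) in
/-- Every fiber functor is isomorphic to the fiber functor of a pair. -/
theorem exists_iso_phi (Φ : LaxBraidedFunctor (KMod k K) (ModuleCat.{u} k)) (hΦ : IsFiberFunctor Φ) :
    ∃ P : GenericPair k R, Nonempty (Φ ≅ phi K P) := by
  have := hΦ.isIso_ε
  have hμ' := hΦ.isIso_μ
  have := hΦ.additive
  have := hΦ.linear
  have := hΦ.leftExact
  have := hΦ.rightExact
  have := hΦ.faithful
  have := hΦ.cocontinuous
  have hμ : ∀ A, Function.Surjective (μ Φ.toFunctor A (KMod.std k K)) := fun A =>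
    ((ConcreteCategory.isIso_iff_bijective _).1 (hμ' A (KMod.std k K))).2
  have hE : KMod.IsExactFunctor Φ.toFunctor := KMod.isExactFunctor_of_preserves R
  have hF : IsTpowSpanned Φ.toFunctor := isTpowSpanned_of_surjective fun f hf => hE.surjective hf
  have hI := thetaNat_isIso (R := R) hμ hE hF fun A => hμ' A _
  refine ⟨pairOf R Φ.toFunctor hμ, ⟨Iso.symm ?_⟩⟩
  exact LaxBraidedFunctor.isoOfComponents (F := phi K (pairOf R Φ.toFunctor hμ)) (G := Φ)
    (fun N => @asIso (ModuleCat.{u} k) _ _ _ ((thetaNat R hμ).app N) (hI N)) (fun f => (thetaNat R hμ).naturality f)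
    (thetaNat_ε hμ) (thetaNat_μ hμ)

end Comparison

/-! ### Isomorphisms of fiber functors -/

section Isomorphisms

open MonoidalCategory Functor.LaxMonoidal

lemma map_nu_of_isMonoidal {k K : Type u} [Field k] [CharZero k] [Field K] [Algebra k K]
    [MulSemiringAction (GLinf k) K] [SMulCommClass (GLinf k) k K]
    {F G : KMod k K ⥤ ModuleCat.{u} k} [F.LaxMonoidal] [G.LaxMonoidal] (τ : F ⟶ G)
    [NatTrans.IsMonoidal τ] : ∀ (n : ℕ) (u : Fin n → F.obj (KMod.std k K)),
    τ.app (KMod.tpow k K n) (nu F n u) = nu G n fun i => τ.app (KMod.std k K) (u i)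
  | 0, u => congrArg (fun H : 𝟙_ (ModuleCat.{u} k) ⟶ G.obj (𝟙_ _) => H (1 : k))
      (NatTrans.IsMonoidal.unit (τ := τ))
  | n + 1, u => by
    have h := congrArg (fun H : F.obj (KMod.tpow k K n) ⊗ F.obj (KMod.std k K) ⟶
        G.obj (KMod.tpow k K n ⊗ KMod.std k K) =>
        H ((nu F n fun i => u i.castSucc) ⊗ₜ[k] u (Fin.last n)))
      (NatTrans.IsMonoidal.tensor (τ := τ) (KMod.tpow k K n) (KMod.std k K))
    refine h.trans ?_
    exact congrArg (fun t => muEl G (KMod.tpow k K n) (KMod.std k K) t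
      (τ.app (KMod.std k K) (u (Fin.last n)))) (map_nu_of_isMonoidal τ n fun i => u i.castSucc)

variable {k R K : Type u} [Field k] [CharZero k] [CommRing R] [IsDomain R] [Algebra k R]
  [MulSemiringAction (GLinf k) R] [SMulCommClass (GLinf k) k R] [IsPolynomialRep k R]
  [Field K] [Algebra k K] [Algebra R K] [IsScalarTower k R K] [IsFractionRing R K]
  [MulSemiringAction (GLinf k) K] [SMulCommClass (GLinf k) k K] [SMulDistribClass (GLinf k) R K]
  {P Q : GenericPair k R}

lemma mkQ_evalTpow (P : GenericPair k R) : ∀ (n : ℕ) (u : Fin n → P.V),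
    (maxSub (polMod (KMod.tpow k K n)) P.x).mkQ (evalTpow k K P.V n u) =
      nu (phiFunctor K P) n fun i => fiberStd K P (u i)
  | 0, u => (one_smul k ((maxSub (polMod (KMod.unit : KMod k K)) P.x).mkQ (unitFn P.V))).symm
  | n + 1, u => by
    refine Eq.trans ?_ (congrArg (fun t => fiberTmul P (KMod.tpow k K n) (KMod.std k K) t
      (fiberStd K P (u (Fin.last n)))) (mkQ_evalTpow P n fun i => u i.castSucc))
    rfl

variable (K) in
/-- The identification of `V` with the fiber of the standard module. -/
def fiberStdEquiv (P : GenericPair k R) : P.V ≃ₗ[k] Fiber (polMod (KMod.std k K)) P.x :=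
  LinearEquiv.ofBijective (fiberStd K P) ⟨fiberStd_injective P, fiberStd_surjective P⟩

lemma phiIso_fiberStd (f : P.Iso Q) (u : P.V) :
    (phiIso K f).hom.hom.hom.app (KMod.std k K) (fiberStd K P u) = fiberStd K Q (f.e u) := rfl

/-- `V'` embeds in the fiber of the standard module, where the effect of `Φ_f` on the image of `V`
is that of `f`. -/
lemma phiIso_injective : Function.Injective (phiIso K : P.Iso Q → (phi K P ≅ phi K Q)) := by
  intro f g h
  refine GenericPair.Iso.ext (LinearEquiv.ext fun u => fiberStd_injective (K := K) Q ?_)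
  rw [← phiIso_fiberStd f u, ← phiIso_fiberStd g u, h]

variable (τ : phiFunctor K P ⟶ phiFunctor K Q) [NatTrans.IsMonoidal τ]

/-- A morphism of fiber functors is determined by its value on the standard module. -/
lemma app_mkQ_of_isMonoidal {e : P.V →ₗ[k] Q.V}
    (he : ∀ u, τ.app (KMod.std k K) (fiberStd K P u) = fiberStd K Q (e u)) {N : KMod k K}
    (h : PolEval k (polMod N) P.V) : τ.app N ((maxSub (polMod N) P.x).mkQ h) =
      (maxSub (polMod N) Q.x).mkQ (evalTransport (polMod N) e h) := by
  induction h using PolEval.induction with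
  | hform n f hf u =>
    -- Every form is a morphism from a tensor power, so naturality and monoidality reduce the claim
    -- to the standard module.
    rw [← phi_map_desc, evalTransport_evalForm, ← phi_map_desc, mkQ_evalTpow, mkQ_evalTpow]
    refine (congrArg (fun H => H (nu (phiFunctor K P) n fun i => fiberStd K P (u i)))
      (τ.naturality (polMod.desc hf))).trans ?_
    refine congrArg ((phiFunctor K Q).map (polMod.desc hf)) ?_
    refine (map_nu_of_isMonoidal τ n _).trans ?_
    exact congrArg (nu (phiFunctor K Q) n) (funext fun i => he (u i))
  | hzero =>
    simp only [map_zero]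
    exact map_zero (τ.app N).hom
  | hadd a b ha hb =>
    simp only [map_add]
    exact (map_add (τ.app N).hom _ _).trans (congrArg₂ (· + ·) ha hb)

/-- On the fiber of the unit, functions act by their values at the points. `τ` takes `1` to `1` and
is given by transport along `e`, so `a` and its transport have the same value. -/
lemma comp_eq_of_isMonoidal {e : P.V →ₗ[k] Q.V}
    (he : ∀ u, τ.app (KMod.std k K) (fiberStd K P u) = fiberStd K Q (e u)) :
    Q.x.comp (AlgEval.map e) = P.x := by
  refine AlgHom.ext fun a => ?_
  have h1 := app_mkQ_of_isMonoidal τ he (a • unitFn P.V)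
  have h2 : evalTransport (polMod (KMod.unit : KMod k K)) e (a • unitFn P.V) =
      AlgEval.map e a • unitFn Q.V := rfl
  have h3 := app_mkQ_of_isMonoidal τ he (unitFn P.V)
  have h4 : evalTransport (polMod (KMod.unit : KMod k K)) e (unitFn P.V) = unitFn Q.V := rfl
  rw [h2, mkQ_alg_smul, mkQ_alg_smul] at h1
  have h6 := ((map_smul (τ.app (KMod.unit : KMod k K)).hom (P.x a) _).trans
    (congrArg (P.x a • ·) (h3.trans (congrArg _ h4)))).symm.trans h1
  by_contra hne
  refine unitFn_notMem (K := K) Q.generic ((Submodule.Quotient.mk_eq_zero _).1 ?_)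
  have h5 : (P.x a - Q.x (AlgEval.map e a)) •
      (maxSub (polMod (KMod.unit : KMod k K)) Q.x).mkQ (unitFn Q.V) = 0 := by
    rw [sub_smul, sub_eq_zero]
    exact h6
  exact (smul_eq_zero.1 h5).resolve_left fun h => hne (sub_eq_zero.1 h).symm

/-- The component at the standard module is a linear isomorphism `V ≅ V'`, compatible with the
points by `comp_eq_of_isMonoidal`; all other components are then identified by
`app_mkQ_of_isMonoidal`. -/
lemma phiIso_surjective : Function.Surjective (phiIso K : P.Iso Q → (phi K P ≅ phi K Q)) := by
  intro α
  let τ : phiFunctor K P ⟶ phiFunctor K Q := α.hom.hom.hom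
  have : NatTrans.IsMonoidal τ := α.hom.hom.isMonoidal
  let σ : phiFunctor K Q ⟶ phiFunctor K P := α.inv.hom.hom
  have h1 : ∀ (N : KMod k K) t, σ.app N (τ.app N t) = t := fun N t =>
    congrArg (fun H : phi K P ⟶ phi K P => H.hom.hom.app N t) α.hom_inv_id
  have h2 : ∀ (N : KMod k K) t, τ.app N (σ.app N t) = t := fun N t =>
    congrArg (fun H : phi K Q ⟶ phi K Q => H.hom.hom.app N t) α.inv_hom_id
  let d : Fiber (polMod (KMod.std k K)) P.x ≃ₗ[k] Fiber (polMod (KMod.std k K)) Q.x :=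
    LinearEquiv.ofLinearMap (τ.app (KMod.std k K)).hom (σ.app (KMod.std k K)).hom
      (LinearMap.ext (h2 _)) (LinearMap.ext (h1 _))
  let e : P.V ≃ₗ[k] Q.V := (fiberStdEquiv K P).trans (d.trans (fiberStdEquiv K Q).symm)
  have he : ∀ u, τ.app (KMod.std k K) (fiberStd K P u) = fiberStd K Q (e.toLinearMap u) :=
    fun u => ((fiberStdEquiv K Q).apply_symm_apply _).symm
  refine ⟨⟨e, comp_eq_of_isMonoidal τ he⟩, Iso.ext (LaxBraidedFunctor.hom_ext ?_)⟩
  refine NatTrans.ext (funext fun N => ModuleCat.hom_ext (LinearMap.ext fun t => ?_))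
  obtain ⟨h, rfl⟩ := Submodule.mkQ_surjective _ t
  exact (app_mkQ_of_isMonoidal τ he h).symm

lemma phiIso_trans {P Q T : GenericPair k R} (f : P.Iso Q) (g : Q.Iso T) :
    phiIso K (f.trans g) = phiIso K f ≪≫ phiIso K g := by
  refine Iso.ext (LaxBraidedFunctor.hom_ext ?_)
  refine NatTrans.ext (funext fun N => ModuleCat.hom_ext (LinearMap.ext fun t => ?_))
  obtain ⟨h, rfl⟩ := Submodule.mkQ_surjective _ t
  rfl

end Isomorphisms

end
end SemilinearGL

theorem mainTheorem7 {k R K : Type u} [Field k] [CharZero k]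
    [CommRing R] [IsDomain R] [Algebra k R] [MulSemiringAction (SemilinearGL.GLinf k) R]
    [SMulCommClass (SemilinearGL.GLinf k) k R] [SemilinearGL.IsPolynomialRep k R]
    [Field K] [Algebra k K] [Algebra R K] [IsScalarTower k R K] [IsFractionRing R K]
    [MulSemiringAction (SemilinearGL.GLinf k) K] [SMulCommClass (SemilinearGL.GLinf k) k K]
    [SMulDistribClass (SemilinearGL.GLinf k) R K]
    (hR : SemilinearGL.IsFinitelyGLGenerated k R)
    (hK : ∀ a : K, (∀ g : SemilinearGL.GLinf k, g • a = a) → ∃ c : k, algebraMap k K c = a) :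
    (∀ P : SemilinearGL.GenericPair k R, SemilinearGL.IsFiberFunctor (SemilinearGL.phi K P)) ∧
    (∀ Φ : LaxBraidedFunctor (SemilinearGL.KMod k K) (ModuleCat.{u} k),
      SemilinearGL.IsFiberFunctor Φ →
        ∃ P : SemilinearGL.GenericPair k R, Nonempty (Φ ≅ SemilinearGL.phi K P)) ∧
    (∀ P Q : SemilinearGL.GenericPair k R,
      Function.Bijective
        (SemilinearGL.phiIso K : P.Iso Q → (SemilinearGL.phi K P ≅ SemilinearGL.phi K Q))) ∧
    (∀ (P Q T : SemilinearGL.GenericPair k R) (f : P.Iso Q) (g : Q.Iso T),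
      SemilinearGL.phiIso K (f.trans g) =
        SemilinearGL.phiIso K f ≪≫ SemilinearGL.phiIso K g) := by
  exact ⟨fun P => SemilinearGL.phi_isFiberFunctor P,
    fun Φ hΦ => SemilinearGL.exists_iso_phi R Φ hΦ,
    fun P Q => ⟨SemilinearGL.phiIso_injective, SemilinearGL.phiIso_surjective⟩,
    fun P Q T f g => SemilinearGL.phiIso_trans f g⟩
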